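/- **Setting.** Let $d\in\{2,3\}$, $T>0$, and let $\Omega\subset\mathbb R^d$ be a bounded polyhedral Lipschitz domain with boundary $\Gamma$, partitioned into disjoint open polyhedral $\Omega_1,\dots,\Omega_J$ ($\bar\Omega=\bigcup_j\bar\Omega_j$). Let $\rho|_{\Omega_j}=\rho_j>0$ and $\omega|_{\Omega_j}=\omega_j\ge 0$ be constants, $\Omega_E=\bigcup_{\omega_j=0}\Omega_j$, and let $\mathcal C,\mathcal D,\mathcal D-\mathcal C$ be symmetric positive definite fourth-order tensors (operators on $\mathbb R^{d\times d}$ with $\sigma:\tau=\sum_{ij}\sigma_{ij}\tau_{ij}$). Write $(\cdot,\cdot)$ for the $L^2(\Omega)$ products, $(u,v)_\rho=(\tfrac1\rho u,v)$, $\mathbb L^2=L^2(\Omega)^{d\times d}$, $\mathbf L^2=L^2(\Omega)^d$, $\mathbb Q=\{s\in\mathbb L^2: s=-s^{\mathsf t}\}$, and let $\operatorname{div}$ act on rows. For pairs $p=(\gamma,\zeta)$, $q=(\eta,\tau)$ of tensor fields put $$\jmath_\omega q=(\eta,\omega\tau),\quad \jmath^+_\omega q=\eta+\omega\tau,\quad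 \pi_2q=(0,\tau),\quad A(p,q)=(\mathcal C^{-1}\gamma,\eta)+((\mathcal D-\mathcal C)^{-1}\zeta,\tau).$$ Let $\mathfrak S$ be the space of all $q=(\eta,\tau)\in\mathbb L^2\times\mathbb L^2$ with $\tau|_{\Omega_E}=0$ and $\operatorname{div}\jmath^+_\omega q\in \mathbf L^2$, with the norm $\big(\|\eta\|^2+\|\omega\tau\|^2+\|\operatorname{div}\jmath_\omega^+q\|^2\big)^{1/2}$, and let $\mathfrak S_{\rm sym}$ be its subspace of all $q$ with $\jmath^+_\omega q$ symmetric. **Continuous problem.** Let $F\in L^2(0,T;\mathbf L^2)$ and $g\in H^2(0,T;H^{1/2}(\Gamma)^d)$. Let $(p,r)$ be a solution with $p\in H^1(0,T;\mathfrak S_{\rm sym})$, $\ddot p\in L^2(0,T;\mathfrak S_{\rm sym}')$ and $r\in C^0([0,T];\mathbb Q)$ of $$\frac{d}{dt}\Big\{A(\jmath_\omega\dot p+\pi_2p,\jmath_\omega q)+(r,\jmath^+_\omega q)\Big\}+(\operatorname{div}\jmath^+_\omega p,\operatorname{div}\jmath^+_\omega q)_\rho=-(F,\operatorname{div}\jmath_\omega^+q)_\rho+\langle\ddot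 g,\jmath_\omega^+q\,n\rangle_\Gamma\qquad\forall q\in\mathfrak S$$ in the sense of distributions on $(0,T)$, and $(s,\jmath_\omega^+p)=0$ for all $s\in\mathbb Q$ (with any initial values). **Mesh.** Let $\mathcal T_h$ be a conforming mesh of $\bar\Omega$ into triangles or tetrahedra $K$ such that each $\bar\Omega_j$ is the union of the elements contained in it. Let $\mathcal F_h^0$, $\mathcal F_h^\partial$ be the sets of interior and boundary edges/faces, $h_{\mathcal F}|_S=\operatorname{diam}S$, and $n_K$ the outward unit normal on $\partial K$. On $S=K\cap K'\in\mathcal F^0_h$ let $\{\!\{v\}\!\}=\frac12(v_K+v_{K'})$ and $[\![\tau]\!]=\tau_Kn_K+\tau_{K'}n_{K'}$, and let $(\cdot,\cdot)_{\mathcal F}$ be the sum of the $L^2(S)$ products over $S\in\mathcal F$. Let $\operatorname{div}_h$ be the element-wise divergence. For $k\ge1$ let $\mathfrak S^{DG}_h$ be the set of pairs $(\eta,\tau)$ of piecewise polynomial tensor fields of degree $\le k$ with $\tau|_{\Omega_E}=0$, and $\mathbb Q_h$ the set of piecewise polynomials of degree $\le k-1$ in $\mathbb Q$. Let $\mathtt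 a\in\mathbb R$. **Proposition.** Assume that $p\in C^2([0,T];\mathbb L^2\times\mathbb L^2)$ and $r\in C^1([0,T];\mathbb Q)$, and let $s,s'>1/2$. Then, for almost every $t\in(0,T)$ such that $\jmath^+_\omega p(t)|_K\in H^s(K)^{d\times d}$ for all $K\in\mathcal T_h$ and $F(t)|_{\Omega_j}\in H^{s'}(\Omega_j)^d$ for all $j$, the following holds at time $t$. The traces of $\jmath_\omega^+p$, $\frac1\rho\operatorname{div}_h\jmath^+_\omega p$ and $\frac1\rho F$ from each element on its edges/faces, and of $\ddot g$ on the boundary edges/faces, exist and are square integrable, and $(p,r)$ satisfies the equations of the interior penalty DG semi-discrete scheme: $$\begin{aligned}&A(\jmath_\omega\ddot p+\pi_2\dot p,\jmath_\omega q)+(\dot r,\jmath^+_\omega q)+(\operatorname{div}_h\jmath^+_\omega p,\operatorname{div}_h\jmath^+_\omega q)_\rho+(\mathtt a h_{\mathcal F}^{-1}[\![\jmath^+_\omega p]\!],[\![\jmath^+_\omega q]\!])_{\mathcal F^0_h}\\&\quad-(\{\!\{\tfrac1\rho\operatorname{div}_h\jmath^+_\omega p\}\!\},[\![\jmath^+_\omega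 q]\!])_{\mathcal F^0_h}-(\{\!\{\tfrac1\rho\operatorname{div}_h\jmath^+_\omega q\}\!\},[\![\jmath^+_\omega p]\!])_{\mathcal F^0_h}\\&=-(F,\operatorname{div}_h\jmath^+_\omega q)_\rho+(\{\!\{\tfrac1\rho F\}\!\},[\![\jmath^+_\omega q]\!])_{\mathcal F^0_h}+(\ddot g,\jmath^+_\omega q\,n)_{\mathcal F^\partial_h}\qquad\forall q\in\mathfrak S^{DG}_h,\\&(s,\jmath^+_\omega p)=0\qquad\forall s\in\mathbb Q_h.\end{aligned}$$ If, moreover, $F\in C^0([0,T];\mathbf L^2)$ and $\ddot g\in C^0([0,T];H^{1/2}(\Gamma)^d)$, then the same holds at every $t\in[0,T]$ (with one-sided derivatives at the end points) at which $\jmath_\omega^+p(t)$ and $F(t)$ have the above regularity. -/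

import Mathlib

open MeasureTheory Set Filter Topology

namespace Zener

noncomputable section

/-! ### Points, tensors, Lebesgue spaces -/

/-- Points and vectors of `ℝ^d`. -/
abbrev Pt (d : ℕ) := EuclideanSpace ℝ (Fin d)

/-- Tensors in `ℝ^{d × d}` with the component-wise (Frobenius) inner product `σ : τ`;
the `(i, j)` entry of `τ` is `τ (i, j)`. -/
abbrev Ten (d : ℕ) := EuclideanSpace ℝ (Fin d × Fin d)

/-- The product `τ n` of a tensor and a vector. -/
def matVec {d : ℕ} (τ : Ten d) (n : Pt d) : Pt d :=
  WithLp.toLp 2 fun i => ∑ j, τ (i, j) * n j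

/-- `L²(Ω; V)`. -/
abbrev L2 {d : ℕ} (Ω : Set (Pt d)) (V : Type) [NormedAddCommGroup V] :=
  Lp V 2 (volume.restrict Ω)

/-- The `L²(Ω)` product of two vector or tensor fields. -/
def prodL2 {d : ℕ} {V : Type} [NormedAddCommGroup V] [InnerProductSpace ℝ V]
    (Ω : Set (Pt d)) (f g : Pt d → V) : ℝ :=
  ∫ x in Ω, inner ℝ (f x) (g x)

/-! ### Weak derivatives and Sobolev spaces -/

/-- Scalar test functions: smooth with compact support in the set `U`. -/
def IsTest {E : Type} [NormedAddCommGroup E] [NormedSpace ℝ E]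
    (U : Set E) (φ : E → ℝ) : Prop :=
  ContDiff ℝ ((⊤ : ℕ∞) : WithTop ℕ∞) φ ∧ HasCompactSupport φ ∧ tsupport φ ⊆ U

/-- The classical partial derivative `∂_i φ`. -/
def partialD {d : ℕ} (i : Fin d) (φ : Pt d → ℝ) (x : Pt d) : ℝ :=
  fderiv ℝ φ x (EuclideanSpace.single i 1)

/-- `v` is the weak partial derivative `∂_i u` in `U`. -/
def IsWeakPartial {d : ℕ} (U : Set (Pt d)) (i : Fin d) (u v : Pt d → ℝ) : Prop :=
  ∀ φ, IsTest U φ → ∫ x in U, u x * partialD i φ x = -∫ x in U, v x * φ x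

/-- `v` is the weak row-wise divergence of the tensor field `τ` in `U`. -/
def IsWeakDiv {d : ℕ} (U : Set (Pt d)) (τ : Pt d → Ten d) (v : Pt d → Pt d) : Prop :=
  ∀ i, ∀ φ, IsTest U φ →
    ∫ x in U, ∑ j, τ x (i, j) * partialD j φ x = -∫ x in U, v x i * φ x

open Classical in
/-- The weak divergence of `τ` in the open set `U` if it exists in `L²(U)` (it is then unique
almost everywhere), and `0` otherwise. -/
def weakDiv {d : ℕ} (U : Set (Pt d)) (τ : Pt d → Ten d) : Pt d → Pt d :=
  if h : ∃ v, MemLp v 2 (volume.restrict U) ∧ IsWeakDiv U τ v then h.choose else 0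

/-- Slobodeckij's space of order `m + σ` on the open set `U`, for `0 ≤ σ < 1`: weak derivatives
up to order `m` in `L²(U)`, those of order `m` with finite Gagliardo seminorm of index `σ`. -/
def MemHsAux {d : ℕ} (U : Set (Pt d)) (σ : ℝ) : ℕ → (Pt d → ℝ) → Prop
  | 0, u => MemLp u 2 (volume.restrict U) ∧
      (0 < σ → ∫⁻ x in U, ∫⁻ y in U,
        ENNReal.ofReal (|u x - u y| ^ 2 / ‖x - y‖ ^ ((d : ℝ) + 2 * σ)) < ⊤)
  | m + 1, u => MemLp u 2 (volume.restrict U) ∧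
      ∀ i, ∃ v, IsWeakPartial U i u v ∧ MemHsAux U σ m v

/-- `u ∈ H^s(U)` for a real number `s ≥ 0`. -/
def MemHs {d : ℕ} (U : Set (Pt d)) (s : ℝ) (u : Pt d → ℝ) : Prop :=
  MemHsAux U (Int.fract s) ⌊s⌋₊ u

/-- `u ∈ H^s(U)` for vector and tensor fields, component by component. -/
def MemHsVec {d : ℕ} {ι : Type} (U : Set (Pt d)) (s : ℝ)
    (u : Pt d → EuclideanSpace ℝ ι) : Prop :=
  ∀ i, MemHs U s fun x => u x i

/-- Products of square integrable functions with test functions are integrable. -/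
lemma integrable_mul_cont {d : ℕ} {ι : Type} [Fintype ι] {Ω : Set (Pt d)}
    (u : L2 Ω (EuclideanSpace ℝ ι)) (i : ι) {ψ : Pt d → ℝ}
    (hc : Continuous ψ) (hs : HasCompactSupport ψ) :
    Integrable (fun x => u x i * ψ x) (volume.restrict Ω) := by
  have h1 : MemLp (fun x => u x i) 2 (volume.restrict Ω) :=
    (Lp.memLp u).continuousLinearMap_comp (EuclideanSpace.proj i : EuclideanSpace ℝ ι →L[ℝ] ℝ)
  have h2 : MemLp ψ 2 (volume.restrict Ω) :=
    (hc.memLp_of_hasCompactSupport hs (p := 2) (μ := volume)).restrict Ω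
  exact h1.integrable_mul h2

lemma IsTest.cont_partialD {d : ℕ} {U : Set (Pt d)} {φ : Pt d → ℝ} (h : IsTest U φ)
    (i : Fin d) : Continuous (partialD i φ) :=
  (h.1.continuous_fderiv (by simp)).clm_apply continuous_const

lemma IsTest.supp_partialD {d : ℕ} {U : Set (Pt d)} {φ : Pt d → ℝ} (h : IsTest U φ)
    (i : Fin d) : HasCompactSupport (partialD i φ) :=
  h.2.1.fderiv_apply (𝕜 := ℝ) _

/-- `H¹(Ω; ℝ^d)`, an element being stored together with its weak gradient:
the entry `(i, j)` of the second component is `∂_j u_i`. -/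
def H1 {d : ℕ} (Ω : Set (Pt d)) : Submodule ℝ (L2 Ω (Pt d) × L2 Ω (Ten d)) where
  carrier := {u | ∀ i j, IsWeakPartial Ω j (fun x => u.1 x i) fun x => u.2 x (i, j)}
  zero_mem' := by
    intro i j φ _
    have h1 : ∫ x in Ω, (0 : L2 Ω (Pt d)) x i * partialD j φ x = ∫ x in Ω, (0 : ℝ) := by
      refine integral_congr_ae ?_
      filter_upwards [Lp.coeFn_zero (Pt d) 2 (volume.restrict Ω)] with x hx
      rw [hx, Pi.zero_apply, PiLp.zero_apply, zero_mul]
    have h2 : ∫ x in Ω, (0 : L2 Ω (Ten d)) x (i, j) * φ x = ∫ x in Ω, (0 : ℝ) := by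
      refine integral_congr_ae ?_
      filter_upwards [Lp.coeFn_zero (Ten d) 2 (volume.restrict Ω)] with x hx
      rw [hx, Pi.zero_apply, PiLp.zero_apply, zero_mul]
    change ∫ x in Ω, (0 : L2 Ω (Pt d)) x i * partialD j φ x =
      -∫ x in Ω, (0 : L2 Ω (Ten d)) x (i, j) * φ x
    rw [h1, h2, integral_zero, neg_zero]
  add_mem' := by
    intro u v hu hv i j φ hφ
    have h1 : ∫ x in Ω, (u.1 + v.1) x i * partialD j φ x =
        ∫ x in Ω, (u.1 x i * partialD j φ x + v.1 x i * partialD j φ x) := by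
      refine integral_congr_ae ?_
      filter_upwards [Lp.coeFn_add u.1 v.1] with x hx
      rw [hx, Pi.add_apply, PiLp.add_apply, add_mul]
    have h2 : ∫ x in Ω, (u.2 + v.2) x (i, j) * φ x =
        ∫ x in Ω, (u.2 x (i, j) * φ x + v.2 x (i, j) * φ x) := by
      refine integral_congr_ae ?_
      filter_upwards [Lp.coeFn_add u.2 v.2] with x hx
      rw [hx, Pi.add_apply, PiLp.add_apply, add_mul]
    rw [integral_add (integrable_mul_cont _ _ (hφ.cont_partialD j) (hφ.supp_partialD j))
      (integrable_mul_cont _ _ (hφ.cont_partialD j) (hφ.supp_partialD j)),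
      hu i j φ hφ, hv i j φ hφ] at h1
    rw [integral_add (integrable_mul_cont _ _ hφ.1.continuous hφ.2.1)
      (integrable_mul_cont _ _ hφ.1.continuous hφ.2.1)] at h2
    change ∫ x in Ω, (u.1 + v.1) x i * partialD j φ x = -∫ x in Ω, (u.2 + v.2) x (i, j) * φ x
    rw [h1, h2]
    ring
  smul_mem' := by
    intro c u hu i j φ hφ
    have h1 : ∫ x in Ω, (c • u.1) x i * partialD j φ x =
        ∫ x in Ω, c * (u.1 x i * partialD j φ x) := by
      refine integral_congr_ae ?_
      filter_upwards [Lp.coeFn_smul c u.1] with x hx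
      rw [hx, Pi.smul_apply, PiLp.smul_apply, smul_eq_mul, mul_assoc]
    have h2 : ∫ x in Ω, (c • u.2) x (i, j) * φ x = ∫ x in Ω, c * (u.2 x (i, j) * φ x) := by
      refine integral_congr_ae ?_
      filter_upwards [Lp.coeFn_smul c u.2] with x hx
      rw [hx, Pi.smul_apply, PiLp.smul_apply, smul_eq_mul, mul_assoc]
    change ∫ x in Ω, (c • u.1) x i * partialD j φ x = -∫ x in Ω, (c • u.2) x (i, j) * φ x
    rw [h1, h2, integral_const_mul, integral_const_mul, hu i j φ hφ]
    ring

/-- `H¹₀(Ω; ℝ^d)`, the kernel of the trace: the closure in `H¹` of the test fields. -/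
def H10 {d : ℕ} (Ω : Set (Pt d)) : Submodule ℝ (H1 Ω) :=
  (Submodule.span ℝ {u : H1 Ω | ∃ φ : Fin d → Pt d → ℝ, (∀ i, IsTest Ω (φ i)) ∧
    ∀ᵐ x ∂volume.restrict Ω, ∀ i, u.1.1 x i = φ i x}).topologicalClosure

instance {d : ℕ} (Ω : Set (Pt d)) : IsClosed (H10 Ω : Set (H1 Ω)) :=
  Submodule.isClosed_topologicalClosure _

/-- The trace space `H^{1/2}(Γ; ℝ^d)`, `Γ = ∂Ω`: the image of the trace operator on `H¹(Ω)`, that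
is, `H¹(Ω)` modulo the kernel of the trace, with the quotient norm. -/
abbrev HHalf {d : ℕ} (Ω : Set (Pt d)) := H1 Ω ⧸ H10 Ω

/-- A lifting to `H¹(Ω)` of a boundary datum. -/
def HHalf.lift {d : ℕ} {Ω : Set (Pt d)} (b : HHalf Ω) : H1 Ω := Quotient.out b

/-- The duality product `⟨b, τ n⟩_Γ` of `b ∈ H^{1/2}(Γ)` with the normal trace of
`τ ∈ H(div, Ω)`, where `δ = div τ`: by Green's formula it is `(∇u, τ) + (u, div τ)` for any
lifting `u` of `b` (two liftings differ by an element of `H¹₀`, on which this vanishes). -/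
def pairingΓ {d : ℕ} {Ω : Set (Pt d)} (b : HHalf Ω) (τ : Pt d → Ten d) (δ : Pt d → Pt d) : ℝ :=
  prodL2 Ω b.lift.1.2 τ + prodL2 Ω b.lift.1.1 δ

/-! ### Traces on faces -/

/-- The value at the boundary point `x` of the trace of `u : U → V`: the limit of its averages
over `U ∩ B(x, r)` as `r → 0`. It only depends on the almost everywhere class of `u`. -/
def traceFrom {d : ℕ} {V : Type} [NormedAddCommGroup V] [NormedSpace ℝ V]
    (U : Set (Pt d)) (u : Pt d → V) (x : Pt d) : V :=
  limUnder (𝓝[>] (0 : ℝ)) fun r => ⨍ y in U ∩ Metric.ball x r, u y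

/-- The surface measure (length if `d = 2`, area if `d = 3`) on a face `S`. -/
def surf {d : ℕ} (S : Set (Pt d)) : Measure (Pt d) :=
  (Measure.euclideanHausdorffMeasure (d - 1)).restrict S

/-- The trace of `u : U → V` on `S ⊆ ∂U` exists, in the sense that almost every point of `S` is
a one-sided Lebesgue point, and it belongs to `L²(S)`. -/
def HasTraceL2 {d : ℕ} {V : Type} [NormedAddCommGroup V] [NormedSpace ℝ V]
    (U S : Set (Pt d)) (u : Pt d → V) : Prop :=
  (∀ᵐ x ∂surf S, Tendsto
    (fun r : ℝ => ⨍⁻ y in U ∩ Metric.ball x r, ‖u y - traceFrom U u x‖ₑ ∂volume) (𝓝[>] 0) (𝓝 0)) ∧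
  MemLp (traceFrom U u) 2 (surf S)

/-! ### The viscoelastic body -/

/-- Bounded domains of `ℝ^d` with Lipschitz boundary: near each boundary point, `Ω` lies strictly
above the graph of a Lipschitz function over the hyperplane orthogonal to some unit vector `e`. -/
structure IsLipschitzDomain {d : ℕ} (Ω : Set (Pt d)) : Prop where
  isOpen : IsOpen Ω
  isConnected : IsConnected Ω
  isBounded : Bornology.IsBounded Ω
  boundary : ∀ x ∈ frontier Ω, ∃ U ∈ 𝓝 x, ∃ e : Pt d, ‖e‖ = 1 ∧
    ∃ (c : NNReal) (f : Pt d → ℝ), LipschitzWith c f ∧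
      ∀ y ∈ U, (y ∈ Ω ↔ f (y - inner ℝ e y • e) < inner ℝ e y)

/-- A symmetric and positive definite tensor of order 4. -/
def IsSymmPosDef {d : ℕ} (C : Ten d →L[ℝ] Ten d) : Prop :=
  (∀ ξ ζ, inner ℝ (C ξ) ζ = inner ℝ ξ (C ζ)) ∧ ∀ ξ, ξ ≠ 0 → 0 < inner ℝ (C ξ) ξ

/-- The domain `Ω` with its partition into `Ω_1, …, Ω_J`, the values `ρ_j`, `ω_j` of the mass
density and of the relaxation time on `Ω_j`, and the tensors of the constitutive law. -/
structure Body (d J : ℕ) where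
  Ω : Set (Pt d)
  isLipschitz : IsLipschitzDomain Ω
  part : Fin J → Set (Pt d)
  part_open : ∀ j, IsOpen (part j)
  part_disjoint : ∀ i j, i ≠ j → Disjoint (part i) (part j)
  part_cover : closure Ω = ⋃ j, closure (part j)
  ρv : Fin J → ℝ
  ρv_pos : ∀ j, 0 < ρv j
  ωv : Fin J → ℝ
  ωv_nonneg : ∀ j, 0 ≤ ωv j
  C : Ten d →L[ℝ] Ten d
  D : Ten d →L[ℝ] Ten d
  C_pos : IsSymmPosDef C
  D_pos : IsSymmPosDef D
  DC_pos : IsSymmPosDef (D - C)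

namespace Body

variable {d J : ℕ} (B : Body d J)

/-- The mass density (with the irrelevant value `0` on the null set of the interfaces). -/
def ρ (x : Pt d) : ℝ := ∑ j, (B.part j).indicator (fun _ => B.ρv j) x

/-- The relaxation time. -/
def ω (x : Pt d) : ℝ := ∑ j, (B.part j).indicator (fun _ => B.ωv j) x

/-- The purely elastic part `Ω_E`. -/
def elastic : Set (Pt d) := ⋃ j ∈ {j | B.ωv j = 0}, B.part j

end Body

/-- `𝕃²(Ω) × 𝕃²(Ω)`. -/
abbrev LL {d : ℕ} (Ω : Set (Pt d)) := L2 Ω (Ten d) × L2 Ω (Ten d)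

/-- Pairs of tensor fields. -/
abbrev PairF (d : ℕ) := (Pt d → Ten d) × (Pt d → Ten d)

/-- The pair of fields of an element of `𝕃²(Ω) × 𝕃²(Ω)`. -/
def fld {d : ℕ} {Ω : Set (Pt d)} (p : LL Ω) : PairF d := (p.1, p.2)

/-- `π₂ (η, τ) = (0, τ)`. -/
def pi2 {d : ℕ} (q : PairF d) : PairF d := (0, q.2)

namespace Body

variable {d J : ℕ} (B : Body d J)

/-- `ȷ_ω (η, τ) = (η, ω τ)`. -/
def jω (q : PairF d) : PairF d := (q.1, fun x => B.ω x • q.2 x)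

/-- `ȷ_ω⁺ (η, τ) = η + ω τ`. -/
def jp (q : PairF d) : Pt d → Ten d := fun x => q.1 x + B.ω x • q.2 x

/-- `A((γ, ζ), (η, τ)) = (C⁻¹ γ, η) + ((D - C)⁻¹ ζ, τ)`. -/
def A (p q : PairF d) : ℝ :=
  prodL2 B.Ω (fun x => B.C.inverse (p.1 x)) q.1 +
    prodL2 B.Ω (fun x => (B.D - B.C).inverse (p.2 x)) q.2

/-- `(1/ρ) v`. -/
def overρ (v : Pt d → Pt d) : Pt d → Pt d := fun x => (1 / B.ρ x) • v x

/-- `(u, v)_ρ = ((1/ρ) u, v)`. -/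
def prodρ (u v : Pt d → Pt d) : ℝ := prodL2 B.Ω (B.overρ u) v

/-- `𝕃²(Ω) × 𝕃²(Ω) × L²(Ω)`, in which the energy space is a closed subspace. -/
abbrev X := L2 B.Ω (Ten d) × L2 B.Ω (Ten d) × L2 B.Ω (Pt d)

variable {B}

/-- The pair `(η, τ)` of an element `(η, τ, δ)`. -/
def X.pair (x : B.X) : LL B.Ω := (x.1, x.2.1)

/-- The component `δ` of an element `(η, τ, δ)`. -/
def X.dv (x : B.X) : Pt d → Pt d := x.2.2

variable (B)

/-- The space `𝔖` of all `q = (η, τ)` with `τ = 0` on `Ω_E` and `ȷ_ω⁺ q ∈ H(div, Ω)`, an element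
being stored together with `div ȷ_ω⁺ q`. The norm of `X` induces on it the topology of `𝔖`. -/
def spaceS : Set B.X :=
  {q | (∀ᵐ x ∂volume.restrict B.Ω, x ∈ B.elastic → q.2.1 x = 0) ∧
    IsWeakDiv B.Ω (B.jp (fld q.pair)) q.dv}

/-- The subspace `𝔖_sym` of all `q ∈ 𝔖` with `ȷ_ω⁺ q` symmetric. -/
def spaceSsym : Set B.X :=
  {q | q ∈ B.spaceS ∧ ∀ᵐ x ∂volume.restrict B.Ω, ∀ i j,
    B.jp (fld q.pair) x (i, j) = B.jp (fld q.pair) x (j, i)}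

/-- The space `ℚ` of skew-symmetric tensors in `𝕃²(Ω)`. -/
def spaceQ : Set (L2 B.Ω (Ten d)) :=
  {s | ∀ᵐ x ∂volume.restrict B.Ω, ∀ i j, s x (i, j) = -s x (j, i)}

end Body

/-! ### The continuous problem -/

/-- `f ∈ H¹(0, T; V)` with derivative `f' ∈ L²(0, T; V)`. -/
def HasTimeDeriv {V : Type} [NormedAddCommGroup V] [NormedSpace ℝ V]
    (T : ℝ) (f f' : ℝ → V) : Prop :=
  MemLp f' 2 (volume.restrict (Ioo 0 T)) ∧ ∀ t ∈ Icc 0 T, f t = f 0 + ∫ s in (0 : ℝ)..t, f' s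

/-- `(p, r)` is a solution on `(0, T)` of the variational formulation with weakly imposed symmetry,
for the body force `F` and the second time derivative `ddg` of the boundary datum. Here `P t` is
`p t` together with `div ȷ_ω⁺ p(t)`, and `P'` is the time derivative of `P`. -/
structure IsSolution {d J : ℕ} (B : Body d J) (T : ℝ) (F : ℝ → L2 B.Ω (Pt d))
    (ddg : ℝ → HHalf B.Ω) (P P' : ℝ → B.X) (r : ℝ → L2 B.Ω (Ten d)) : Prop where
  /-- `p ∈ H¹(0, T; 𝔖_sym)` -/
  mem : ∀ t ∈ Icc 0 T, P t ∈ B.spaceSsym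
  timeDeriv : HasTimeDeriv T P P'
  timeDeriv_mem : ∀ᵐ t ∂volume.restrict (Ioo 0 T), P' t ∈ B.spaceSsym
  /-- the second derivative of `p` is in `L²(0, T; 𝔖_sym')`, for the pivot space `𝔏²_sym`;
  functionals on `𝔖_sym` are represented by extensions to `X` -/
  second : ∃ Ψ : ℝ → (B.X →L[ℝ] ℝ), MemLp Ψ 2 (volume.restrict (Ioo 0 T)) ∧
    ∀ q ∈ B.spaceSsym, ∀ φ : ℝ → ℝ, IsTest (Ioo 0 T) φ →
      ∫ t in (0 : ℝ)..T, deriv φ t *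
          (prodL2 B.Ω (P' t).1 q.1 + prodL2 B.Ω (P' t).2.1 q.2.1) =
        -∫ t in (0 : ℝ)..T, φ t * Ψ t q
  /-- `r ∈ C⁰(ℚ)` -/
  rot_cont : ContinuousOn r (Icc 0 T)
  rot_mem : ∀ t ∈ Icc 0 T, r t ∈ B.spaceQ
  /-- `d/dt {A(ȷ_ω p' + π₂ p, ȷ_ω q) + (r, ȷ_ω⁺ q)} + (div ȷ_ω⁺ p, div ȷ_ω⁺ q)_ρ`
  `= -(F, div ȷ_ω⁺ q)_ρ + ⟨g'', ȷ_ω⁺ q n⟩_Γ` in the sense of distributions on `(0, T)` -/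
  motion : ∀ q ∈ B.spaceS, ∀ φ : ℝ → ℝ, IsTest (Ioo 0 T) φ →
    -(∫ t in (0 : ℝ)..T, deriv φ t *
        (B.A (B.jω (fld (P' t).pair) + pi2 (fld (P t).pair)) (B.jω (fld q.pair)) +
          prodL2 B.Ω (r t) (B.jp (fld q.pair)))) +
      ∫ t in (0 : ℝ)..T, φ t * B.prodρ (P t).dv q.dv =
    ∫ t in (0 : ℝ)..T, φ t *
      (-B.prodρ (F t) q.dv + pairingΓ (ddg t) (B.jp (fld q.pair)) q.dv)
  /-- `(s, ȷ_ω⁺ p) = 0` for all `s ∈ ℚ` -/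
  symm : ∀ t ∈ Icc 0 T, ∀ s ∈ B.spaceQ, prodL2 B.Ω s (B.jp (fld (P t).pair)) = 0

/-! ### Meshes and the DG scheme -/

/-- The closed simplex with the given vertices. -/
def hull {d : ℕ} (K : Finset (Pt d)) : Set (Pt d) := convexHull ℝ (K : Set (Pt d))

/-- Triangulations of `Ω` into triangles (`d = 2`) or tetrahedra (`d = 3`), which are given by
their vertices; two elements meet in the simplex spanned by their common vertices. -/
structure Mesh {d : ℕ} (Ω : Set (Pt d)) where
  elems : Finset (Finset (Pt d))
  card_eq : ∀ K ∈ elems, K.card = d + 1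
  indep : ∀ K ∈ elems, AffineIndependent ℝ ((↑) : K → Pt d)
  cover : ⋃ K ∈ elems, hull K = closure Ω
  conforming : ∀ K ∈ elems, ∀ K' ∈ elems,
    hull K ∩ hull K' = convexHull ℝ ((K : Set (Pt d)) ∩ K')

namespace Mesh

variable {d : ℕ} {Ω : Set (Pt d)} (M : Mesh Ω)

/-- The mesh is compatible with the partition: each `closure Ω_j` is the union of the elements
contained in `Ω_j`. -/
def Compatible {J : ℕ} (part : Fin J → Set (Pt d)) : Prop :=
  ∀ j, ⋃ K ∈ {K | K ∈ M.elems ∧ interior (hull K) ⊆ part j}, hull K = closure (part j)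

open Classical in
/-- The edges (`d = 2`) or faces (`d = 3`) of the elements. -/
def faces : Finset (Finset (Pt d)) := M.elems.biUnion fun K => K.powersetCard d

open Classical in
/-- Interior edges or faces. -/
def intFaces : Finset (Finset (Pt d)) :=
  M.faces.filter fun S => ∃ K ∈ M.elems, ∃ K' ∈ M.elems, K ≠ K' ∧ hull S = hull K ∩ hull K'

open Classical in
/-- Boundary edges or faces. -/
def bdryFaces : Finset (Finset (Pt d)) := M.faces.filter fun S => hull S ⊆ frontier Ω

open Classical in
/-- The elements that have `S` as an edge or face: two for an interior one, one for a boundary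
one. -/
def around (S : Finset (Pt d)) : Finset (Finset (Pt d)) := M.elems.filter fun K => S ⊆ K

/-- The unit normal vector on the face `S` of the simplex `K` that points out of `K`. -/
def normal (K S : Finset (Pt d)) : Pt d :=
  Classical.epsilon fun n : Pt d => ‖n‖ = 1 ∧ (∀ x ∈ S, ∀ y ∈ S, inner ℝ n (y - x) = 0) ∧
    ∀ x ∈ S, ∀ y ∈ K, inner ℝ n (y - x) ≤ 0

/-- `Σ_K τ_K n_K` over the elements `K` around the face `S`. On an interior face this is the jump
of `τ`, on a boundary face it is `τ n`. -/
def jump (τ : Pt d → Ten d) (S : Finset (Pt d)) (x : Pt d) : Pt d :=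
  ∑ K ∈ M.around S, matVec (traceFrom (hull K) τ x) (normal K S)

/-- The average `(v_K + v_{K'}) / 2` on the interior face `S` of `K` and `K'`. -/
def mean (v : Pt d → Pt d) (S : Finset (Pt d)) (x : Pt d) : Pt d :=
  (1 / 2 : ℝ) • ∑ K ∈ M.around S, traceFrom (hull K) v x

/-- The inner product of `L²(ℱ_h⁰)`. -/
def prodFaces (u v : Finset (Pt d) → Pt d → Pt d) : ℝ :=
  ∑ S ∈ M.intFaces, ∫ x, inner ℝ (u S x) (v S x) ∂surf (hull S)

/-- The element-wise divergence `div_h τ`. -/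
def brokenDiv (τ : Pt d → Ten d) (x : Pt d) : Pt d :=
  ∑ K ∈ M.elems, (interior (hull K)).indicator (weakDiv (interior (hull K)) τ) x

/-- The broken Sobolev space `ℍ^s(𝒯_h)`. -/
def MemBrokenHs (s : ℝ) (τ : Pt d → Ten d) : Prop :=
  ∀ K ∈ M.elems, MemHsVec (interior (hull K)) s τ

/-- Tensor fields that are polynomials of degree at most `m` on each element. -/
def IsPiecewisePoly (m : ℕ) (τ : Pt d → Ten d) : Prop :=
  ∀ K ∈ M.elems, ∀ ij, ∃ p : MvPolynomial (Fin d) ℝ, p.totalDegree ≤ m ∧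
    ∀ᵐ x ∂volume.restrict (hull K), τ x ij = MvPolynomial.eval (fun i => x i) p

end Mesh

section DG

variable {d J : ℕ} (B : Body d J) (M : Mesh B.Ω)

/-- `𝔖_h^{DG}`: pairs `(η, τ)` of piecewise polynomials of degree at most `k`, `τ = 0` on `Ω_E`. -/
def spaceDG (k : ℕ) : Set (LL B.Ω) :=
  {q | M.IsPiecewisePoly k q.1 ∧ M.IsPiecewisePoly k q.2 ∧
    ∀ᵐ x ∂volume.restrict B.Ω, x ∈ B.elastic → q.2 x = 0}

/-- `ℚ_h`: skew-symmetric piecewise polynomials of degree at most `k - 1`. -/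
def spaceQh (k : ℕ) : Set (L2 B.Ω (Ten d)) :=
  {s | M.IsPiecewisePoly (k - 1) s ∧ s ∈ B.spaceQ}

/-- The traces on the edges or faces of the mesh of `ȷ_ω⁺ p`, `(1/ρ) div_h ȷ_ω⁺ p` and `(1/ρ) F`
from each element, and of the boundary datum `b`, exist as square integrable functions. -/
def HasFaceTraces (F : L2 B.Ω (Pt d)) (b : HHalf B.Ω) (p : LL B.Ω) : Prop :=
  (∀ K ∈ M.elems, ∀ S ∈ K.powersetCard d,
    HasTraceL2 (hull K) (hull S) (B.jp (fld p)) ∧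
    HasTraceL2 (hull K) (hull S) (B.overρ (M.brokenDiv (B.jp (fld p)))) ∧
    HasTraceL2 (hull K) (hull S) (B.overρ F)) ∧
  ∀ S ∈ M.bdryFaces, HasTraceL2 B.Ω (hull S) b.lift.1.1

/-- The equations of the DG scheme of degree `k` with penalty parameter `a` at some instant, in
which `p`, `p'`, `p''` are the values of the first unknown and of its time derivatives, `r'` that
of the time derivative of the second unknown, `F` that of the body force and `b` that of the
second time derivative of the boundary datum. -/
def SatisfiesDG (k : ℕ) (a : ℝ) (F : L2 B.Ω (Pt d)) (b : HHalf B.Ω)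
    (p p' p'' : LL B.Ω) (r' : L2 B.Ω (Ten d)) : Prop :=
  (∀ q ∈ spaceDG B M k,
    B.A (B.jω (fld p'') + pi2 (fld p')) (B.jω (fld q)) + prodL2 B.Ω r' (B.jp (fld q))
      + B.prodρ (M.brokenDiv (B.jp (fld p))) (M.brokenDiv (B.jp (fld q)))
      + M.prodFaces (fun S x => (a * (Metric.diam (hull S))⁻¹) • M.jump (B.jp (fld p)) S x)
          (M.jump (B.jp (fld q)))
      - M.prodFaces (M.mean (B.overρ (M.brokenDiv (B.jp (fld p))))) (M.jump (B.jp (fld q)))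
      - M.prodFaces (M.mean (B.overρ (M.brokenDiv (B.jp (fld q))))) (M.jump (B.jp (fld p)))
    = -B.prodρ F (M.brokenDiv (B.jp (fld q)))
      + M.prodFaces (M.mean (B.overρ F)) (M.jump (B.jp (fld q)))
      + ∑ S ∈ M.bdryFaces, ∫ x, inner ℝ (traceFrom B.Ω b.lift.1.1 x)
          (M.jump (B.jp (fld q)) S x) ∂surf (hull S)) ∧
  ∀ s ∈ spaceQh B M k, prodL2 B.Ω s (B.jp (fld p)) = 0

end DG

end

end Zener

/-!
The distributional equation, tested with one stress `q`, says that `ȧ + m = g` on `(0, T)` with a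
continuously differentiable `a`; hence it holds at almost every instant. The energy space is
separable and both sides are continuous in `q`, so that almost every instant serves all `q` at once
(`IsSolution.ae_instantMotion`), and every instant does if the data are continuous in time
(`IsSolution.instantMotion`). From there on the argument is about a fixed instant
(`InstantMotion.satisfiesDG`).

At that instant, stresses with one smooth entry, which need not vanish on the boundary, show that
the acceleration `(1/ρ)(div ȷ⁺p + F)` has a weak gradient in `L²`, given by the strain rate
`𝒞⁻¹ z₁ + r'` (`InstantMotion.isWeakPartial`), and that its trace is that of `g̈`
(`Mesh.trace_eq_bdry`). The pairs `(-ωτ, τ)`, whose total stress vanishes, give the constitutive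
relation for the viscous part (`InstantMotion.constitutive`). Green's formula with the acceleration
on each element, summed over the mesh (`Mesh.green_mesh_jump`), then turns the equation of motion
into the scheme: acceleration and total stress have matching traces from both sides of an interior
face, the jump of `ȷ⁺p` vanishes (`Mesh.jump_eq_zero`), and with it the penalty and the
symmetrization term.

All traces are one-sided Lebesgue values. Their theory rests on one property, `OscDecay`: the double
integral of `|u(y) - u(z)|²` over `|y - z| < r` is `O(r^(d+1+ε))` for some `ε > 0`. It holds for
`H^s` with `s > 1/2` (`MemHs.oscDecay`) and for `H¹` on convex sets (`oscDecay_of_weakPartial`). The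
averages over balls of radius `2⁻ⁿ` centred on a face then converge geometrically at almost every
point of the face, to a square integrable trace (`OscDecay.trace`), and the averages over thin
layers along the face converge to the integral of the trace (`tendsto_strip`). Cutting off along
such layers proves Green's formula on a simplex (`green_bsimplex`) for vector fields whose weak
divergence is square integrable, without approximation by smooth fields. Comparing it with the
definition of the weak divergence, localized near a face, gives the continuity of normal traces
(`Mesh.sum_trace_normal_eq_zero`).
-/

open scoped ENNReal

set_option linter.unusedSectionVars false

namespace Zener

/-! ### Traces of functions with decaying oscillation -/

section Trace

variable {d : ℕ} {V : Type} [NormedAddCommGroup V] [NormedSpace ℝ V]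

/-- `u ∈ L²(K)` whose squared oscillation at distance `2⁻ⁿ` is `O(β⁴ⁿ 2^(-n(d+1)))` for some
`β < 1`. Both `H¹` on convex sets and the Slobodeckij spaces of order `s > 1/2` consist of such
functions, and this is all that traces on hyperplanes require. -/
def OscDecay (K : Set (Pt d)) (u : Pt d → V) : Prop :=
  MemLp u 2 (volume.restrict K) ∧ ∃ β C : ℝ≥0∞, β < 1 ∧ C ≠ ∞ ∧ ∀ n : ℕ,
    ∫⁻ y in K, ∫⁻ z in K ∩ Metric.ball y ((1 / 2) ^ n), ‖u y - u z‖ₑ ^ 2 ≤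
      C * β ^ (4 * n) * (2⁻¹ ^ n) ^ (d + 1)

/-- The geometric hypotheses under which traces are taken with respect to a measure `μ` on the
boundary of `K`: balls centred on the support of `μ` meet `K` in a set of full dimension `d`, and
`μ` is of dimension `d - 1`. -/
structure TraceGeom (K : Set (Pt d)) (μ : Measure (Pt d)) : Prop where
  meas : MeasurableSet K
  finite : volume K ≠ ∞
  finite' : IsFiniteMeasure μ
  lower : ∃ c : ℝ≥0∞, c ≠ 0 ∧ c ≠ ∞ ∧ ∀ᵐ x ∂μ, ∀ n : ℕ,
    c * (2⁻¹ ^ n) ^ d ≤ volume (K ∩ Metric.ball x ((1 / 2) ^ n))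
  upper : ∃ C : ℝ≥0∞, C ≠ ∞ ∧ ∀ (y : Pt d) (n : ℕ),
    μ (Metric.ball y ((1 / 2) ^ n)) * 2⁻¹ ^ n ≤ C * (2⁻¹ ^ n) ^ d

/-- `c` is the one-sided Lebesgue value of `u` at `x` from `U`. -/
def IsLebesgueValue (U : Set (Pt d)) (u : Pt d → V) (x : Pt d) (c : V) : Prop :=
  Tendsto (fun r : ℝ => ⨍⁻ y in U ∩ Metric.ball x r, ‖u y - c‖ₑ ∂volume) (𝓝[>] 0) (𝓝 0)

/-- Cauchy–Schwarz against the constant `1`. -/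
lemma lintegral_sq_le {α : Type*} [MeasurableSpace α] (μ : Measure α) {f : α → ℝ≥0∞}
    (hf : AEMeasurable f μ) : (∫⁻ x, f x ∂μ) ^ 2 ≤ μ univ * ∫⁻ x, f x ^ 2 ∂μ := by
  have h := ENNReal.lintegral_mul_le_Lp_mul_Lq μ Real.HolderConjugate.two_two
    (aemeasurable_const (b := (1 : ℝ≥0∞))) hf
  simp only [Pi.mul_apply, one_mul, ENNReal.one_rpow, lintegral_const] at h
  calc (∫⁻ x, f x ∂μ) ^ 2 ≤ (μ univ ^ (1 / 2 : ℝ) * (∫⁻ x, f x ^ (2 : ℝ) ∂μ) ^ (1 / 2 : ℝ)) ^ 2 := by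
        gcongr
    _ = _ := by
        rw [mul_pow, ← ENNReal.rpow_natCast, ← ENNReal.rpow_natCast, ← ENNReal.rpow_mul,
          ← ENNReal.rpow_mul]
        simp

lemma traceFrom_congr {U U' : Set (Pt d)} {u u' : Pt d → V}
    (hU : U =ᵐ[volume] U') (h : u =ᵐ[volume.restrict U] u') (x : Pt d) :
    traceFrom U u x = traceFrom U' u' x := by
  have : (fun r : ℝ => ⨍ y in U ∩ Metric.ball x r, u y) =
      fun r : ℝ => ⨍ y in U' ∩ Metric.ball x r, u' y := by
    ext r
    have hs : (U ∩ Metric.ball x r : Set (Pt d)) =ᵐ[volume] (U' ∩ Metric.ball x r : Set (Pt d)) :=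
      hU.inter (ae_eq_refl _)
    rw [← setAverage_congr hs]
    exact average_congr (ae_restrict_of_ae_restrict_of_subset inter_subset_left h)
  simp only [traceFrom, this]

lemma laverage_congr_set {U U' : Set (Pt d)} {f g : Pt d → ℝ≥0∞}
    (hU : U =ᵐ[volume] U') (h : f =ᵐ[volume.restrict U] g) :
    ⨍⁻ y in U, f y ∂volume = ⨍⁻ y in U', g y ∂volume := by
  rw [setLAverage_eq, setLAverage_eq, measure_congr hU, ← setLIntegral_congr hU,
    lintegral_congr_ae h]

/-- Two sets that agree near `x` up to a null set have the same Lebesgue values at `x`. -/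
lemma IsLebesgueValue.congr_near {U U' : Set (Pt d)} {u : Pt d → V} {x : Pt d} {c : V}
    (hu : IsLebesgueValue U u x c) {R : ℝ} (hR : 0 < R)
    (hU : (U ∩ Metric.ball x R : Set (Pt d)) =ᵐ[volume] (U' ∩ Metric.ball x R : Set (Pt d))) :
    IsLebesgueValue U' u x c := by
  refine Tendsto.congr' ?_ hu
  filter_upwards [Ioo_mem_nhdsGT hR] with r hr
  refine laverage_congr_set ?_ (ae_eq_refl _)
  have hb : Metric.ball x R ∩ Metric.ball x r = Metric.ball x r :=
    inter_eq_right.2 (Metric.ball_subset_ball hr.2.le)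
  have := hU.inter (ae_eq_refl (Metric.ball x r : Set (Pt d)))
  rwa [inter_assoc, inter_assoc, hb] at this

lemma enorm_average_sub_le [CompleteSpace V] {W : Set (Pt d)} {u : Pt d → V} (c : V)
    (h0 : volume W ≠ 0) (h1 : volume W ≠ ∞) (hu : IntegrableOn u W) :
    ‖(⨍ y in W, u y) - c‖ₑ ≤ ⨍⁻ y in W, ‖u y - c‖ₑ ∂volume := by
  have hc : c = ⨍ _ in W, c := (setAverage_const h0 h1 c).symm
  conv_lhs => rw [hc]
  rw [setAverage_eq, setAverage_eq, ← smul_sub,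
    ← integral_sub hu (integrableOn_const h1), setLAverage_eq, enorm_smul, mul_comm,
    ENNReal.div_eq_inv_mul, mul_comm]
  gcongr
  · rw [Real.enorm_eq_ofReal (by positivity), measureReal_def,
      ← ENNReal.toReal_inv, ENNReal.ofReal_toReal (ENNReal.inv_ne_top.2 h0)]
  · exact enorm_integral_le_lintegral_enorm _

lemma IsLebesgueValue.traceFrom_eq [CompleteSpace V] {U : Set (Pt d)} {u : Pt d → V} {x : Pt d}
    {c : V} (hu : IsLebesgueValue U u x c)
    (hpos : ∀ r > 0, volume (U ∩ Metric.ball x r) ≠ 0) (hint : IntegrableOn u U) :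
    traceFrom U u x = c := by
  refine Tendsto.limUnder_eq ?_
  rw [tendsto_iff_edist_tendsto_0]
  refine tendsto_of_tendsto_of_tendsto_of_le_of_le' tendsto_const_nhds hu
    (Eventually.of_forall fun _ => zero_le) ?_
  filter_upwards [self_mem_nhdsWithin] with r hr
  rw [edist_eq_enorm_sub]
  exact enorm_average_sub_le c (hpos r hr)
    ((measure_mono inter_subset_right).trans_lt measure_ball_lt_top).ne
    (hint.mono_set inter_subset_left)

lemma IsLebesgueValue.comp_clm {W : Type} [NormedAddCommGroup W] [NormedSpace ℝ W]
    {U : Set (Pt d)} {u : Pt d → V} {x : Pt d} {c : V}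
    (hu : IsLebesgueValue U u x c) (L : V →L[ℝ] W) : IsLebesgueValue U (fun y => L (u y)) x (L c) := by
  have h : Tendsto (fun r : ℝ => ‖L‖ₑ * ⨍⁻ y in U ∩ Metric.ball x r, ‖u y - c‖ₑ ∂volume)
      (𝓝[>] 0) (𝓝 0) := by
    simpa using ENNReal.Tendsto.const_mul hu (Or.inr (by simp))
  refine tendsto_of_tendsto_of_tendsto_of_le_of_le tendsto_const_nhds h
    (fun _ => zero_le) fun r => ?_
  simp only [laverage]
  rw [← lintegral_const_mul' _ _ (by simp)]
  refine lintegral_mono fun y => ?_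
  dsimp only
  rw [← map_sub]
  exact L.le_opENorm _

lemma IsLebesgueValue.add {U : Set (Pt d)} {u v : Pt d → V} {x : Pt d} {c e : V}
    (hu : IsLebesgueValue U u x c) (hv : IsLebesgueValue U v x e)
    (hm : AEStronglyMeasurable u (volume.restrict U)) :
    IsLebesgueValue U (fun y => u y + v y) x (c + e) := by
  have h := Tendsto.add hu hv
  rw [add_zero] at h
  refine tendsto_of_tendsto_of_tendsto_of_le_of_le tendsto_const_nhds h
    (fun _ => zero_le) fun r => ?_
  simp only [laverage]
  have hm' : AEMeasurable (fun y => ‖u y - c‖ₑ) (volume.restrict (U ∩ Metric.ball x r)) :=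
    ((hm.mono_measure (Measure.restrict_mono inter_subset_left le_rfl)).sub
      aestronglyMeasurable_const).enorm
  rw [← lintegral_add_left' (hm'.mono_ac (Measure.smul_absolutelyContinuous))]
  refine lintegral_mono fun y => ?_
  dsimp only
  rw [add_sub_add_comm]
  exact enorm_add_le _ _

/-- A function that is continuous at `x` has its value there as Lebesgue value, from any `U`. -/
lemma isLebesgueValue_of_continuousAt {U : Set (Pt d)} {u : Pt d → V} {x : Pt d}
    (hu : ContinuousAt u x) : IsLebesgueValue U u x (u x) := by
  rw [IsLebesgueValue, ENNReal.tendsto_nhds_zero]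
  intro ε hε
  have h1 : ∀ᶠ y in 𝓝 x, ‖u y - u x‖ₑ ≤ ε := by
    have := tendsto_iff_edist_tendsto_0.1 hu
    filter_upwards [(ENNReal.tendsto_nhds_zero.1 this) ε hε] with y hy
    rwa [edist_eq_enorm_sub] at hy
  obtain ⟨R, hR, h2⟩ := Metric.eventually_nhds_iff_ball.1 h1
  filter_upwards [Ioo_mem_nhdsGT hR] with r hr
  rw [setLAverage_eq]
  refine ENNReal.div_le_of_le_mul ?_
  calc ∫⁻ y in U ∩ Metric.ball x r, ‖u y - u x‖ₑ
      ≤ ∫⁻ y in U ∩ Metric.ball x r, ε := by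
        refine lintegral_mono_ae ?_
        have : ∀ᵐ y ∂volume.restrict (U ∩ Metric.ball x r), y ∈ Metric.ball x r :=
          ae_restrict_of_ae_restrict_of_subset inter_subset_right
            (ae_restrict_mem measurableSet_ball)
        filter_upwards [this] with y hy
        exact h2 y (Metric.ball_subset_ball hr.2.le hy)
    _ = ε * volume (U ∩ Metric.ball x r) := by simp

end Trace

/-! ### Oscillation over balls centred on the boundary -/

section Trace

variable {d : ℕ} {V : Type} [NormedAddCommGroup V] [NormedSpace ℝ V]

lemma add_sq_le_four (a b : ℝ≥0∞) : (a + b) ^ 2 ≤ 4 * (a ^ 2 + b ^ 2) := by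
  have key : ∀ x y : ℝ≥0∞, x ≤ y → (x + y) ^ 2 ≤ 4 * (x ^ 2 + y ^ 2) := fun x y h =>
    calc (x + y) ^ 2 ≤ (y + y) ^ 2 := by gcongr
      _ = 4 * y ^ 2 := by rw [← two_mul, mul_pow]; norm_num
      _ ≤ _ := by gcongr; exact le_add_self
  rcases le_total a b with h | h
  · exact key a b h
  · rw [add_comm a, add_comm (a ^ 2)]
    exact key b a h

lemma memLp_two_iff {α : Type*} [MeasurableSpace α] {μ : Measure α} {f : α → V} :
    MemLp f 2 μ ↔ AEStronglyMeasurable f μ ∧ ∫⁻ x, ‖f x‖ₑ ^ 2 ∂μ < ∞ := by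
  refine and_congr_right fun _ => ?_
  rw [eLpNorm_lt_top_iff_lintegral_rpow_enorm_lt_top (by norm_num) (by norm_num)]
  simp

/-- The oscillation of `u` on pairs of points of `K` at distance less than `2⁻⁽ⁿ⁺¹⁾` from `x`. -/
noncomputable def ballOsc (K : Set (Pt d)) (u : Pt d → V) (n : ℕ) (x : Pt d) : ℝ≥0∞ :=
  ∫⁻ p, {q : Pt d × Pt d × Pt d | dist q.2.1 q.1 < (1 / 2) ^ (n + 1) ∧
    dist q.2.2 q.1 < (1 / 2) ^ (n + 1)}.indicator (fun q => ‖u q.2.1 - u q.2.2‖ₑ ^ 2) (x, p)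
    ∂((volume.restrict K).prod (volume.restrict K))

lemma measurable_osc_integrand {u : Pt d → V} (hu : StronglyMeasurable u) (n : ℕ) :
    Measurable ({q : Pt d × Pt d × Pt d | dist q.2.1 q.1 < (1 / 2) ^ (n + 1) ∧
    dist q.2.2 q.1 < (1 / 2) ^ (n + 1)}.indicator fun q => ‖u q.2.1 - u q.2.2‖ₑ ^ 2) := by
  refine Measurable.indicator ?_ ?_
  · have h1 : StronglyMeasurable fun q : Pt d × Pt d × Pt d => u q.2.1 :=
      hu.comp_measurable (by fun_prop)
    have h2 : StronglyMeasurable fun q : Pt d × Pt d × Pt d => u q.2.2 :=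
      hu.comp_measurable (by fun_prop)
    exact (h1.sub h2).enorm.pow_const 2
  · have h1 : IsOpen {q : Pt d × Pt d × Pt d | dist q.2.1 q.1 < (1 / 2) ^ (n + 1)} :=
      isOpen_lt (by fun_prop) (by fun_prop)
    have h2 : IsOpen {q : Pt d × Pt d × Pt d | dist q.2.2 q.1 < (1 / 2) ^ (n + 1)} :=
      isOpen_lt (by fun_prop) (by fun_prop)
    exact (h1.inter h2).measurableSet

lemma measurable_ballOsc {K : Set (Pt d)} {u : Pt d → V} (hu : StronglyMeasurable u) (n : ℕ) :
    Measurable (ballOsc K u n) :=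
  (measurable_osc_integrand hu n).lintegral_prod_right'

lemma ballOsc_eq {K : Set (Pt d)} {u : Pt d → V} (hu : StronglyMeasurable u) (n : ℕ) (x : Pt d) :
    ballOsc K u n x = ∫⁻ y in K ∩ Metric.ball x ((1 / 2) ^ (n + 1)),
      ∫⁻ z in K ∩ Metric.ball x ((1 / 2) ^ (n + 1)), ‖u y - u z‖ₑ ^ 2 := by
  have hm := (measurable_osc_integrand hu n).comp (measurable_prodMk_left (x := x))
  have h := lintegral_prod (μ := volume.restrict K) (ν := volume.restrict K) _ hm.aemeasurable
  rw [ballOsc]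
  refine h.trans ?_
  rw [inter_comm, ← Measure.restrict_restrict measurableSet_ball,
    ← lintegral_indicator measurableSet_ball]
  refine lintegral_congr fun y => ?_
  by_cases hy : y ∈ Metric.ball x ((1 / 2) ^ (n + 1))
  · simp only [Function.comp_apply]
    rw [indicator_of_mem hy, ← lintegral_indicator measurableSet_ball]
    refine lintegral_congr fun z => ?_
    by_cases hz : z ∈ Metric.ball x ((1 / 2) ^ (n + 1))
    · rw [indicator_of_mem hz, indicator_of_mem]
      exact ⟨hy, hz⟩
    · rw [indicator_of_notMem hz, indicator_of_notMem]
      exact fun h => hz h.2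
  · rw [indicator_of_notMem hy]
    refine lintegral_eq_zero_of_ae_eq_zero (ae_of_all _ fun z => ?_)
    exact indicator_of_notMem (fun h => hy h.1) _

/-- The average oscillation near the points of a `(d-1)`-dimensional measure decays by one power
of the radius less than that of the volume, that is, it still decays. -/
lemma lintegral_ballOsc_le {K : Set (Pt d)} {μ : Measure (Pt d)} (hG : TraceGeom K μ)
    {u : Pt d → V} (hu : StronglyMeasurable u) {β C : ℝ≥0∞} (hC : C ≠ ∞)
    (h : ∀ n : ℕ, ∫⁻ y in K, ∫⁻ z in K ∩ Metric.ball y ((1 / 2) ^ n), ‖u y - u z‖ₑ ^ 2 ≤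
      C * β ^ (4 * n) * (2⁻¹ ^ n) ^ (d + 1)) :
    ∃ D : ℝ≥0∞, D ≠ ∞ ∧ ∀ n, ∫⁻ x, ballOsc K u n x ∂μ ≤ D * β ^ (4 * n) * (2⁻¹ ^ n) ^ (2 * d) := by
  have := hG.finite'
  have : IsFiniteMeasure (volume.restrict K) := ⟨by simpa using hG.finite.lt_top⟩
  obtain ⟨C', hC', hup⟩ := hG.upper
  refine ⟨2 * C' * 2⁻¹ ^ d * C, ?_, fun n => ?_⟩
  · exact ENNReal.mul_ne_top (ENNReal.mul_ne_top (ENNReal.mul_ne_top (by simp) hC') (by simp)) hC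
  set E : ℝ≥0∞ := 2⁻¹ ^ n with hE
  have hE0 : E ≠ 0 := by simp [hE]
  have hE1 : E ≠ ∞ := by simp [hE]
  have hf : Measurable fun p : Pt d × Pt d => ‖u p.1 - u p.2‖ₑ ^ 2 :=
    ((hu.comp_measurable measurable_fst).sub (hu.comp_measurable measurable_snd)).enorm.pow_const 2
  have hS : MeasurableSet {p : Pt d × Pt d | dist p.2 p.1 < (1 / 2) ^ n} :=
    (isOpen_lt (by fun_prop) (by fun_prop)).measurableSet
  have h1 : (∫⁻ x, ballOsc K u n x ∂μ) * (2⁻¹ * E) ≤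
      (C' * (2⁻¹ * E) ^ d) * (C * β ^ (4 * n) * E ^ (d + 1)) := by
    unfold ballOsc
    have hsw := lintegral_lintegral_swap (μ := μ)
      (ν := (volume.restrict K).prod (volume.restrict K)) (f := Function.curry
        ({q : Pt d × Pt d × Pt d | dist q.2.1 q.1 < (1 / 2) ^ (n + 1) ∧
          dist q.2.2 q.1 < (1 / 2) ^ (n + 1)}.indicator fun q => ‖u q.2.1 - u q.2.2‖ₑ ^ 2))
      (by rw [Function.uncurry_curry]; exact (measurable_osc_integrand hu n).aemeasurable)
    simp only [Function.curry_apply] at hsw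
    rw [hsw, ← lintegral_mul_const' _ _ (ENNReal.mul_ne_top (by simp) hE1)]
    calc _ ≤ ∫⁻ p, (C' * (2⁻¹ * E) ^ d) *
          {p : Pt d × Pt d | dist p.2 p.1 < (1 / 2) ^ n}.indicator
            (fun p => ‖u p.1 - u p.2‖ₑ ^ 2) p
            ∂((volume.restrict K).prod (volume.restrict K)) := by
          refine lintegral_mono fun p => ?_
          dsimp only
          by_cases hp : dist p.2 p.1 < (1 / 2) ^ n
          · rw [indicator_of_mem (show p ∈ {p : Pt d × Pt d | dist p.2 p.1 < (1 / 2) ^ n} from hp)]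
            calc _ ≤ (∫⁻ x in Metric.ball p.1 ((1 / 2) ^ (n + 1)), ‖u p.1 - u p.2‖ₑ ^ 2 ∂μ)
                  * (2⁻¹ * E) := by
                  refine mul_le_mul' ?_ le_rfl
                  rw [← lintegral_indicator measurableSet_ball]
                  refine lintegral_mono fun x => ?_
                  by_cases hx : dist p.1 x < (1 / 2) ^ (n + 1) ∧ dist p.2 x < (1 / 2) ^ (n + 1)
                  · rw [indicator_of_mem
                        (show (x, p) ∈ {q : Pt d × Pt d × Pt d | dist q.2.1 q.1 < (1 / 2) ^ (n + 1) ∧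
                          dist q.2.2 q.1 < (1 / 2) ^ (n + 1)} from hx),
                      indicator_of_mem (by rw [Metric.mem_ball, dist_comm]; exact hx.1)]
                  · rw [indicator_of_notMem (show (x, p) ∉ {q : Pt d × Pt d × Pt d |
                        dist q.2.1 q.1 < (1 / 2) ^ (n + 1) ∧ dist q.2.2 q.1 < (1 / 2) ^ (n + 1)}
                        from hx)]
                    exact zero_le
              _ = ‖u p.1 - u p.2‖ₑ ^ 2 *
                  (μ (Metric.ball p.1 ((1 / 2) ^ (n + 1))) * 2⁻¹ ^ (n + 1)) := by
                  rw [setLIntegral_const, pow_succ' (2⁻¹ : ℝ≥0∞), mul_assoc]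
              _ ≤ ‖u p.1 - u p.2‖ₑ ^ 2 * (C' * (2⁻¹ ^ (n + 1)) ^ d) := by
                  exact mul_le_mul' le_rfl (hup _ _)
              _ = _ := by rw [mul_comm, pow_succ' (2⁻¹ : ℝ≥0∞) n]
          · have h0 : ∀ x, {q : Pt d × Pt d × Pt d | dist q.2.1 q.1 < (1 / 2) ^ (n + 1) ∧
                dist q.2.2 q.1 < (1 / 2) ^ (n + 1)}.indicator
                (fun q => ‖u q.2.1 - u q.2.2‖ₑ ^ 2) (x, p) = 0 := by
              refine fun x => indicator_of_notMem (fun hx => hp ?_) _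
              have hx1 : dist p.1 x < (1 / 2) ^ (n + 1) := hx.1
              have hx2 : dist p.2 x < (1 / 2) ^ (n + 1) := hx.2
              calc dist p.2 p.1 ≤ dist p.2 x + dist p.1 x := dist_triangle_right _ _ _
                _ < (1 / 2) ^ (n + 1) + (1 / 2) ^ (n + 1) := by gcongr
                _ = (1 / 2) ^ n := by ring
            simp only [h0, lintegral_zero, zero_mul]
            exact zero_le
      _ = (C' * (2⁻¹ * E) ^ d) * ∫⁻ y in K, ∫⁻ z in K ∩ Metric.ball y ((1 / 2) ^ n),
            ‖u y - u z‖ₑ ^ 2 := by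
          rw [lintegral_const_mul _ (hf.indicator hS), lintegral_prod _ (hf.indicator hS).aemeasurable]
          congr 1
          refine lintegral_congr fun y => ?_
          rw [inter_comm, ← Measure.restrict_restrict measurableSet_ball,
            ← lintegral_indicator measurableSet_ball]
          rfl
      _ ≤ _ := by gcongr; exact h n
  have h2 : (∫⁻ x, ballOsc K u n x ∂μ) = (∫⁻ x, ballOsc K u n x ∂μ) * (2⁻¹ * E) * (2 * E⁻¹) := by
    rw [mul_assoc, show (2⁻¹ * E) * (2 * E⁻¹) = (2⁻¹ * 2) * (E * E⁻¹) by ring,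
      ENNReal.inv_mul_cancel (by simp) (by simp), ENNReal.mul_inv_cancel hE0 hE1, one_mul, mul_one]
  rw [h2]
  calc _ ≤ (C' * (2⁻¹ * E) ^ d) * (C * β ^ (4 * n) * E ^ (d + 1)) * (2 * E⁻¹) := by gcongr
    _ = 2 * C' * 2⁻¹ ^ d * C * β ^ (4 * n) * E ^ (2 * d) * (E * E⁻¹) := by ring
    _ = _ := by rw [ENNReal.mul_inv_cancel hE0 hE1, mul_one]

lemma volume_ball_pow (x : Pt d) (n : ℕ) :
    volume (Metric.ball x ((1 / 2) ^ n)) = (2⁻¹ ^ n) ^ d * volume (Metric.ball (0 : Pt d) 1) := by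
  rw [Measure.addHaar_ball_of_pos _ _ (by positivity)]
  congr 1
  rw [finrank_euclideanSpace_fin, ENNReal.ofReal_pow (by positivity),
    ENNReal.ofReal_pow (by positivity), one_div, ENNReal.ofReal_inv_of_pos (by norm_num)]
  simp

end Trace

/-! ### Convergence of averages at the boundary -/

section Trace

variable {d : ℕ} {V : Type} [NormedAddCommGroup V] [NormedSpace ℝ V]

/-- The mean deviation of `u` from its average on `W` is controlled by the double integral of
its squared differences. -/
lemma lintegral_sub_average_sq_le [CompleteSpace V] {W : Set (Pt d)} {u : Pt d → V}
    (hu : StronglyMeasurable u) (h0 : volume W ≠ 0) (h1 : volume W ≠ ∞) (hi : IntegrableOn u W) :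
    (∫⁻ y in W, ‖u y - ⨍ z in W, u z‖ₑ) ^ 2 ≤ ∫⁻ y in W, ∫⁻ z in W, ‖u y - u z‖ₑ ^ 2 := by
  have : IsFiniteMeasure (volume.restrict W) := ⟨by simpa using h1.lt_top⟩
  have hm2 : Measurable fun p : Pt d × Pt d => ‖u p.1 - u p.2‖ₑ :=
    ((hu.comp_measurable measurable_fst).sub (hu.comp_measurable measurable_snd)).enorm
  have hm (y : Pt d) : Measurable fun z => ‖u y - u z‖ₑ := hm2.comp measurable_prodMk_left
  have hI : (∫⁻ y in W, ∫⁻ z in W, ‖u y - u z‖ₑ) ^ 2 ≤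
      volume W ^ 2 * ∫⁻ y in W, ∫⁻ z in W, ‖u y - u z‖ₑ ^ 2 :=
    calc (∫⁻ y in W, ∫⁻ z in W, ‖u y - u z‖ₑ) ^ 2
        ≤ volume W * ∫⁻ y in W, (∫⁻ z in W, ‖u y - u z‖ₑ) ^ 2 := by
          have := lintegral_sq_le (volume.restrict W) (f := fun y => ∫⁻ z in W, ‖u y - u z‖ₑ)
            hm2.lintegral_prod_right'.aemeasurable
          simpa using this
      _ ≤ volume W * ∫⁻ y in W, volume W * ∫⁻ z in W, ‖u y - u z‖ₑ ^ 2 := by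
          gcongr with y
          simpa using lintegral_sq_le (volume.restrict W) (hm y).aemeasurable
      _ = _ := by rw [lintegral_const_mul' _ _ h1, sq, mul_assoc]
  have hJ : volume W * (∫⁻ y in W, ‖u y - ⨍ z in W, u z‖ₑ) ≤
      ∫⁻ y in W, ∫⁻ z in W, ‖u y - u z‖ₑ := by
    rw [← lintegral_const_mul' _ _ h1]
    refine lintegral_mono fun y => ?_
    have h := enorm_average_sub_le (u y) h0 h1 hi
    rw [setLAverage_eq] at h
    calc volume W * ‖u y - ⨍ z in W, u z‖ₑ
        = volume W * ‖(⨍ z in W, u z) - u y‖ₑ := by rw [enorm_sub_rev]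
      _ ≤ volume W * ((∫⁻ z in W, ‖u z - u y‖ₑ) / volume W) := by gcongr
      _ = ∫⁻ z in W, ‖u z - u y‖ₑ := ENNReal.mul_div_cancel h0 h1
      _ = _ := by simp only [enorm_sub_rev]
  have hK : volume W ^ 2 * (∫⁻ y in W, ‖u y - ⨍ z in W, u z‖ₑ) ^ 2 ≤
      volume W ^ 2 * ∫⁻ y in W, ∫⁻ z in W, ‖u y - u z‖ₑ ^ 2 := by
    rw [← mul_pow]
    exact (pow_le_pow_left₀ zero_le hJ 2).trans hI
  exact (ENNReal.mul_le_mul_iff_right (pow_ne_zero 2 h0) (ENNReal.pow_ne_top h1)).1 hK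

/-- The ball oscillations of all radii are dominated by one square integrable function times a
geometric weight. -/
lemma exists_ballOsc_bound {K : Set (Pt d)} {μ : Measure (Pt d)} (hG : TraceGeom K μ)
    {u : Pt d → V} (hu : StronglyMeasurable u) (ho : OscDecay K u) :
    ∃ (b : ℝ≥0∞) (H : Pt d → ℝ≥0∞), b < 1 ∧ Measurable H ∧ ∫⁻ x, H x ^ 2 ∂μ < ∞ ∧
      ∀ x n, ballOsc K u n x ≤ (b ^ n * (2⁻¹ ^ n) ^ d * H x) ^ 2 := by
  obtain ⟨-, β, C, hβ, hC, h⟩ := ho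
  -- `β` may vanish, but the weights below are divided by
  set b : ℝ≥0∞ := max β 2⁻¹ with hb
  have hb1 : b < 1 := max_lt hβ (by simp)
  have hb0 : b ≠ 0 := (lt_of_lt_of_le (by simp) (le_max_right β 2⁻¹)).ne'
  have hbt : b ≠ ∞ := (hb1.trans ENNReal.one_lt_top).ne
  have h' : ∀ n : ℕ, ∫⁻ y in K, ∫⁻ z in K ∩ Metric.ball y ((1 / 2) ^ n), ‖u y - u z‖ₑ ^ 2 ≤
      C * b ^ (4 * n) * (2⁻¹ ^ n) ^ (d + 1) := fun n =>
    (h n).trans (by gcongr; exact le_max_left _ _)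
  obtain ⟨D, hD, hbd⟩ := lintegral_ballOsc_le hG hu hC h'
  have hw0 (n : ℕ) : (b ^ n * (2⁻¹ ^ n) ^ d) ^ 2 ≠ 0 :=
    pow_ne_zero _ (mul_ne_zero (pow_ne_zero _ hb0) (by simp))
  have hwt (n : ℕ) : (b ^ n * (2⁻¹ ^ n) ^ d) ^ 2 ≠ ∞ :=
    ENNReal.pow_ne_top (ENNReal.mul_ne_top (ENNReal.pow_ne_top hbt) (by simp))
  -- the integrals decay like `b⁴ⁿ` and the squared weights like `b²ⁿ`, so that the sum is integrable
  set h : Pt d → ℝ≥0∞ := fun x => ∑' n, ((b ^ n * (2⁻¹ ^ n) ^ d) ^ 2)⁻¹ * ballOsc K u n x with hh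
  have hmn (n : ℕ) : Measurable fun x => ((b ^ n * (2⁻¹ ^ n) ^ d) ^ 2)⁻¹ * ballOsc K u n x :=
    (measurable_ballOsc hu n).const_mul _
  have hmh : Measurable h := Measurable.tsum hmn
  have hsq (x : Pt d) : (h x ^ (1 / 2 : ℝ)) ^ 2 = h x := by
    rw [← ENNReal.rpow_natCast, ← ENNReal.rpow_mul]; simp
  refine ⟨b, fun x => h x ^ (1 / 2 : ℝ), hb1, hmh.pow_const _, ?_, fun x n => ?_⟩
  · simp only [hsq]
    rw [hh, lintegral_tsum fun n => (hmn n).aemeasurable]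
    calc _ ≤ ∑' n : ℕ, D * (b ^ 2) ^ n := by
          refine ENNReal.tsum_le_tsum fun n => ?_
          rw [lintegral_const_mul _ (measurable_ballOsc hu n)]
          calc _ ≤ ((b ^ n * (2⁻¹ ^ n) ^ d) ^ 2)⁻¹ * (D * b ^ (4 * n) * (2⁻¹ ^ n) ^ (2 * d)) := by
                gcongr; exact hbd n
            _ = (((b ^ n * (2⁻¹ ^ n) ^ d) ^ 2)⁻¹ * (b ^ n * (2⁻¹ ^ n) ^ d) ^ 2) *
                  (D * (b ^ 2) ^ n) := by ring
            _ = _ := by rw [ENNReal.inv_mul_cancel (hw0 n) (hwt n), one_mul]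
      _ < ∞ := by
          rw [ENNReal.tsum_mul_left, ENNReal.tsum_geometric]
          refine ENNReal.mul_lt_top hD.lt_top (ENNReal.inv_lt_top.2 ?_)
          rw [tsub_pos_iff_lt]
          exact pow_lt_one₀ zero_le hb1 two_ne_zero
  · rw [mul_pow, hsq]
    calc ballOsc K u n x = (b ^ n * (2⁻¹ ^ n) ^ d) ^ 2 *
          (((b ^ n * (2⁻¹ ^ n) ^ d) ^ 2)⁻¹ * ballOsc K u n x) := by
          rw [← mul_assoc, ENNReal.mul_inv_cancel (hw0 n) (hwt n), one_mul]
      _ ≤ _ := by gcongr; exact ENNReal.le_tsum n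

/-- At almost every point, the averages over shrinking balls converge to a limit at a
geometric rate. -/
lemma exists_trace_aux [CompleteSpace V] {K : Set (Pt d)} {μ : Measure (Pt d)}
    (hG : TraceGeom K μ) {u : Pt d → V} (hu : StronglyMeasurable u) (ho : OscDecay K u) :
    ∃ (T : Pt d → V) (H : Pt d → ℝ≥0∞) (b C : ℝ≥0∞), AEStronglyMeasurable T μ ∧ Measurable H ∧
      ∫⁻ x, H x ^ 2 ∂μ < ∞ ∧ b < 1 ∧ C ≠ ∞ ∧ ∀ᵐ x ∂μ, ∀ n : ℕ,
        ⨍⁻ y in K ∩ Metric.ball x ((1 / 2) ^ (n + 1)), ‖u y - T x‖ₑ ∂volume ≤ C * H x * b ^ n := by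
  have := hG.finite'
  have : IsFiniteMeasure (volume.restrict K) := ⟨by simpa using hG.finite.lt_top⟩
  obtain ⟨b, H, hb1, hH, hH2, hbd⟩ := exists_ballOsc_bound hG hu ho
  obtain ⟨c, hc0, hct, hlow⟩ := hG.lower
  have hiK : IntegrableOn u K := ho.1.integrable one_le_two
  set v := volume (Metric.ball (0 : Pt d) 1) with hv
  have hvt : v ≠ ∞ := measure_ball_lt_top.ne
  -- the averages
  set M : ℕ → Pt d → V := fun n x => ⨍ y in K ∩ Metric.ball x ((1 / 2) ^ (n + 1)), u y with hM
  have hMm (n : ℕ) : StronglyMeasurable (M n) := by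
    have hS : MeasurableSet {q : Pt d × Pt d | dist q.2 q.1 < (1 / 2) ^ (n + 1)} :=
      (isOpen_lt (by fun_prop) (by fun_prop)).measurableSet
    have e (x : Pt d) : M n x = ((∫⁻ y in K, {q : Pt d × Pt d | dist q.2 q.1 <
        (1 / 2) ^ (n + 1)}.indicator 1 (x, y)).toReal)⁻¹ • ∫ y in K,
          {q : Pt d × Pt d | dist q.2 q.1 < (1 / 2) ^ (n + 1)}.indicator (fun q => u q.2) (x, y) := by
      rw [hM]
      simp only [setAverage_eq, measureReal_def]
      rw [inter_comm, ← Measure.restrict_apply measurableSet_ball,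
        ← Measure.restrict_restrict measurableSet_ball, ← lintegral_indicator_one measurableSet_ball,
        ← integral_indicator measurableSet_ball]
      rfl
    rw [show M n = _ from funext e]
    refine StronglyMeasurable.smul (Measurable.stronglyMeasurable ?_) ?_
    · exact ((Measurable.lintegral_prod_right'
        (measurable_one.indicator hS)).ennreal_toReal).inv
    · exact StronglyMeasurable.integral_prod_right'
        ((hu.comp_measurable measurable_snd).indicator hS)
  have hHfin : ∀ᵐ x ∂μ, H x < ∞ := by
    filter_upwards [ae_lt_top (hH.pow_const 2) hH2.ne] with x hx
    exact (ENNReal.pow_lt_top_iff.1 hx).resolve_right two_ne_zero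
  set c' := c * 2⁻¹ ^ d with hc'
  have hc'0 : c' ≠ 0 := mul_ne_zero hc0 (by simp)
  have hc't : c' ≠ ∞ := ENNReal.mul_ne_top hct (by simp)
  set Q := v / (c' * 2⁻¹ ^ d) with hQ
  have hQt : Q ≠ ∞ := ENNReal.div_ne_top hvt (mul_ne_zero hc'0 (by simp))
  have key : ∀ᵐ x ∂μ, (∀ n : ℕ, ⨍⁻ y in K ∩ Metric.ball x ((1 / 2) ^ (n + 1)),
      ‖u y - M n x‖ₑ ∂volume ≤ c'⁻¹ * H x * b ^ n) ∧
      ∀ n : ℕ, edist (M n x) (M (n + 1) x) ≤ (Q * c'⁻¹ * H x) * b ^ n := by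
    filter_upwards [hlow] with x hx
    have hE (n : ℕ) : ((2⁻¹ : ℝ≥0∞) ^ n) ^ d ≠ 0 := by simp
    have hEt (n : ℕ) : ((2⁻¹ : ℝ≥0∞) ^ n) ^ d ≠ ∞ := by simp
    have hlow' (n : ℕ) : c' * (2⁻¹ ^ n) ^ d ≤ volume (K ∩ Metric.ball x ((1 / 2) ^ (n + 1))) := by
      refine le_trans (le_of_eq ?_) (hx (n + 1))
      rw [hc', pow_succ]; ring
    have hm0 (n : ℕ) : volume (K ∩ Metric.ball x ((1 / 2) ^ (n + 1))) ≠ 0 :=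
      (lt_of_lt_of_le (pos_iff_ne_zero.2 (mul_ne_zero hc'0 (hE n))) (hlow' n)).ne'
    have hmt (n : ℕ) : volume (K ∩ Metric.ball x ((1 / 2) ^ (n + 1))) ≠ ∞ :=
      ((measure_mono inter_subset_right).trans_lt measure_ball_lt_top).ne
    have hmu (n : ℕ) : volume (K ∩ Metric.ball x ((1 / 2) ^ (n + 1))) ≤ (2⁻¹ ^ n) ^ d * v := by
      refine (measure_mono inter_subset_right).trans ?_
      rw [volume_ball_pow]
      exact mul_le_mul' (pow_le_pow_left₀ zero_le
        (pow_le_pow_of_le_one zero_le (ENNReal.inv_le_one.2 one_le_two) (Nat.le_succ n)) d) le_rfl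
    have h1 : ∀ n : ℕ, ⨍⁻ y in K ∩ Metric.ball x ((1 / 2) ^ (n + 1)),
        ‖u y - M n x‖ₑ ∂volume ≤ c'⁻¹ * H x * b ^ n := by
      intro n
      have h2 := lintegral_sub_average_sq_le hu (hm0 n) (hmt n) (hiK.mono_set inter_subset_left)
      rw [← ballOsc_eq hu] at h2
      have h3 := (ENNReal.pow_le_pow_left_iff two_ne_zero).1 (h2.trans (hbd x n))
      rw [setLAverage_eq]
      calc _ ≤ b ^ n * (2⁻¹ ^ n) ^ d * H x / (c' * (2⁻¹ ^ n) ^ d) := by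
            gcongr
            exact hlow' n
        _ = c'⁻¹ * H x * b ^ n * ((2⁻¹ ^ n) ^ d * ((2⁻¹ ^ n) ^ d)⁻¹) := by
            rw [ENNReal.div_eq_inv_mul, ENNReal.mul_inv (Or.inl hc'0) (Or.inl hc't)]
            ring
        _ = _ := by rw [ENNReal.mul_inv_cancel (hE n) (hEt n), mul_one]
    refine ⟨h1, fun n => ?_⟩
    have hsub : K ∩ Metric.ball x ((1 / 2) ^ (n + 1 + 1)) ⊆ K ∩ Metric.ball x ((1 / 2) ^ (n + 1)) :=
      inter_subset_inter_right _ (Metric.ball_subset_ball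
        (pow_le_pow_of_le_one (by norm_num) (by norm_num) (Nat.le_succ _)))
    rw [edist_comm, edist_eq_enorm_sub]
    calc ‖M (n + 1) x - M n x‖ₑ
        ≤ ⨍⁻ y in K ∩ Metric.ball x ((1 / 2) ^ (n + 1 + 1)), ‖u y - M n x‖ₑ ∂volume :=
          enorm_average_sub_le _ (hm0 (n + 1)) (hmt (n + 1)) (hiK.mono_set inter_subset_left)
      _ ≤ (∫⁻ y in K ∩ Metric.ball x ((1 / 2) ^ (n + 1)), ‖u y - M n x‖ₑ) /
            (c' * 2⁻¹ ^ d * (2⁻¹ ^ n) ^ d) := by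
          rw [setLAverage_eq]
          refine ENNReal.div_le_div (lintegral_mono_set hsub) ?_
          refine le_trans (le_of_eq ?_) (hlow' (n + 1))
          rw [pow_succ (2⁻¹ : ℝ≥0∞) n]; ring
      _ = volume (K ∩ Metric.ball x ((1 / 2) ^ (n + 1))) / (c' * 2⁻¹ ^ d * (2⁻¹ ^ n) ^ d) *
            ⨍⁻ y in K ∩ Metric.ball x ((1 / 2) ^ (n + 1)), ‖u y - M n x‖ₑ ∂volume := by
          rw [setLAverage_eq, ENNReal.div_eq_inv_mul, ENNReal.div_eq_inv_mul (a := volume _),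
            mul_assoc (c' * 2⁻¹ ^ d * (2⁻¹ ^ n) ^ d)⁻¹, ENNReal.mul_div_cancel (hm0 n) (hmt n)]
      _ ≤ ((2⁻¹ ^ n) ^ d * v) / (c' * 2⁻¹ ^ d * (2⁻¹ ^ n) ^ d) * (c'⁻¹ * H x * b ^ n) := by
          gcongr
          · exact hmu n
          · exact h1 n
      _ = Q * (((2⁻¹ ^ n) ^ d)⁻¹ * (2⁻¹ ^ n) ^ d) * (c'⁻¹ * H x * b ^ n) := by
          rw [hQ, ENNReal.div_eq_inv_mul, ENNReal.div_eq_inv_mul,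
            ENNReal.mul_inv (a := c' * 2⁻¹ ^ d) (Or.inr (hEt n)) (Or.inr (hE n))]
          ring
      _ = _ := by rw [ENNReal.inv_mul_cancel (hE n) (hEt n)]; ring
  have hlim : ∀ᵐ x ∂μ, ∃ t, Tendsto (fun n => M n x) atTop (𝓝 t) := by
    filter_upwards [key, hHfin] with x hx hxH
    refine cauchySeq_tendsto_of_complete (cauchySeq_of_edist_le_geometric b _ hb1 ?_ hx.2)
    exact ENNReal.mul_ne_top (ENNReal.mul_ne_top hQt (ENNReal.inv_ne_top.2 hc'0)) hxH.ne
  obtain ⟨T, hTm, hT⟩ := exists_stronglyMeasurable_limit_of_tendsto_ae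
    (fun n => (hMm n).aestronglyMeasurable) hlim
  refine ⟨T, H, b, c'⁻¹ + Q * c'⁻¹ / (1 - b), hTm.aestronglyMeasurable, hH, hH2, hb1, ?_, ?_⟩
  · refine ENNReal.add_ne_top.2 ⟨ENNReal.inv_ne_top.2 hc'0, ENNReal.div_ne_top
      (ENNReal.mul_ne_top hQt (ENNReal.inv_ne_top.2 hc'0)) (tsub_pos_iff_lt.2 hb1).ne'⟩
  · filter_upwards [key, hT] with x hx hxT n
    have h2 := edist_le_of_edist_le_geometric_of_tendsto b _ hx.2 hxT n
    calc ⨍⁻ y in K ∩ Metric.ball x ((1 / 2) ^ (n + 1)), ‖u y - T x‖ₑ ∂volume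
        ≤ (⨍⁻ y in K ∩ Metric.ball x ((1 / 2) ^ (n + 1)), ‖u y - M n x‖ₑ ∂volume) +
          ⨍⁻ y in K ∩ Metric.ball x ((1 / 2) ^ (n + 1)), edist (M n x) (T x) ∂volume := by
          simp only [laverage]
          rw [← lintegral_add_right _ measurable_const]
          refine lintegral_mono fun y => ?_
          simp only [← edist_eq_enorm_sub]
          exact edist_triangle _ _ _
      _ ≤ c'⁻¹ * H x * b ^ n + Q * c'⁻¹ * H x * b ^ n / (1 - b) := by
          refine add_le_add (hx.1 n) (le_trans ?_ h2)
          rw [setLAverage_eq, setLIntegral_const]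
          rw [mul_div_assoc]
          exact mul_le_of_le_one_right' ENNReal.div_self_le_one
      _ = _ := by simp only [ENNReal.div_eq_inv_mul]; ring

end Trace

/-! ### The trace theorem -/

section Trace

variable {d : ℕ} {V : Type} [NormedAddCommGroup V] [NormedSpace ℝ V]

lemma OscDecay.congr {K : Set (Pt d)} {u v : Pt d → V} (ho : OscDecay K u)
    (h : u =ᵐ[volume.restrict K] v) : OscDecay K v := by
  obtain ⟨hL, β, C, hβ, hC, hb⟩ := ho
  refine ⟨(memLp_congr_ae h).1 hL, β, C, hβ, hC, fun n => (le_of_eq ?_).trans (hb n)⟩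
  refine lintegral_congr_ae ?_
  filter_upwards [h] with y hy
  refine lintegral_congr_ae ?_
  filter_upwards [ae_restrict_of_ae_restrict_of_subset inter_subset_left h] with z hz
  rw [hy, hz]

lemma OscDecay.mono {K K' : Set (Pt d)} {u : Pt d → V} (ho : OscDecay K u) (h : K' ⊆ K) :
    OscDecay K' u := by
  obtain ⟨hL, β, C, hβ, hC, hb⟩ := ho
  refine ⟨hL.mono_measure (Measure.restrict_mono h le_rfl), β, C, hβ, hC,
    fun n => le_trans ?_ (hb n)⟩
  refine (lintegral_mono_set h).trans (lintegral_mono fun y => ?_)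
  exact lintegral_mono_set (inter_subset_inter_left _ h)

lemma OscDecay.congr_set {K K' : Set (Pt d)} {u : Pt d → V} (ho : OscDecay K u)
    (h : K =ᵐ[volume] K') : OscDecay K' u := by
  obtain ⟨hL, β, C, hβ, hC, hb⟩ := ho
  refine ⟨by rwa [← Measure.restrict_congr_set h], β, C, hβ, hC, fun n => le_trans ?_ (hb n)⟩
  rw [← Measure.restrict_congr_set h]
  refine lintegral_mono fun y => ?_
  rw [← Measure.restrict_congr_set (h.inter (ae_eq_refl (Metric.ball y ((1 / 2) ^ n))))]

lemma OscDecay.clm {W : Type} [NormedAddCommGroup W] [NormedSpace ℝ W] {K : Set (Pt d)}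
    {u : Pt d → V} (ho : OscDecay K u) (L : V →L[ℝ] W) : OscDecay K fun y => L (u y) := by
  obtain ⟨hL, β, C, hβ, hC, hb⟩ := ho
  refine ⟨L.comp_memLp' hL, β, ‖L‖ₑ ^ 2 * C, hβ, ENNReal.mul_ne_top (by simp) hC, fun n => ?_⟩
  calc _ ≤ ∫⁻ y in K, ∫⁻ z in K ∩ Metric.ball y ((1 / 2) ^ n), ‖L‖ₑ ^ 2 * ‖u y - u z‖ₑ ^ 2 := by
        refine lintegral_mono fun y => lintegral_mono fun z => ?_
        dsimp only
        rw [← map_sub, ← mul_pow]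
        gcongr
        exact L.le_opENorm _
    _ = ‖L‖ₑ ^ 2 * ∫⁻ y in K, ∫⁻ z in K ∩ Metric.ball y ((1 / 2) ^ n), ‖u y - u z‖ₑ ^ 2 := by
        rw [← lintegral_const_mul' _ _ (by simp)]
        refine lintegral_congr fun y => ?_
        rw [lintegral_const_mul' _ _ (by simp)]
    _ ≤ ‖L‖ₑ ^ 2 * (C * β ^ (4 * n) * (2⁻¹ ^ n) ^ (d + 1)) := by gcongr; exact hb n
    _ = _ := by ring

lemma measurable_lintegral_diff {K : Set (Pt d)} {u : Pt d → V} (hu : StronglyMeasurable u)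
    (n : ℕ) : Measurable fun y => ∫⁻ z in K ∩ Metric.ball y ((1 / 2) ^ n), ‖u y - u z‖ₑ ^ 2 := by
  have hf : Measurable fun p : Pt d × Pt d => ‖u p.1 - u p.2‖ₑ ^ 2 :=
    ((hu.comp_measurable measurable_fst).sub (hu.comp_measurable measurable_snd)).enorm.pow_const 2
  have hS : MeasurableSet {p : Pt d × Pt d | dist p.2 p.1 < (1 / 2) ^ n} :=
    (isOpen_lt (by fun_prop) (by fun_prop)).measurableSet
  convert (hf.indicator hS).lintegral_prod_right' (ν := volume.restrict K) using 2 with y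
  rw [inter_comm, ← Measure.restrict_restrict measurableSet_ball,
    ← lintegral_indicator measurableSet_ball]
  rfl

lemma OscDecay.add {K : Set (Pt d)} {u v : Pt d → V} (hu : OscDecay K u) (hv : OscDecay K v) :
    OscDecay K fun y => u y + v y := by
  -- pass to strongly measurable representatives, so that the integrals are additive
  suffices h : ∀ u v : Pt d → V, StronglyMeasurable u → StronglyMeasurable v → OscDecay K u →
      OscDecay K v → OscDecay K fun y => u y + v y by
    have e1 := hu.1.1.ae_eq_mk
    have e2 := hv.1.1.ae_eq_mk
    refine (h _ _ hu.1.1.stronglyMeasurable_mk hv.1.1.stronglyMeasurable_mk (hu.congr e1)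
      (hv.congr e2)).congr ?_
    filter_upwards [e1, e2] with y h1 h2
    rw [h1, h2]
  clear hu hv u v
  intro u v hum hvm hu hv
  obtain ⟨hL, β, C, hβ, hC, hb⟩ := hu
  obtain ⟨hL', β', C', hβ', hC', hb'⟩ := hv
  refine ⟨hL.add hL', max β β', 4 * (C + C'), max_lt hβ hβ',
    ENNReal.mul_ne_top (by simp) (ENNReal.add_ne_top.2 ⟨hC, hC'⟩), fun n => ?_⟩
  calc _ ≤ ∫⁻ y in K, ∫⁻ z in K ∩ Metric.ball y ((1 / 2) ^ n),
        4 * (‖u y - u z‖ₑ ^ 2 + ‖v y - v z‖ₑ ^ 2) := by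
        refine lintegral_mono fun y => lintegral_mono fun z => ?_
        dsimp only
        rw [add_sub_add_comm]
        exact (pow_le_pow_left₀ zero_le (enorm_add_le _ _) 2).trans (add_sq_le_four _ _)
    _ = 4 * ((∫⁻ y in K, ∫⁻ z in K ∩ Metric.ball y ((1 / 2) ^ n), ‖u y - u z‖ₑ ^ 2) +
          ∫⁻ y in K, ∫⁻ z in K ∩ Metric.ball y ((1 / 2) ^ n), ‖v y - v z‖ₑ ^ 2) := by
        rw [← lintegral_add_left (measurable_lintegral_diff hum n),
          ← lintegral_const_mul' _ _ (by simp)]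
        refine lintegral_congr fun y => ?_
        rw [lintegral_const_mul' _ _ (by simp), lintegral_add_left]
        exact ((stronglyMeasurable_const.sub hum).enorm.pow_const 2)
    _ ≤ 4 * (C * (max β β') ^ (4 * n) * (2⁻¹ ^ n) ^ (d + 1) +
          C' * (max β β') ^ (4 * n) * (2⁻¹ ^ n) ^ (d + 1)) := by
        gcongr
        · exact (hb n).trans (by gcongr; exact le_max_left _ _)
        · exact (hb' n).trans (by gcongr; exact le_max_right _ _)
    _ = _ := by ring

lemma OscDecay.of_components {ι : Type} [Fintype ι] {K : Set (Pt d)}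
    {u : Pt d → EuclideanSpace ℝ ι} (h : ∀ i, OscDecay K fun y => u y i) : OscDecay K u := by
  classical
  have key : ∀ s : Finset ι, OscDecay K fun y => ∑ i ∈ s, EuclideanSpace.single i (u y i) := by
    intro s
    induction s using Finset.induction_on with
    | empty =>
      simp only [Finset.sum_empty]
      exact ⟨MemLp.zero, 0, 0, by simp, by simp, by simp⟩
    | insert i s hi ih =>
      simp only [Finset.sum_insert hi]
      refine OscDecay.add ?_ ih
      have := (h i).clm ((ContinuousLinearMap.toSpanSingleton ℝ
        (EuclideanSpace.single i (1 : ℝ) : EuclideanSpace ℝ ι)))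
      refine this.congr (ae_of_all _ fun y => ?_)
      ext j
      by_cases hj : j = i <;> simp [hj]
  refine (key Finset.univ).congr (ae_of_all _ fun y => ?_)
  ext j
  simp

/-- The trace theorem: at almost every boundary point, `u` has a one-sided Lebesgue value, which
is approached at a geometric rate with a square integrable constant, and the trace is square
integrable. -/
theorem OscDecay.trace [CompleteSpace V] {K : Set (Pt d)} {μ : Measure (Pt d)}
    (hG : TraceGeom K μ) {u : Pt d → V} (ho : OscDecay K u) :
    MemLp (traceFrom K u) 2 μ ∧
      (∀ᵐ x ∂μ, IsLebesgueValue K u x (traceFrom K u x)) ∧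
      ∃ (H : Pt d → ℝ≥0∞) (b C : ℝ≥0∞), Measurable H ∧ ∫⁻ x, H x ^ 2 ∂μ < ∞ ∧ b < 1 ∧ C ≠ ∞ ∧
        ∀ᵐ x ∂μ, ∀ n : ℕ, ⨍⁻ y in K ∩ Metric.ball x ((1 / 2) ^ (n + 1)),
          ‖u y - traceFrom K u x‖ₑ ∂volume ≤ C * H x * b ^ n := by
  have := hG.finite'
  have : IsFiniteMeasure (volume.restrict K) := ⟨by simpa using hG.finite.lt_top⟩
  have e := ho.1.1.ae_eq_mk
  obtain ⟨T, H, b, C, hT, hH, hH2, hb, hC, hbd⟩ := exists_trace_aux hG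
    ho.1.1.stronglyMeasurable_mk (ho.congr e)
  obtain ⟨c, hc0, hct, hlow⟩ := hG.lower
  have hHfin : ∀ᵐ x ∂μ, H x < ∞ := by
    filter_upwards [ae_lt_top (hH.pow_const 2) hH2.ne] with x hx
    exact (ENNReal.pow_lt_top_iff.1 hx).resolve_right two_ne_zero
  have hbd' : ∀ᵐ x ∂μ, ∀ n : ℕ, ⨍⁻ y in K ∩ Metric.ball x ((1 / 2) ^ (n + 1)),
      ‖u y - T x‖ₑ ∂volume ≤ C * H x * b ^ n := by
    filter_upwards [hbd] with x hx n
    refine (le_of_eq ?_).trans (hx n)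
    refine laverage_congr_set (ae_eq_refl _) ?_
    filter_upwards [ae_restrict_of_ae_restrict_of_subset inter_subset_left e] with y hy
    rw [hy]
  set v := volume (Metric.ball (0 : Pt d) 1) with hv
  have hvt : v ≠ ∞ := measure_ball_lt_top.ne
  have hpos : ∀ᵐ x ∂μ, ∀ r > 0, volume (K ∩ Metric.ball x r) ≠ 0 := by
    filter_upwards [hlow] with x hx r hr
    obtain ⟨n, hn⟩ := exists_pow_lt_of_lt_one hr (show (1 / 2 : ℝ) < 1 by norm_num)
    refine (lt_of_lt_of_le (pos_iff_ne_zero.2 (mul_ne_zero hc0 (by simp))) ((hx n).trans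
      (measure_mono (inter_subset_inter_right _ (Metric.ball_subset_ball hn.le))))).ne'
  have hleb : ∀ᵐ x ∂μ, IsLebesgueValue K u x (T x) := by
    filter_upwards [hlow, hbd', hHfin] with x hx hxb hxH
    -- between consecutive dyadic radii the averages are comparable
    have hQ : v / (c * (2⁻¹ ^ 2) ^ d) ≠ ∞ := ENNReal.div_ne_top hvt (mul_ne_zero hc0 (by simp))
    have hle : ∀ n : ℕ, ∀ r : ℝ, (1 / 2) ^ (n + 2) ≤ r → r ≤ (1 / 2) ^ (n + 1) →
        ⨍⁻ y in K ∩ Metric.ball x r, ‖u y - T x‖ₑ ∂volume ≤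
          v / (c * (2⁻¹ ^ 2) ^ d) * (C * H x) * b ^ n := by
      intro n r hr1 hr2
      have hE : ((2⁻¹ : ℝ≥0∞) ^ n) ^ d ≠ 0 := by simp
      have hEt : ((2⁻¹ : ℝ≥0∞) ^ n) ^ d ≠ ∞ := by simp
      have hl : c * (2⁻¹ ^ 2) ^ d * (2⁻¹ ^ n) ^ d ≤ volume (K ∩ Metric.ball x r) := by
        refine le_trans (le_of_eq ?_) ((hx (n + 2)).trans
          (measure_mono (inter_subset_inter_right _ (Metric.ball_subset_ball hr1))))
        rw [pow_add, mul_pow]; ring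
      have hm0 : volume (K ∩ Metric.ball x ((1 / 2) ^ (n + 1))) ≠ 0 :=
        (lt_of_lt_of_le (pos_iff_ne_zero.2 (mul_ne_zero hc0 (by simp))) (hx (n + 1))).ne'
      have hmt : volume (K ∩ Metric.ball x ((1 / 2) ^ (n + 1))) ≠ ∞ :=
        ((measure_mono inter_subset_right).trans_lt measure_ball_lt_top).ne
      calc _ ≤ (∫⁻ y in K ∩ Metric.ball x ((1 / 2) ^ (n + 1)), ‖u y - T x‖ₑ) /
              (c * (2⁻¹ ^ 2) ^ d * (2⁻¹ ^ n) ^ d) := by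
            rw [setLAverage_eq]
            exact ENNReal.div_le_div
              (lintegral_mono_set (inter_subset_inter_right _ (Metric.ball_subset_ball hr2))) hl
        _ = volume (K ∩ Metric.ball x ((1 / 2) ^ (n + 1))) / (c * (2⁻¹ ^ 2) ^ d * (2⁻¹ ^ n) ^ d) *
              ⨍⁻ y in K ∩ Metric.ball x ((1 / 2) ^ (n + 1)), ‖u y - T x‖ₑ ∂volume := by
            rw [setLAverage_eq, ENNReal.div_eq_inv_mul, ENNReal.div_eq_inv_mul (a := volume _),
              mul_assoc (c * (2⁻¹ ^ 2) ^ d * (2⁻¹ ^ n) ^ d)⁻¹, ENNReal.mul_div_cancel hm0 hmt]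
        _ ≤ ((2⁻¹ ^ n) ^ d * v) / (c * (2⁻¹ ^ 2) ^ d * (2⁻¹ ^ n) ^ d) * (C * H x * b ^ n) := by
            refine mul_le_mul' (ENNReal.div_le_div_right ?_ _) (hxb n)
            refine (measure_mono inter_subset_right).trans ?_
            rw [volume_ball_pow]
            exact mul_le_mul' (pow_le_pow_left₀ zero_le
              (pow_le_pow_of_le_one zero_le (ENNReal.inv_le_one.2 one_le_two) (Nat.le_succ n)) d)
              le_rfl
        _ = v / (c * (2⁻¹ ^ 2) ^ d) * (((2⁻¹ ^ n) ^ d)⁻¹ * (2⁻¹ ^ n) ^ d) * (C * H x * b ^ n) := by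
            rw [ENNReal.div_eq_inv_mul, ENNReal.div_eq_inv_mul,
              ENNReal.mul_inv (a := c * (2⁻¹ ^ 2) ^ d) (Or.inr hEt) (Or.inr hE)]
            ring
        _ = _ := by rw [ENNReal.inv_mul_cancel hE hEt]; ring
    have hlim : Tendsto (fun n : ℕ => v / (c * (2⁻¹ ^ 2) ^ d) * (C * H x) * b ^ n) atTop (𝓝 0) := by
      have := ENNReal.Tendsto.const_mul (a := v / (c * (2⁻¹ ^ 2) ^ d) * (C * H x))
        (ENNReal.tendsto_pow_atTop_nhds_zero_of_lt_one hb)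
        (Or.inr (ENNReal.mul_ne_top hQ (ENNReal.mul_ne_top hC hxH.ne)))
      simpa using this
    rw [IsLebesgueValue, ENNReal.tendsto_nhds_zero]
    intro ε hε
    obtain ⟨N, hN⟩ := eventually_atTop.1 ((ENNReal.tendsto_nhds_zero.1 hlim) ε hε)
    filter_upwards [Ioo_mem_nhdsGT (show (0 : ℝ) < (1 / 2) ^ (N + 1) by positivity)] with r hr
    obtain ⟨m, hm1, hm2⟩ := exists_nat_pow_near_of_lt_one hr.1 (by
        exact hr.2.le.trans (pow_le_one₀ (by norm_num) (by norm_num)))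
      (show (0 : ℝ) < 1 / 2 by norm_num) (by norm_num)
    have hNm : N + 1 ≤ m := by
      by_contra hlt
      have : (1 / 2 : ℝ) ^ (N + 1) ≤ (1 / 2) ^ (m + 1) :=
        pow_le_pow_of_le_one (by norm_num) (by norm_num) (by omega)
      linarith [hr.2]
    obtain ⟨n, rfl⟩ : ∃ n, m = n + 1 := ⟨m - 1, by omega⟩
    exact (hle n r hm1.le hm2).trans (hN n (by omega))
  have hTeq : traceFrom K u =ᵐ[μ] T := by
    filter_upwards [hleb, hpos] with x hx hxp
    exact hx.traceFrom_eq hxp (ho.1.integrable one_le_two)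
  refine ⟨?_, ?_, H, b, C, hH, hH2, hb, hC, ?_⟩
  · rw [memLp_congr_ae hTeq, memLp_two_iff]
    refine ⟨hT, ?_⟩
    set A : ℝ≥0∞ := (∫⁻ y in K, ‖u y‖ₑ) / (c * (2⁻¹ ^ 1) ^ d) with hA
    have hAt : A ≠ ∞ := ENNReal.div_ne_top
      (ho.1.integrable one_le_two).2.ne (mul_ne_zero hc0 (by simp))
    calc ∫⁻ x, ‖T x‖ₑ ^ 2 ∂μ ≤ ∫⁻ x, 4 * (A ^ 2 + (C * H x) ^ 2) ∂μ := by
          refine lintegral_mono_ae ?_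
          filter_upwards [hlow, hbd'] with x hx hxb
          refine le_trans (pow_le_pow_left₀ zero_le ?_ 2) (add_sq_le_four _ _)
          have hm0 : volume (K ∩ Metric.ball x ((1 / 2) ^ (0 + 1))) ≠ 0 :=
            (lt_of_lt_of_le (pos_iff_ne_zero.2 (mul_ne_zero hc0 (by simp))) (hx (0 + 1))).ne'
          have hmt : volume (K ∩ Metric.ball x ((1 / 2) ^ (0 + 1))) ≠ ∞ :=
            ((measure_mono inter_subset_right).trans_lt measure_ball_lt_top).ne
          have hiu : AEMeasurable (fun y => ‖u y‖ₑ)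
              (volume.restrict (K ∩ Metric.ball x ((1 / 2) ^ (0 + 1)))) :=
            (ho.1.1.mono_measure (Measure.restrict_mono inter_subset_left le_rfl)).enorm
          calc ‖T x‖ₑ = ⨍⁻ _ in K ∩ Metric.ball x ((1 / 2) ^ (0 + 1)), ‖T x‖ₑ ∂volume := by
                rw [setLAverage_eq, setLIntegral_const, ENNReal.mul_div_cancel_right hm0 hmt]
            _ ≤ (⨍⁻ y in K ∩ Metric.ball x ((1 / 2) ^ (0 + 1)), ‖u y‖ₑ ∂volume) +
                ⨍⁻ y in K ∩ Metric.ball x ((1 / 2) ^ (0 + 1)), ‖u y - T x‖ₑ ∂volume := by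
                simp only [laverage]
                rw [← lintegral_add_left' (hiu.mono_ac (Measure.smul_absolutelyContinuous))]
                refine lintegral_mono fun y => ?_
                calc ‖T x‖ₑ = ‖u y - (u y - T x)‖ₑ := by rw [sub_sub_cancel]
                  _ ≤ _ := enorm_sub_le
            _ ≤ A + C * H x := by
                refine add_le_add ?_ (by simpa using hxb 0)
                rw [setLAverage_eq]
                exact ENNReal.div_le_div (lintegral_mono_set inter_subset_left) (hx 1)
      _ = 4 * (A ^ 2 * μ univ + C ^ 2 * ∫⁻ x, H x ^ 2 ∂μ) := by
          rw [lintegral_const_mul' _ _ (by simp), lintegral_add_left measurable_const,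
            lintegral_const]
          simp only [mul_pow]
          rw [lintegral_const_mul' _ _ (ENNReal.pow_ne_top hC)]
      _ < ∞ := by
          refine ENNReal.mul_lt_top (by simp) (ENNReal.add_lt_top.2 ⟨?_, ?_⟩)
          · exact ENNReal.mul_lt_top (ENNReal.pow_lt_top hAt.lt_top) (measure_lt_top _ _)
          · exact ENNReal.mul_lt_top (ENNReal.pow_lt_top hC.lt_top) hH2
  · filter_upwards [hTeq, hleb] with x h1 h2
    rwa [h1]
  · filter_upwards [hTeq, hbd'] with x h1 h2 n
    rw [h1]
    exact h2 n

end Trace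

/-! ### Integration along hyperplanes -/

section Slicing

variable {d : ℕ}

/-- The hyperplane through `p` orthogonal to `a`. -/
def hyper (a p : Pt d) : Set (Pt d) := {x | inner ℝ a (x - p) = 0}

/-- The surface measure on the hyperplane through `p` orthogonal to `a`. -/
noncomputable def hyperMeas (a p : Pt d) : Measure (Pt d) := surf (hyper a p)

lemma finrank_orthogonal_add_one {a : Pt d} (ha : a ≠ 0) :
    Module.finrank ℝ (ℝ ∙ a)ᗮ + 1 = d := by
  have h1 := (ℝ ∙ a).finrank_add_finrank_orthogonal
  rw [finrank_span_singleton ha, finrank_euclideanSpace_fin] at h1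
  omega

lemma isometry_hyper (a p : Pt d) : Isometry fun w : (ℝ ∙ a)ᗮ => (w : Pt d) + p :=
  Isometry.of_dist_eq fun x y => by rw [dist_add_right, Subtype.dist_eq]

lemma range_hyper (a p : Pt d) : range (fun w : (ℝ ∙ a)ᗮ => (w : Pt d) + p) = hyper a p := by
  ext x
  constructor
  · rintro ⟨w, rfl⟩
    have := Submodule.mem_orthogonal_singleton_iff_inner_right.1 w.2
    simpa [hyper] using this
  · intro hx
    exact ⟨⟨x - p, Submodule.mem_orthogonal_singleton_iff_inner_right.2 hx⟩, by simp⟩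

lemma hyperMeas_eq_map {a : Pt d} (ha : a ≠ 0) (p : Pt d) :
    hyperMeas a p = (volume : Measure (ℝ ∙ a)ᗮ).map fun w : (ℝ ∙ a)ᗮ => (w : Pt d) + p := by
  have hd : d - 1 = Module.finrank ℝ (ℝ ∙ a)ᗮ := by
    have := finrank_orthogonal_add_one ha
    omega
  rw [hyperMeas, surf, ← range_hyper, hd, ← (isometry_hyper a p).map_euclideanHausdorffMeasure,
    InnerProductSpace.euclideanHausdorffMeasure_eq_volume]

lemma sFinite_hyperMeas {a : Pt d} (ha : a ≠ 0) (p : Pt d) : SFinite (hyperMeas a p) := by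
  rw [hyperMeas_eq_map ha]
  infer_instance

lemma measurable_hyper_param (a p : Pt d) : Measurable fun w : (ℝ ∙ a)ᗮ => (w : Pt d) + p :=
  (isometry_hyper a p).continuous.measurable

/-- Fubini's theorem along the hyperplanes orthogonal to `a`, in the oblique direction `v`. -/
lemma lintegral_slicing {a v : Pt d} (hav : inner ℝ a v = 1) (p : Pt d) {g : Pt d → ℝ≥0∞}
    (hg : Measurable g) :
    ∫⁻ y, g y = ‖a‖ₑ⁻¹ * ∫⁻ s : ℝ, ∫⁻ x, g (x + s • v) ∂hyperMeas a p := by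
  have ha : a ≠ 0 := by rintro rfl; simp at hav
  have hna : ‖a‖ ≠ 0 := norm_ne_zero_iff.2 ha
  set e : (ℝ ∙ a) := ⟨(‖a‖ ^ 2)⁻¹ • a, Submodule.smul_mem _ _ (Submodule.mem_span_singleton_self a)⟩
    with he
  have he0 : e ≠ 0 := by
    rw [Ne, ← Submodule.coe_eq_zero]
    simp [he, ha]
  have hne : ‖e‖ₑ = ‖a‖ₑ⁻¹ := by
    have : ‖e‖ = ‖a‖⁻¹ := by
      simp only [he, Submodule.coe_norm, norm_smul, norm_inv, norm_pow, norm_norm]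
      field_simp
    rw [← ofReal_norm, this, ENNReal.ofReal_inv_of_pos (norm_pos_iff.2 ha), ofReal_norm]
  set w0 : (ℝ ∙ a)ᗮ := ⟨v - (e : Pt d), by
    rw [Submodule.mem_orthogonal_singleton_iff_inner_right, inner_sub_right, hav]
    simp only [he, real_inner_smul_right, real_inner_self_eq_norm_sq]
    field_simp; simp⟩ with hw0
  have h1 : ∫⁻ y, g y = ∫⁻ q : (ℝ ∙ a) × (ℝ ∙ a)ᗮ, g ((q.1 : Pt d) + q.2 + p) := by
    have := ((ℝ ∙ a).measurePreserving_measurableEquivProd p).symm.lintegral_comp hg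
    rw [InnerProductSpace.euclideanHausdorffMeasure_eq_volume] at this
    rw [← this]
    simp
  have hrank : Module.finrank ℝ (ℝ ∙ a) = 1 := finrank_span_singleton ha
  have hgm : Measurable fun q : (ℝ ∙ a) × (ℝ ∙ a)ᗮ => g ((q.1 : Pt d) + q.2 + p) := by fun_prop
  rw [h1, Measure.volume_eq_prod, lintegral_prod _ hgm.aemeasurable,
    volume_eq_of_finrank_eq_one hrank he0, lintegral_smul_measure, lintegral_map, hne, smul_eq_mul]
  · congr 1
    refine lintegral_congr fun s => ?_
    rw [hyperMeas_eq_map ha, lintegral_map (by fun_prop) (measurable_hyper_param a p),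
      ← lintegral_add_right_eq_self _ (s • w0)]
    refine lintegral_congr fun w => ?_
    congr 1
    simp only [hw0, Submodule.coe_smul, Submodule.coe_add]
    module
  · exact hgm.lintegral_prod_right'
  · fun_prop

lemma map_slicing {a v : Pt d} (hav : inner ℝ a v = 1) (p : Pt d) :
    (volume : Measure (Pt d)) =
      ‖a‖ₑ⁻¹ • ((hyperMeas a p).prod volume).map fun q : Pt d × ℝ => q.1 + q.2 • v := by
  have ha : a ≠ 0 := by rintro rfl; simp at hav
  have := sFinite_hyperMeas ha p
  refine Measure.ext fun s hs => ?_
  have hm : Measurable fun q : Pt d × ℝ => q.1 + q.2 • v := by fun_prop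
  rw [Measure.smul_apply, Measure.map_apply hm hs, Measure.prod_apply_symm (hm hs), smul_eq_mul,
    ← lintegral_indicator_one hs, lintegral_slicing hav p (measurable_one.indicator hs)]
  congr 1
  refine lintegral_congr fun t => ?_
  rw [← lintegral_indicator_one (measurable_prodMk_right (hm hs))]
  rfl

lemma integral_slicing {a v : Pt d} (hav : inner ℝ a v = 1) (p : Pt d) {g : Pt d → ℝ}
    (hg : AEStronglyMeasurable g) :
    ∫ y, g y = ‖a‖⁻¹ * ∫ q : Pt d × ℝ, g (q.1 + q.2 • v) ∂((hyperMeas a p).prod volume) := by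
  have ha : a ≠ 0 := by rintro rfl; simp at hav
  have hm : Measurable fun q : Pt d × ℝ => q.1 + q.2 • v := by fun_prop
  have h0 : ‖a‖ₑ⁻¹ ≠ 0 := by simp
  have hg' : AEStronglyMeasurable g
      (((hyperMeas a p).prod volume).map fun q : Pt d × ℝ => q.1 + q.2 • v) := by
    have h := hg
    rw [map_slicing hav p] at h
    refine h.mono_ac ?_
    exact Measure.AbsolutelyContinuous.smul_right Measure.AbsolutelyContinuous.rfl h0
  conv_lhs => rw [map_slicing hav p]
  rw [integral_smul_measure, integral_map hm.aemeasurable hg', smul_eq_mul]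
  simp

/-- The projection onto the hyperplane through `p` orthogonal to `a` along `v`. -/
noncomputable def proj (a v p y : Pt d) : Pt d := y - (inner ℝ a (y - p) : ℝ) • v

lemma proj_add_smul {a v p x : Pt d} (hav : inner ℝ a v = 1) (hx : x ∈ hyper a p) (s : ℝ) :
    proj a v p (x + s • v) = x := by
  have : inner ℝ a (x + s • v - p) = s := by
    rw [add_sub_right_comm, inner_add_right, show inner ℝ a (x - p) = 0 from hx,
      real_inner_smul_right, hav]
    ring
  rw [proj, this, add_sub_cancel_right]

lemma inner_add_smul {a v p x : Pt d} (hav : inner ℝ a v = 1) (hx : x ∈ hyper a p) (s : ℝ) :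
    inner ℝ a (x + s • v - p) = s := by
  rw [add_sub_right_comm, inner_add_right, show inner ℝ a (x - p) = 0 from hx,
    real_inner_smul_right, hav]
  ring

lemma measurableSet_hyper (a p : Pt d) : MeasurableSet (hyper a p) :=
  (isClosed_eq (by fun_prop) continuous_const).measurableSet

@[fun_prop]
lemma continuous_proj (a v p : Pt d) : Continuous (proj a v p) := by
  unfold proj
  fun_prop

lemma ae_mem_hyper (a p : Pt d) : ∀ᵐ x ∂hyperMeas a p, x ∈ hyper a p :=
  ae_restrict_mem (measurableSet_hyper a p)

lemma quasiMeasurePreserving_proj {a v : Pt d} (hav : inner ℝ a v = 1) (p : Pt d) :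
    Measure.QuasiMeasurePreserving (proj a v p) volume (hyperMeas a p) := by
  refine ⟨(continuous_proj a v p).measurable, ?_⟩
  refine Measure.AbsolutelyContinuous.mk fun s hs h0 => ?_
  have hms : MeasurableSet (proj a v p ⁻¹' s) := (continuous_proj a v p).measurable hs
  rw [Measure.map_apply (continuous_proj a v p).measurable hs, ← lintegral_indicator_one hms,
    lintegral_slicing hav p (measurable_one.indicator hms)]
  have : ∀ t : ℝ, ∫⁻ x, (proj a v p ⁻¹' s).indicator 1 (x + t • v) ∂hyperMeas a p = 0 := by
    intro t
    rw [← h0, ← lintegral_indicator_one hs]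
    refine lintegral_congr_ae ?_
    filter_upwards [ae_mem_hyper a p] with x hx
    have hiff : x + t • v ∈ proj a v p ⁻¹' s ↔ x ∈ s := by
      rw [mem_preimage, proj_add_smul hav hx]
    by_cases h : x ∈ s
    · rw [indicator_of_mem h, indicator_of_mem (hiff.2 h), Pi.one_apply, Pi.one_apply]
    · rw [indicator_of_notMem h, indicator_of_notMem (fun h' => h (hiff.1 h'))]
  simp [this]

/-- Integrals over a layer of thickness `δ` of functions of the projection. -/
lemma lintegral_strip_le {a v : Pt d} (hav : inner ℝ a v = 1) (p : Pt d) {K S : Set (Pt d)}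
    (hK : ∀ y ∈ K, proj a v p y ∈ S) (hK0 : ∀ y ∈ K, (0 : ℝ) ≤ inner ℝ a (y - p))
    (hS : S ⊆ hyper a p) (hSm : MeasurableSet S)
    {G : Pt d → ℝ≥0∞} (hG : Measurable G) {δ : ℝ} :
    ∫⁻ y in K ∩ {y | inner ℝ a (y - p) < δ}, G (proj a v p y) ≤
      ‖a‖ₑ⁻¹ * ENNReal.ofReal δ * ∫⁻ x, G x ∂surf S := by
  have hm : MeasurableSet (proj a v p ⁻¹' S ∩ {y | inner ℝ a (y - p) ∈ Ico 0 δ}) :=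
    ((continuous_proj a v p).measurable hSm).inter
      ((show Continuous fun y : Pt d => (inner ℝ a (y - p) : ℝ) by fun_prop).measurable
        measurableSet_Ico)
  calc _ ≤ ∫⁻ y in proj a v p ⁻¹' S ∩ {y | inner ℝ a (y - p) ∈ Ico 0 δ}, G (proj a v p y) :=
        lintegral_mono_set fun y hy => ⟨hK y hy.1, hK0 y hy.1, hy.2⟩
    _ = ‖a‖ₑ⁻¹ * ∫⁻ s : ℝ, ∫⁻ x, (Ico 0 δ).indicator 1 s * S.indicator G x ∂hyperMeas a p := by
        have hgm : Measurable fun y => G (proj a v p y) := hG.comp (continuous_proj a v p).measurable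
        rw [← lintegral_indicator hm, lintegral_slicing hav p (hgm.indicator hm)]
        congr 1
        refine lintegral_congr fun s => lintegral_congr_ae ?_
        filter_upwards [ae_mem_hyper a p] with x hx
        have hiff : x + s • v ∈ proj a v p ⁻¹' S ∩ {y | inner ℝ a (y - p) ∈ Ico 0 δ} ↔
            x ∈ S ∧ s ∈ Ico 0 δ := by
          rw [mem_inter_iff, mem_preimage, proj_add_smul hav hx, mem_ofPred_eq,
            inner_add_smul hav hx]
        by_cases h : x ∈ S ∧ s ∈ Ico 0 δ
        · rw [indicator_of_mem (hiff.2 h), indicator_of_mem h.1, indicator_of_mem h.2,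
            proj_add_smul hav hx, Pi.one_apply, one_mul]
        · rw [indicator_of_notMem (fun h' => h (hiff.1 h'))]
          by_cases h1 : x ∈ S
          · rw [indicator_of_notMem (fun h2 => h ⟨h1, h2⟩), zero_mul]
          · rw [indicator_of_notMem h1, mul_zero]
    _ = _ := by
        have hSS : (hyperMeas a p).restrict S = surf S := by
          rw [hyperMeas, surf, surf, Measure.restrict_restrict hSm, inter_eq_left.2 hS]
        have : ∀ s : ℝ, ∫⁻ x, (Ico 0 δ).indicator 1 s * S.indicator G x ∂hyperMeas a p =
            (Ico (0 : ℝ) δ).indicator 1 s * ∫⁻ x, G x ∂surf S := by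
          intro s
          rw [lintegral_const_mul _ (hG.indicator hSm), lintegral_indicator hSm, hSS]
        simp only [this]
        rw [lintegral_mul_const _ (measurable_one.indicator measurableSet_Ico),
          lintegral_indicator_one measurableSet_Ico, Real.volume_Ico, sub_zero, mul_assoc]

/-- Surface measures on parts of a hyperplane are of dimension `d - 1`. -/
lemma surf_ball_le {a p : Pt d} (ha : a ≠ 0) {S : Set (Pt d)} (hS : S ⊆ hyper a p) :
    ∃ C : ℝ≥0∞, C ≠ ∞ ∧ ∀ (y : Pt d) (n : ℕ),
      surf S (Metric.ball y ((1 / 2) ^ n)) * 2⁻¹ ^ n ≤ C * (2⁻¹ ^ n) ^ d := by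
  have hd := finrank_orthogonal_add_one ha
  refine ⟨2 ^ Module.finrank ℝ (ℝ ∙ a)ᗮ * volume (Metric.ball (0 : (ℝ ∙ a)ᗮ) 1),
    ENNReal.mul_ne_top (by simp) measure_ball_lt_top.ne, fun y n => ?_⟩
  have h1 : surf S (Metric.ball y ((1 / 2) ^ n)) ≤ hyperMeas a p (Metric.ball y ((1 / 2) ^ n)) :=
    Measure.restrict_mono hS le_rfl _
  have h2 : hyperMeas a p (Metric.ball y ((1 / 2) ^ n)) ≤
      (2 * 2⁻¹ ^ n) ^ Module.finrank ℝ (ℝ ∙ a)ᗮ * volume (Metric.ball (0 : (ℝ ∙ a)ᗮ) 1) := by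
    rw [hyperMeas_eq_map ha, Measure.map_apply (measurable_hyper_param a p) measurableSet_ball]
    rcases eq_empty_or_nonempty ((fun w : (ℝ ∙ a)ᗮ => (w : Pt d) + p) ⁻¹'
      Metric.ball y ((1 / 2) ^ n)) with h | ⟨w, hw⟩
    · rw [h, measure_empty]; exact zero_le
    · have hsub : (fun w : (ℝ ∙ a)ᗮ => (w : Pt d) + p) ⁻¹' Metric.ball y ((1 / 2) ^ n) ⊆
          Metric.ball w (2 * (1 / 2) ^ n) := by
        intro w' hw'
        rw [Metric.mem_ball, ← (isometry_hyper a p).dist_eq]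
        have e1 : dist ((w : Pt d) + p) y < (1 / 2) ^ n := hw
        have e2 : dist ((w' : Pt d) + p) y < (1 / 2) ^ n := hw'
        calc _ ≤ dist ((w' : Pt d) + p) y + dist ((w : Pt d) + p) y := dist_triangle_right _ _ _
          _ < _ := by linarith
      refine (measure_mono hsub).trans (le_of_eq ?_)
      rw [Measure.addHaar_ball_of_pos _ _ (by positivity)]
      congr 1
      rw [ENNReal.ofReal_pow (by positivity), ENNReal.ofReal_mul (by norm_num),
        ENNReal.ofReal_pow (by positivity), one_div, ENNReal.ofReal_inv_of_pos (by norm_num)]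
      simp
  calc _ ≤ (2 * 2⁻¹ ^ n) ^ Module.finrank ℝ (ℝ ∙ a)ᗮ * volume (Metric.ball (0 : (ℝ ∙ a)ᗮ) 1) *
        2⁻¹ ^ n := by gcongr; exact h1.trans h2
    _ = 2 ^ Module.finrank ℝ (ℝ ∙ a)ᗮ * volume (Metric.ball (0 : (ℝ ∙ a)ᗮ) 1) *
        (2⁻¹ ^ n) ^ (Module.finrank ℝ (ℝ ∙ a)ᗮ + 1) := by rw [mul_pow]; ring
    _ = _ := by rw [hd]

/-- Two transversal hyperplanes meet in a set of vanishing surface measure. -/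
lemma hyperMeas_hyper {a v b : Pt d} (p q : Pt d) (hav : inner ℝ a v = 1) (hb : b ≠ 0)
    (hbv : inner ℝ b v = 0) : hyperMeas a p (hyper b q) = 0 := by
  have ha : a ≠ 0 := by rintro rfl; simp at hav
  have hm := measurableSet_hyper b q
  have h0 : volume (hyper b q) = 0 := by
    obtain ⟨w, hw⟩ : ∃ w, inner ℝ b w = 1 := by
      refine ⟨(‖b‖ ^ 2)⁻¹ • b, ?_⟩
      rw [real_inner_smul_right, real_inner_self_eq_norm_sq, inv_mul_cancel₀]
      exact pow_ne_zero _ (norm_ne_zero_iff.2 hb)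
    rw [← lintegral_indicator_one hm, lintegral_slicing hw q (measurable_one.indicator hm),
      mul_eq_zero]
    right
    have : ∀ᵐ s : ℝ, s ≠ 0 := by simp [ae_iff]
    refine (lintegral_eq_zero_iff' ?_).2 ?_
    · have := sFinite_hyperMeas hb q
      exact (Measurable.lintegral_prod_right' (f := fun z : ℝ × Pt d =>
        (hyper b q).indicator (1 : Pt d → ℝ≥0∞) (z.2 + z.1 • w))
        ((measurable_one.indicator hm).comp (by fun_prop))).aemeasurable
    · filter_upwards [this] with s hs
      refine (lintegral_congr_ae ?_).trans lintegral_zero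
      filter_upwards [ae_mem_hyper b q] with x hx
      refine indicator_of_notMem (fun h => hs ?_) _
      rw [← inner_add_smul hw hx s]
      exact h
  rw [← lintegral_indicator_one hm, lintegral_slicing hav p (measurable_one.indicator hm),
    mul_eq_zero] at h0
  have h1 : ∀ s : ℝ, ∫⁻ x, (hyper b q).indicator 1 (x + s • v) ∂hyperMeas a p =
      hyperMeas a p (hyper b q) := by
    intro s
    rw [← lintegral_indicator_one hm]
    refine lintegral_congr fun x => ?_
    have hiff : x + s • v ∈ hyper b q ↔ x ∈ hyper b q := by
      simp only [hyper, mem_ofPred_eq, add_sub_right_comm, inner_add_right,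
        real_inner_smul_right, hbv, mul_zero, add_zero]
    by_cases h : x ∈ hyper b q
    · rw [indicator_of_mem h, indicator_of_mem (hiff.2 h), Pi.one_apply, Pi.one_apply]
    · rw [indicator_of_notMem h, indicator_of_notMem (fun h' => h (hiff.1 h'))]
  simp only [h1, lintegral_const, Real.volume_univ] at h0
  rcases h0 with h0 | h0
  · simp at h0
  · exact (mul_eq_zero.1 h0).resolve_right (by simp)

end Slicing

/-! ### Thin layers along a face -/

section Strip

variable {d : ℕ}

/-- A body `K` above its face `S` in the hyperplane through `p` orthogonal to `a`, such that the
projection along `v` maps `K` into `S`. -/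
structure StripGeom (a v p : Pt d) (K S : Set (Pt d)) : Prop where
  inner_eq : inner ℝ a v = 1
  proj_mem : ∀ y ∈ K, proj a v p y ∈ S
  nonneg : ∀ y ∈ K, (0 : ℝ) ≤ inner ℝ a (y - p)
  subset : S ⊆ hyper a p
  meas : MeasurableSet S
  geom : TraceGeom K (surf S)

lemma StripGeom.ne_zero {a v p : Pt d} {K S : Set (Pt d)} (hG : StripGeom a v p K S) : a ≠ 0 := by
  rintro rfl
  simpa using hG.inner_eq

lemma StripGeom.hyperMeas_restrict {a v p : Pt d} {K S : Set (Pt d)} (hG : StripGeom a v p K S) :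
    (hyperMeas a p).restrict S = surf S := by
  rw [hyperMeas, surf, surf, Measure.restrict_restrict hG.meas, inter_eq_left.2 hG.subset]

lemma StripGeom.ae_proj {a v p : Pt d} {K S : Set (Pt d)} (hG : StripGeom a v p K S)
    {P : Pt d → Prop} (h : ∀ᵐ x ∂surf S, P x) :
    ∀ᵐ y ∂volume.restrict K, P (proj a v p y) := by
  rw [← hG.hyperMeas_restrict, ae_restrict_iff' hG.meas] at h
  have h1 := (quasiMeasurePreserving_proj hG.inner_eq p).ae h
  rw [ae_restrict_iff' hG.geom.meas]
  filter_upwards [h1] with y hy hyK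
  exact hy (hG.proj_mem y hyK)

/-- In thin layers along the face `S`, a function of decaying oscillation is close in the mean to
its trace at the projected points. -/
lemma tendsto_strip_error_aux {V : Type} [NormedAddCommGroup V] [NormedSpace ℝ V] [CompleteSpace V]
    {a v p : Pt d} {K S : Set (Pt d)} (hG : StripGeom a v p K S) {u : Pt d → V}
    (hu : StronglyMeasurable u) (ho : OscDecay K u) {c₀ : ℝ} (hc₀ : 0 < c₀)
    (hcv : c₀ * ‖v‖ ≤ 1 / 2) :
    Tendsto (fun n : ℕ => (2 : ℝ≥0∞) ^ n *
      ∫⁻ y in K ∩ {y | inner ℝ a (y - p) < c₀ * (1 / 2) ^ n},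
        ‖u y - traceFrom K u (proj a v p y)‖ₑ) atTop (𝓝 0) := by
  have := hG.geom.finite'
  obtain ⟨-, -, H, b, C, hH, hH2, hb, hC, hT⟩ := ho.trace hG.geom
  obtain ⟨-, β, C₁, hβ, hC₁, hosc⟩ := ho
  obtain ⟨c, hc0, hct, hlow⟩ := hG.geom.lower
  have ha : ‖a‖ₑ⁻¹ ≠ ∞ := by simpa using hG.ne_zero
  set vb := volume (Metric.ball (0 : Pt d) 1) with hvb
  have hvbt : vb ≠ ∞ := measure_ball_lt_top.ne
  set c' := c * 2⁻¹ ^ d with hc'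
  have hc'0 : c' ≠ 0 := mul_ne_zero hc0 (by simp)
  have hc't : c' ≠ ∞ := ENNReal.mul_ne_top hct (by simp)
  set A := ‖a‖ₑ⁻¹ * ENNReal.ofReal c₀ * surf S univ with hA
  have hAt : A ≠ ∞ := ENNReal.mul_ne_top (ENNReal.mul_ne_top ha (by simp)) (measure_ne_top _ _)
  have hHi : ∫⁻ x, H x ∂surf S ≠ ∞ := by
    have h1 := lintegral_sq_le (surf S) hH.aemeasurable
    have h2 : (∫⁻ x, H x ∂surf S) ^ 2 < ∞ :=
      h1.trans_lt (ENNReal.mul_lt_top (measure_lt_top _ _) hH2)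
    exact ((ENNReal.pow_lt_top_iff.1 h2).resolve_right two_ne_zero).ne
  set A' := ‖a‖ₑ⁻¹ * ENNReal.ofReal c₀ * ∫⁻ x, H x ∂surf S with hA'
  have hA't : A' ≠ ∞ := ENNReal.mul_ne_top (ENNReal.mul_ne_top ha (by simp)) hHi
  set R := 1 + A * vb * C₁ with hR
  have hRt : R ≠ ∞ := ENNReal.add_ne_top.2
    ⟨by simp, ENNReal.mul_ne_top (ENNReal.mul_ne_top hAt hvbt) hC₁⟩
  have hdiff : Measurable fun q : Pt d × Pt d => ‖u q.1 - u q.2‖ₑ :=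
    ((hu.comp_measurable measurable_fst).sub (hu.comp_measurable measurable_snd)).enorm
  have hofReal (n : ℕ) : ENNReal.ofReal (c₀ * (1 / 2) ^ n) = ENNReal.ofReal c₀ * 2⁻¹ ^ n := by
    rw [ENNReal.ofReal_mul hc₀.le, ENNReal.ofReal_pow (by positivity), one_div,
      ENNReal.ofReal_inv_of_pos (by norm_num)]
    simp
  have key : ∀ n : ℕ, (2 : ℝ≥0∞) ^ n * ∫⁻ y in K ∩ {y | inner ℝ a (y - p) < c₀ * (1 / 2) ^ n},
      ‖u y - traceFrom K u (proj a v p y)‖ₑ ≤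
        c'⁻¹ * (R * (β ^ 2) ^ n + vb * C * A' * b ^ n) := by
    intro n
    set Z := K ∩ {y | inner ℝ a (y - p) < c₀ * (1 / 2) ^ n} with hZ
    have hZm : MeasurableSet Z := hG.geom.meas.inter
      ((show Continuous fun y : Pt d => (inner ℝ a (y - p) : ℝ) by fun_prop).measurable
        measurableSet_Iio)
    set E : ℝ≥0∞ := 2⁻¹ ^ n with hE
    have hE0 : E ≠ 0 := by simp [hE]
    have hEt : E ≠ ∞ := by simp [hE]
    set Jf : Pt d → ℝ≥0∞ := fun y => ∫⁻ z in K ∩ Metric.ball y ((1 / 2) ^ n), ‖u y - u z‖ₑ with hJf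
    have hJm : Measurable Jf := by
      have hS : MeasurableSet {p : Pt d × Pt d | dist p.2 p.1 < (1 / 2) ^ n} :=
        (isOpen_lt (by fun_prop) (by fun_prop)).measurableSet
      convert (hdiff.indicator hS).lintegral_prod_right' (ν := volume.restrict K) using 2 with y
      rw [hJf]
      dsimp only
      rw [inter_comm, ← Measure.restrict_restrict measurableSet_ball,
        ← lintegral_indicator measurableSet_ball]
      rfl
    have hvolB (y : Pt d) : volume (K ∩ Metric.ball y ((1 / 2) ^ n)) ≤ E ^ d * vb := by
      refine (measure_mono inter_subset_right).trans ?_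
      rw [volume_ball_pow]
    -- the double integral over close pairs of points, one of which is in the layer
    have hJ : ∫⁻ y in Z, Jf y ≤ R * (β ^ 2) ^ n * E ^ (d + 1) := by
      have hvZ : volume Z ≤ A * E := by
        have := lintegral_strip_le hG.inner_eq p hG.proj_mem hG.nonneg hG.subset hG.meas
          (G := 1) measurable_one (δ := c₀ * (1 / 2) ^ n)
        simp only [Pi.one_apply, lintegral_one, Measure.restrict_apply_univ, hofReal] at this
        refine this.trans (le_of_eq ?_)
        rw [hA]; ring
      have h1 : (∫⁻ y in Z, Jf y) ^ 2 ≤ (R * (β ^ 2) ^ n * E ^ (d + 1)) ^ 2 := by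
        calc (∫⁻ y in Z, Jf y) ^ 2 ≤ volume Z * ∫⁻ y in Z, Jf y ^ 2 := by
              simpa using lintegral_sq_le (volume.restrict Z) hJm.aemeasurable
          _ ≤ (A * E) * ∫⁻ y in K, (E ^ d * vb) *
                ∫⁻ z in K ∩ Metric.ball y ((1 / 2) ^ n), ‖u y - u z‖ₑ ^ 2 := by
              refine mul_le_mul' hvZ ((lintegral_mono_set inter_subset_left).trans
                (lintegral_mono fun y => ?_))
              have hmy : Measurable fun z => ‖u y - u z‖ₑ := hdiff.comp measurable_prodMk_left
              refine (lintegral_sq_le (volume.restrict (K ∩ Metric.ball y ((1 / 2) ^ n)))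
                hmy.aemeasurable).trans ?_
              rw [Measure.restrict_apply_univ]
              exact mul_le_mul' (hvolB y) le_rfl
          _ ≤ (A * E) * ((E ^ d * vb) * (C₁ * β ^ (4 * n) * E ^ (d + 1))) := by
              rw [lintegral_const_mul' _ _ (ENNReal.mul_ne_top (ENNReal.pow_ne_top hEt) hvbt)]
              exact mul_le_mul' le_rfl (mul_le_mul' le_rfl (hosc n))
          _ = (A * vb * C₁) * ((β ^ 2) ^ n * E ^ (d + 1)) ^ 2 := by ring
          _ ≤ R ^ 2 * ((β ^ 2) ^ n * E ^ (d + 1)) ^ 2 := by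
              refine mul_le_mul' ?_ le_rfl
              calc A * vb * C₁ ≤ R := le_add_self
                _ ≤ R ^ 2 := le_self_pow₀ (by rw [hR]; exact le_self_add) two_ne_zero
          _ = _ := by ring
      exact (ENNReal.pow_le_pow_left_iff two_ne_zero).1 h1
    have hHZ : ∫⁻ y in Z, H (proj a v p y) ≤ A' * E := by
      refine (lintegral_strip_le hG.inner_eq p hG.proj_mem hG.nonneg hG.subset hG.meas
        hH (δ := c₀ * (1 / 2) ^ n)).trans (le_of_eq ?_)
      rw [hofReal, hA']; ring
    -- compare `u y` with the trace through the averages over balls around the projected point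
    have hpt : ∀ᵐ y ∂volume.restrict Z, c' * E ^ d * ‖u y - traceFrom K u (proj a v p y)‖ₑ ≤
        Jf y + E ^ d * vb * (C * H (proj a v p y) * b ^ n) := by
      have hae := ae_restrict_of_ae_restrict_of_subset (μ := volume) (s := Z) inter_subset_left
        (hG.ae_proj (hlow.and hT))
      filter_upwards [hae, ae_restrict_mem hZm] with y hy hyZ
      set x := proj a v p y with hx
      set W := K ∩ Metric.ball x ((1 / 2) ^ (n + 1)) with hW
      have hyx : dist x y ≤ (1 / 2) ^ (n + 1) := by
        have h1 := hG.nonneg y hyZ.1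
        have h2 : inner ℝ a (y - p) < c₀ * (1 / 2) ^ n := hyZ.2
        rw [hx, proj, dist_eq_norm, sub_sub_cancel_left, norm_neg, norm_smul, Real.norm_of_nonneg h1]
        calc _ ≤ c₀ * (1 / 2) ^ n * ‖v‖ := by gcongr
          _ = (c₀ * ‖v‖) * (1 / 2) ^ n := by ring
          _ ≤ (1 / 2) * (1 / 2) ^ n := by gcongr
          _ = _ := by ring
      have hWsub : W ⊆ K ∩ Metric.ball y ((1 / 2) ^ n) := by
        refine inter_subset_inter_right _ fun z hz => ?_
        rw [Metric.mem_ball] at hz ⊢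
        calc dist z y ≤ dist z x + dist x y := dist_triangle _ _ _
          _ < (1 / 2) ^ (n + 1) + (1 / 2) ^ (n + 1) := add_lt_add_of_lt_of_le hz hyx
          _ = _ := by ring
      have hWl : c' * E ^ d ≤ volume W := by
        refine le_trans (le_of_eq ?_) (hy.1 (n + 1))
        rw [hc', pow_succ]; ring
      have hW0 : volume W ≠ 0 :=
        (lt_of_lt_of_le (pos_iff_ne_zero.2 (mul_ne_zero hc'0 (pow_ne_zero _ hE0))) hWl).ne'
      have hWt : volume W ≠ ∞ := ((measure_mono inter_subset_right).trans_lt measure_ball_lt_top).ne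
      have hmy : Measurable fun z => ‖u y - u z‖ₑ := hdiff.comp measurable_prodMk_left
      calc c' * E ^ d * ‖u y - traceFrom K u x‖ₑ
          ≤ ∫⁻ z in W, ‖u y - traceFrom K u x‖ₑ := by
            rw [setLIntegral_const, mul_comm]
            exact mul_le_mul' le_rfl hWl
        _ ≤ ∫⁻ z in W, (‖u y - u z‖ₑ + ‖u z - traceFrom K u x‖ₑ) := by
            refine lintegral_mono fun z => ?_
            simp only [← edist_eq_enorm_sub]
            exact edist_triangle _ _ _
        _ = (∫⁻ z in W, ‖u y - u z‖ₑ) + volume W *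
              ⨍⁻ z in W, ‖u z - traceFrom K u x‖ₑ ∂volume := by
            rw [lintegral_add_left hmy, setLAverage_eq, ENNReal.mul_div_cancel hW0 hWt]
        _ ≤ _ := add_le_add (lintegral_mono_set hWsub)
            (mul_le_mul' ((measure_mono hWsub).trans (hvolB y)) (hy.2 n))
    have hfin : c' * E ^ d * ∫⁻ y in Z, ‖u y - traceFrom K u (proj a v p y)‖ₑ ≤
        E ^ (d + 1) * (R * (β ^ 2) ^ n + vb * C * A' * b ^ n) := by
      rw [← lintegral_const_mul' _ _ (ENNReal.mul_ne_top hc't (ENNReal.pow_ne_top hEt))]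
      calc _ ≤ ∫⁻ y in Z, (Jf y + E ^ d * vb * (C * H (proj a v p y) * b ^ n)) :=
            lintegral_mono_ae hpt
        _ = (∫⁻ y in Z, Jf y) + (E ^ d * vb * C * b ^ n) * ∫⁻ y in Z, H (proj a v p y) := by
            rw [lintegral_add_left hJm, ← lintegral_const_mul' _ _ ?_]
            · congr 1
              refine lintegral_congr fun y => ?_
              ring
            · refine ENNReal.mul_ne_top (ENNReal.mul_ne_top (ENNReal.mul_ne_top
                (ENNReal.pow_ne_top hEt) hvbt) hC) (ENNReal.pow_ne_top (hb.trans_le le_top).ne)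
        _ ≤ R * (β ^ 2) ^ n * E ^ (d + 1) + (E ^ d * vb * C * b ^ n) * (A' * E) :=
            add_le_add hJ (mul_le_mul' le_rfl hHZ)
        _ = _ := by ring
    have h2E : (2 : ℝ≥0∞) ^ n = E⁻¹ := by rw [hE, ← ENNReal.inv_pow, inv_inv]
    rw [h2E]
    calc E⁻¹ * ∫⁻ y in Z, ‖u y - traceFrom K u (proj a v p y)‖ₑ
        = (c'⁻¹ * c') * ((E ^ d)⁻¹ * E ^ d) * (E⁻¹ * ∫⁻ y in Z,
            ‖u y - traceFrom K u (proj a v p y)‖ₑ) := by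
          rw [ENNReal.inv_mul_cancel hc'0 hc't, ENNReal.inv_mul_cancel (pow_ne_zero _ hE0)
            (ENNReal.pow_ne_top hEt), one_mul, one_mul]
      _ = c'⁻¹ * (E ^ d)⁻¹ * E⁻¹ * (c' * E ^ d * ∫⁻ y in Z,
            ‖u y - traceFrom K u (proj a v p y)‖ₑ) := by ring
      _ ≤ c'⁻¹ * (E ^ d)⁻¹ * E⁻¹ * (E ^ (d + 1) * (R * (β ^ 2) ^ n + vb * C * A' * b ^ n)) :=
          mul_le_mul' le_rfl hfin
      _ = ((E ^ d)⁻¹ * E ^ d) * (E⁻¹ * E) * (c'⁻¹ * (R * (β ^ 2) ^ n + vb * C * A' * b ^ n)) := by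
          ring
      _ = _ := by
          rw [ENNReal.inv_mul_cancel hE0 hEt, ENNReal.inv_mul_cancel (pow_ne_zero _ hE0)
            (ENNReal.pow_ne_top hEt), one_mul, one_mul]
  have hl : Tendsto (fun n : ℕ => c'⁻¹ * (R * (β ^ 2) ^ n + vb * C * A' * b ^ n)) atTop
      (𝓝 (c'⁻¹ * (R * 0 + vb * C * A' * 0))) := by
    refine ENNReal.Tendsto.const_mul (Tendsto.add ?_ ?_) (Or.inr (ENNReal.inv_ne_top.2 hc'0))
    · exact ENNReal.Tendsto.const_mul (ENNReal.tendsto_pow_atTop_nhds_zero_of_lt_one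
        (pow_lt_one₀ zero_le hβ two_ne_zero)) (Or.inr hRt)
    · exact ENNReal.Tendsto.const_mul (ENNReal.tendsto_pow_atTop_nhds_zero_of_lt_one hb)
        (Or.inr (ENNReal.mul_ne_top (ENNReal.mul_ne_top hvbt hC) hA't))
  simp only [mul_zero, add_zero] at hl
  exact tendsto_of_tendsto_of_tendsto_of_le_of_le tendsto_const_nhds hl (fun _ => zero_le) key

lemma tendsto_strip_error {V : Type} [NormedAddCommGroup V] [NormedSpace ℝ V] [CompleteSpace V]
    {a v p : Pt d} {K S : Set (Pt d)} (hG : StripGeom a v p K S) {u : Pt d → V}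
    (ho : OscDecay K u) {c₀ : ℝ} (hc₀ : 0 < c₀) (hcv : c₀ * ‖v‖ ≤ 1 / 2) :
    Tendsto (fun n : ℕ => (2 : ℝ≥0∞) ^ n *
      ∫⁻ y in K ∩ {y | inner ℝ a (y - p) < c₀ * (1 / 2) ^ n},
        ‖u y - traceFrom K u (proj a v p y)‖ₑ) atTop (𝓝 0) := by
  have e := ho.1.1.ae_eq_mk
  refine (tendsto_strip_error_aux hG ho.1.1.stronglyMeasurable_mk (ho.congr e) hc₀ hcv).congr
    fun n => ?_
  congr 1
  refine lintegral_congr_ae ?_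
  filter_upwards [ae_restrict_of_ae_restrict_of_subset inter_subset_left e] with y hy
  rw [hy, traceFrom_congr (ae_eq_refl K) e]

lemma hyper_smul {c : ℝ} (hc : c ≠ 0) (a p : Pt d) : hyper (c • a) p = hyper a p := by
  ext x
  simp [hyper, real_inner_smul_left, hc]

/-- Weighted averages over thin layers along the face `S` converge to surface integrals of the
trace. -/
lemma tendsto_strip {a v p : Pt d} {K S : Set (Pt d)} (hG : StripGeom a v p K S) {u : Pt d → ℝ}
    (ho : OscDecay K u) {c₀ : ℝ} (hc₀ : 0 < c₀) (hcv : c₀ * ‖v‖ ≤ 1 / 2)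
    {w : ℕ → Pt d → ℝ} (hwm : ∀ n, Measurable (w n)) {B : ℝ} (hB : ∀ n, ∀ y ∈ K, |w n y| ≤ B)
    (hw0 : ∀ n, ∀ y ∈ K, c₀ * (1 / 2) ^ n ≤ inner ℝ a (y - p) → w n y = 0)
    {φ : Pt d → ℝ} {θ : ℝ → ℝ}
    (hlim : ∀ᵐ x ∂surf S, ∀ s ∈ Ioo 0 c₀, Tendsto
      (fun n : ℕ => K.indicator (w n) (x + (s * (1 / 2) ^ n) • v)) atTop (𝓝 (θ s * φ x))) :
    Tendsto (fun n : ℕ => 2 ^ n * ∫ y in K, w n y * u y) atTop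
      (𝓝 (‖a‖⁻¹ * ((∫ s in Ioo 0 c₀, θ s) * ∫ x, φ x * traceFrom K u x ∂surf S))) := by
  have := hG.geom.finite'
  have : IsFiniteMeasure (volume.restrict K) := ⟨by simpa using hG.geom.finite.lt_top⟩
  have := sFinite_hyperMeas hG.ne_zero p
  have htr := ho.trace hG.geom
  have hKm := hG.geom.meas
  have hui : IntegrableOn u K := ho.1.integrable one_le_two
  set T : Pt d → ℝ := S.indicator (traceFrom K u) with hT
  have hTm : AEStronglyMeasurable T (hyperMeas a p) := by
    rw [hT, aestronglyMeasurable_indicator_iff hG.meas, hG.hyperMeas_restrict]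
    exact htr.1.1
  have hTi : Integrable T (hyperMeas a p) := by
    rw [hT, integrable_indicator_iff hG.meas, IntegrableOn, hG.hyperMeas_restrict]
    exact htr.1.integrable one_le_two
  have hTK (y : Pt d) (hy : y ∈ K) : T (proj a v p y) = traceFrom K u (proj a v p y) :=
    indicator_of_mem (hG.proj_mem y hy) _
  have hTpm : AEStronglyMeasurable (fun y => T (proj a v p y)) volume :=
    hTm.comp_quasiMeasurePreserving (quasiMeasurePreserving_proj hG.inner_eq p)
  have hWm (n : ℕ) : Measurable (K.indicator (w n)) := (hwm n).indicator hKm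
  -- the layers seen in the coordinates `x + (s / 2 ^ n) v`
  have hslice (n : ℕ) : 2 ^ n * ∫ y, K.indicator (w n) y * T (proj a v p y) =
      ‖a‖⁻¹ * ∫ q : Pt d × ℝ, K.indicator (w n) (q.1 + (q.2 * (1 / 2) ^ n) • v) * T q.1
        ∂((hyperMeas a p).prod volume) := by
    have hav : inner ℝ ((2 : ℝ) ^ n • a) ((1 / 2 : ℝ) ^ n • v) = 1 := by
      rw [real_inner_smul_left, real_inner_smul_right, hG.inner_eq, mul_one, ← mul_pow]
      norm_num
    have hH : hyperMeas ((2 : ℝ) ^ n • a) p = hyperMeas a p := by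
      rw [hyperMeas, hyperMeas, hyper_smul (by positivity)]
    have h := integral_slicing hav p ((hWm n).aestronglyMeasurable.mul hTpm)
    simp only [Pi.mul_apply] at h
    rw [h, hH, norm_smul, mul_inv, ← mul_assoc, ← mul_assoc, norm_pow, Real.norm_ofNat,
      mul_inv_cancel₀ (by positivity), one_mul]
    congr 1
    have hae : ∀ᵐ q : Pt d × ℝ ∂((hyperMeas a p).prod volume), q.1 ∈ hyper a p :=
      Measure.quasiMeasurePreserving_fst.ae (ae_mem_hyper a p)
    refine integral_congr_ae ?_
    filter_upwards [hae] with q hq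
    rw [smul_smul, proj_add_smul hG.inner_eq hq]
  have hmain : Tendsto (fun n : ℕ => 2 ^ n * ∫ y, K.indicator (w n) y * T (proj a v p y)) atTop
      (𝓝 (‖a‖⁻¹ * ((∫ s in Ioo 0 c₀, θ s) * ∫ x, φ x * traceFrom K u x ∂surf S))) := by
    simp only [hslice]
    refine Tendsto.const_mul _ ?_
    have hlimeq : (∫ s in Ioo 0 c₀, θ s) * ∫ x, φ x * traceFrom K u x ∂surf S =
        ∫ q : Pt d × ℝ, (φ q.1 * T q.1) * (Ioo 0 c₀).indicator θ q.2
          ∂((hyperMeas a p).prod volume) := by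
      rw [integral_prod_mul (fun x => φ x * T x) ((Ioo 0 c₀).indicator θ),
        integral_indicator measurableSet_Ioo, mul_comm, ← hG.hyperMeas_restrict,
        ← integral_indicator hG.meas]
      congr 2
      ext x
      by_cases hx : x ∈ S <;> simp [hT, hx]
    rw [hlimeq]
    refine tendsto_integral_of_dominated_convergence
      (fun q => (|B| * ‖T q.1‖) * (Ico 0 c₀).indicator 1 q.2) ?_ ?_ ?_ ?_
    · intro n
      refine AEStronglyMeasurable.mul ?_ hTm.comp_fst
      exact ((hWm n).comp (by fun_prop)).aestronglyMeasurable
    · refine Integrable.mul_prod (hTi.norm.const_mul _) ?_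
      rw [integrable_indicator_iff measurableSet_Ico]
      exact integrableOn_const (by simp)
    · intro n
      have hae : ∀ᵐ q : Pt d × ℝ ∂((hyperMeas a p).prod volume), q.1 ∈ hyper a p :=
        Measure.quasiMeasurePreserving_fst.ae (ae_mem_hyper a p)
      filter_upwards [hae] with q hq
      by_cases hK : q.1 + (q.2 * (1 / 2) ^ n) • v ∈ K
      · have hs := inner_add_smul hG.inner_eq hq (q.2 * (1 / 2) ^ n)
        have hs0 : 0 ≤ q.2 := by
          have := hG.nonneg _ hK
          rw [hs] at this
          exact nonneg_of_mul_nonneg_left this (by positivity)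
        rw [indicator_of_mem hK]
        by_cases hsc : q.2 < c₀
        · rw [indicator_of_mem (show q.2 ∈ Ico 0 c₀ from ⟨hs0, hsc⟩), Pi.one_apply, mul_one,
            norm_mul]
          gcongr
          exact (hB n _ hK).trans (le_abs_self B)
        · rw [hw0 n _ hK (by rw [hs]; gcongr; exact not_lt.1 hsc), zero_mul, norm_zero]
          exact mul_nonneg (by positivity) (indicator_nonneg (fun _ _ => zero_le_one) _)
      · rw [indicator_of_notMem hK, zero_mul, norm_zero]
        exact mul_nonneg (by positivity) (indicator_nonneg (fun _ _ => zero_le_one) _)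
    · rw [← hG.hyperMeas_restrict, ae_restrict_iff' hG.meas] at hlim
      have h1 : ∀ᵐ q : Pt d × ℝ ∂((hyperMeas a p).prod volume), q.1 ∈ hyper a p ∧
          (q.1 ∈ S → ∀ s ∈ Ioo 0 c₀, Tendsto (fun n : ℕ => K.indicator (w n)
            (q.1 + (s * (1 / 2) ^ n) • v)) atTop (𝓝 (θ s * φ q.1))) :=
        Measure.quasiMeasurePreserving_fst.ae ((ae_mem_hyper a p).and hlim)
      have h2 : ∀ᵐ q : Pt d × ℝ ∂((hyperMeas a p).prod volume), q.2 ≠ 0 :=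
        Measure.quasiMeasurePreserving_snd.ae (p := fun s : ℝ => s ≠ 0) (by simp [ae_iff])
      filter_upwards [h1, h2] with q hq hq0
      by_cases hS : q.1 ∈ S
      · by_cases hs : q.2 ∈ Ioo 0 c₀
        · rw [indicator_of_mem hs]
          have := (hq.2 hS q.2 hs).mul_const (T q.1)
          convert this using 2
          ring
        · rw [indicator_of_notMem hs, mul_zero]
          refine tendsto_const_nhds.congr fun n => ?_
          by_cases hK : q.1 + (q.2 * (1 / 2) ^ n) • v ∈ K
          · have hi := inner_add_smul hG.inner_eq hq.1 (q.2 * (1 / 2) ^ n)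
            have hs0 : 0 ≤ q.2 := by
              have := hG.nonneg _ hK
              rw [hi] at this
              exact nonneg_of_mul_nonneg_left this (by positivity)
            have hsc : c₀ ≤ q.2 := by
              by_contra hlt
              exact hs ⟨lt_of_le_of_ne hs0 (Ne.symm hq0), not_le.1 hlt⟩
            rw [indicator_of_mem hK, hw0 n _ hK (by rw [hi]; gcongr), zero_mul]
          · rw [indicator_of_notMem hK, zero_mul]
      · simp [hT, hS]
  -- replacing `u` by the trace at the projected point costs nothing in the limit
  have hB0 : ∀ n, ∀ y ∈ K, |w n y| ≤ |B| := fun n y hy => (hB n y hy).trans (le_abs_self B)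
  have herr := tendsto_strip_error hG ho hc₀ hcv
  set I : ℕ → ℝ≥0∞ := fun n => ∫⁻ y in K, ‖w n y * (u y - T (proj a v p y))‖ₑ with hI
  have hIle (n : ℕ) : I n ≤ ENNReal.ofReal |B| *
      ∫⁻ y in K ∩ {y | inner ℝ a (y - p) < c₀ * (1 / 2) ^ n},
        ‖u y - traceFrom K u (proj a v p y)‖ₑ := by
    have hZm : MeasurableSet {y : Pt d | inner ℝ a (y - p) < c₀ * (1 / 2) ^ n} :=
      ((show Continuous fun y : Pt d => (inner ℝ a (y - p) : ℝ) by fun_prop).measurable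
        measurableSet_Iio)
    rw [← lintegral_const_mul' _ _ (by simp), inter_comm, ← Measure.restrict_restrict hZm,
      ← lintegral_indicator hZm]
    refine setLIntegral_mono' hKm fun y hy => ?_
    by_cases hyZ : inner ℝ a (y - p) < c₀ * (1 / 2) ^ n
    · rw [indicator_of_mem (show y ∈ {y : Pt d | inner ℝ a (y - p) < c₀ * (1 / 2) ^ n} from hyZ),
        enorm_mul, hTK y hy]
      gcongr
      rw [Real.enorm_eq_ofReal_abs]
      exact ENNReal.ofReal_le_ofReal (hB0 n y hy)
    · rw [hw0 n y hy (not_lt.1 hyZ), zero_mul, enorm_zero]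
      exact zero_le
  have hI0 : Tendsto (fun n : ℕ => (2 : ℝ≥0∞) ^ n * I n) atTop (𝓝 0) := by
    have h := ENNReal.Tendsto.const_mul (a := ENNReal.ofReal |B|) herr (Or.inr (by simp))
    rw [mul_zero] at h
    refine tendsto_of_tendsto_of_tendsto_of_le_of_le tendsto_const_nhds h (fun _ => zero_le)
      fun n => ?_
    calc (2 : ℝ≥0∞) ^ n * I n ≤ 2 ^ n * (ENNReal.ofReal |B| * _) := mul_le_mul' le_rfl (hIle n)
      _ = _ := by ring
  have hdiff : Tendsto (fun n : ℕ => 2 ^ n * ∫ y in K, w n y * (u y - T (proj a v p y))) atTop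
      (𝓝 0) := by
    rw [tendsto_iff_edist_tendsto_0]
    refine tendsto_of_tendsto_of_tendsto_of_le_of_le tendsto_const_nhds hI0 (fun _ => zero_le)
      fun n => ?_
    rw [edist_eq_enorm_sub, sub_zero, enorm_mul, enorm_pow]
    refine mul_le_mul' ?_ (enorm_integral_le_lintegral_enorm _)
    rw [Real.enorm_eq_ofReal (by norm_num)]
    simp
  have hsum := hmain.add hdiff
  rw [add_zero] at hsum
  refine hsum.congr' ?_
  have hfin : ∀ᶠ n : ℕ in atTop, I n < ∞ := by
    filter_upwards [(ENNReal.tendsto_nhds_zero.1 hI0) 1 one_pos] with n hn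
    have h2 : I n ≤ 2 ^ n * I n := le_mul_of_one_le_left zero_le (one_le_pow₀ one_le_two)
    exact (h2.trans hn).trans_lt ENNReal.one_lt_top
  filter_upwards [hfin] with n hn
  have hi1 : IntegrableOn (fun y => w n y * (u y - T (proj a v p y))) K :=
    ⟨(hwm n).aestronglyMeasurable.mul (hui.1.sub hTpm.restrict), hn⟩
  have hi2 : IntegrableOn (fun y => w n y * u y) K := by
    refine hui.bdd_mul (c := |B|) (hwm n).aestronglyMeasurable ?_
    filter_upwards [ae_restrict_mem hKm] with y hy
    exact hB0 n y hy
  have hi3 : IntegrableOn (fun y => w n y * T (proj a v p y)) K := by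
    refine (hi2.sub hi1).congr (ae_of_all _ fun y => ?_)
    simp only [Pi.sub_apply]
    ring
  have e1 : ∫ y, K.indicator (w n) y * T (proj a v p y) = ∫ y in K, w n y * T (proj a v p y) := by
    rw [← integral_indicator hKm]
    congr 1
    ext y
    by_cases hy : y ∈ K <;> simp [hy]
  rw [e1, ← mul_add, ← integral_add hi3 hi1]
  congr 2
  ext y
  ring

end Strip

/-! ### Simplices in barycentric coordinates -/

section Simplex

variable {d : ℕ} {ι : Type} [Fintype ι] (b : AffineBasis ι ℝ (Pt d))

/-- The gradient of the `i`-th barycentric coordinate. -/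
noncomputable def grad (i : ι) : Pt d :=
  (InnerProductSpace.toDual ℝ (Pt d)).symm (LinearMap.toContinuousLinearMap (b.coord i).linear)

lemma inner_grad_sub (i : ι) (x y : Pt d) :
    inner ℝ (grad b i) (y - x) = b.coord i y - b.coord i x := by
  rw [grad, InnerProductSpace.toDual_symm_apply]
  have := (b.coord i).linearMap_vsub y x
  simpa using this

lemma coord_add_smul (i : ι) (x v : Pt d) (s : ℝ) :
    b.coord i (x + s • v) = b.coord i x + s * inner ℝ (grad b i) v := by
  have := inner_grad_sub b i x (x + s • v)
  rw [add_sub_cancel_left, real_inner_smul_right] at this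
  linarith

lemma continuous_coord (i : ι) : Continuous (b.coord i) :=
  (b.coord i).continuous_of_finiteDimensional

lemma inner_grad_edge [DecidableEq ι] (i j k : ι) :
    inner ℝ (grad b k) (b i - b j) = (if k = i then 1 else 0) - (if k = j then 1 else 0) := by
  rw [inner_grad_sub, b.coord_apply, b.coord_apply]

lemma hyper_grad (i : ι) {p : Pt d} (hp : b.coord i p = 0) :
    hyper (grad b i) p = {x | b.coord i x = 0} := by
  ext x
  simp [hyper, inner_grad_sub, hp]

/-- The face of a simplex spanned by some of its vertices, in barycentric coordinates. -/
lemma convexHull_image_eq (s : Set ι) :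
    convexHull ℝ (b '' s) = {x | (∀ k, 0 ≤ b.coord k x) ∧ ∀ k ∉ s, b.coord k x = 0} := by
  classical
  refine Subset.antisymm (convexHull_min ?_ ?_) ?_
  · rintro _ ⟨i, hi, rfl⟩
    refine ⟨fun k => ?_, fun k hk => ?_⟩
    · rw [b.coord_apply]; split_ifs <;> norm_num
    · rw [b.coord_apply_ne]; rintro rfl; exact hk hi
  · intro x hx y hy α β hα hβ hαβ
    have e (k : ι) : b.coord k (α • x + β • y) = α * b.coord k x + β * b.coord k y := by
      have := Convex.combo_affine_apply (f := b.coord k) (x := x) (y := y) hαβ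
      simpa using this
    refine ⟨fun k => ?_, fun k hk => ?_⟩
    · rw [e]
      have := hx.1 k
      have := hy.1 k
      positivity
    · rw [e, hx.2 k hk, hy.2 k hk]; simp
  · rintro x ⟨h0, hs⟩
    rw [← b.linear_combination_coord_eq_self x]
    have : ∑ i, b.coord i x • b i = ∑ i with i ∈ s, b.coord i x • b i := by
      rw [Finset.sum_filter]
      refine Finset.sum_congr rfl fun i _ => ?_
      split_ifs with h
      · rfl
      · rw [hs i h, zero_smul]
    rw [this]
    refine (convex_convexHull ℝ _).sum_mem (fun i _ => h0 i) ?_ ?_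
    · rw [Finset.sum_filter, ← b.sum_coord_apply_eq_one x]
      refine Finset.sum_congr rfl fun i _ => ?_
      split_ifs with h
      · rfl
      · rw [hs i h]
    · intro i hi
      exact subset_convexHull ℝ _ ⟨i, (Finset.mem_filter.1 hi).2, rfl⟩

/-- The closed simplex. -/
def bsimplex (b : AffineBasis ι ℝ (Pt d)) : Set (Pt d) := convexHull ℝ (range b)

/-- The facet opposite to the vertex `i`. -/
def facet (b : AffineBasis ι ℝ (Pt d)) (i : ι) : Set (Pt d) := convexHull ℝ (b '' {i}ᶜ)

lemma mem_bsimplex {x : Pt d} : x ∈ bsimplex b ↔ ∀ k, 0 ≤ b.coord k x := by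
  rw [bsimplex, ← image_univ, convexHull_image_eq]
  simp

lemma mem_facet {i : ι} {x : Pt d} : x ∈ facet b i ↔ x ∈ bsimplex b ∧ b.coord i x = 0 := by
  rw [facet, convexHull_image_eq, mem_bsimplex]
  simp

lemma mem_interior_bsimplex {x : Pt d} : x ∈ interior (bsimplex b) ↔ ∀ k, 0 < b.coord k x := by
  rw [bsimplex, b.interior_convexHull]
  rfl

lemma isCompact_bsimplex : IsCompact (bsimplex b) := (finite_range b).isCompact_convexHull (𝕜 := ℝ)

lemma isCompact_facet (i : ι) : IsCompact (facet b i) :=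
  ((toFinite {i}ᶜ).image b).isCompact_convexHull (𝕜 := ℝ)

lemma bsimplex_ae_eq_interior : (interior (bsimplex b) : Set (Pt d)) =ᵐ[volume] bsimplex b :=
  interior_ae_eq_of_null_frontier ((convex_convexHull ℝ _).addHaar_frontier volume)

lemma hyperMeas_lt_top {a : Pt d} (ha : a ≠ 0) (p : Pt d) {S : Set (Pt d)} (hS : IsCompact S) :
    hyperMeas a p S < ∞ := by
  rw [hyperMeas_eq_map ha, Measure.map_apply (measurable_hyper_param a p) hS.measurableSet]
  have hb : Bornology.IsBounded ((fun w : (ℝ ∙ a)ᗮ => (w : Pt d) + p) ⁻¹' S) :=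
    (isometry_hyper a p).antilipschitz.isBounded_preimage hS.isBounded
  exact hb.measure_lt_top

/-- A convex body has a positive proportion of every small ball centred at one of its points. -/
lemma exists_lower_bound {K : Set (Pt d)} (hK : IsCompact K) (hc : Convex ℝ K)
    (h0 : volume K ≠ 0) :
    ∃ c : ℝ≥0∞, c ≠ 0 ∧ c ≠ ∞ ∧ ∀ x ∈ K, ∀ n : ℕ,
      c * (2⁻¹ ^ n) ^ d ≤ volume (K ∩ Metric.ball x ((1 / 2) ^ n)) := by
  set R := Metric.diam K + 1 with hR
  have hRp : 0 < R := by have := Metric.diam_nonneg (s := K); positivity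
  have hR1 : 1 ≤ R := by have := Metric.diam_nonneg (s := K); linarith
  refine ⟨ENNReal.ofReal (R⁻¹ ^ d) * volume K, mul_ne_zero ?_ h0,
    ENNReal.mul_ne_top (by simp) hK.measure_lt_top.ne, fun x hx n => ?_⟩
  · rw [Ne, ENNReal.ofReal_eq_zero, not_le]; positivity
  have hsub : AffineMap.homothety x (R⁻¹ * (1 / 2) ^ n) '' K ⊆ K ∩ Metric.ball x ((1 / 2) ^ n) := by
    rintro _ ⟨y, hy, rfl⟩
    have ht : R⁻¹ * (1 / 2) ^ n ≤ 1 :=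
      mul_le_one₀ (inv_le_one_of_one_le₀ hR1) (by positivity)
        (pow_le_one₀ (by norm_num) (by norm_num))
    refine ⟨?_, ?_⟩
    · rw [AffineMap.homothety_eq_lineMap]
      exact hc.lineMap_mem hx hy ⟨by positivity, ht⟩
    · rw [Metric.mem_ball, dist_homothety_center, Real.norm_of_nonneg (by positivity)]
      have h1 : dist x y < R := by
        have := Metric.dist_le_diam_of_mem hK.isBounded hx hy
        linarith
      calc R⁻¹ * (1 / 2) ^ n * dist x y < R⁻¹ * (1 / 2) ^ n * R := by gcongr
        _ = _ := by field_simp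
  refine le_trans (le_of_eq ?_) (measure_mono hsub)
  rw [Measure.addHaar_image_homothety, finrank_euclideanSpace_fin, abs_of_nonneg (by positivity),
    mul_pow, ENNReal.ofReal_mul (by positivity), mul_assoc, mul_assoc, mul_comm (volume K)]
  congr 2
  rw [ENNReal.ofReal_pow (by positivity), ENNReal.ofReal_pow (by positivity), one_div,
    ENNReal.ofReal_inv_of_pos (by norm_num)]
  simp

lemma volume_bsimplex_ne_zero : volume (bsimplex b) ≠ 0 := by
  have h : (interior (bsimplex b)).Nonempty := by
    rw [bsimplex, interior_convexHull_nonempty_iff_affineSpan_eq_top]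
    exact b.tot
  exact (lt_of_lt_of_le (isOpen_interior.measure_pos volume h) (measure_mono interior_subset)).ne'

lemma stripGeom_bsimplex [DecidableEq ι] {i j : ι} (hij : i ≠ j) :
    StripGeom (grad b i) (b i - b j) (b j) (bsimplex b) (facet b i) := by
  have hav : inner ℝ (grad b i) (b i - b j) = 1 := by
    rw [inner_grad_edge, if_pos rfl, if_neg hij, sub_zero]
  have hpj : b.coord i (b j) = 0 := b.coord_apply_ne hij
  have ha : grad b i ≠ 0 := by intro h; simp [h] at hav
  have hsub : facet b i ⊆ hyper (grad b i) (b j) := by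
    rw [hyper_grad b i hpj]
    exact fun x hx => ((mem_facet b).1 hx).2
  have hin (y : Pt d) : inner ℝ (grad b i) (y - b j) = b.coord i y := by
    rw [inner_grad_sub, hpj, sub_zero]
  refine ⟨hav, fun y hy => ?_, fun y hy => ?_, hsub, (isCompact_facet b i).measurableSet,
    (isCompact_bsimplex b).measurableSet, (isCompact_bsimplex b).measure_lt_top.ne, ⟨?_⟩, ?_, ?_⟩
  · have hc (k : ι) : b.coord k (proj (grad b i) (b i - b j) (b j) y) =
        b.coord k y - b.coord i y * ((if k = i then 1 else 0) - (if k = j then 1 else 0)) := by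
      rw [proj, sub_eq_add_neg, ← neg_smul, coord_add_smul, hin, inner_grad_edge]
      ring
    have hy' := (mem_bsimplex b).1 hy
    refine (mem_facet b).2 ⟨(mem_bsimplex b).2 fun k => ?_, ?_⟩
    · rw [hc]
      by_cases hki : k = i
      · subst hki
        simp [hij]
      · by_cases hkj : k = j
        · have := hy' k
          have := hy' i
          subst hkj
          rw [if_neg hki, if_pos rfl]
          linarith
        · simpa [hki, hkj] using hy' k
    · rw [hc]; simp [hij]
  · rw [hin]
    exact (mem_bsimplex b).1 hy i
  · rw [surf, Measure.restrict_apply_univ]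
    have h := hyperMeas_lt_top ha (b j) (isCompact_facet b i)
    rwa [hyperMeas, surf, Measure.restrict_apply (isCompact_facet b i).measurableSet,
      inter_eq_left.2 hsub] at h
  · obtain ⟨c, hc0, hct, hc⟩ := exists_lower_bound (isCompact_bsimplex b) (convex_convexHull ℝ _)
      (volume_bsimplex_ne_zero b)
    refine ⟨c, hc0, hct, ?_⟩
    filter_upwards [ae_restrict_mem (isCompact_facet b i).measurableSet] with x hx
    exact hc x ((mem_facet b).1 hx).1
  · exact surf_ball_le ha hsub

/-- Almost all points of a facet are in its relative interior. -/
lemma ae_facet_pos [DecidableEq ι] (h3 : 3 ≤ Fintype.card ι) (i : ι) :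
    ∀ᵐ x ∂surf (facet b i), x ∈ facet b i ∧ ∀ k, k ≠ i → 0 < b.coord k x := by
  have hmem : ∀ᵐ x ∂surf (facet b i), x ∈ facet b i :=
    ae_restrict_mem (isCompact_facet b i).measurableSet
  have hnull (k : ι) (hk : k ≠ i) : ∀ᵐ x ∂surf (facet b i), b.coord k x ≠ 0 := by
    obtain ⟨l, hl⟩ : ∃ l, l ∉ ({i, k} : Finset ι) := by
      by_contra! h
      have h1 : Fintype.card ι ≤ ({i, k} : Finset ι).card :=
        Finset.card_le_card fun x _ => h x
      have h2 := Finset.card_le_two (a := i) (b := k)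
      omega
    simp only [Finset.mem_insert, Finset.mem_singleton, not_or] at hl
    have hav : inner ℝ (grad b i) (b i - b l) = 1 := by
      rw [inner_grad_edge, if_pos rfl, if_neg (Ne.symm hl.1), sub_zero]
    have hbv : inner ℝ (grad b k) (b i - b l) = 0 := by
      rw [inner_grad_edge, if_neg hk, if_neg (Ne.symm hl.2), sub_zero]
    have hb : grad b k ≠ 0 := by
      have h1 : inner ℝ (grad b k) (b k - b l) = 1 := by
        rw [inner_grad_edge, if_pos rfl, if_neg (Ne.symm hl.2), sub_zero]
      intro h; simp [h] at h1
    have h0 := hyperMeas_hyper (b l) (b l) hav hb hbv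
    rw [hyper_grad b k (b.coord_apply_ne (Ne.symm hl.2))] at h0
    have hle : surf (facet b i) ≤ hyperMeas (grad b i) (b l) := by
      refine Measure.restrict_mono ?_ le_rfl
      rw [hyper_grad b i (b.coord_apply_ne (Ne.symm hl.1))]
      exact fun x hx => ((mem_facet b).1 hx).2
    rw [ae_iff]
    simpa using le_antisymm ((hle _).trans h0.le) zero_le
  have hall : ∀ᵐ x ∂surf (facet b i), ∀ k, k ≠ i → b.coord k x ≠ 0 := by
    rw [ae_all_iff]
    intro k
    by_cases hk : k = i
    · exact ae_of_all _ fun x h => absurd hk h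
    · filter_upwards [hnull k hk] with x hx _ using hx
  filter_upwards [hmem, hall] with x hx hk
  exact ⟨hx, fun k hki => lt_of_le_of_ne ((mem_bsimplex b).1 ((mem_facet b).1 hx).1 k)
    (Ne.symm (hk k hki))⟩

end Simplex

/-! ### Green's formula on a simplex -/

section Cutoff

/-- A smooth transition from `0` on `(-∞, 1/3]` to `1` on `[2/3, ∞)`. -/
noncomputable def ramp (t : ℝ) : ℝ := Real.smoothTransition (3 * t - 1)

lemma contDiff_ramp : ContDiff ℝ ((⊤ : ℕ∞) : WithTop ℕ∞) ramp :=
  Real.smoothTransition.contDiff.comp (by fun_prop)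

lemma ramp_of_le {t : ℝ} (h : t ≤ 1 / 3) : ramp t = 0 :=
  Real.smoothTransition.zero_of_nonpos (by linarith)

lemma ramp_of_ge {t : ℝ} (h : 2 / 3 ≤ t) : ramp t = 1 :=
  Real.smoothTransition.one_of_one_le (by linarith)

lemma ramp_nonneg (t : ℝ) : 0 ≤ ramp t := Real.smoothTransition.nonneg _

lemma ramp_le_one (t : ℝ) : ramp t ≤ 1 := Real.smoothTransition.le_one _

lemma continuous_deriv_ramp : Continuous (deriv ramp) :=
  contDiff_ramp.continuous_deriv (by simp)

lemma hasDerivAt_ramp (t : ℝ) : HasDerivAt ramp (deriv ramp t) t :=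
  (contDiff_ramp.differentiable (by simp) t).hasDerivAt

lemma deriv_ramp_of_ge {t : ℝ} (h : 1 ≤ t) : deriv ramp t = 0 := by
  have : ramp =ᶠ[𝓝 t] fun _ => 1 := by
    filter_upwards [lt_mem_nhds (show (2 / 3 : ℝ) < t by linarith)] with s hs
    exact ramp_of_ge hs.le
  rw [this.deriv_eq, deriv_const]

lemma exists_deriv_ramp_bound : ∃ C, 0 ≤ C ∧ ∀ t, 0 ≤ t → |deriv ramp t| ≤ C := by
  obtain ⟨C, hC⟩ := (isCompact_Icc (a := (0 : ℝ)) (b := 1)).exists_bound_of_continuousOn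
    continuous_deriv_ramp.continuousOn
  have h0 : 0 ≤ C := (norm_nonneg _).trans (hC 0 (by simp))
  refine ⟨C, h0, fun t ht => ?_⟩
  rcases le_total t 1 with h | h
  · exact hC t ⟨ht, h⟩
  · rw [deriv_ramp_of_ge h, abs_zero]
    exact h0

lemma integral_deriv_ramp {c : ℝ} (hc : 0 < c) : ∫ s in Ioo 0 c, deriv ramp (s / c) = c := by
  rw [← integral_Ioc_eq_integral_Ioo, ← intervalIntegral.integral_of_le hc.le]
  have h : ∀ x ∈ uIcc 0 c, HasDerivAt (fun s => c * ramp (s / c)) (deriv ramp (x / c)) x := by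
    intro x _
    have h1 : HasDerivAt (fun s : ℝ => s / c) (1 / c) x := (hasDerivAt_id x).div_const c
    have h2 := ((hasDerivAt_ramp (x / c)).comp x h1).const_mul c
    exact h2.congr_deriv (by rw [mul_one_div, mul_div_cancel₀ _ hc.ne'])
  rw [intervalIntegral.integral_eq_sub_of_hasDerivAt h]
  · rw [div_self hc.ne', zero_div, ramp_of_ge (by norm_num), ramp_of_le (by norm_num)]
    ring
  · exact (continuous_deriv_ramp.comp (continuous_id.div_const c)).intervalIntegrable _ _

end Cutoff

section Green

variable {d : ℕ} {ι : Type} [Fintype ι] [DecidableEq ι] (b : AffineBasis ι ℝ (Pt d))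

/-- A cut-off function that vanishes near the boundary of a simplex and is `1` at those points
whose barycentric coordinates are at least `ε`. -/
noncomputable def cutoff (ε : ℝ) (x : Pt d) : ℝ := ∏ i, ramp (b.coord i x / ε)

lemma coord_eq_inner_grad (i : ι) (y : Pt d) :
    b.coord i y = innerSL ℝ (grad b i) y + b.coord i 0 := by
  have := inner_grad_sub b i 0 y
  rw [sub_zero] at this
  rw [innerSL_apply_apply, this]
  ring

lemma contDiff_coord (i : ι) : ContDiff ℝ ((⊤ : ℕ∞) : WithTop ℕ∞) (b.coord i) := by
  rw [show (b.coord i : Pt d → ℝ) = _ from funext (coord_eq_inner_grad b i)]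
  exact (innerSL ℝ (grad b i)).contDiff.add contDiff_const

lemma contDiff_cutoff (ε : ℝ) : ContDiff ℝ ((⊤ : ℕ∞) : WithTop ℕ∞) (cutoff b ε) :=
  contDiff_prod fun i _ => contDiff_ramp.comp ((contDiff_coord b i).div_const ε)

lemma hasFDerivAt_coord (i : ι) (x : Pt d) :
    HasFDerivAt (b.coord i) (innerSL ℝ (grad b i)) x := by
  rw [show (b.coord i : Pt d → ℝ) = _ from funext (coord_eq_inner_grad b i)]
  exact (innerSL ℝ (grad b i)).hasFDerivAt.add_const _

lemma partialD_cutoff (ε : ℝ) (j : Fin d) (x : Pt d) :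
    partialD j (cutoff b ε) x = ∑ i, ε⁻¹ * (deriv ramp (b.coord i x / ε) *
      ∏ k ∈ Finset.univ.erase i, ramp (b.coord k x / ε)) * grad b i j := by
  have h1 (i : ι) : HasFDerivAt (fun y => ramp (b.coord i y / ε))
      ((deriv ramp (b.coord i x / ε) * ε⁻¹) • innerSL ℝ (grad b i)) x := by
    have h2 : HasDerivAt (fun t : ℝ => ramp (t / ε)) (deriv ramp (b.coord i x / ε) * ε⁻¹)
        (b.coord i x) := by
      have h3 : HasDerivAt (fun s : ℝ => s / ε) ε⁻¹ (b.coord i x) := by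
        simpa using (hasDerivAt_id (b.coord i x)).div_const ε
      exact (hasDerivAt_ramp _).comp _ h3
    exact h2.comp_hasFDerivAt x (hasFDerivAt_coord b i x)
  have h2 := HasFDerivAt.finsetProd (u := Finset.univ) fun i _ => h1 i
  have h3 : fderiv ℝ (cutoff b ε) x = _ := h2.fderiv
  rw [partialD, h3, _root_.sum_apply]
  refine Finset.sum_congr rfl fun i _ => ?_
  simp only [_root_.smul_apply, innerSL_apply_apply, smul_eq_mul,
    EuclideanSpace.inner_single_right]
  simp
  ring

lemma cutoff_nonneg (ε : ℝ) (x : Pt d) : 0 ≤ cutoff b ε x :=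
  Finset.prod_nonneg fun _ _ => ramp_nonneg _

lemma prod_ramp_le_one (s : Finset ι) (ε : ℝ) (x : Pt d) :
    ∏ k ∈ s, ramp (b.coord k x / ε) ≤ 1 :=
  Finset.prod_le_one (fun _ _ => ramp_nonneg _) fun _ _ => ramp_le_one _

lemma tsupport_cutoff_subset {ε : ℝ} (hε : 0 < ε) :
    tsupport (cutoff b ε) ⊆ interior (bsimplex b) := by
  have hcl : IsClosed {x : Pt d | ∀ k, ε / 3 ≤ b.coord k x} := by
    simp only [ofPred_forall]
    exact isClosed_iInter fun k => isClosed_le continuous_const (continuous_coord b k)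
  have h1 : tsupport (cutoff b ε) ⊆ {x : Pt d | ∀ k, ε / 3 ≤ b.coord k x} := by
    refine closure_minimal (fun x hx k => ?_) hcl
    by_contra hlt
    refine hx (Finset.prod_eq_zero (Finset.mem_univ k) (ramp_of_le ?_))
    rw [div_le_iff₀ hε]
    linarith [not_le.1 hlt]
  refine h1.trans fun x hx => (mem_interior_bsimplex b).2 fun k => ?_
  have := hx k
  have : 0 < ε / 3 := by positivity
  linarith [hx k]

lemma isTest_cutoff_mul {ε : ℝ} (hε : 0 < ε) {φ : Pt d → ℝ}
    (hφ : ContDiff ℝ ((⊤ : ℕ∞) : WithTop ℕ∞) φ) :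
    IsTest (interior (bsimplex b)) fun x => cutoff b ε x * φ x := by
  have h1 : tsupport (fun x => cutoff b ε x * φ x) ⊆ tsupport (cutoff b ε) :=
    tsupport_mul_subset_left
  have h2 := h1.trans (tsupport_cutoff_subset b hε)
  refine ⟨(contDiff_cutoff b ε).mul hφ, ?_, h2⟩
  exact (isCompact_bsimplex b).of_isClosed_subset (isClosed_tsupport _)
    (h2.trans interior_subset)

lemma tendsto_ramp_layer {t : ℝ} (ht : 0 < t) {c : ℝ} (hc : 0 < c) {f : ℕ → ℝ}
    (hf : Tendsto f atTop (𝓝 t)) :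
    ∀ᶠ n : ℕ in atTop, ramp (f n / (c * (1 / 2) ^ n)) = 1 := by
  have h1 : ∀ᶠ n : ℕ in atTop, t / 2 < f n := hf.eventually (lt_mem_nhds (by linarith))
  have h2 : Tendsto (fun n : ℕ => c * (1 / 2 : ℝ) ^ n) atTop (𝓝 (c * 0)) :=
    (tendsto_pow_atTop_nhds_zero_of_lt_one (by norm_num) (by norm_num)).const_mul c
  rw [mul_zero] at h2
  have h3 : ∀ᶠ n : ℕ in atTop, c * (1 / 2 : ℝ) ^ n < t / 2 := h2.eventually (gt_mem_nhds (by linarith))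
  filter_upwards [h1, h3] with n hn hn'
  refine ramp_of_ge ?_
  rw [le_div_iff₀ (by positivity)]
  linarith

lemma partialD_mul {φ ψ : Pt d → ℝ} {x : Pt d} (j : Fin d) (hφ : DifferentiableAt ℝ φ x)
    (hψ : DifferentiableAt ℝ ψ x) :
    partialD j (fun y => φ y * ψ y) x = φ x * partialD j ψ x + partialD j φ x * ψ x := by
  simp only [partialD]
  rw [fderiv_fun_mul hφ hψ]
  simp
  ring

/-- Green's formula on a simplex for a field of decaying oscillation whose weak divergence is
square integrable. The boundary terms arise from cutting off along the facets. -/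
theorem green_bsimplex (h3 : 3 ≤ Fintype.card ι) {σ : Pt d → Pt d} (hσ : OscDecay (bsimplex b) σ)
    {δ : Pt d → ℝ} (hδ : MemLp δ 2 (volume.restrict (bsimplex b)))
    (hw : ∀ φ, IsTest (interior (bsimplex b)) φ →
      ∫ x in bsimplex b, ∑ j, σ x j * partialD j φ x = -∫ x in bsimplex b, δ x * φ x)
    {φ : Pt d → ℝ} (hφ : ContDiff ℝ ((⊤ : ℕ∞) : WithTop ℕ∞) φ) :
    ∫ x in bsimplex b, (∑ j, σ x j * partialD j φ x + δ x * φ x) =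
      ∑ i, ∫ x, inner ℝ (traceFrom (bsimplex b) σ x) (-(‖grad b i‖⁻¹ • grad b i)) * φ x
        ∂surf (facet b i) := by
  have hKm : MeasurableSet (bsimplex b) := (isCompact_bsimplex b).measurableSet
  have : IsFiniteMeasure (volume.restrict (bsimplex b)) :=
    ⟨by simpa using (isCompact_bsimplex b).measure_lt_top⟩
  have hcard : 1 < Fintype.card ι := by omega
  have : Nontrivial ι := Fintype.one_lt_card_iff_nontrivial.1 hcard
  choose o ho using fun i : ι => exists_ne i
  -- the width of the layers
  obtain ⟨c₀, hc₀, hcv⟩ : ∃ c₀ : ℝ, 0 < c₀ ∧ ∀ i, c₀ * ‖b i - b (o i)‖ ≤ 1 / 2 := by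
    have hs : 0 ≤ ∑ i, ‖b i - b (o i)‖ := Finset.sum_nonneg fun _ _ => norm_nonneg _
    refine ⟨(2 * (1 + ∑ i, ‖b i - b (o i)‖))⁻¹, by positivity, fun i => ?_⟩
    have h1 : ‖b i - b (o i)‖ ≤ ∑ i, ‖b i - b (o i)‖ :=
      Finset.single_le_sum (f := fun i => ‖b i - b (o i)‖) (fun _ _ => norm_nonneg _)
        (Finset.mem_univ i)
    rw [inv_mul_le_iff₀ (by positivity)]
    linarith
  set ε : ℕ → ℝ := fun n => c₀ * (1 / 2) ^ n with hε
  have hεp (n : ℕ) : 0 < ε n := by positivity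
  obtain ⟨Bφ, hBφ⟩ := (isCompact_bsimplex b).exists_bound_of_continuousOn hφ.continuous.continuousOn
  obtain ⟨Br, hBr0, hBr⟩ := exists_deriv_ramp_bound
  have hpc (j : Fin d) : Continuous (partialD j φ) :=
    (hφ.continuous_fderiv (by simp)).clm_apply continuous_const
  have hσj (j : Fin d) : IntegrableOn (fun x => σ x j) (bsimplex b) :=
    (hσ.clm (EuclideanSpace.proj j : Pt d →L[ℝ] ℝ)).1.integrable one_le_two
  have hcont {g f : Pt d → ℝ} (hg : Continuous g) (hf : IntegrableOn f (bsimplex b)) :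
      IntegrableOn (fun x => f x * g x) (bsimplex b) :=
    hf.mul_continuousOn hg.continuousOn (isCompact_bsimplex b)
  have hI : IntegrableOn (fun x => ∑ j, σ x j * partialD j φ x + δ x * φ x) (bsimplex b) :=
    (integrable_finsetSum _ fun j _ => hcont (hpc j) (hσj j)).add
      (hcont hφ.continuous (hδ.integrable one_le_two))
  set w : ι → ℕ → Pt d → ℝ := fun i n y => (deriv ramp (b.coord i y / ε n) *
      ∏ k ∈ Finset.univ.erase i, ramp (b.coord k y / ε n)) * φ y with hw'
  have hwc (i : ι) (n : ℕ) : Continuous (w i n) := by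
    have h1 : Continuous fun y => deriv ramp (b.coord i y / ε n) :=
      continuous_deriv_ramp.comp ((continuous_coord b i).div_const _)
    have h2 : Continuous fun y => ∏ k ∈ Finset.univ.erase i, ramp (b.coord k y / ε n) :=
      continuous_finsetProd _ fun k _ =>
        contDiff_ramp.continuous.comp ((continuous_coord b k).div_const _)
    exact (h1.mul h2).mul hφ.continuous
  have hσg (i : ι) : OscDecay (bsimplex b) fun y => inner ℝ (grad b i) (σ y) :=
    hσ.clm (innerSL ℝ (grad b i))
  -- the weak formulation tested with the cut-off function
  have htest (n : ℕ) : (∫ x in bsimplex b, cutoff b (ε n) x *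
      (∑ j, σ x j * partialD j φ x + δ x * φ x)) +
      ∑ i, c₀⁻¹ * (2 ^ n * ∫ x in bsimplex b, w i n x * inner ℝ (grad b i) (σ x)) = 0 := by
    have h1 := hw _ (isTest_cutoff_mul b (hεp n) hφ)
    have h2 : ∀ x, ∑ j, σ x j * partialD j (fun y => cutoff b (ε n) y * φ y) x =
        cutoff b (ε n) x * (∑ j, σ x j * partialD j φ x + δ x * φ x) - δ x * (cutoff b (ε n) x * φ x)
        + ∑ i, c₀⁻¹ * (2 ^ n * (w i n x * inner ℝ (grad b i) (σ x))) := by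
      intro x
      have hin (i : ι) : inner ℝ (grad b i) (σ x) = ∑ j, σ x j * grad b i j := by
        rw [PiLp.inner_apply]; rfl
      have hεn : (ε n)⁻¹ = c₀⁻¹ * 2 ^ n := by
        rw [hε]; simp [mul_comm]
      have h3 (j : Fin d) := partialD_mul (x := x) j
        ((contDiff_cutoff b (ε n)).differentiable (by simp) x) (hφ.differentiable (by simp) x)
      simp only [h3, partialD_cutoff, hin, mul_add, Finset.sum_add_distrib]
      have e1 : ∑ j, σ x j * (cutoff b (ε n) x * partialD j φ x) =
          cutoff b (ε n) x * ∑ j, σ x j * partialD j φ x := by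
        rw [Finset.mul_sum]
        exact Finset.sum_congr rfl fun j _ => by ring
      have e2 : ∑ j, σ x j * ((∑ i, (ε n)⁻¹ * (deriv ramp (b.coord i x / ε n) *
          ∏ k ∈ Finset.univ.erase i, ramp (b.coord k x / ε n)) * grad b i j) * φ x) =
          ∑ i, c₀⁻¹ * (2 ^ n * (w i n x * ∑ j, σ x j * grad b i j)) := by
        simp only [Finset.mul_sum, Finset.sum_mul]
        rw [Finset.sum_comm]
        refine Finset.sum_congr rfl fun i _ => Finset.sum_congr rfl fun j _ => ?_
        rw [hεn, hw']
        ring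
      rw [e1, e2]
      ring
    simp only [h2] at h1
    have i1 : IntegrableOn (fun x => cutoff b (ε n) x *
        (∑ j, σ x j * partialD j φ x + δ x * φ x)) (bsimplex b) := by
      simpa only [mul_comm] using hcont (contDiff_cutoff b (ε n)).continuous hI
    have i2 : IntegrableOn (fun x => δ x * (cutoff b (ε n) x * φ x)) (bsimplex b) :=
      hcont ((contDiff_cutoff b (ε n)).continuous.mul hφ.continuous) (hδ.integrable one_le_two)
    have i3 (i : ι) : IntegrableOn (fun x => c₀⁻¹ * (2 ^ n * (w i n x * inner ℝ (grad b i) (σ x))))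
        (bsimplex b) := by
      refine Integrable.const_mul (Integrable.const_mul ?_ _) _
      exact (hcont (hwc i n) ((hσg i).1.integrable one_le_two)).congr_fun
        (fun x _ => mul_comm _ _) hKm
    have i12 : IntegrableOn (fun x => cutoff b (ε n) x * (∑ j, σ x j * partialD j φ x + δ x * φ x) -
        δ x * (cutoff b (ε n) x * φ x)) (bsimplex b) := i1.sub i2
    rw [integral_add i12 (integrable_finsetSum _ fun i _ => i3 i), integral_sub i1 i2,
      integral_finsetSum _ fun i _ => i3 i] at h1
    simp only [integral_const_mul] at h1
    linarith
  have hlim1 : Tendsto (fun n => ∫ x in bsimplex b, cutoff b (ε n) x *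
      (∑ j, σ x j * partialD j φ x + δ x * φ x)) atTop
      (𝓝 (∫ x in bsimplex b, (∑ j, σ x j * partialD j φ x + δ x * φ x))) := by
    refine tendsto_integral_of_dominated_convergence _ (fun n => ?_) hI.norm (fun n => ?_) ?_
    · exact (contDiff_cutoff b (ε n)).continuous.aestronglyMeasurable.mul hI.1
    · refine ae_of_all _ fun x => ?_
      rw [norm_mul, Real.norm_of_nonneg (cutoff_nonneg b _ x)]
      exact mul_le_of_le_one_left (norm_nonneg _) (prod_ramp_le_one b _ _ x)
    · rw [← Measure.restrict_congr_set (bsimplex_ae_eq_interior b)]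
      filter_upwards [ae_restrict_mem isOpen_interior.measurableSet] with x hx
      have h1 : ∀ᶠ n : ℕ in atTop, ∀ k, ramp (b.coord k x / ε n) = 1 :=
        eventually_all.2 fun k =>
          tendsto_ramp_layer ((mem_interior_bsimplex b).1 hx k) hc₀ tendsto_const_nhds
      refine tendsto_const_nhds.congr' ?_
      filter_upwards [h1] with n hn
      rw [cutoff, Finset.prod_congr rfl fun k _ => hn k, Finset.prod_const_one, one_mul]
  have hlim2 (i : ι) : Tendsto (fun n => 2 ^ n * ∫ x in bsimplex b,
      w i n x * inner ℝ (grad b i) (σ x)) atTop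
      (𝓝 (‖grad b i‖⁻¹ * ((∫ s in Ioo 0 c₀, deriv ramp (s / c₀)) * ∫ x, φ x *
        traceFrom (bsimplex b) (fun y => inner ℝ (grad b i) (σ y)) x ∂surf (facet b i)))) := by
    have hij := (ho i).symm
    have hin (y : Pt d) : inner ℝ (grad b i) (y - b (o i)) = b.coord i y := by
      rw [inner_grad_sub, b.coord_apply_ne hij, sub_zero]
    refine tendsto_strip (stripGeom_bsimplex b hij) (hσg i) hc₀ (hcv i)
      (fun n => (hwc i n).measurable) (B := Br * 1 * Bφ) (fun n y hy => ?_) (fun n y hy hle => ?_) ?_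
    · have hk := (mem_bsimplex b).1 hy
      rw [hw', abs_mul, abs_mul]
      gcongr
      · exact hBr _ (div_nonneg (hk i) (hεp n).le)
      · rw [abs_of_nonneg (Finset.prod_nonneg fun _ _ => ramp_nonneg _)]
        exact prod_ramp_le_one b _ _ y
      · exact hBφ y hy
    · rw [hin] at hle
      rw [hw']
      dsimp only
      rw [deriv_ramp_of_ge, zero_mul, zero_mul]
      rwa [le_div_iff₀ (hεp n), one_mul]
    · filter_upwards [ae_facet_pos b h3 i] with x hx s hs
      have hpt : Tendsto (fun n : ℕ => x + (s * (1 / 2) ^ n) • (b i - b (o i))) atTop (𝓝 x) := by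
        have h1 : Tendsto (fun n : ℕ => s * (1 / 2 : ℝ) ^ n) atTop (𝓝 (s * 0)) :=
          (tendsto_pow_atTop_nhds_zero_of_lt_one (by norm_num) (by norm_num)).const_mul s
        have h2 := (h1.smul_const (b i - b (o i))).const_add x
        simpa using h2
      have hci (n : ℕ) : b.coord i (x + (s * (1 / 2) ^ n) • (b i - b (o i))) = s * (1 / 2) ^ n := by
        rw [coord_add_smul, ((mem_facet b).1 hx.1).2, inner_grad_edge, if_pos rfl, if_neg hij]
        ring
      have hev : ∀ᶠ n : ℕ in atTop, ∀ k, k ≠ i →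
          (ramp (b.coord k (x + (s * (1 / 2) ^ n) • (b i - b (o i))) / ε n) = 1 ∧
          0 < b.coord k (x + (s * (1 / 2) ^ n) • (b i - b (o i)))) := by
        refine eventually_all.2 fun k => ?_
        by_cases hk : k = i
        · exact Eventually.of_forall fun n h => absurd hk h
        · have hck := ((continuous_coord b k).tendsto x).comp hpt
          filter_upwards [tendsto_ramp_layer (hx.2 k hk) hc₀ hck,
            hck.eventually (lt_mem_nhds (hx.2 k hk))] with n h1 h2 _ using ⟨h1, h2⟩
      have hφl := ((hφ.continuous.tendsto x).comp hpt).const_mul (deriv ramp (s / c₀))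
      refine hφl.congr' ?_
      filter_upwards [hev] with n hn
      have hmem : x + (s * (1 / 2) ^ n) • (b i - b (o i)) ∈ bsimplex b := by
        refine (mem_bsimplex b).2 fun k => ?_
        by_cases hk : k = i
        · subst hk
          rw [hci]
          have := hs.1
          positivity
        · exact (hn k hk).2.le
      rw [indicator_of_mem hmem, hw']
      dsimp only [Function.comp_apply]
      rw [hci, Finset.prod_congr rfl fun k hk => (hn k (Finset.ne_of_mem_erase hk)).1,
        Finset.prod_const_one, mul_one, hε]
      congr 2
      field_simp
  have hlim3 := hlim1.add (tendsto_finsetSum Finset.univ fun i _ => (hlim2 i).const_mul c₀⁻¹)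
  simp only [htest] at hlim3
  have h0 := tendsto_nhds_unique hlim3 tendsto_const_nhds
  rw [eq_neg_of_add_eq_zero_left h0, ← Finset.sum_neg_distrib]
  refine Finset.sum_congr rfl fun i _ => ?_
  rw [integral_deriv_ramp hc₀]
  have hG := stripGeom_bsimplex b (ho i).symm
  have htr : ∀ᵐ x ∂surf (facet b i), traceFrom (bsimplex b) (fun y => inner ℝ (grad b i) (σ y)) x =
      inner ℝ (grad b i) (traceFrom (bsimplex b) σ x) := by
    obtain ⟨c, hc0, -, hlow⟩ := hG.geom.lower
    filter_upwards [(hσ.trace hG.geom).2.1, hlow] with x hx hl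
    refine (hx.comp_clm (innerSL ℝ (grad b i))).traceFrom_eq (fun r hr => ?_)
      ((hσg i).1.integrable one_le_two)
    obtain ⟨n, hn⟩ := exists_pow_lt_of_lt_one hr (show (1 / 2 : ℝ) < 1 by norm_num)
    exact (lt_of_lt_of_le (pos_iff_ne_zero.2 (mul_ne_zero hc0 (by simp))) ((hl n).trans
      (measure_mono (inter_subset_inter_right _ (Metric.ball_subset_ball hn.le))))).ne'
  rw [mul_left_comm, ← mul_assoc c₀⁻¹, inv_mul_cancel₀ hc₀.ne', one_mul, ← integral_const_mul,
    ← integral_neg]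
  refine integral_congr_ae ?_
  filter_upwards [htr] with x hx
  rw [hx, inner_neg_right, real_inner_smul_right, real_inner_comm]
  ring

end Green

/-! ### Sobolev and Slobodeckij functions have decaying oscillation -/

section Sobolev

variable {d : ℕ}

lemma IsTest.mono {U U' : Set (Pt d)} {φ : Pt d → ℝ} (h : IsTest U φ) (hU : U ⊆ U') :
    IsTest U' φ := ⟨h.1, h.2.1, h.2.2.trans hU⟩

lemma IsTest.eq_zero {U : Set (Pt d)} {φ : Pt d → ℝ} (h : IsTest U φ) {x : Pt d} (hx : x ∉ U) :
    φ x = 0 := image_eq_zero_of_notMem_tsupport fun hx' => hx (h.2.2 hx')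

lemma IsTest.partialD_eq_zero {U : Set (Pt d)} {φ : Pt d → ℝ} (h : IsTest U φ) (j : Fin d)
    {x : Pt d} (hx : x ∉ U) : partialD j φ x = 0 := by
  rw [partialD, fderiv_of_notMem_tsupport (𝕜 := ℝ) fun hx' => hx (h.2.2 hx')]
  rfl

lemma IsTest.setIntegral_mul {U : Set (Pt d)} {φ : Pt d → ℝ} (h : IsTest U φ) (u : Pt d → ℝ) :
    ∫ x in U, u x * φ x = ∫ x, u x * φ x :=
  setIntegral_eq_integral_of_forall_compl_eq_zero fun x hx => by rw [h.eq_zero hx, mul_zero]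

lemma IsTest.setIntegral_mul_partialD {U : Set (Pt d)} {φ : Pt d → ℝ} (h : IsTest U φ) (j : Fin d)
    (u : Pt d → ℝ) : ∫ x in U, u x * partialD j φ x = ∫ x, u x * partialD j φ x :=
  setIntegral_eq_integral_of_forall_compl_eq_zero fun x hx => by
    rw [h.partialD_eq_zero j hx, mul_zero]

lemma IsWeakPartial.mono {U U' : Set (Pt d)} {j : Fin d} {u v : Pt d → ℝ}
    (h : IsWeakPartial U' j u v) (hU : U ⊆ U') : IsWeakPartial U j u v := by
  intro φ hφ
  have := h φ (hφ.mono hU)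
  rw [hφ.setIntegral_mul_partialD, hφ.setIntegral_mul,
    ← (hφ.mono hU).setIntegral_mul_partialD, ← (hφ.mono hU).setIntegral_mul]
  exact this

/-- The shear `(x, t) ↦ (x + t h, t)` preserves the measure. -/
lemma measurePreserving_shear (h : Pt d) (ν : Measure ℝ) [SFinite ν] :
    MeasurePreserving (fun p : Pt d × ℝ => (p.1 + p.2 • h, p.2))
      ((volume : Measure (Pt d)).prod ν) (volume.prod ν) := by
  have h1 : MeasurePreserving (fun p : ℝ × Pt d => (p.1, p.2 + p.1 • h))
      (ν.prod (volume : Measure (Pt d))) (ν.prod volume) :=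
    MeasurePreserving.skew_product (f := id) (g := fun t x => x + t • h) (MeasurePreserving.id ν)
      (by fun_prop) (ae_of_all _ fun t => map_add_right_eq_self _ _)
  exact (Measure.measurePreserving_swap.comp h1).comp Measure.measurePreserving_swap

lemma integrable_mul_shift {u φ : Pt d → ℝ} (hu : Integrable u) (hc : Continuous φ)
    (hs : HasCompactSupport φ) (h : Pt d) (ν : Measure ℝ) [IsFiniteMeasure ν] :
    Integrable (fun p : Pt d × ℝ => u p.1 * φ (p.1 - p.2 • h)) (volume.prod ν) := by
  obtain ⟨C, hC⟩ := hc.bounded_above_of_compact_support hs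
  refine (hu.comp_fst ν).mul_bdd (c := C) ?_ (ae_of_all _ fun p => hC _)
  exact (hc.comp (by fun_prop)).aestronglyMeasurable

/-- The line derivative formula for the translates of a Sobolev function, in weak form. -/
lemma integral_translate_sub {U : Set (Pt d)} (hc : Convex ℝ U)
    {u : Pt d → ℝ} {g : Pt d → Pt d} (hu : Integrable u) (hg : Integrable g)
    (hw : ∀ j, IsWeakPartial U j u fun x => g x j) (h : Pt d) {φ : Pt d → ℝ}
    (hφ : IsTest (U ∩ (fun x => x + h) ⁻¹' U) φ) :
    ∫ x, (u (x + h) - u x) * φ x =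
      ∫ x, (∫ t in Ioo (0 : ℝ) 1, inner ℝ h (g (x + t • h))) * φ x := by
  set ν : Measure ℝ := volume.restrict (Ioo 0 1) with hν
  have hG : Integrable (fun x => (inner ℝ h (g x) : ℝ)) := hg.const_inner h
  obtain ⟨C, hC⟩ := hφ.1.continuous.bounded_above_of_compact_support hφ.2.1
  have hdc : Continuous fun x => fderiv ℝ φ x h :=
    (hφ.1.continuous_fderiv (by simp)).clm_apply continuous_const
  have hds : HasCompactSupport fun x => fderiv ℝ φ x h := hφ.2.1.fderiv_apply (𝕜 := ℝ) h
  -- the translates of the test function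
  have hφt (t : ℝ) (ht : t ∈ Ioo (0 : ℝ) 1) : IsTest U fun x => φ (x - t • h) := by
    refine ⟨hφ.1.comp (by fun_prop), hφ.2.1.comp_homeomorph (Homeomorph.subRight (t • h)), ?_⟩
    have h1 : tsupport (fun x => φ (x - t • h)) = (fun x => x - t • h) ⁻¹' tsupport φ :=
      tsupport_comp_eq_preimage φ (Homeomorph.subRight (t • h))
    rw [h1]
    intro x hx
    have h2 := hφ.2.2 hx
    have h3 := hc h2.1 h2.2 (sub_nonneg.2 ht.2.le) ht.1.le (by ring)
    convert h3 using 1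
    module
  have hstep (t : ℝ) (ht : t ∈ Ioo (0 : ℝ) 1) :
      ∫ x, u x * -(fderiv ℝ φ (x - t • h) h) = ∫ x, inner ℝ h (g x) * φ (x - t • h) := by
    have hT := hφt t ht
    have hpd : ∀ x, fderiv ℝ φ (x - t • h) h =
        ∑ j, h j * partialD j (fun x => φ (x - t • h)) x := by
      intro x
      have e1 : fderiv ℝ (fun x => φ (x - t • h)) x = fderiv ℝ φ (x - t • h) := by
        rw [fderiv_comp_sub]
      have e2 : h = ∑ j, h j • EuclideanSpace.single j (1 : ℝ) := by
        ext k
        simp [Finset.sum_apply, Pi.single_apply]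
      simp only [partialD, e1]
      have e3 := congrArg (fderiv ℝ φ (x - t • h)) e2
      rw [map_sum] at e3
      simpa only [map_smul, smul_eq_mul] using e3
    have hi1 (j : Fin d) : Integrable fun x => u x * partialD j (fun x => φ (x - t • h)) x := by
      obtain ⟨D, hD⟩ := (hT.cont_partialD j).bounded_above_of_compact_support (hT.supp_partialD j)
      exact hu.mul_bdd (hT.cont_partialD j).aestronglyMeasurable (ae_of_all _ hD)
    have hi2 (j : Fin d) : Integrable fun x => g x j * φ (x - t • h) := by
      have : Integrable fun x => g x j := (EuclideanSpace.proj j : Pt d →L[ℝ] ℝ).integrable_comp hg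
      exact this.mul_bdd hT.1.continuous.aestronglyMeasurable (ae_of_all _ fun x => hC _)
    have e3 : ∀ x, u x * -(fderiv ℝ φ (x - t • h) h) =
        ∑ j, -h j * (u x * partialD j (fun x => φ (x - t • h)) x) := by
      intro x
      rw [hpd, ← Finset.sum_neg_distrib, Finset.mul_sum]
      exact Finset.sum_congr rfl fun j _ => by ring
    have e4 : ∀ x, inner ℝ h (g x) * φ (x - t • h) = ∑ j, h j * (g x j * φ (x - t • h)) := by
      intro x
      rw [PiLp.inner_apply, Finset.sum_mul]
      refine Finset.sum_congr rfl fun j _ => ?_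
      simp
      ring
    simp only [e3, e4]
    rw [integral_finsetSum _ fun j _ => (hi1 j).const_mul _,
      integral_finsetSum _ fun j _ => (hi2 j).const_mul _]
    refine Finset.sum_congr rfl fun j _ => ?_
    rw [integral_const_mul, integral_const_mul]
    have := hw j _ hT
    rw [hT.setIntegral_mul_partialD, hT.setIntegral_mul] at this
    rw [this]
    ring
  have hI1 : Integrable (fun p : Pt d × ℝ => u p.1 * -(fderiv ℝ φ (p.1 - p.2 • h) h))
      (volume.prod ν) := by
    simp only [mul_neg]
    exact (integrable_mul_shift hu hdc hds h ν).neg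
  have hI2 := integrable_mul_shift hG hφ.1.continuous hφ.2.1 h ν
  have hI3 : Integrable (fun p : Pt d × ℝ => inner ℝ h (g (p.1 + p.2 • h)) * φ p.1)
      (volume.prod ν) := by
    have := (measurePreserving_shear h ν).integrable_comp_of_integrable hI2
    simpa [Function.comp_def] using this
  have hftc (x : Pt d) : φ (x - h) - φ x = ∫ t in Ioo (0 : ℝ) 1, -(fderiv ℝ φ (x - t • h) h) := by
    rw [← integral_Ioc_eq_integral_Ioo, ← intervalIntegral.integral_of_le zero_le_one]
    rw [intervalIntegral.integral_eq_sub_of_hasDerivAt (f := fun t : ℝ => φ (x - t • h))]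
    · simp
    · intro t _
      have h1 : HasDerivAt (fun t : ℝ => x - t • h) (-h) t := by
        simpa using ((hasDerivAt_id t).smul_const h).const_sub x
      have h2 := (hφ.1.differentiable (by simp) (x - t • h)).hasFDerivAt.comp_hasDerivAt t h1
      exact (h2.congr_deriv (by simp))
    · exact Continuous.intervalIntegrable
        (hdc.comp (by fun_prop : Continuous fun t : ℝ => x - t • h)).neg _ _
  have hib (f : Pt d → ℝ) (hf : Integrable f) (e : Pt d) : Integrable fun x => f x * φ (x - e) :=
    hf.mul_bdd (g := fun x => φ (x - e)) (c := C)
      (hφ.1.continuous.comp (continuous_id.sub continuous_const)).aestronglyMeasurable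
      (ae_of_all _ fun x => hC _)
  calc ∫ x, (u (x + h) - u x) * φ x = (∫ x, u (x + h) * φ x) - ∫ x, u x * φ x := by
        simp only [sub_mul]
        refine integral_sub ?_ ?_
        · simpa using (hib _ (hu.comp_add_right h) 0)
        · simpa using (hib _ hu 0)
    _ = (∫ x, u x * φ (x - h)) - ∫ x, u x * φ x := by
        congr 1
        rw [← integral_add_right_eq_self (fun x => u x * φ (x - h)) h]
        simp
    _ = ∫ x, u x * (φ (x - h) - φ x) := by
        rw [← integral_sub (hib u hu h) (by simpa using hib u hu 0)]
        simp only [mul_sub]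
    _ = ∫ x, ∫ t, u x * -(fderiv ℝ φ (x - t • h) h) ∂ν := by
        refine integral_congr_ae (ae_of_all _ fun x => ?_)
        dsimp only
        rw [hftc, integral_const_mul]
    _ = ∫ t, (∫ x, u x * -(fderiv ℝ φ (x - t • h) h)) ∂ν := integral_integral_swap hI1
    _ = ∫ t, (∫ x, inner ℝ h (g x) * φ (x - t • h)) ∂ν :=
        setIntegral_congr_fun measurableSet_Ioo fun t ht => hstep t ht
    _ = ∫ t, (∫ x, inner ℝ h (g (x + t • h)) * φ x) ∂ν := by
        refine integral_congr_ae (ae_of_all _ fun t => ?_)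
        dsimp only
        rw [← integral_add_right_eq_self (fun x => inner ℝ h (g x) * φ (x - t • h)) (t • h)]
        simp
    _ = ∫ x, ∫ t, inner ℝ h (g (x + t • h)) * φ x ∂ν := (integral_integral_swap hI3).symm
    _ = _ := by simp only [integral_mul_const, hν]

/-- The `L²` modulus of continuity of a function with weak gradient `g` in a convex set. -/
lemma lintegral_translate_sub_sq_le {U : Set (Pt d)} (ho : IsOpen U) (hc : Convex ℝ U)
    {u : Pt d → ℝ} {g : Pt d → Pt d} (hu : Integrable u) (hg : Integrable g)
    (hgm : StronglyMeasurable g)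
    (hw : ∀ j, IsWeakPartial U j u fun x => g x j) (h : Pt d) :
    ∫⁻ x in U ∩ (fun x => x + h) ⁻¹' U, ‖u x - u (x + h)‖ₑ ^ 2 ≤
      ‖h‖ₑ ^ 2 * ∫⁻ x, ‖g x‖ₑ ^ 2 := by
  set ν : Measure ℝ := volume.restrict (Ioo 0 1) with hν
  have hG : Integrable (fun x => (inner ℝ h (g x) : ℝ)) := hg.const_inner h
  have hV : IsOpen (U ∩ (fun x => x + h) ⁻¹' U) := ho.inter (ho.preimage (by fun_prop))
  have hI : Integrable (fun p : Pt d × ℝ => inner ℝ h (g (p.1 + p.2 • h))) (volume.prod ν) :=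
    (measurePreserving_shear h ν).integrable_comp_of_integrable (hG.comp_fst ν)
  have hi1 : Integrable fun x => u (x + h) - u x := (hu.comp_add_right h).sub hu
  have hi2 : Integrable fun x => ∫ t, inner ℝ h (g (x + t • h)) ∂ν := hI.integral_prod_left
  have hi12 : Integrable fun x => u (x + h) - u x - ∫ t, inner ℝ h (g (x + t • h)) ∂ν := hi1.sub hi2
  have hae := hV.ae_eq_zero_of_integral_contDiff_smul_eq_zero (μ := volume)
    (f := fun x => u (x + h) - u x - ∫ t, inner ℝ h (g (x + t • h)) ∂ν)
    (hi12.locallyIntegrable.locallyIntegrableOn _) fun φ h1 h2 h3 => by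
      have hφ : IsTest (U ∩ (fun x => x + h) ⁻¹' U) φ := ⟨h1, h2, h3⟩
      obtain ⟨C, hC⟩ := h1.continuous.bounded_above_of_compact_support h2
      have key := integral_translate_sub hc hu hg hw h hφ
      simp only [smul_eq_mul, mul_comm (φ _), sub_mul (_ - _) _ (φ _)]
      rw [integral_sub
        (hi1.mul_bdd h1.continuous.aestronglyMeasurable (ae_of_all _ fun x => hC _))
        (hi2.mul_bdd h1.continuous.aestronglyMeasurable (ae_of_all _ fun x => hC _)), key, hν,
        sub_self]
  have hm : Measurable fun p : Pt d × ℝ => ‖g (p.1 + p.2 • h)‖ₑ ^ 2 :=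
    (hgm.comp_measurable (by fun_prop)).enorm.pow_const 2
  calc ∫⁻ x in U ∩ (fun x => x + h) ⁻¹' U, ‖u x - u (x + h)‖ₑ ^ 2
      ≤ ∫⁻ x in U ∩ (fun x => x + h) ⁻¹' U, ∫⁻ t, ‖h‖ₑ ^ 2 * ‖g (x + t • h)‖ₑ ^ 2 ∂ν := by
        refine lintegral_mono_ae ?_
        filter_upwards [ae_restrict_mem hV.measurableSet, ae_restrict_of_ae hae] with x hx hx'
        have e1 : u (x + h) - u x = ∫ t, inner ℝ h (g (x + t • h)) ∂ν := sub_eq_zero.1 (hx' hx)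
        have e2 : ‖u x - u (x + h)‖ₑ ≤ ∫⁻ t, ‖h‖ₑ * ‖g (x + t • h)‖ₑ ∂ν := by
          rw [← enorm_neg, neg_sub, e1]
          refine (enorm_integral_le_lintegral_enorm _).trans (lintegral_mono fun t => ?_)
          rw [← enorm_norm h, ← enorm_norm (g _), ← enorm_mul]
          refine enorm_le_iff_norm_le.2 ?_
          rw [norm_mul, norm_norm, norm_norm]
          exact norm_inner_le_norm _ _
        have hmt : Measurable fun t : ℝ => ‖h‖ₑ * ‖g (x + t • h)‖ₑ :=
          measurable_const.mul (hgm.comp_measurable (by fun_prop)).enorm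
        calc _ ≤ (∫⁻ t, ‖h‖ₑ * ‖g (x + t • h)‖ₑ ∂ν) ^ 2 := by gcongr
          _ ≤ ν univ * ∫⁻ t, (‖h‖ₑ * ‖g (x + t • h)‖ₑ) ^ 2 ∂ν :=
            lintegral_sq_le ν hmt.aemeasurable
          _ = _ := by simp [hν, mul_pow]
    _ ≤ ∫⁻ x, ∫⁻ t, ‖h‖ₑ ^ 2 * ‖g (x + t • h)‖ₑ ^ 2 ∂ν := setLIntegral_le_lintegral _ _
    _ = ∫⁻ t, (∫⁻ x, ‖h‖ₑ ^ 2 * ‖g (x + t • h)‖ₑ ^ 2) ∂ν :=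
        lintegral_lintegral_swap (measurable_const.mul hm).aemeasurable
    _ = ∫⁻ t, (‖h‖ₑ ^ 2 * ∫⁻ x, ‖g x‖ₑ ^ 2) ∂ν := by
        refine lintegral_congr fun t => ?_
        rw [lintegral_const_mul _ (by exact (hgm.comp_measurable (by fun_prop)).enorm.pow_const 2),
          lintegral_add_right_eq_self (fun x => ‖g x‖ₑ ^ 2) (t • h)]
    _ = _ := by simp [hν]

/-- Functions in `H¹` of a bounded convex set have decaying oscillation. -/
lemma oscDecay_of_weakPartial {U : Set (Pt d)} (ho : IsOpen U) (hc : Convex ℝ U)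
    (hb : Bornology.IsBounded U) {u : Pt d → ℝ} {g : Pt d → Pt d}
    (hu : MemLp u 2 (volume.restrict U)) (hg : MemLp g 2 (volume.restrict U))
    (hw : ∀ j, IsWeakPartial U j u fun x => g x j) : OscDecay U u := by
  -- pass to measurable representatives that vanish outside `U`
  suffices H : ∀ (u : Pt d → ℝ) (g : Pt d → Pt d), StronglyMeasurable u → StronglyMeasurable g →
      MemLp u 2 → MemLp g 2 → Integrable u → Integrable g →
      (∀ j, IsWeakPartial U j u fun x => g x j) → OscDecay U u by
    have hm := ho.measurableSet
    have : IsFiniteMeasure (volume.restrict U) := ⟨by simpa using hb.measure_lt_top⟩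
    have e1 : U.indicator (hu.1.mk u) =ᵐ[volume.restrict U] u :=
      (indicator_ae_eq_restrict hm).trans hu.1.ae_eq_mk.symm
    have e2 : U.indicator (hg.1.mk g) =ᵐ[volume.restrict U] g :=
      (indicator_ae_eq_restrict hm).trans hg.1.ae_eq_mk.symm
    have l1 : MemLp (U.indicator (hu.1.mk u)) 2 :=
      (memLp_indicator_iff_restrict hm).2 ((memLp_congr_ae hu.1.ae_eq_mk).1 hu)
    have l2 : MemLp (U.indicator (hg.1.mk g)) 2 :=
      (memLp_indicator_iff_restrict hm).2 ((memLp_congr_ae hg.1.ae_eq_mk).1 hg)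
    have i1 : Integrable (U.indicator (hu.1.mk u)) :=
      (integrable_indicator_iff hm).2 ((hu.integrable one_le_two).congr hu.1.ae_eq_mk)
    have i2 : Integrable (U.indicator (hg.1.mk g)) :=
      (integrable_indicator_iff hm).2 ((hg.integrable one_le_two).congr hg.1.ae_eq_mk)
    refine (H _ _ (hu.1.stronglyMeasurable_mk.indicator hm) (hg.1.stronglyMeasurable_mk.indicator hm)
      l1 l2 i1 i2 fun j φ hφ => ?_).congr e1
    have e3 := hw j φ hφ
    have e4 : ∫ x in U, U.indicator (hg.1.mk g) x j * φ x = ∫ x in U, g x j * φ x :=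
      integral_congr_ae (by filter_upwards [e2] with x hx; rw [hx])
    rw [integral_congr_ae (g := fun x => u x * partialD j φ x)
        (by filter_upwards [e1] with x hx; rw [hx]), e3, e4]
  intro u g hum hgm hu hg hui hgi hw
  have hgf : ∫⁻ x, ‖g x‖ₑ ^ 2 ≠ ∞ := (memLp_two_iff.1 hg).2.ne
  -- translations by at most `r = 2⁻ⁿ` gain `r²`, the ball of translations has volume `O(rᵈ)`, and
  -- `r^(d+2) = β⁴ⁿ r^(d+1)` for this `β`
  refine ⟨hu.restrict U, (2⁻¹ : ℝ≥0∞) ^ (1 / 4 : ℝ),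
    volume (Metric.ball (0 : Pt d) 1) * ∫⁻ x, ‖g x‖ₑ ^ 2, ?_, ?_, fun n => ?_⟩
  · exact ENNReal.rpow_lt_one (by simp) (by norm_num)
  · exact ENNReal.mul_ne_top measure_ball_lt_top.ne hgf
  have hβ : ((2⁻¹ : ℝ≥0∞) ^ (1 / 4 : ℝ)) ^ (4 * n) = 2⁻¹ ^ n := by
    rw [← ENNReal.rpow_natCast, ← ENNReal.rpow_mul, ← ENNReal.rpow_natCast]
    congr 1
    push_cast
    ring
  rw [hβ]
  set r : ℝ := (1 / 2) ^ n with hr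
  have hf : Measurable fun p : Pt d × Pt d => ‖u p.1 - u (p.1 + p.2)‖ₑ ^ 2 :=
    ((hum.comp_measurable measurable_fst).sub (hum.comp_measurable (by fun_prop))).enorm.pow_const 2
  have hS : MeasurableSet {p : Pt d × Pt d | p.1 ∈ U ∧ p.1 + p.2 ∈ U ∧ p.2 ∈ Metric.ball 0 r} :=
    ((ho.preimage continuous_fst).inter ((ho.preimage (by fun_prop : Continuous fun p : Pt d × Pt d =>
      p.1 + p.2)).inter (Metric.isOpen_ball.preimage continuous_snd))).measurableSet
  set Φ := {p : Pt d × Pt d | p.1 ∈ U ∧ p.1 + p.2 ∈ U ∧ p.2 ∈ Metric.ball 0 r}.indicator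
    fun p : Pt d × Pt d => ‖u p.1 - u (p.1 + p.2)‖ₑ ^ 2 with hΦ
  have hΦm : Measurable Φ := hf.indicator hS
  calc ∫⁻ y in U, ∫⁻ z in U ∩ Metric.ball y r, ‖u y - u z‖ₑ ^ 2
      = ∫⁻ y, ∫⁻ h, Φ (y, h) := by
        rw [← lintegral_indicator ho.measurableSet]
        refine lintegral_congr fun y => ?_
        by_cases hy : y ∈ U
        · rw [indicator_of_mem hy, ← lintegral_indicator (ho.inter Metric.isOpen_ball).measurableSet,
            ← lintegral_add_left_eq_self _ y]
          refine lintegral_congr fun h => ?_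
          have h1 : (y + h ∈ U ∩ Metric.ball y r) ↔ (y ∈ U ∧ y + h ∈ U ∧ h ∈ Metric.ball 0 r) := by
            simp [hy]
          by_cases h2 : y + h ∈ U ∩ Metric.ball y r
          · rw [indicator_of_mem h2, hΦ, indicator_of_mem (by exact h1.1 h2)]
          · rw [indicator_of_notMem h2, hΦ, indicator_of_notMem (by exact mt h1.2 h2)]
        · rw [indicator_of_notMem hy]
          simp [hΦ, hy]
    _ = ∫⁻ h, ∫⁻ y, Φ (y, h) := lintegral_lintegral_swap hΦm.aemeasurable
    _ ≤ ∫⁻ h, (Metric.ball (0 : Pt d) r).indicator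
        (fun _ => (2⁻¹ ^ n) ^ 2 * ∫⁻ x, ‖g x‖ₑ ^ 2) h := by
        refine lintegral_mono fun h => ?_
        dsimp only
        by_cases hh : h ∈ Metric.ball (0 : Pt d) r
        · rw [indicator_of_mem hh]
          have h1 : ∫⁻ y, Φ (y, h) = ∫⁻ x in U ∩ (fun x => x + h) ⁻¹' U, ‖u x - u (x + h)‖ₑ ^ 2 := by
            rw [← lintegral_indicator (ho.inter (ho.preimage (by fun_prop))).measurableSet]
            refine lintegral_congr fun y => ?_
            have h1 : (y ∈ U ∩ (fun x => x + h) ⁻¹' U) ↔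
                (y ∈ U ∧ y + h ∈ U ∧ h ∈ Metric.ball 0 r) := by simp only [hh, and_true]; rfl
            by_cases h2 : y ∈ U ∩ (fun x => x + h) ⁻¹' U
            · rw [indicator_of_mem h2, hΦ, indicator_of_mem (by exact h1.1 h2)]
            · rw [indicator_of_notMem h2, hΦ, indicator_of_notMem (by exact mt h1.2 h2)]
          rw [h1]
          refine (lintegral_translate_sub_sq_le ho hc hui hgi hgm hw h).trans ?_
          have h2 : ‖h‖ₑ ≤ 2⁻¹ ^ n := by
            have h3 : ‖h‖ ≤ (1 / 2) ^ n := (mem_ball_zero_iff.1 hh).le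
            rw [← ofReal_norm, show (2⁻¹ : ℝ≥0∞) = ENNReal.ofReal (1 / 2) by
              rw [ENNReal.ofReal_div_of_pos two_pos]; simp, ← ENNReal.ofReal_pow (by norm_num)]
            exact ENNReal.ofReal_le_ofReal h3
          gcongr
        · rw [indicator_of_notMem hh]
          refine le_of_eq ((lintegral_congr fun y => ?_).trans lintegral_zero)
          rw [hΦ, indicator_of_notMem fun hy => hh hy.2.2]
    _ = _ := by
        rw [lintegral_indicator_const Metric.isOpen_ball.measurableSet, volume_ball_pow]
        ring

/-- Functions of Slobodeckij's space `H^s` with `s > 1/2` on an open set have decaying oscillation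
on every bounded convex open subset. -/
lemma MemHs.oscDecay {U W : Set (Pt d)} (ho : IsOpen U) (hc : Convex ℝ U)
    (hb : Bornology.IsBounded U) (hUW : U ⊆ W) {s : ℝ} (hs : 1 / 2 < s) {u : Pt d → ℝ}
    (h : MemHs W s u) : OscDecay U u := by
  have hle : volume.restrict U ≤ volume.restrict W := Measure.restrict_mono hUW le_rfl
  unfold MemHs at h
  rcases hm : ⌊s⌋₊ with _ | m
  · rw [hm, MemHsAux] at h
    have hfr : Int.fract s = s := Int.fract_eq_self.2 ⟨by linarith, Nat.floor_eq_zero.1 hm⟩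
    rw [hfr] at h
    obtain ⟨hL, hI⟩ := h
    -- `s < 1`: at distance at most `r = 2⁻ⁿ` the kernel of the seminorm is at least `r^(-d-2s)`, and
    -- `r^(d+2s) = β⁴ⁿ r^(d+1)` for this `β`
    refine OscDecay.mono ⟨hL, (2⁻¹ : ℝ≥0∞) ^ ((2 * s - 1) / 4 : ℝ), _,
      ENNReal.rpow_lt_one (by simp) (by linarith), (hI (by linarith)).ne, fun n => ?_⟩ hUW
    have hβ : ((2⁻¹ : ℝ≥0∞) ^ ((2 * s - 1) / 4 : ℝ)) ^ (4 * n) * (2⁻¹ ^ n) ^ (d + 1) =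
        ENNReal.ofReal (((1 / 2 : ℝ) ^ n) ^ ((d : ℝ) + 2 * s)) := by
      rw [← ENNReal.ofReal_rpow_of_pos (by positivity), ENNReal.ofReal_pow (by norm_num),
        show ENNReal.ofReal (1 / 2) = 2⁻¹ by rw [ENNReal.ofReal_div_of_pos two_pos]; simp,
        ← ENNReal.rpow_natCast, ← ENNReal.rpow_natCast, ← ENNReal.rpow_natCast,
        ← ENNReal.rpow_mul, ← ENNReal.rpow_mul, ← ENNReal.rpow_mul,
        ← ENNReal.rpow_add _ _ (by simp) (by simp)]
      congr 1
      push_cast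
      ring
    rw [mul_assoc, hβ, mul_comm, ← lintegral_const_mul' _ _ ENNReal.ofReal_ne_top]
    refine lintegral_mono fun x => ?_
    dsimp only
    rw [← lintegral_const_mul' _ _ ENNReal.ofReal_ne_top]
    rw [inter_comm, ← Measure.restrict_restrict Metric.isOpen_ball.measurableSet]
    refine (setLIntegral_mono' Metric.isOpen_ball.measurableSet fun z hz => ?_).trans
      (setLIntegral_le_lintegral _ _)
    rw [← ENNReal.ofReal_mul (by positivity), ← Real.enorm_abs, ← ofReal_norm, Real.norm_eq_abs,
      abs_abs, ← ENNReal.ofReal_pow (abs_nonneg _)]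
    refine ENNReal.ofReal_le_ofReal ?_
    rcases eq_or_ne x z with rfl | hxz
    · simp
    · have h0 : 0 < ‖x - z‖ := norm_sub_pos_iff.2 hxz
      have h1 : ‖x - z‖ ≤ (1 / 2) ^ n := by
        rw [norm_sub_rev, ← dist_eq_norm]
        exact (Metric.mem_ball.1 hz).le
      rw [mul_div_left_comm]
      refine le_mul_of_one_le_right (by positivity) ((one_le_div (by positivity)).2 ?_)
      exact Real.rpow_le_rpow h0.le h1 (by positivity)
  -- `s ≥ 1`: a weak gradient in `L²` is enough
  · rw [hm, MemHsAux] at h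
    obtain ⟨hL, hI⟩ := h
    choose v hv hv' using hI
    have hvL (i : Fin d) : MemLp (v i) 2 (volume.restrict W) := by
      have := hv' i
      cases m with
      | zero => exact this.1
      | succ m => exact this.1
    refine oscDecay_of_weakPartial ho hc hb (g := fun x => WithLp.toLp 2 fun j => v j x)
      (hL.mono_measure hle) ?_ fun j => (hv j).mono hUW
    have : MemLp (fun x => (fun j => v j x)) 2 (volume.restrict U) :=
      memLp_pi_iff.2 fun j => (hvL j).mono_measure hle
    exact ((PiLp.continuousLinearEquiv 2 ℝ (fun _ : Fin d => ℝ)).symm :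
      (Fin d → ℝ) →L[ℝ] Pt d).comp_memLp' this

end Sobolev

/-! ### Geometry of the mesh -/

/-- A Lipschitz domain has no slits: it is the interior of its closure. -/
lemma IsLipschitzDomain.interior_closure {d : ℕ} {Ω : Set (Pt d)} (h : IsLipschitzDomain Ω) :
    interior (closure Ω) = Ω := by
  refine Subset.antisymm (fun x hx => ?_) (interior_maximal subset_closure h.isOpen)
  by_contra hxΩ
  have hfr : x ∈ frontier Ω := by
    rw [frontier, h.isOpen.interior_eq]
    exact ⟨interior_subset hx, hxΩ⟩
  obtain ⟨U, hU, e, he, c, f, hf, hUΩ⟩ := h.boundary x hfr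
  have hxf : inner ℝ e x ≤ f (x - inner ℝ e x • e) := by
    by_contra hlt
    exact hxΩ ((hUΩ x (mem_of_mem_nhds hU)).2 (not_le.1 hlt))
  -- points slightly below `x` are exterior
  have hcont : Tendsto (fun t : ℝ => x - t • e) (𝓝[>] 0) (𝓝 x) := by
    have : Continuous fun t : ℝ => x - t • e := by fun_prop
    have h1 := this.tendsto 0
    simp only [zero_smul, sub_zero] at h1
    exact h1.mono_left nhdsWithin_le_nhds
  have hev : ∀ᶠ t : ℝ in 𝓝[>] 0, x - t • e ∈ interior U ∩ interior (closure Ω) :=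
    hcont (inter_mem (interior_mem_nhds.2 hU) (isOpen_interior.mem_nhds hx))
  obtain ⟨t, ⟨ht1, ht2⟩, ht0⟩ := (hev.and self_mem_nhdsWithin).exists
  set y := x - t • e with hy
  have hey : inner ℝ e y = inner ℝ e x - t := by
    rw [hy, inner_sub_right, real_inner_smul_right, real_inner_self_eq_norm_sq, he]
    ring
  have hyperp : y - inner ℝ e y • e = x - inner ℝ e x • e := by
    rw [hey, hy]
    module
  have hylt : inner ℝ e y < f (y - inner ℝ e y • e) := by
    rw [hyperp, hey]
    have : 0 < t := ht0
    linarith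
  have hfc := hf.continuous
  have hopen : IsOpen (interior U ∩ {z | inner ℝ e z < f (z - inner ℝ e z • e)}) :=
    isOpen_interior.inter (isOpen_lt (by fun_prop) (by fun_prop))
  obtain ⟨z, hz, hzΩ⟩ := mem_closure_iff.1 (interior_subset ht2) _ hopen ⟨ht1, hylt⟩
  exact lt_asymm hz.2 ((hUΩ z (interior_subset hz.1)).1 hzΩ)

namespace Mesh

variable {d : ℕ} {Ω : Set (Pt d)} (M : Mesh Ω)

/-- The vertices of an element as an affine basis; its coordinates are the barycentric
coordinates of the element. -/
noncomputable def basis {K : Finset (Pt d)} (hK : K ∈ M.elems) : AffineBasis K ℝ (Pt d) where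
  toFun := (↑)
  ind' := M.indep K hK
  tot' := by
    rw [(M.indep K hK).affineSpan_eq_top_iff_card_eq_finrank_add_one, Fintype.card_coe,
      M.card_eq K hK, finrank_euclideanSpace_fin]

variable {K K' S S' : Finset (Pt d)}

@[simp] lemma basis_apply (hK : K ∈ M.elems) (v : K) : M.basis hK v = (v : Pt d) := rfl

lemma hull_eq (hK : K ∈ M.elems) : hull K = bsimplex (M.basis hK) := by
  rw [hull, bsimplex]
  congr 1
  ext x
  simp

lemma mem_hull (hK : K ∈ M.elems) {x : Pt d} : x ∈ hull K ↔ ∀ k, 0 ≤ (M.basis hK).coord k x := by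
  rw [M.hull_eq hK, mem_bsimplex]

lemma mem_interior_hull (hK : K ∈ M.elems) {x : Pt d} : x ∈ interior (hull K) ↔ ∀ k,
    0 < (M.basis hK).coord k x := by
  rw [M.hull_eq hK, mem_interior_bsimplex]

lemma mem_convexHull_inter (hK : K ∈ M.elems) (A : Set (Pt d)) {x : Pt d} :
    x ∈ convexHull ℝ ((K : Set (Pt d)) ∩ A) ↔
    (∀ k, 0 ≤ (M.basis hK).coord k x) ∧ ∀ k : K, (k : Pt d) ∉ A → (M.basis hK).coord k x = 0 := by
  have h : (K : Set (Pt d)) ∩ A = M.basis hK '' {k : K | (k : Pt d) ∈ A} := by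
    ext y
    simp only [mem_inter_iff, Finset.mem_coe, mem_image, mem_ofPred_eq, basis_apply]
    exact ⟨fun h => ⟨⟨y, h.1⟩, h.2, rfl⟩, fun ⟨k, hk, hky⟩ => hky ▸ ⟨k.2, hk⟩⟩
  rw [h, convexHull_image_eq]
  rfl

lemma mem_hull_subset (hK : K ∈ M.elems) (hS : S ⊆ K) {x : Pt d} : x ∈ hull S ↔
    (∀ k, 0 ≤ (M.basis hK).coord k x) ∧ ∀ k : K, (k : Pt d) ∉ S → (M.basis hK).coord k x = 0 := by
  rw [hull, ← inter_eq_right.2 (Finset.coe_subset.2 hS), M.mem_convexHull_inter hK]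
  rfl

lemma mem_hull_inter (hK : K ∈ M.elems) (hK' : K' ∈ M.elems) {x : Pt d} : x ∈ hull K ∩ hull K' ↔
    (∀ k, 0 ≤ (M.basis hK).coord k x) ∧ ∀ k : K, (k : Pt d) ∉ K' → (M.basis hK).coord k x = 0 := by
  rw [M.conforming K hK K' hK', M.mem_convexHull_inter hK]
  rfl

lemma isCompact_hull (S : Finset (Pt d)) : IsCompact (hull S) :=
  S.finite_toSet.isCompact_convexHull (𝕜 := ℝ)

lemma measurableSet_hull (S : Finset (Pt d)) : MeasurableSet (hull S) :=
  (isCompact_hull S).measurableSet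

lemma interior_hull_ae_eq (K : Finset (Pt d)) :
    (interior (hull K) : Set (Pt d)) =ᵐ[volume] hull K :=
  interior_ae_eq_of_null_frontier ((convex_convexHull ℝ _).addHaar_frontier volume)

lemma hull_mono (h : S ⊆ S') : hull S ⊆ hull S' := convexHull_mono (Finset.coe_subset.2 h)

lemma mem_faces : S ∈ M.faces ↔ ∃ K ∈ M.elems, S ⊆ K ∧ S.card = d := by
  simp [faces, Finset.mem_powersetCard]

lemma mem_around : K ∈ M.around S ↔ K ∈ M.elems ∧ S ⊆ K := by simp [around]

open Classical in
/-- The vertex of an element opposite to a face. -/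
lemma exists_opposite (hK : K ∈ M.elems) (hSK : S ⊆ K) (hS : S.card = d) : ∃ v : K,
    S = K.erase v := by
  have h1 : (K \ S).card = 1 := by
    rw [Finset.card_sdiff_of_subset hSK, M.card_eq K hK, hS]
    omega
  obtain ⟨v, hv⟩ := Finset.card_eq_one.1 h1
  have hvm : v ∈ K \ S := by rw [hv]; exact Finset.mem_singleton_self v
  refine ⟨⟨v, (Finset.mem_sdiff.1 hvm).1⟩, ?_⟩
  rw [Finset.erase_eq, ← hv, Finset.sdiff_sdiff_eq_self hSK]

open Classical in
lemma hull_erase (hK : K ∈ M.elems) (v : K) : hull (K.erase v) = facet (M.basis hK) v := by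
  rw [hull, facet]
  congr 1
  ext y
  simp only [Finset.coe_erase, Set.mem_sdiff, Finset.mem_coe, mem_singleton_iff, mem_image,
    mem_compl_iff, basis_apply]
  refine ⟨fun h => ⟨⟨y, h.1⟩, fun h' => h.2 (by rw [← h']), rfl⟩, ?_⟩
  rintro ⟨k, hk, rfl⟩
  exact ⟨k.2, fun h => hk (Subtype.ext h)⟩

open Classical in
/-- The relative interior of a face, as the points of the face outside its own faces. -/
def openFace (S : Finset (Pt d)) : Set (Pt d) := {x | x ∈ hull S ∧ ∀ u ∈ S, x ∉ hull (S.erase u)}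

open Classical in
lemma mem_openFace (hK : K ∈ M.elems) (v : K) {x : Pt d} : x ∈ openFace (K.erase v) ↔
    (M.basis hK).coord v x = 0 ∧ ∀ k, k ≠ v → 0 < (M.basis hK).coord k x := by
  have hsub : K.erase v ⊆ K := Finset.erase_subset _ _
  have hne {k : K} : (k : Pt d) ∈ K.erase (v : Pt d) ↔ k ≠ v := by
    rw [Finset.mem_erase, and_iff_left k.2, Ne, ← Subtype.ext_iff]
  unfold openFace
  rw [mem_ofPred_eq, M.mem_hull_subset hK hsub]
  constructor
  · rintro ⟨⟨h1, h2⟩, h3⟩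
    refine ⟨h2 v (by simp), fun k hk => lt_of_le_of_ne (h1 k) fun h0 => ?_⟩
    refine h3 k (hne.2 hk) ((M.mem_hull_subset hK ((Finset.erase_subset _ _).trans hsub)).2
      ⟨h1, fun l hl => ?_⟩)
    by_cases hlk : l = k
    · rw [hlk, ← h0]
    · exact h2 l fun hl' => hl (Finset.mem_erase.2 ⟨fun h => hlk (Subtype.ext h), hl'⟩)
  · rintro ⟨h1, h2⟩
    refine ⟨⟨fun k => ?_, fun k hk => ?_⟩, fun u hu hx => ?_⟩
    · by_cases hk : k = v
      · rw [hk, h1]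
      · exact (h2 k hk).le
    · rw [not_not.1 (mt hne.2 hk), h1]
    · have huK : u ∈ K := hsub hu
      have h3 := ((M.mem_hull_subset hK ((Finset.erase_subset _ _).trans hsub)).1 hx).2 ⟨u, huK⟩
        (by simp)
      exact (h2 ⟨u, huK⟩ (hne.1 hu)).ne' h3

lemma openFace_subset (S : Finset (Pt d)) : openFace S ⊆ hull S := fun _ h => h.1

lemma card_vertices (hK : K ∈ M.elems) (hd : 2 ≤ d) : 3 ≤ Fintype.card K := by
  rw [Fintype.card_coe, M.card_eq K hK]
  omega

lemma ae_openFace (hd : 2 ≤ d) (hS : S ∈ M.faces) : ∀ᵐ x ∂surf (hull S), x ∈ openFace S := by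
  classical
  obtain ⟨K, hK, hSK, hc⟩ := M.mem_faces.1 hS
  obtain ⟨v, rfl⟩ := M.exists_opposite hK hSK hc
  rw [M.hull_erase hK v]
  filter_upwards [ae_facet_pos (M.basis hK) (M.card_vertices hK hd) v] with x hx
  exact (M.mem_openFace hK v).2 ⟨((mem_facet _).1 hx.1).2, hx.2⟩

lemma subset_closure_openFace (hd : 2 ≤ d) (hS : S ∈ M.faces) : hull S ⊆ closure (openFace S) := by
  classical
  obtain ⟨K, hK, hSK, hc⟩ := M.mem_faces.1 hS
  obtain ⟨v, rfl⟩ := M.exists_opposite hK hSK hc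
  intro x hx
  rw [M.mem_hull_subset hK (Finset.erase_subset _ _)] at hx
  have hxv := hx.2 v (by simp)
  -- move towards the barycentre of the face
  set b := M.basis hK
  have hco (k : K) (t : ℝ) : b.coord k (x + t • ∑ i ∈ Finset.univ.erase v, (b i - x)) =
      b.coord k x + t * ∑ i ∈ Finset.univ.erase v, ((if k = i then 1 else 0) - b.coord k x) := by
    rw [coord_add_smul, inner_sum]
    congr 2
    refine Finset.sum_congr rfl fun i _ => ?_
    rw [inner_grad_sub, b.coord_apply]
  have hcard : ((Finset.univ.erase v).card : ℝ) = d := by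
    rw [Finset.card_erase_of_mem (Finset.mem_univ _), Finset.card_univ, Fintype.card_coe,
      M.card_eq K hK]
    simp
  have htend : Tendsto (fun t : ℝ => x + t • ∑ i ∈ Finset.univ.erase v, (b i - x)) (𝓝[>] 0)
      (𝓝 x) := by
    have : Continuous fun t : ℝ => x + t • ∑ i ∈ Finset.univ.erase v, (b i - x) := by fun_prop
    have h1 := this.tendsto 0
    simp only [zero_smul, add_zero] at h1
    exact h1.mono_left nhdsWithin_le_nhds
  refine mem_closure_of_tendsto htend ?_
  have hd0 : (0 : ℝ) < d := by positivity
  filter_upwards [Ioo_mem_nhdsGT (show (0 : ℝ) < 1 / d by positivity)] with t ht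
  have htd : 0 < 1 - t * d := by
    have := (lt_div_iff₀ hd0).1 ht.2
    linarith
  refine (M.mem_openFace hK v).2 ⟨?_, fun k hk => ?_⟩
  · rw [hco, hxv]
    rw [Finset.sum_eq_zero, mul_zero, add_zero]
    intro i hi
    rw [if_neg (Finset.ne_of_mem_erase hi).symm, sub_zero]
  · rw [hco, Finset.sum_sub_distrib, Finset.sum_const, nsmul_eq_mul, hcard,
      Finset.sum_ite_eq, if_pos (Finset.mem_erase.2 ⟨hk, Finset.mem_univ _⟩)]
    have h0 := hx.1 k
    have : b.coord k x + t * (1 - d * b.coord k x) = (1 - t * d) * b.coord k x + t := by ring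
    rw [this]
    have := mul_nonneg htd.le h0
    linarith [ht.1]

lemma nonempty_openFace (hd : 2 ≤ d) (hS : S ∈ M.faces) : (openFace S).Nonempty := by
  obtain ⟨K, hK, hSK, hc⟩ := M.mem_faces.1 hS
  have h1 : S.Nonempty := Finset.card_pos.1 (by omega)
  obtain ⟨x, hx⟩ := h1
  have h2 := M.subset_closure_openFace hd hS (subset_convexHull ℝ _ (Finset.mem_coe.2 hx))
  exact closure_nonempty_iff.1 ⟨x, h2⟩

lemma subset_of_mem_openFace (hK' : K' ∈ M.elems) (hS : S ∈ M.faces) {x : Pt d}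
    (hx : x ∈ openFace S)
    (hxK : x ∈ hull K') : S ⊆ K' := by
  classical
  obtain ⟨K, hK, hSK, hc⟩ := M.mem_faces.1 hS
  obtain ⟨v, rfl⟩ := M.exists_opposite hK hSK hc
  intro u hu
  have h1 := (M.mem_hull_inter hK hK').1 ⟨hull_mono (Finset.erase_subset _ _) hx.1, hxK⟩
  by_contra huK
  have h2 := h1.2 ⟨u, hSK hu⟩ huK
  have hne : (⟨u, hSK hu⟩ : K) ≠ v := fun h => (Finset.mem_erase.1 hu).1 (by rw [← h])
  exact (((M.mem_openFace hK v).1 hx).2 _ hne).ne' h2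

lemma surf_hull_hull (hd : 2 ≤ d) (hS : S ∈ M.faces) (hS' : S' ∈ M.faces) (hne : S ≠ S') :
    surf (hull S) (hull S') = 0 := by
  classical
  have h : ∀ᵐ x ∂surf (hull S), x ∉ hull S' := by
    filter_upwards [M.ae_openFace hd hS] with x hx hx'
    obtain ⟨K', hK', hSK', hc'⟩ := M.mem_faces.1 hS'
    have hSK := M.subset_of_mem_openFace hK' hS hx (hull_mono hSK' hx')
    obtain ⟨K, _, _, hc⟩ := M.mem_faces.1 hS
    obtain ⟨v, rfl⟩ := M.exists_opposite hK' hSK hc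
    obtain ⟨u, rfl⟩ := M.exists_opposite hK' hSK' hc'
    have huv : u ≠ v := fun h => hne (by rw [h])
    have h1 := ((M.mem_hull_subset hK' hSK').1 hx').2 u (by simp)
    exact (((M.mem_openFace hK' v).1 hx).2 u huv).ne' h1
  simpa [ae_iff] using h

/-! #### Normal vectors -/

open Classical in
lemma eq_smul_grad (hK : K ∈ M.elems) {v w : K} (hw : w ≠ v) {n : Pt d}
    (hn : ∀ x ∈ K.erase v, ∀ y ∈ K.erase v, inner ℝ n (y - x) = (0 : ℝ)) :
    n = (inner ℝ n ((v : Pt d) - w) : ℝ) • grad (M.basis hK) v := by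
  set b := M.basis hK with hb
  refine ext_inner_right ℝ fun z => ?_
  have h1 : (w : Pt d) + z = ∑ i, b.coord i (w + z) • b i := (b.linear_combination_coord_eq_self _).symm
  have h2 : z = ∑ i, b.coord i (w + z) • ((i : Pt d) - w) := by
    have h3 : ∑ i, b.coord i (w + z) • (w : Pt d) = w := by
      rw [← Finset.sum_smul, b.sum_coord_apply_eq_one, one_smul]
    simp only [smul_sub, Finset.sum_sub_distrib, h3]
    exact eq_sub_of_add_eq' h1
  have hmem {i : K} (hi : i ≠ v) : (i : Pt d) ∈ K.erase (v : Pt d) :=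
    Finset.mem_erase.2 ⟨fun h => hi (Subtype.ext h), i.2⟩
  have h4 : inner ℝ (grad b v) z = b.coord v (w + z) := by
    have := inner_grad_sub b v w (w + z)
    rw [add_sub_cancel_left] at this
    rw [this, show (w : Pt d) = b w from rfl, b.coord_apply_ne hw.symm]
    simp [sub_zero]
  rw [real_inner_smul_left, h4]
  conv_lhs => rw [h2]
  rw [inner_sum, Finset.sum_eq_single v]
  · rw [real_inner_smul_right]; ring
  · intro i _ hi
    rw [real_inner_smul_right, hn _ (hmem hw) _ (hmem hi), mul_zero]
  · simp

lemma grad_ne_zero {ι : Type} [Fintype ι] [DecidableEq ι] (b : AffineBasis ι ℝ (Pt d)) {i j : ι}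
    (hij : i ≠ j) : grad b i ≠ 0 := by
  intro h
  have := inner_grad_edge b i j i
  rw [h, inner_zero_left, if_pos rfl, if_neg hij] at this
  norm_num at this

open Classical in
lemma normal_spec (hK : K ∈ M.elems) {v w : K} (hw : w ≠ v) :
    ‖normal K (K.erase v)‖ = 1 ∧ (∀ x ∈ K.erase v, ∀ y ∈ K.erase v,
      inner ℝ (normal K (K.erase v)) (y - x) = (0 : ℝ)) ∧
    ∀ x ∈ K.erase v, ∀ y ∈ K, inner ℝ (normal K (K.erase v)) (y - x) ≤ (0 : ℝ) := by
  set b := M.basis hK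
  have ha := grad_ne_zero b hw.symm
  refine Classical.epsilon_spec (p := fun n : Pt d => ‖n‖ = 1 ∧
    (∀ x ∈ K.erase (v : Pt d), ∀ y ∈ K.erase (v : Pt d), inner ℝ n (y - x) = (0 : ℝ)) ∧
    ∀ x ∈ K.erase (v : Pt d), ∀ y ∈ K, inner ℝ n (y - x) ≤ (0 : ℝ))
    ⟨-(‖grad b v‖⁻¹ • grad b v), ?_, fun x hx y hy => ?_, fun x hx y hy => ?_⟩
  · rw [norm_neg, norm_smul, norm_inv, norm_norm, inv_mul_cancel₀ (norm_ne_zero_iff.2 ha)]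
  all_goals
    obtain ⟨hxv, hxK⟩ := Finset.mem_erase.1 hx
    have h1 : b.coord v x = 0 := b.coord_apply_ne (i := v) (j := ⟨x, hxK⟩) fun h => hxv (by rw [h])
    rw [inner_neg_left, real_inner_smul_left, inner_grad_sub, h1]
  · obtain ⟨hyv, hyK⟩ := Finset.mem_erase.1 hy
    have h2 : b.coord v y = 0 := b.coord_apply_ne (i := v) (j := ⟨y, hyK⟩) fun h => hyv (by rw [h])
    rw [h2]
    simp
  · have h2 : 0 ≤ b.coord v y := (M.mem_hull hK).1 (subset_convexHull ℝ _ hy) v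
    have : 0 ≤ ‖grad b v‖⁻¹ * (b.coord v y - 0) := by rw [sub_zero]; positivity
    linarith

open Classical in
lemma normal_eq (hK : K ∈ M.elems) {v w : K} (hw : w ≠ v) : normal K (K.erase v) =
    -(‖grad (M.basis hK) v‖⁻¹ • grad (M.basis hK) v) := by
  obtain ⟨h1, h2, h3⟩ := M.normal_spec hK hw
  have ha := norm_pos_iff.2 (grad_ne_zero (M.basis hK) hw.symm)
  have h4 := M.eq_smul_grad hK hw h2
  set c : ℝ := inner ℝ (normal K (K.erase v)) ((v : Pt d) - w)
  have hc : c ≤ 0 := h3 w (Finset.mem_erase.2 ⟨fun h => hw (Subtype.ext h), w.2⟩) v v.2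
  rw [h4, norm_smul, Real.norm_of_nonpos hc] at h1
  rw [h4, ← neg_smul]
  congr 1
  have := eq_inv_of_mul_eq_one_left h1
  linarith

lemma exists_ne_vertex (hK : K ∈ M.elems) (hd : 2 ≤ d) (v : K) : ∃ w : K, w ≠ v := by
  have : 1 < Fintype.card K := by have := M.card_vertices hK hd; omega
  have : Nontrivial K := Fintype.one_lt_card_iff_nontrivial.1 this
  exact exists_ne v

lemma eq_of_interior_inter (hK : K ∈ M.elems) (hK' : K' ∈ M.elems)
    (h : (interior (hull K) ∩ interior (hull K')).Nonempty) : K = K' := by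
  obtain ⟨x, hx, hx'⟩ := h
  have h1 := (M.mem_hull_inter hK hK').1 ⟨interior_subset hx, interior_subset hx'⟩
  refine Finset.eq_of_subset_of_card_le (fun u hu => ?_)
    (by rw [M.card_eq K hK, M.card_eq K' hK'])
  by_contra huK
  exact ((M.mem_interior_hull hK).1 hx ⟨u, hu⟩).ne' (h1.2 ⟨u, hu⟩ huK)

open Classical in
/-- Two elements with a common face lie on different sides of it: the barycentric coordinates
that vanish on it are negative multiples of each other. -/
lemma exists_neg_coord (hK : K ∈ M.elems) (hK' : K' ∈ M.elems) (hd : 2 ≤ d) (hne : K ≠ K') {v : K}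
    {v' : K'}
    (hS : K.erase v = K'.erase v') : ∃ c : ℝ, c < 0 ∧
      grad (M.basis hK') v' = c • grad (M.basis hK) v ∧
      ∀ y, (M.basis hK').coord v' y = c * (M.basis hK).coord v y := by
  set b := M.basis hK
  set b' := M.basis hK'
  obtain ⟨w, hw⟩ := M.exists_ne_vertex hK hd v
  have hwS : (w : Pt d) ∈ K.erase (v : Pt d) := Finset.mem_erase.2 ⟨fun h => hw (Subtype.ext h), w.2⟩
  have hz {x : Pt d} (hx : x ∈ K.erase (v : Pt d)) : b'.coord v' x = 0 := by
    rw [hS] at hx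
    obtain ⟨h1, h2⟩ := Finset.mem_erase.1 hx
    exact b'.coord_apply_ne (i := v') (j := ⟨x, h2⟩) fun h => h1 (by rw [h])
  have hwz : b.coord v w = 0 := b.coord_apply_ne hw.symm
  have hg := M.eq_smul_grad hK hw (n := grad b' v') fun x hx y hy => by
    rw [inner_grad_sub, hz hx, hz hy, sub_zero]
  set c : ℝ := inner ℝ (grad b' v') ((v : Pt d) - w) with hc
  have hcoord : ∀ y, b'.coord v' y = c * b.coord v y := by
    intro y
    have h1 := inner_grad_sub b' v' w y
    rw [hz hwS, sub_zero, hg, real_inner_smul_left, inner_grad_sub, hwz, sub_zero] at h1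
    exact h1.symm
  refine ⟨c, ?_, hg, hcoord⟩
  by_contra hc0
  have hc1 : 0 < c := by
    refine lt_of_le_of_ne (not_lt.1 hc0) fun h0 => ?_
    have := hcoord v'
    rw [show (v' : Pt d) = b' v' from rfl, b'.coord_apply_eq, ← h0, zero_mul] at this
    exact one_ne_zero this
  have hSf : K.erase (v : Pt d) ∈ M.faces := M.mem_faces.2 ⟨K, hK, Finset.erase_subset _ _, by
    rw [Finset.card_erase_of_mem v.2, M.card_eq K hK]; simp⟩
  obtain ⟨x, hx⟩ := M.nonempty_openFace hd hSf
  have hx1 := (M.mem_openFace hK v).1 hx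
  have hx2 := (M.mem_openFace hK' v').1 (hS ▸ hx)
  -- move from `x` into `K`
  have htend : Tendsto (fun t : ℝ => x + t • ((v : Pt d) - w)) (𝓝[>] 0) (𝓝 x) := by
    have : Continuous fun t : ℝ => x + t • ((v : Pt d) - w) := by fun_prop
    have h1 := this.tendsto 0
    simp only [zero_smul, add_zero] at h1
    exact h1.mono_left nhdsWithin_le_nhds
  have hev1 : ∀ᶠ t : ℝ in 𝓝[>] 0, ∀ k, k ≠ v → 0 < b.coord k (x + t • ((v : Pt d) - w)) :=
    eventually_all.2 fun k => by
      by_cases hk : k = v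
      · exact Eventually.of_forall fun _ h => absurd hk h
      · filter_upwards [((continuous_coord b k).tendsto x |>.comp htend).eventually
          (lt_mem_nhds (hx1.2 k hk))] with t ht _ using ht
  have hev2 : ∀ᶠ t : ℝ in 𝓝[>] 0, ∀ k, k ≠ v' → 0 < b'.coord k (x + t • ((v : Pt d) - w)) :=
    eventually_all.2 fun k => by
      by_cases hk : k = v'
      · exact Eventually.of_forall fun _ h => absurd hk h
      · filter_upwards [((continuous_coord b' k).tendsto x |>.comp htend).eventually
          (lt_mem_nhds (hx2.2 k hk))] with t ht _ using ht
  obtain ⟨t, ⟨h1, h2⟩, ht⟩ := ((hev1.and hev2).and self_mem_nhdsWithin).exists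
  have hv : b.coord v (x + t • ((v : Pt d) - w)) = t := by
    rw [coord_add_smul, hx1.1]
    have := inner_grad_edge b v w v
    rw [if_pos rfl, if_neg hw.symm, sub_zero] at this
    rw [show ((v : Pt d) - w) = b v - b w from rfl, this]
    ring
  refine hne (M.eq_of_interior_inter hK hK' ⟨x + t • ((v : Pt d) - w), ?_, ?_⟩)
  · refine (M.mem_interior_hull hK).2 fun k => ?_
    by_cases hk : k = v
    · subst hk; rw [hv]; exact ht
    · exact h1 k hk
  · refine (M.mem_interior_hull hK').2 fun k => ?_
    by_cases hk : k = v'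
    · subst hk; rw [hcoord, hv]; exact mul_pos hc1 ht
    · exact h2 k hk

lemma normal_opposite (hd : 2 ≤ d) (hSc : S.card = d) (hSK : S ⊆ K) (hSK' : S ⊆ K')
    (hK : K ∈ M.elems) (hK' : K' ∈ M.elems) (hne : K ≠ K') : normal K' S = -normal K S := by
  classical
  obtain ⟨v, hv⟩ := M.exists_opposite hK hSK hSc
  obtain ⟨v', hv'⟩ := M.exists_opposite hK' hSK' hSc
  obtain ⟨w, hw⟩ := M.exists_ne_vertex hK hd v
  obtain ⟨w', hw'⟩ := M.exists_ne_vertex hK' hd v'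
  obtain ⟨c, hc, hg, -⟩ := M.exists_neg_coord hK hK' hd hne (hv.symm.trans hv')
  have e1 := M.normal_eq hK hw
  have e2 := M.normal_eq hK' hw'
  rw [← hv] at e1
  rw [← hv'] at e2
  rw [e1, e2, hg, norm_smul, Real.norm_of_nonpos hc.le, smul_smul, neg_neg, ← neg_smul]
  congr 1
  rw [mul_inv, inv_neg, mul_right_comm, neg_mul, inv_mul_cancel₀ hc.ne]
  ring

lemma hull_union_mem_nhds (hd : 2 ≤ d) (hSc : S.card = d) (hSK : S ⊆ K) (hSK' : S ⊆ K')
    (hK : K ∈ M.elems) (hK' : K' ∈ M.elems) (hne : K ≠ K') {x : Pt d} (hx : x ∈ openFace S) :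
    hull K ∪ hull K' ∈ 𝓝 x := by
  classical
  obtain ⟨v, hv⟩ := M.exists_opposite hK hSK hSc
  obtain ⟨v', hv'⟩ := M.exists_opposite hK' hSK' hSc
  obtain ⟨c, hc, -, hcoord⟩ := M.exists_neg_coord hK hK' hd hne (hv.symm.trans hv')
  have hx1 := (M.mem_openFace hK v).1 (hv ▸ hx)
  have hx2 := (M.mem_openFace hK' v').1 (hv' ▸ hx)
  have hev1 : ∀ᶠ y in 𝓝 x, ∀ k, k ≠ v → 0 < (M.basis hK).coord k y :=
    eventually_all.2 fun k => by
      by_cases hk : k = v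
      · exact Eventually.of_forall fun _ h => absurd hk h
      · filter_upwards [((continuous_coord (M.basis hK) k).tendsto x).eventually
          (lt_mem_nhds (hx1.2 k hk))] with t ht _ using ht
  have hev2 : ∀ᶠ y in 𝓝 x, ∀ k, k ≠ v' → 0 < (M.basis hK').coord k y :=
    eventually_all.2 fun k => by
      by_cases hk : k = v'
      · exact Eventually.of_forall fun _ h => absurd hk h
      · filter_upwards [((continuous_coord (M.basis hK') k).tendsto x).eventually
          (lt_mem_nhds (hx2.2 k hk))] with t ht _ using ht
  filter_upwards [hev1, hev2] with y h1 h2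
  rcases le_total 0 ((M.basis hK).coord v y) with h | h
  · refine Or.inl ((M.mem_hull hK).2 fun k => ?_)
    by_cases hk : k = v
    · rwa [hk]
    · exact (h1 k hk).le
  · refine Or.inr ((M.mem_hull hK').2 fun k => ?_)
    by_cases hk : k = v'
    · rw [hk, hcoord]; exact mul_nonneg_of_nonpos_of_nonpos hc.le h
    · exact (h2 k hk).le

end Mesh

/-! ### Interior and boundary faces -/

namespace Mesh

variable {d : ℕ} {Ω : Set (Pt d)} (M : Mesh Ω) {K K' S S' : Finset (Pt d)}

lemma hull_subset_closure (hK : K ∈ M.elems) : hull K ⊆ closure Ω := by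
  rw [← M.cover]
  exact subset_biUnion_of_mem (u := fun K => hull K) hK

lemma interior_hull_subset (hΩ : IsLipschitzDomain Ω) (hK : K ∈ M.elems) :
    interior (hull K) ⊆ Ω := by
  rw [← hΩ.interior_closure]
  exact interior_mono (M.hull_subset_closure hK)

lemma isClosed_biUnion_hull (s : Finset (Finset (Pt d))) : IsClosed (⋃ K ∈ s, hull K) :=
  isClosed_biUnion_finset fun K _ => (isCompact_hull K).isClosed

/-- Near a point of an open face, the domain consists of the elements around the face. -/
lemma eventually_mem_around (hS : S ∈ M.faces) {x : Pt d} (hx : x ∈ openFace S) :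
    ∀ᶠ y in 𝓝 x, y ∈ closure Ω → ∃ K ∈ M.around S, y ∈ hull K := by
  classical
  have hcl : IsClosed (⋃ K ∈ M.elems.filter fun K => ¬ S ⊆ K, hull K) := isClosed_biUnion_hull _
  have hxn : x ∉ ⋃ K ∈ M.elems.filter fun K => ¬ S ⊆ K, hull K := by
    simp only [mem_iUnion, not_exists]
    intro K hK hxK
    obtain ⟨h1, h2⟩ := Finset.mem_filter.1 hK
    exact h2 (M.subset_of_mem_openFace h1 hS hx hxK)
  filter_upwards [hcl.isOpen_compl.mem_nhds hxn] with y hy hyΩ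
  rw [← M.cover] at hyΩ
  simp only [mem_iUnion] at hyΩ
  obtain ⟨K, hK, hyK⟩ := hyΩ
  refine ⟨K, M.mem_around.2 ⟨hK, ?_⟩, hyK⟩
  by_contra hSK
  exact hy (mem_biUnion (t := fun K => hull K) (Finset.mem_filter.2 ⟨hK, hSK⟩) hyK)

/-- An open face around which there is a single element does not meet the domain. -/
lemma around_eq_singleton (hd : 2 ≤ d) (hΩ : IsLipschitzDomain Ω) (hS : S ∈ M.faces)
    (hKS : M.around S = {K}) : hull S ⊆ frontier Ω ∧
      ∀ x ∈ openFace S, ∀ᶠ y in 𝓝 x, (y ∈ closure Ω ↔ y ∈ hull K) := by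
  classical
  obtain ⟨hK, hSK⟩ := M.mem_around.1 (hKS ▸ Finset.mem_singleton_self K : K ∈ M.around S)
  have hnear : ∀ x ∈ openFace S, ∀ᶠ y in 𝓝 x, (y ∈ closure Ω ↔ y ∈ hull K) := by
    intro x hx
    filter_upwards [M.eventually_mem_around hS hx] with y hy
    refine ⟨fun h => ?_, fun h => M.hull_subset_closure hK h⟩
    obtain ⟨K', h1, h2⟩ := hy h
    rw [hKS, Finset.mem_singleton] at h1
    rwa [← h1]
  refine ⟨fun x hx => ?_, hnear⟩
  have hsub : openFace S ⊆ Ωᶜ := by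
    intro y hy hyΩ
    obtain ⟨_, _, _, hc⟩ := M.mem_faces.1 hS
    obtain ⟨v, hv⟩ := M.exists_opposite hK hSK hc
    have h1 : hull K ∈ 𝓝 y := by
      filter_upwards [hnear y hy, hΩ.isOpen.mem_nhds hyΩ] with z h1 h2 using
        h1.1 (subset_closure h2)
    have h2 := (M.mem_interior_hull hK).1 (mem_interior_iff_mem_nhds.2 h1) v
    exact h2.ne' ((M.mem_openFace hK v).1 (hv ▸ hy)).1
  have h1 : x ∈ Ωᶜ := closure_minimal hsub hΩ.isOpen.isClosed_compl
    (M.subset_closure_openFace hd hS hx)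
  rw [frontier, hΩ.isOpen.interior_eq]
  exact ⟨M.hull_subset_closure hK (hull_mono hSK hx), h1⟩

/-- The interior of a face common to two elements lies in the domain. -/
lemma openFace_subset_of_two (hd : 2 ≤ d) (hΩ : IsLipschitzDomain Ω) (hSc : S.card = d)
    (hK : K ∈ M.around S) (hK' : K' ∈ M.around S) (hne : K ≠ K') : openFace S ⊆ Ω := by
  intro x hx
  obtain ⟨h1, h2⟩ := M.mem_around.1 hK
  obtain ⟨h3, h4⟩ := M.mem_around.1 hK'
  rw [← hΩ.interior_closure]
  refine mem_interior_iff_mem_nhds.2 (mem_of_superset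
    (M.hull_union_mem_nhds hd hSc h2 h4 h1 h3 hne hx) ?_)
  exact union_subset (M.hull_subset_closure h1) (M.hull_subset_closure h3)

/-- There are at most two elements around a face. -/
lemma around_eq_pair (hd : 2 ≤ d) (hSc : S.card = d)
    (hK : K ∈ M.around S) (hK' : K' ∈ M.around S) (hne : K ≠ K') : M.around S = {K, K'} := by
  classical
  obtain ⟨h1, h2⟩ := M.mem_around.1 hK
  obtain ⟨h3, h4⟩ := M.mem_around.1 hK'
  ext L
  rw [Finset.mem_insert, Finset.mem_singleton]
  refine ⟨fun hL => ?_, ?_⟩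
  · obtain ⟨h5, h6⟩ := M.mem_around.1 hL
    by_contra! h
    have e1 := M.normal_opposite hd hSc h2 h4 h1 h3 hne
    have e2 := M.normal_opposite hd hSc h2 h6 h1 h5 h.1.symm
    have e3 := M.normal_opposite hd hSc h4 h6 h3 h5 h.2.symm
    rw [e2, e1, neg_neg] at e3
    obtain ⟨v, hv⟩ := M.exists_opposite h1 h2 hSc
    obtain ⟨w, hw⟩ := M.exists_ne_vertex h1 hd v
    have hn := (M.normal_spec h1 hw).1
    rw [← hv] at hn
    rw [neg_eq_iff_add_eq_zero, ← two_smul ℝ, smul_eq_zero] at e3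
    rcases e3 with e3 | e3
    · norm_num at e3
    · rw [e3, norm_zero] at hn
      norm_num at hn
  · rintro (rfl | rfl) <;> assumption

lemma mem_of_vertex_mem_hull (hK : K ∈ M.elems) (hK' : K' ∈ M.elems) {v : Pt d} (hv : v ∈ K)
    (hv' : v ∈ hull K') : v ∈ K' := by
  have h := (M.mem_hull_inter hK hK').1 ⟨subset_convexHull ℝ _ hv, hv'⟩
  by_contra hn
  have h1 := h.2 ⟨v, hv⟩ hn
  have h2 : (M.basis hK).coord ⟨v, hv⟩ v = 1 := (M.basis hK).coord_apply_eq ⟨v, hv⟩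
  rw [h2] at h1
  exact one_ne_zero h1

lemma mem_intFaces : S ∈ M.intFaces ↔ S ∈ M.faces ∧
    ∃ K ∈ M.around S, ∃ K' ∈ M.around S, K ≠ K' := by
  classical
  rw [intFaces, Finset.mem_filter]
  refine and_congr_right fun hS => ?_
  obtain ⟨L, hL, hSL, hc⟩ := M.mem_faces.1 hS
  constructor
  · rintro ⟨K, hK, K', hK', hne, h⟩
    have hsub {N : Finset (Pt d)} (hN : N ∈ M.elems) (h : hull S ⊆ hull N) : S ⊆ N := fun v hv =>
      M.mem_of_vertex_mem_hull hL hN (hSL hv) (h (subset_convexHull ℝ _ hv))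
    exact ⟨K, M.mem_around.2 ⟨hK, hsub hK (h ▸ inter_subset_left)⟩,
      K', M.mem_around.2 ⟨hK', hsub hK' (h ▸ inter_subset_right)⟩, hne⟩
  · rintro ⟨K, hK, K', hK', hne⟩
    obtain ⟨h1, h2⟩ := M.mem_around.1 hK
    obtain ⟨h3, h4⟩ := M.mem_around.1 hK'
    refine ⟨K, h1, K', h3, hne, ?_⟩
    have hcard : (K ∩ K').card ≤ S.card := by
      by_contra! hlt
      have h5 : (K ∩ K').card = d + 1 := by
        have := Finset.card_le_card (Finset.inter_subset_left (s₁ := K) (s₂ := K'))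
        rw [M.card_eq K h1] at this
        omega
      refine hne ?_
      have e1 := Finset.eq_of_subset_of_card_le (Finset.inter_subset_left (s₁ := K) (s₂ := K'))
        (by rw [h5, M.card_eq K h1])
      have e2 := Finset.eq_of_subset_of_card_le (Finset.inter_subset_right (s₁ := K) (s₂ := K'))
        (by rw [h5, M.card_eq K' h3])
      exact e1.symm.trans e2
    have hSeq : S = K ∩ K' := Finset.eq_of_subset_of_card_le (Finset.subset_inter h2 h4) hcard
    rw [M.conforming K h1 K' h3, ← Finset.coe_inter, ← hSeq]
    rfl

lemma around_nonempty (hS : S ∈ M.faces) : ∃ K, K ∈ M.around S := by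
  obtain ⟨K, hK, hSK, -⟩ := M.mem_faces.1 hS
  exact ⟨K, M.mem_around.2 ⟨hK, hSK⟩⟩

/-- The boundary faces are the faces that are not interior. -/
lemma bdryFaces_eq (hd : 2 ≤ d) (hΩ : IsLipschitzDomain Ω) :
    M.bdryFaces = M.faces \ M.intFaces := by
  classical
  ext S
  rw [bdryFaces, Finset.mem_filter, Finset.mem_sdiff]
  refine and_congr_right fun hS => ?_
  obtain ⟨_, _, _, hc⟩ := M.mem_faces.1 hS
  constructor
  · intro h hi
    obtain ⟨-, K, hK, K', hK', hne⟩ := M.mem_intFaces.1 hi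
    obtain ⟨x, hx⟩ := M.nonempty_openFace hd hS
    have h1 := h (openFace_subset S hx)
    rw [frontier, hΩ.isOpen.interior_eq] at h1
    exact h1.2 (M.openFace_subset_of_two hd hΩ hc hK hK' hne hx)
  · intro hi
    obtain ⟨K, hK⟩ := M.around_nonempty hS
    refine (M.around_eq_singleton hd hΩ hS (K := K) ?_).1
    rw [Finset.eq_singleton_iff_unique_mem]
    refine ⟨hK, fun K' hK' => ?_⟩
    by_contra hne
    exact hi (M.mem_intFaces.2 ⟨hS, K', hK', K, hK, hne⟩)

lemma exists_around_bdry (hd : 2 ≤ d) (hΩ : IsLipschitzDomain Ω) (hS : S ∈ M.bdryFaces) :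
    ∃ K, M.around S = {K} := by
  classical
  rw [M.bdryFaces_eq hd hΩ, Finset.mem_sdiff] at hS
  obtain ⟨K, hK⟩ := M.around_nonempty hS.1
  refine ⟨K, Finset.eq_singleton_iff_unique_mem.2 ⟨hK, fun K' hK' => ?_⟩⟩
  by_contra hne
  exact hS.2 (M.mem_intFaces.2 ⟨hS.1, K', hK', K, hK, hne⟩)

lemma intFaces_subset : M.intFaces ⊆ M.faces := by
  classical
  exact Finset.filter_subset _ _

lemma bdryFaces_subset : M.bdryFaces ⊆ M.faces := by
  classical
  exact Finset.filter_subset _ _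

lemma sum_faces (hd : 2 ≤ d) (hΩ : IsLipschitzDomain Ω) (f : Finset (Pt d) → ℝ) :
    ∑ S ∈ M.faces, f S = ∑ S ∈ M.intFaces, f S + ∑ S ∈ M.bdryFaces, f S := by
  rw [M.bdryFaces_eq hd hΩ, add_comm, Finset.sum_sdiff M.intFaces_subset]

/-- Summation over the faces of the elements. -/
lemma sum_elems_faces (f : Finset (Pt d) → Finset (Pt d) → ℝ) :
    ∑ K ∈ M.elems, ∑ S ∈ K.powersetCard d, f K S = ∑ S ∈ M.faces, ∑ K ∈ M.around S, f K S := by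
  classical
  refine Finset.sum_comm' fun K S => ?_
  rw [M.mem_around, M.mem_faces, Finset.mem_powersetCard]
  exact ⟨fun ⟨h1, h2, h3⟩ => ⟨⟨h1, h2⟩, K, h1, h2, h3⟩, fun ⟨⟨h1, h2⟩, _, _, _, h3⟩ => ⟨h1, h2, h3⟩⟩

open Classical in
lemma sum_powersetCard (hK : K ∈ M.elems) (f : Finset (Pt d) → ℝ) :
    ∑ S ∈ K.powersetCard d, f S = ∑ v : K, f (K.erase v) := by
  refine (Finset.sum_bij (fun (v : K) _ => K.erase (v : Pt d)) (fun v _ => ?_) (fun v _ w _ h => ?_)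
    (fun S hS => ?_) fun _ _ => rfl).symm
  · rw [Finset.mem_powersetCard, Finset.card_erase_of_mem v.2, M.card_eq K hK]
    exact ⟨Finset.erase_subset _ _, rfl⟩
  · by_contra hne
    have : (v : Pt d) ∈ K.erase (w : Pt d) :=
      Finset.mem_erase.2 ⟨fun h => hne (Subtype.ext h), v.2⟩
    rw [← h] at this
    exact (Finset.mem_erase.1 this).1 rfl
  · obtain ⟨h1, h2⟩ := Finset.mem_powersetCard.1 hS
    obtain ⟨v, hv⟩ := M.exists_opposite hK h1 h2
    exact ⟨v, Finset.mem_univ _, hv.symm⟩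

/-! #### Decomposition of the domain -/

lemma pairwise_disjoint_interior :
    (M.elems : Set (Finset (Pt d))).Pairwise (Function.onFun Disjoint fun K => interior (hull K)) := by
  intro K hK K' hK' hne
  rw [Function.onFun, Set.disjoint_iff_inter_eq_empty, ← not_nonempty_iff_eq_empty]
  exact fun h => hne (M.eq_of_interior_inter hK hK' h)

lemma volume_inter (hK : K ∈ M.elems) (hK' : K' ∈ M.elems) (hne : K ≠ K') :
    volume (interior (hull K) ∩ hull K') = 0 := by
  have h := M.pairwise_disjoint_interior hK hK' hne
  have h1 : (interior (hull K) ∩ hull K' : Set (Pt d)) =ᵐ[volume]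
      (interior (hull K) ∩ interior (hull K') : Set (Pt d)) :=
    (ae_eq_refl _).inter (interior_hull_ae_eq K').symm
  rw [measure_congr h1, (Set.disjoint_iff_inter_eq_empty.1 h), measure_empty]

lemma ae_eq_biUnion_interior (hΩ : IsLipschitzDomain Ω) :
    Ω =ᵐ[volume] (⋃ K ∈ M.elems, interior (hull K) : Set (Pt d)) := by
  have h1 : (⋃ K ∈ M.elems, interior (hull K) : Set (Pt d)) =ᵐ[volume]
      (⋃ K ∈ M.elems, hull K : Set (Pt d)) :=
    Filter.EventuallyEq.countable_bUnion (Finset.countable_toSet M.elems) fun K _ => interior_hull_ae_eq K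
  rw [M.cover] at h1
  refine EventuallyLE.antisymm ?_ (LE.le.eventuallyLE
    (iUnion₂_subset fun K hK => M.interior_hull_subset hΩ hK))
  exact (LE.le.eventuallyLE subset_closure).trans h1.symm.le

lemma ae_eq_closure (M : Mesh Ω) (hΩ : IsLipschitzDomain Ω) : Ω =ᵐ[volume] closure Ω := by
  have h1 : (⋃ K ∈ M.elems, interior (hull K) : Set (Pt d)) =ᵐ[volume]
      (⋃ K ∈ M.elems, hull K : Set (Pt d)) :=
    Filter.EventuallyEq.countable_bUnion (Finset.countable_toSet M.elems) fun K _ => interior_hull_ae_eq K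
  rw [M.cover] at h1
  exact (M.ae_eq_biUnion_interior hΩ).trans h1

lemma ae_mem_interior (hΩ : IsLipschitzDomain Ω) :
    ∀ᵐ x ∂volume.restrict Ω, ∃ K ∈ M.elems, x ∈ interior (hull K) := by
  rw [Measure.restrict_congr_set (M.ae_eq_biUnion_interior hΩ)]
  filter_upwards [ae_restrict_mem (Finset.measurableSet_biUnion _ fun K _ =>
    isOpen_interior.measurableSet)] with x hx
  simpa using hx

lemma setIntegral_eq_sum (hΩ : IsLipschitzDomain Ω) {f : Pt d → ℝ}
    (hf : ∀ K ∈ M.elems, IntegrableOn f (hull K)) :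
    ∫ x in Ω, f x = ∑ K ∈ M.elems, ∫ x in hull K, f x := by
  have e := M.ae_eq_biUnion_interior hΩ
  rw [setIntegral_congr_set e, integral_biUnion_finset _ (fun K _ => isOpen_interior.measurableSet)
    M.pairwise_disjoint_interior fun K hK => (hf K hK).mono_set interior_subset]
  exact Finset.sum_congr rfl fun K _ => setIntegral_congr_set (interior_hull_ae_eq K)

lemma restrict_hull_le (hΩ : IsLipschitzDomain Ω) (hK : K ∈ M.elems) :
    volume.restrict (hull K) ≤ volume.restrict Ω := by
  rw [← Measure.restrict_congr_set (interior_hull_ae_eq K)]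
  exact Measure.restrict_mono (M.interior_hull_subset hΩ hK) le_rfl

/-- Every element lies in one part of the body: otherwise the other elements, which meet it in null
sets, would cover its interior. -/
lemma exists_part {J : ℕ} {part : Fin J → Set (Pt d)} (hM : M.Compatible part)
    (hcov : closure Ω = ⋃ j, closure (part j)) (hK : K ∈ M.elems) :
    ∃ j, interior (hull K) ⊆ part j := by
  by_contra! hno
  have hpos : 0 < volume (interior (hull K)) := by
    have := volume_bsimplex_ne_zero (M.basis hK)
    rw [← M.hull_eq hK] at this
    rw [measure_congr (interior_hull_ae_eq K)]
    exact pos_iff_ne_zero.2 this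
  have hsub : interior (hull K) ⊆ ⋃ K' ∈ M.elems.erase K, interior (hull K) ∩ hull K' := by
    intro x hx
    have h1 : x ∈ closure Ω := M.hull_subset_closure hK (interior_subset hx)
    rw [hcov] at h1
    obtain ⟨j, hj⟩ := mem_iUnion.1 h1
    rw [← hM j] at hj
    simp only [mem_iUnion, mem_ofPred_eq] at hj
    obtain ⟨K', ⟨h2, h3⟩, h4⟩ := hj
    refine mem_biUnion (Finset.mem_coe.2 (Finset.mem_erase.2 ⟨?_, h2⟩)) ⟨hx, h4⟩
    rintro rfl
    exact hno j h3
  have h0 : volume (⋃ K' ∈ M.elems.erase K, interior (hull K) ∩ hull K') = 0 :=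
    (measure_biUnion_null_iff (Finset.countable_toSet _)).2 fun K' hK' => by
      obtain ⟨h1, h2⟩ := Finset.mem_erase.1 (Finset.mem_coe.1 hK')
      exact M.volume_inter hK h2 h1.symm
  exact hpos.ne' (measure_mono_null hsub h0)

end Mesh

/-! ### Traces and Green's formula on elements -/

namespace Mesh

variable {d : ℕ} {Ω : Set (Pt d)} (M : Mesh Ω) {K K' S S' : Finset (Pt d)}

/-- The field `σ` has decaying oscillation on the element `K` and `δ` is its weak divergence. -/
structure HasDivOn (K : Finset (Pt d)) (σ : Pt d → Pt d) (δ : Pt d → ℝ) : Prop where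
  osc : OscDecay (hull K) σ
  memLp : MemLp δ 2 (volume.restrict (hull K))
  weak : ∀ φ, IsTest (interior (hull K)) φ →
    ∫ x in hull K, ∑ j, σ x j * partialD j φ x = -∫ x in hull K, δ x * φ x

lemma traceGeom (hd : 2 ≤ d) (hK : K ∈ M.elems) (hS : S ∈ K.powersetCard d) :
    TraceGeom (hull K) (surf (hull S)) := by
  classical
  obtain ⟨h1, h2⟩ := Finset.mem_powersetCard.1 hS
  obtain ⟨v, rfl⟩ := M.exists_opposite hK h1 h2
  obtain ⟨w, hw⟩ := M.exists_ne_vertex hK hd v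
  rw [M.hull_erase hK v, M.hull_eq hK]
  exact (stripGeom_bsimplex (M.basis hK) hw.symm).geom

lemma isFiniteMeasure_surf (hd : 2 ≤ d) (hS : S ∈ M.faces) : IsFiniteMeasure (surf (hull S)) := by
  obtain ⟨K, hK, h1, h2⟩ := M.mem_faces.1 hS
  exact (M.traceGeom hd hK (Finset.mem_powersetCard.2 ⟨h1, h2⟩)).finite'

/-- Points of a face have positive volume density in the adjacent elements. -/
lemma volume_hull_inter_ball_ne_zero (hK : K ∈ M.elems) {x : Pt d} (hx : x ∈ hull K) {r : ℝ}
    (hr : 0 < r) : volume (hull K ∩ Metric.ball x r) ≠ 0 := by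
  have h0 : volume (hull K) ≠ 0 := by
    rw [M.hull_eq hK]
    exact volume_bsimplex_ne_zero _
  obtain ⟨c, hc0, -, hlow⟩ := exists_lower_bound (isCompact_hull K) (convex_convexHull ℝ _) h0
  obtain ⟨n, hn⟩ := exists_pow_lt_of_lt_one hr (show (1 / 2 : ℝ) < 1 by norm_num)
  exact (lt_of_lt_of_le (pos_iff_ne_zero.2 (mul_ne_zero hc0 (by simp))) ((hlow x hx n).trans
    (measure_mono (inter_subset_inter_right _ (Metric.ball_subset_ball hn.le))))).ne'

lemma _root_.Zener.OscDecay.integrableOn {V : Type} [NormedAddCommGroup V] [NormedSpace ℝ V]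
    {K : Finset (Pt d)} {u : Pt d → V} (h : OscDecay (hull K) u) : IntegrableOn u (hull K) := by
  have : IsFiniteMeasure (volume.restrict (hull K)) :=
    ⟨by simpa using (isCompact_hull K).measure_lt_top⟩
  exact h.1.integrable one_le_two

lemma ae_mem_hull (hSK : S ⊆ K) : ∀ᵐ x ∂surf (hull S), x ∈ hull K :=
  (ae_restrict_mem (measurableSet_hull S)).mono fun _ hx => hull_mono hSK hx

lemma traceFrom_eq_of_isLebesgueValue {V : Type} [NormedAddCommGroup V] [NormedSpace ℝ V]
    [CompleteSpace V] (hK : K ∈ M.elems) {u : Pt d → V} (hu : IntegrableOn u (hull K)) {x : Pt d}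
    (hx : x ∈ hull K) {c : V} (h : IsLebesgueValue (hull K) u x c) : traceFrom (hull K) u x = c :=
  h.traceFrom_eq (fun _ hr => M.volume_hull_inter_ball_ne_zero hK hx hr) hu

/-- Traces commute with continuous linear maps. -/
lemma traceFrom_clm {V W : Type} [NormedAddCommGroup V] [NormedSpace ℝ V] [CompleteSpace V]
    [NormedAddCommGroup W] [NormedSpace ℝ W] [CompleteSpace W] (hd : 2 ≤ d) (hK : K ∈ M.elems)
    (hS : S ∈ K.powersetCard d) {u : Pt d → V} (hu : OscDecay (hull K) u) (L : V →L[ℝ] W) :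
    ∀ᵐ x ∂surf (hull S), traceFrom (hull K) (fun y => L (u y)) x = L (traceFrom (hull K) u x) := by
  filter_upwards [(hu.trace (M.traceGeom hd hK hS)).2.1,
    ae_mem_hull (Finset.mem_powersetCard.1 hS).1] with x hx hxK
  exact M.traceFrom_eq_of_isLebesgueValue hK (hu.clm L).integrableOn hxK (hx.comp_clm L)

lemma traceFrom_add {V : Type} [NormedAddCommGroup V] [NormedSpace ℝ V] [CompleteSpace V]
    (hd : 2 ≤ d) (hK : K ∈ M.elems) (hS : S ∈ K.powersetCard d) {u v : Pt d → V}
    (hu : OscDecay (hull K) u) (hv : OscDecay (hull K) v) :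
    ∀ᵐ x ∂surf (hull S), traceFrom (hull K) (fun y => u y + v y) x =
      traceFrom (hull K) u x + traceFrom (hull K) v x := by
  filter_upwards [(hu.trace (M.traceGeom hd hK hS)).2.1, (hv.trace (M.traceGeom hd hK hS)).2.1,
    ae_mem_hull (Finset.mem_powersetCard.1 hS).1] with x hx hx' hxK
  exact M.traceFrom_eq_of_isLebesgueValue hK (hu.add hv).integrableOn hxK
    (hx.add hx' hu.1.1)

/-- A continuous function is its own trace. -/
lemma traceFrom_of_continuous {V : Type} [NormedAddCommGroup V] [NormedSpace ℝ V] [CompleteSpace V]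
    (hK : K ∈ M.elems) {u f : Pt d → V} (hf : Continuous f)
    (hu : u =ᵐ[volume.restrict (hull K)] f) {x : Pt d} (hx : x ∈ hull K) :
    traceFrom (hull K) u x = f x := by
  rw [traceFrom_congr (ae_eq_refl _) hu]
  exact M.traceFrom_eq_of_isLebesgueValue hK
    (hf.continuousOn.integrableOn_compact (isCompact_hull K)) hx
    (isLebesgueValue_of_continuousAt hf.continuousAt)

/-- Green's formula on an element. -/
lemma green_elem (hd : 2 ≤ d) (hK : K ∈ M.elems) {σ : Pt d → Pt d} {δ : Pt d → ℝ}
    (h : HasDivOn K σ δ) {φ : Pt d → ℝ} (hφ : ContDiff ℝ ((⊤ : ℕ∞) : WithTop ℕ∞) φ) :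
    ∫ x in hull K, (∑ j, σ x j * partialD j φ x + δ x * φ x) = ∑ S ∈ K.powersetCard d,
      ∫ x, inner ℝ (traceFrom (hull K) σ x) (normal K S) * φ x ∂surf (hull S) := by
  classical
  rw [M.sum_powersetCard hK]
  have hg := green_bsimplex (M.basis hK) (M.card_vertices hK hd) (σ := σ) (δ := δ) (φ := φ)
  rw [← M.hull_eq hK] at hg
  rw [hg h.osc h.memLp h.weak hφ]
  refine Finset.sum_congr rfl fun v _ => ?_
  obtain ⟨w, hw⟩ := M.exists_ne_vertex hK hd v
  rw [M.hull_erase hK v, M.normal_eq hK hw]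

lemma integrable_trace_normal (hd : 2 ≤ d) (hK : K ∈ M.elems) (hS : S ∈ K.powersetCard d)
    {σ : Pt d → Pt d} (h : OscDecay (hull K) σ) (n : Pt d) :
    Integrable (fun x => (inner ℝ (traceFrom (hull K) σ x) n : ℝ)) (surf (hull S)) := by
  have hG := M.traceGeom hd hK hS
  have := hG.finite'
  exact ((h.trace hG).1.integrable one_le_two).inner_const n

lemma mem_powersetCard_of_around (hS : S ∈ M.faces) (hK : K ∈ M.around S) :
    K ∈ M.elems ∧ S ∈ K.powersetCard d := by
  obtain ⟨h1, h2⟩ := M.mem_around.1 hK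
  obtain ⟨_, _, _, hc⟩ := M.mem_faces.1 hS
  exact ⟨h1, Finset.mem_powersetCard.2 ⟨h2, hc⟩⟩

/-- If the weak formulation of `div σ = δ` holds in the open set `U`, then the normal
components of the traces of `σ` from the elements around a face cancel on the part of the face
in `U`. -/
theorem sum_trace_normal_eq_zero (hd : 2 ≤ d) {σ : Pt d → Pt d}
    {δ : Pt d → ℝ} (h : ∀ K ∈ M.elems, HasDivOn K σ δ) {U : Set (Pt d)} (hU : IsOpen U)
    (hz : ∀ ψ, IsTest U ψ →
      ∑ K ∈ M.elems, ∫ x in hull K, (∑ j, σ x j * partialD j ψ x + δ x * ψ x) = 0)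
    (hS : S ∈ M.faces) :
    ∀ᵐ x ∂surf (hull S), x ∈ U →
      ∑ K ∈ M.around S, inner ℝ (traceFrom (hull K) σ x) (normal K S) = (0 : ℝ) := by
  classical
  set V : Set (Pt d) := U ∩ (⋃ S' ∈ M.faces.erase S, hull S')ᶜ with hV
  have hVo : IsOpen V := hU.inter (isClosed_biUnion_hull _).isOpen_compl
  have hfin := M.isFiniteMeasure_surf hd hS
  have hint (S : Finset (Pt d)) (hS : S ∈ M.faces) (K : Finset (Pt d)) (hK : K ∈ M.around S) :=
    M.integrable_trace_normal hd (M.mem_powersetCard_of_around hS hK).1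
      (M.mem_powersetCard_of_around hS hK).2
      (h K (M.mem_powersetCard_of_around hS hK).1).osc (normal K S)
  have hI : Integrable (fun x => ∑ K ∈ M.around S,
      (inner ℝ (traceFrom (hull K) σ x) (normal K S) : ℝ)) (surf (hull S)) :=
    integrable_finsetSum _ fun K hK => hint S hS K hK
  have hae := hVo.ae_eq_zero_of_integral_contDiff_smul_eq_zero
    (hI.locallyIntegrable.locallyIntegrableOn V) fun ψ h1 h2 h3 => by
      have hψ : IsTest V ψ := ⟨h1, h2, h3⟩
      have h4 := hz ψ (hψ.mono inter_subset_left)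
      rw [Finset.sum_congr rfl fun K hK => M.green_elem hd hK (h K hK) h1,
        M.sum_elems_faces, Finset.sum_eq_single_of_mem S hS] at h4
      · obtain ⟨C, hC⟩ := h1.continuous.bounded_above_of_compact_support h2
        rw [← integral_finsetSum _ fun K hK => (hint S hS K hK).mul_bdd
          h1.continuous.aestronglyMeasurable (ae_of_all _ hC)] at h4
        rw [← h4]
        refine integral_congr_ae (ae_of_all _ fun x => ?_)
        dsimp only
        rw [smul_eq_mul, mul_comm, Finset.sum_mul]
      · intro S' hS' hne
        refine Finset.sum_eq_zero fun K _ => ?_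
        refine integral_eq_zero_of_ae ?_
        filter_upwards [ae_mem_hull (subset_refl S')] with x hx
        rw [hψ.eq_zero fun hxV => hxV.2
          (mem_biUnion (t := fun S => hull S) (Finset.mem_coe.2 (Finset.mem_erase.2 ⟨hne, hS'⟩)) hx),
          mul_zero, Pi.zero_apply]
  have hnot : ∀ᵐ x ∂surf (hull S), x ∉ ⋃ S' ∈ M.faces.erase S, hull S' := by
    have : surf (hull S) (⋃ S' ∈ M.faces.erase S, hull S') = 0 :=
      (measure_biUnion_null_iff (Finset.countable_toSet _)).2 fun S' hS' => by
        obtain ⟨h1, h2⟩ := Finset.mem_erase.1 (Finset.mem_coe.1 hS')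
        exact M.surf_hull_hull hd hS h2 h1.symm
    exact measure_eq_zero_iff_ae_notMem.1 this
  filter_upwards [hae, hnot] with x h1 h2 hxU
  exact h1 ⟨hxU, h2⟩

end Mesh

/-! ### Weak divergence and jumps -/

/-- The fundamental lemma of the calculus of variations in an open set. -/
lemma ae_eq_of_setIntegral_test_eq {E : Type} [NormedAddCommGroup E] [NormedSpace ℝ E]
    [FiniteDimensional ℝ E] [MeasurableSpace E] [BorelSpace E] {μ : Measure E} {U : Set E}
    (hU : IsOpen U) {f g : E → ℝ} (hf : LocallyIntegrable f (μ.restrict U))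
    (hg : LocallyIntegrable g (μ.restrict U))
    (h : ∀ φ, IsTest U φ → ∫ x in U, f x * φ x ∂μ = ∫ x in U, g x * φ x ∂μ) :
    f =ᵐ[μ.restrict U] g := by
  have key : ∀ᵐ x ∂μ, x ∈ U → (f - g) x = 0 := by
    refine hU.ae_eq_zero_of_integral_contDiff_smul_eq_zero
      (locallyIntegrableOn_of_locallyIntegrable_restrict (hf.sub hg)) fun φ g1 g2 g3 => ?_
    have h0 : ∀ x, x ∉ U → φ x • (f - g) x = 0 := fun x hx => by
      rw [image_eq_zero_of_notMem_tsupport fun h' => hx (g3 h'), zero_smul]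
    rw [← setIntegral_eq_integral_of_forall_compl_eq_zero h0]
    have i1 := hf.integrable_smul_left_of_hasCompactSupport g1.continuous g2
    have i2 := hg.integrable_smul_left_of_hasCompactSupport g1.continuous g2
    have e := h φ ⟨g1, g2, g3⟩
    simp only [mul_comm _ (φ _), ← smul_eq_mul] at e
    simp only [Pi.sub_apply, smul_sub]
    rw [integral_sub i1 i2, e, sub_self]
  filter_upwards [ae_restrict_of_ae key, ae_restrict_mem hU.measurableSet] with x hx hxU
  exact sub_eq_zero.1 (hx hxU)

section WeakDiv

variable {d : ℕ}

/-- The weak divergence is unique. -/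
lemma weakDiv_ae_eq {U : Set (Pt d)} (hU : IsOpen U) {τ : Pt d → Ten d} {v : Pt d → Pt d}
    (hv : MemLp v 2 (volume.restrict U)) (h : IsWeakDiv U τ v) :
    weakDiv U τ =ᵐ[volume.restrict U] v := by
  have hex : ∃ v, MemLp v 2 (volume.restrict U) ∧ IsWeakDiv U τ v := ⟨v, hv, h⟩
  have he : weakDiv U τ = hex.choose := by rw [weakDiv, dif_pos hex]
  obtain ⟨h1, h2⟩ := hex.choose_spec
  rw [← he] at h1 h2
  have hcomp {f : Pt d → Pt d} (hf : MemLp f 2 (volume.restrict U)) (i : Fin d) :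
      MemLp (fun x => f x i) 2 (volume.restrict U) :=
    (EuclideanSpace.proj i : Pt d →L[ℝ] ℝ).comp_memLp' hf
  have key (i : Fin d) : (fun x => weakDiv U τ x i) =ᵐ[volume.restrict U] fun x => v x i :=
    ae_eq_of_setIntegral_test_eq hU ((hcomp h1 i).locallyIntegrable one_le_two)
      ((hcomp hv i).locallyIntegrable one_le_two) fun φ hφ =>
        neg_inj.1 ((h2 i φ hφ).symm.trans (h i φ hφ))
  filter_upwards [ae_all_iff.2 key] with x hx
  ext i
  exact hx i

lemma IsTest.setIntegral_sum_mul_partialD {U : Set (Pt d)} {φ : Pt d → ℝ} (h : IsTest U φ)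
    (σ : Pt d → Pt d) : ∫ x in U, ∑ j, σ x j * partialD j φ x = ∫ x, ∑ j, σ x j * partialD j φ x :=
  setIntegral_eq_integral_of_forall_compl_eq_zero fun x hx =>
    Finset.sum_eq_zero fun j _ => by rw [h.partialD_eq_zero j hx, mul_zero]

end WeakDiv

namespace Mesh

variable {d : ℕ} {Ω : Set (Pt d)} (M : Mesh Ω) {K K' S S' : Finset (Pt d)}

lemma brokenDiv_of_mem (hK : K ∈ M.elems) (τ : Pt d → Ten d) {x : Pt d}
    (hx : x ∈ interior (hull K)) : M.brokenDiv τ x = weakDiv (interior (hull K)) τ x := by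
  rw [brokenDiv, Finset.sum_eq_single_of_mem K hK, indicator_of_mem hx]
  intro K' hK' hne
  refine indicator_of_notMem (fun hx' => hne ?_) _
  exact M.eq_of_interior_inter hK' hK ⟨x, hx', hx⟩

lemma ae_mem_interior_hull (K : Finset (Pt d)) :
    ∀ᵐ x ∂volume.restrict (hull K), x ∈ interior (hull K) := by
  rw [← Measure.restrict_congr_set (interior_hull_ae_eq K)]
  exact ae_restrict_mem isOpen_interior.measurableSet

lemma brokenDiv_ae_eq (hK : K ∈ M.elems) {τ : Pt d → Ten d} {v : Pt d → Pt d}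
    (hv : MemLp v 2 (volume.restrict (hull K))) (h : IsWeakDiv (interior (hull K)) τ v) :
    M.brokenDiv τ =ᵐ[volume.restrict (hull K)] v := by
  rw [← Measure.restrict_congr_set (interior_hull_ae_eq K)] at hv
  have h1 := weakDiv_ae_eq isOpen_interior hv h
  rw [Measure.restrict_congr_set (interior_hull_ae_eq K)] at h1
  filter_upwards [h1, ae_mem_interior_hull K] with x hx hxK
  rw [M.brokenDiv_of_mem hK τ hxK, hx]

/-- A field with weak divergence in the domain has the same divergence on the elements. -/
lemma isWeakDiv_elem (hΩ : IsLipschitzDomain Ω) (hK : K ∈ M.elems) {τ : Pt d → Ten d}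
    {v : Pt d → Pt d} (h : IsWeakDiv Ω τ v) : IsWeakDiv (interior (hull K)) τ v := by
  intro i φ hφ
  have hφ' := hφ.mono (M.interior_hull_subset hΩ hK)
  have h1 := h i φ hφ'
  rw [hφ.setIntegral_mul fun x => v x i, hφ.setIntegral_sum_mul_partialD fun x =>
    WithLp.toLp 2 fun j => τ x (i, j)]
  rwa [hφ'.setIntegral_mul fun x => v x i, hφ'.setIntegral_sum_mul_partialD fun x =>
    WithLp.toLp 2 fun j => τ x (i, j)] at h1

lemma memLp_hull (hΩ : IsLipschitzDomain Ω) (hK : K ∈ M.elems) {V : Type} [NormedAddCommGroup V]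
    {f : Pt d → V} (hf : MemLp f 2 (volume.restrict Ω)) : MemLp f 2 (volume.restrict (hull K)) :=
  hf.mono_measure (M.restrict_hull_le hΩ hK)

lemma isBounded_interior_hull (K : Finset (Pt d)) : Bornology.IsBounded (interior (hull K)) :=
  (isCompact_hull K).isBounded.subset interior_subset

lemma convex_interior_hull (K : Finset (Pt d)) : Convex ℝ (interior (hull K)) :=
  (convex_convexHull ℝ _).interior

/-- Fields in `H¹(Ω)` have decaying oscillation on the elements. -/
lemma oscDecay_of_H1 (hΩ : IsLipschitzDomain Ω) (hK : K ∈ M.elems) {u : Pt d → Pt d}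
    {G : Pt d → Ten d} (hu : MemLp u 2 (volume.restrict Ω)) (hG : MemLp G 2 (volume.restrict Ω))
    (hw : ∀ i j, IsWeakPartial Ω j (fun x => u x i) fun x => G x (i, j)) :
    OscDecay (hull K) u := by
  refine OscDecay.congr_set (OscDecay.of_components fun i => ?_) (interior_hull_ae_eq K)
  have hle : volume.restrict (interior (hull K)) ≤ volume.restrict Ω :=
    Measure.restrict_mono (M.interior_hull_subset hΩ hK) le_rfl
  have hrow : MemLp (fun x => (WithLp.toLp 2 fun j => G x (i, j) : Pt d)) 2
      (volume.restrict (interior (hull K))) := by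
    have h1 : MemLp (fun x => (fun j => G x (i, j))) 2 (volume.restrict (interior (hull K))) :=
      memLp_pi_iff.2 fun j =>
        (EuclideanSpace.proj (i, j) : Ten d →L[ℝ] ℝ).comp_memLp' (hG.mono_measure hle)
    exact ((PiLp.continuousLinearEquiv 2 ℝ (fun _ : Fin d => ℝ)).symm :
      (Fin d → ℝ) →L[ℝ] Pt d).comp_memLp' h1
  exact oscDecay_of_weakPartial isOpen_interior (convex_interior_hull K) (isBounded_interior_hull K)
    ((EuclideanSpace.proj i : Pt d →L[ℝ] ℝ).comp_memLp' (hu.mono_measure hle)) hrow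
    fun j => (hw i j).mono (M.interior_hull_subset hΩ hK)

lemma sum_smul_single_mul {j : Fin d} (c : ℝ) (f : Fin d → ℝ) :
    ∑ l, (c • EuclideanSpace.single j (1 : ℝ) : Pt d) l * f l = c * f j := by
  rw [Finset.sum_eq_single_of_mem j (Finset.mem_univ _)]
  · simp
  · intro l _ hl
    simp [hl]

/-- `∂_j u_i` is the divergence of the field `u_i e_j`. -/
lemma hasDivOn_of_H1 (hΩ : IsLipschitzDomain Ω) (hK : K ∈ M.elems) {u : Pt d → Pt d}
    {G : Pt d → Ten d} (hu : MemLp u 2 (volume.restrict Ω)) (hG : MemLp G 2 (volume.restrict Ω))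
    (hw : ∀ i j, IsWeakPartial Ω j (fun x => u x i) fun x => G x (i, j)) (i j : Fin d) :
    HasDivOn K (fun x => u x i • EuclideanSpace.single j (1 : ℝ)) fun x => G x (i, j) where
  osc := (M.oscDecay_of_H1 hΩ hK hu hG hw).clm
    ((EuclideanSpace.proj i : Pt d →L[ℝ] ℝ).smulRight (EuclideanSpace.single j (1 : ℝ) : Pt d))
  memLp := (EuclideanSpace.proj (i, j) : Ten d →L[ℝ] ℝ).comp_memLp' (M.memLp_hull hΩ hK hG)
  weak := fun φ hφ => by
    simp only [sum_smul_single_mul]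
    rw [← setIntegral_congr_set (interior_hull_ae_eq K),
      ← setIntegral_congr_set (interior_hull_ae_eq K)]
    exact (hw i j).mono (M.interior_hull_subset hΩ hK) φ hφ

lemma hasDivOn_row (hΩ : IsLipschitzDomain Ω) (hK : K ∈ M.elems) {τ : Pt d → Ten d}
    {v : Pt d → Pt d} (hv : MemLp v 2 (volume.restrict Ω)) (h : IsWeakDiv Ω τ v)
    (hτ : OscDecay (hull K) τ) (i : Fin d) :
    HasDivOn K (fun x => WithLp.toLp 2 fun j => τ x (i, j)) fun x => v x i where
  osc := OscDecay.of_components fun j => hτ.clm (EuclideanSpace.proj (i, j) : Ten d →L[ℝ] ℝ)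
  memLp := (EuclideanSpace.proj i : Pt d →L[ℝ] ℝ).comp_memLp' (M.memLp_hull hΩ hK hv)
  weak := fun φ hφ => by
    rw [← setIntegral_congr_set (interior_hull_ae_eq K),
      ← setIntegral_congr_set (interior_hull_ae_eq K)]
    exact M.isWeakDiv_elem hΩ hK h i φ hφ

lemma HasDivOn.integrableOn {σ : Pt d → Pt d} {δ : Pt d → ℝ} (h : HasDivOn K σ δ)
    {φ : Pt d → ℝ} (hφ : ContDiff ℝ ((⊤ : ℕ∞) : WithTop ℕ∞) φ) :
    IntegrableOn (fun x => ∑ j, σ x j * partialD j φ x + δ x * φ x) (hull K) := by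
  have : IsFiniteMeasure (volume.restrict (hull K)) :=
    ⟨by simpa using (isCompact_hull K).measure_lt_top⟩
  refine Integrable.add (integrable_finsetSum _ fun j _ => ?_) ?_
  · have h1 : IntegrableOn (fun x => σ x j) (hull K) :=
      (h.osc.clm (EuclideanSpace.proj j : Pt d →L[ℝ] ℝ)).integrableOn
    exact h1.mul_continuousOn ((hφ.continuous_fderiv (by simp)).clm_apply
      continuous_const).continuousOn (isCompact_hull K)
  · have h1 : IntegrableOn δ (hull K) := h.memLp.integrable one_le_two
    exact h1.mul_continuousOn hφ.continuous.continuousOn (isCompact_hull K)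

/-- The jump of a field with weak divergence in `Ω` vanishes. -/
lemma jump_eq_zero (hd : 2 ≤ d) (hΩ : IsLipschitzDomain Ω) {τ : Pt d → Ten d}
    {v : Pt d → Pt d} (hτL : MemLp τ 2 (volume.restrict Ω)) (hv : MemLp v 2 (volume.restrict Ω))
    (h : IsWeakDiv Ω τ v) (hτ : ∀ K ∈ M.elems, OscDecay (hull K) τ) (hS : S ∈ M.intFaces) :
    ∀ᵐ x ∂surf (hull S), M.jump τ S x = 0 := by
  have hSf := M.intFaces_subset hS
  obtain ⟨-, K, hK, K', hK', hne⟩ := M.mem_intFaces.1 hS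
  obtain ⟨_, _, _, hc⟩ := M.mem_faces.1 hSf
  have hdiv (i : Fin d) (K : Finset (Pt d)) (hK : K ∈ M.elems) :=
    M.hasDivOn_row hΩ hK hv h (hτ K hK) i
  have h1 (i : Fin d) := M.sum_trace_normal_eq_zero hd (hdiv i) hΩ.isOpen (fun ψ hψ => by
    rw [← M.setIntegral_eq_sum hΩ fun K hK => (hdiv i K hK).integrableOn hψ.1]
    have h2 := h i ψ hψ
    have hψL : MemLp ψ 2 (volume.restrict Ω) :=
      (hψ.1.continuous.memLp_of_hasCompactSupport hψ.2.1 (p := 2) (μ := volume)).restrict Ω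
    have h3 : IntegrableOn (fun x => v x i * ψ x) Ω :=
      ((EuclideanSpace.proj i : Pt d →L[ℝ] ℝ).comp_memLp' hv).integrable_mul hψL
    have h4 : IntegrableOn (fun x => ∑ j, τ x (i, j) * partialD j ψ x) Ω :=
      integrable_finsetSum _ fun j _ =>
        ((EuclideanSpace.proj (i, j) : Ten d →L[ℝ] ℝ).comp_memLp' hτL).integrable_mul
          (((hψ.cont_partialD j).memLp_of_hasCompactSupport (hψ.supp_partialD j)
            (p := 2) (μ := volume)).restrict Ω)
    exact (integral_add h4 h3).trans (by rw [h2]; ring)) hSf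
  have h2 : ∀ᵐ x ∂surf (hull S), ∀ K ∈ M.around S, ∀ i,
      traceFrom (hull K) (fun x => (WithLp.toLp 2 fun j => τ x (i, j) : Pt d)) x =
      WithLp.toLp 2 fun j => traceFrom (hull K) τ x (i, j) := by
    refine (Finset.eventually_all _).2 fun K hK => ae_all_iff.2 fun i => ?_
    obtain ⟨h3, h4⟩ := M.mem_powersetCard_of_around hSf hK
    let L : Ten d →L[ℝ] Pt d := ((PiLp.continuousLinearEquiv 2 ℝ (fun _ : Fin d => ℝ)).symm :
      (Fin d → ℝ) →L[ℝ] Pt d).comp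
        (ContinuousLinearMap.pi fun j => (EuclideanSpace.proj (i, j) : Ten d →L[ℝ] ℝ))
    exact M.traceFrom_clm hd h3 h4 (hτ K h3) L
  filter_upwards [ae_all_iff.2 h1, h2, M.ae_openFace hd hSf] with x hx1 hx2 hx3
  ext i
  have h5 := hx1 i (M.openFace_subset_of_two hd hΩ hc hK hK' hne hx3)
  rw [jump, PiLp.zero_apply]
  rw [← h5]
  simp only [matVec, WithLp.ofLp_sum, Finset.sum_apply]
  refine Finset.sum_congr rfl fun K hK => ?_
  rw [hx2 K hK i, PiLp.inner_apply]
  refine Finset.sum_congr rfl fun j _ => ?_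
  simp [mul_comm]

end Mesh

/-! ### Matching traces of `H¹` fields -/

namespace Mesh

variable {d : ℕ} {Ω : Set (Pt d)} (M : Mesh Ω) {K K' S S' : Finset (Pt d)}

/-- Matching of the traces of an `H¹` field: the weak formulation of the definition of its
gradient in an open set `U` relates the traces on the part of a face in `U`. -/
lemma sum_trace_mul_normal_eq_zero (hd : 2 ≤ d) (hΩ : IsLipschitzDomain Ω) {u : Pt d → Pt d}
    {G : Pt d → Ten d} (hu : ∀ K ∈ M.elems, OscDecay (hull K) u)
    (hdiv : ∀ K ∈ M.elems, ∀ i j, HasDivOn K (fun x => u x i • EuclideanSpace.single j (1 : ℝ))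
      fun x => G x (i, j))
    {U : Set (Pt d)} (hU : IsOpen U) (hz : ∀ i j ψ, IsTest U ψ →
      ∫ x in Ω, (u x i * partialD j ψ x + G x (i, j) * ψ x) = 0) (hS : S ∈ M.faces) :
    ∀ᵐ x ∂surf (hull S), x ∈ U → ∀ i j,
      ∑ K ∈ M.around S, traceFrom (hull K) u x i * normal K S j = 0 := by
  have h1 (i j : Fin d) := M.sum_trace_normal_eq_zero hd (fun K hK => hdiv K hK i j) hU
    (fun ψ hψ => by
      rw [← M.setIntegral_eq_sum hΩ fun K hK => (hdiv K hK i j).integrableOn hψ.1]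
      simp only [sum_smul_single_mul]
      exact hz i j ψ hψ) hS
  have h2 : ∀ᵐ x ∂surf (hull S), ∀ K ∈ M.around S, ∀ i j : Fin d,
      traceFrom (hull K) (fun x => u x i • EuclideanSpace.single j (1 : ℝ)) x =
      traceFrom (hull K) u x i • (EuclideanSpace.single j (1 : ℝ) : Pt d) := by
    refine (Finset.eventually_all _).2 fun K hK => ae_all_iff.2 fun i => ae_all_iff.2 fun j => ?_
    obtain ⟨h3, h4⟩ := M.mem_powersetCard_of_around hS hK
    exact M.traceFrom_clm hd h3 h4 (hu K h3)
      ((EuclideanSpace.proj i : Pt d →L[ℝ] ℝ).smulRight (EuclideanSpace.single j (1 : ℝ) : Pt d))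
  filter_upwards [ae_all_iff.2 fun i => ae_all_iff.2 (h1 i), h2] with x hx1 hx2 hxU i j
  rw [← hx1 i j hxU]
  refine Finset.sum_congr rfl fun K hK => ?_
  rw [hx2 K hK i j, real_inner_smul_left, EuclideanSpace.inner_single_left]
  simp

lemma norm_normal (hd : 2 ≤ d) (hS : S ∈ M.faces) (hK : K ∈ M.around S) : ‖normal K S‖ = 1 := by
  classical
  obtain ⟨h1, h2⟩ := M.mem_around.1 hK
  obtain ⟨_, _, _, hc⟩ := M.mem_faces.1 hS
  obtain ⟨v, hv⟩ := M.exists_opposite h1 h2 hc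
  obtain ⟨w, hw⟩ := M.exists_ne_vertex h1 hd v
  rw [hv]
  exact (M.normal_spec h1 hw).1

lemma eq_of_forall_mul_normal (hd : 2 ≤ d) (hS : S ∈ M.faces) (hK : K ∈ M.around S) {u v : Pt d}
    (h : ∀ i j, (u i - v i) * normal K S j = 0) : u = v := by
  have hn : normal K S ≠ 0 := norm_ne_zero_iff.1 (by rw [M.norm_normal hd hS hK]; norm_num)
  obtain ⟨j, hj⟩ : ∃ j, normal K S j ≠ 0 := by
    by_contra! h0
    exact hn (by ext j; simpa using h0 j)
  ext i
  exact sub_eq_zero.1 ((mul_eq_zero.1 (h i j)).resolve_right hj)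

/-- The traces of an `H¹` field from both sides of an interior face agree. -/
lemma trace_eq_mean (hd : 2 ≤ d) (hΩ : IsLipschitzDomain Ω) {u : Pt d → Pt d}
    {G : Pt d → Ten d} (hu : ∀ K ∈ M.elems, OscDecay (hull K) u)
    (hdiv : ∀ K ∈ M.elems, ∀ i j, HasDivOn K (fun x => u x i • EuclideanSpace.single j (1 : ℝ))
      fun x => G x (i, j))
    (hz : ∀ i j ψ, IsTest Ω ψ → ∫ x in Ω, (u x i * partialD j ψ x + G x (i, j) * ψ x) = 0)
    (hS : S ∈ M.intFaces) :
    ∀ᵐ x ∂surf (hull S), ∀ K ∈ M.around S, traceFrom (hull K) u x = M.mean u S x := by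
  classical
  have hSf := M.intFaces_subset hS
  obtain ⟨-, K, hK, K', hK', hne⟩ := M.mem_intFaces.1 hS
  obtain ⟨_, _, _, hc⟩ := M.mem_faces.1 hSf
  have hpair := M.around_eq_pair hd hc hK hK' hne
  obtain ⟨k1, k2⟩ := M.mem_around.1 hK
  obtain ⟨k3, k4⟩ := M.mem_around.1 hK'
  filter_upwards [M.sum_trace_mul_normal_eq_zero hd hΩ hu hdiv hΩ.isOpen hz hSf,
    M.ae_openFace hd hSf] with x hx hxS
  have h1 := hx (M.openFace_subset_of_two hd hΩ hc hK hK' hne hxS)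
  have heq : traceFrom (hull K) u x = traceFrom (hull K') u x := by
    refine M.eq_of_forall_mul_normal hd hSf hK fun i j => ?_
    have h2 := h1 i j
    rw [hpair, Finset.sum_pair hne, M.normal_opposite hd hc k2 k4 k1 k3 hne, PiLp.neg_apply] at h2
    linarith
  have hm : M.mean u S x = traceFrom (hull K') u x := by
    rw [mean, hpair, Finset.sum_pair hne, heq, ← two_smul ℝ, smul_smul]
    norm_num
  intro L hL
  rw [hpair, Finset.mem_insert, Finset.mem_singleton] at hL
  rcases hL with rfl | rfl
  · rw [hm, heq]
  · rw [hm]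

/-- The trace on a boundary face from the domain is that from the adjacent element. -/
lemma trace_bdry {V : Type} [NormedAddCommGroup V] [NormedSpace ℝ V] [CompleteSpace V]
    (hd : 2 ≤ d) (hΩ : IsLipschitzDomain Ω) (hS : S ∈ M.bdryFaces) (hK : K ∈ M.around S)
    {u : Pt d → V} (hu : OscDecay (hull K) u) (hui : IntegrableOn u Ω) :
    ∀ᵐ x ∂surf (hull S), IsLebesgueValue Ω u x (traceFrom (hull K) u x) ∧
      traceFrom Ω u x = traceFrom (hull K) u x := by
  have hSf := M.bdryFaces_subset hS
  obtain ⟨h1, h2⟩ := M.mem_powersetCard_of_around hSf hK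
  have hKS : M.around S = {K} := by
    obtain ⟨K', hK'⟩ := M.exists_around_bdry hd hΩ hS
    rw [hK', Finset.mem_singleton] at hK
    rw [hK', hK]
  filter_upwards [(hu.trace (M.traceGeom hd h1 h2)).2.1, M.ae_openFace hd hSf] with x hx hxS
  have hxK : x ∈ hull K := hull_mono (Finset.mem_powersetCard.1 h2).1 hxS.1
  obtain ⟨R, hR, hball⟩ := Metric.eventually_nhds_iff_ball.1
    ((M.around_eq_singleton hd hΩ hSf hKS).2 x hxS)
  have hset : (hull K ∩ Metric.ball x R : Set (Pt d)) =ᵐ[volume] (Ω ∩ Metric.ball x R : Set (Pt d)) := by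
    have e1 : (hull K ∩ Metric.ball x R : Set (Pt d)) = closure Ω ∩ Metric.ball x R := by
      ext y
      exact and_congr_left fun hy => (hball y hy).symm
    rw [e1]
    exact (M.ae_eq_closure hΩ).symm.inter (ae_eq_refl _)
  have hL : IsLebesgueValue Ω u x (traceFrom (hull K) u x) := IsLebesgueValue.congr_near hx hR hset
  refine ⟨hL, hL.traceFrom_eq (fun r hr h0 => ?_) hui⟩
  refine M.volume_hull_inter_ball_ne_zero h1 hxK hr ?_
  have hsub : (hull K ∩ Metric.ball x r : Set (Pt d)) ≤ᵐ[volume] (Ω ∩ Metric.ball x r : Set (Pt d)) := by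
    have e1 : (hull K : Set (Pt d)) ≤ᵐ[volume] Ω :=
      (interior_hull_ae_eq K).symm.le.trans
        (LE.le.eventuallyLE (M.interior_hull_subset hΩ h1))
    exact e1.inter EventuallyLE.rfl
  exact measure_mono_null_ae hsub h0

lemma hasTraceL2_elem {V : Type} [NormedAddCommGroup V] [NormedSpace ℝ V] [CompleteSpace V]
    (hd : 2 ≤ d) (hK : K ∈ M.elems) (hS : S ∈ K.powersetCard d) {u : Pt d → V}
    (hu : OscDecay (hull K) u) : HasTraceL2 (hull K) (hull S) u :=
  ⟨(hu.trace (M.traceGeom hd hK hS)).2.1, (hu.trace (M.traceGeom hd hK hS)).1⟩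

lemma hasTraceL2_bdry {V : Type} [NormedAddCommGroup V] [NormedSpace ℝ V] [CompleteSpace V]
    (hd : 2 ≤ d) (hΩ : IsLipschitzDomain Ω) (hS : S ∈ M.bdryFaces)
    {u : Pt d → V} (hu : ∀ K ∈ M.elems, OscDecay (hull K) u) (hui : IntegrableOn u Ω) :
    HasTraceL2 Ω (hull S) u := by
  obtain ⟨K, hK⟩ := M.around_nonempty (M.bdryFaces_subset hS)
  obtain ⟨h1, h2⟩ := M.mem_powersetCard_of_around (M.bdryFaces_subset hS) hK
  have h3 := M.trace_bdry hd hΩ hS hK (hu K h1) hui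
  refine ⟨?_, ?_⟩
  · filter_upwards [h3] with x hx
    rw [hx.2]
    exact hx.1
  · refine (memLp_congr_ae ?_).2 ((hu K h1).trace (M.traceGeom hd h1 h2)).1
    filter_upwards [h3] with x hx using hx.2

/-- Fields with the same trace in the weak sense have the same traces on the boundary faces. -/
lemma trace_eq_bdry (hd : 2 ≤ d) (hΩ : IsLipschitzDomain Ω) {u v : Pt d → Pt d}
    {G H : Pt d → Ten d} (hu : MemLp u 2 (volume.restrict Ω)) (hG : MemLp G 2 (volume.restrict Ω))
    (hw : ∀ i j, IsWeakPartial Ω j (fun x => u x i) fun x => G x (i, j))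
    (hv : MemLp v 2 (volume.restrict Ω)) (hH : MemLp H 2 (volume.restrict Ω))
    (hw' : ∀ i j, IsWeakPartial Ω j (fun x => v x i) fun x => H x (i, j))
    (hz : ∀ i j ψ, IsTest univ ψ → ∫ x in Ω, (u x i * partialD j ψ x + G x (i, j) * ψ x) =
      ∫ x in Ω, (v x i * partialD j ψ x + H x (i, j) * ψ x))
    (hvi : IntegrableOn v Ω) (hS : S ∈ M.bdryFaces) :
    ∀ᵐ x ∂surf (hull S), ∀ K ∈ M.around S, traceFrom (hull K) u x = traceFrom Ω v x := by
  have hSf := M.bdryFaces_subset hS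
  obtain ⟨K, hKS⟩ := M.exists_around_bdry hd hΩ hS
  have hK : K ∈ M.around S := by rw [hKS]; exact Finset.mem_singleton_self K
  obtain ⟨h1, h2⟩ := M.mem_powersetCard_of_around hSf hK
  have hou (K : Finset (Pt d)) (hK : K ∈ M.elems) := M.oscDecay_of_H1 hΩ hK hu hG hw
  have hov (K : Finset (Pt d)) (hK : K ∈ M.elems) := M.oscDecay_of_H1 hΩ hK hv hH hw'
  have hpi {f : Pt d → Pt d} (hf : MemLp f 2 (volume.restrict Ω)) (i : Fin d) :
      MemLp (fun x => f x i) 2 (volume.restrict Ω) :=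
    (EuclideanSpace.proj i : Pt d →L[ℝ] ℝ).comp_memLp' hf
  have hpi' {f : Pt d → Ten d} (hf : MemLp f 2 (volume.restrict Ω)) (i : Fin d × Fin d) :
      MemLp (fun x => f x i) 2 (volume.restrict Ω) :=
    (EuclideanSpace.proj i : Ten d →L[ℝ] ℝ).comp_memLp' hf
  -- the difference has zero trace
  have hdu : MemLp (fun x => u x + -v x) 2 (volume.restrict Ω) := hu.add hv.neg
  have hdG : MemLp (fun x => G x + -H x) 2 (volume.restrict Ω) := hG.add hH.neg
  have htest {U : Set (Pt d)} {ψ : Pt d → ℝ} (hψ : IsTest U ψ) :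
      MemLp ψ 2 (volume.restrict Ω) :=
    (hψ.1.continuous.memLp_of_hasCompactSupport hψ.2.1 (p := 2) (μ := volume)).restrict Ω
  have htest' {U : Set (Pt d)} {ψ : Pt d → ℝ} (hψ : IsTest U ψ) (j : Fin d) :
      MemLp (partialD j ψ) 2 (volume.restrict Ω) :=
    ((hψ.cont_partialD j).memLp_of_hasCompactSupport (hψ.supp_partialD j)
      (p := 2) (μ := volume)).restrict Ω
  have hzd : ∀ i j ψ, IsTest univ ψ → ∫ x in Ω, ((u x + -v x) i * partialD j ψ x +
      (G x + -H x) (i, j) * ψ x) = 0 := by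
    intro i j ψ hψ
    have i1 : IntegrableOn (fun x => u x i * partialD j ψ x + G x (i, j) * ψ x) Ω :=
      ((hpi hu i).integrable_mul (htest' hψ j)).add ((hpi' hG (i, j)).integrable_mul (htest hψ))
    have i2 : IntegrableOn (fun x => v x i * partialD j ψ x + H x (i, j) * ψ x) Ω :=
      ((hpi hv i).integrable_mul (htest' hψ j)).add ((hpi' hH (i, j)).integrable_mul (htest hψ))
    rw [← sub_eq_zero.2 (hz i j ψ hψ), ← integral_sub i1 i2]
    refine integral_congr_ae (ae_of_all _ fun x => ?_)
    simp only [PiLp.add_apply, PiLp.neg_apply]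
    ring
  have hwd : ∀ i j, IsWeakPartial Ω j (fun x => (u x + -v x) i) fun x => (G x + -H x) (i, j) := by
    intro i j ψ hψ
    have i1 := (hpi hdu i).integrable_mul (htest' hψ j)
    have i2 := (hpi' hdG (i, j)).integrable_mul (htest hψ)
    have h3 := hzd i j ψ (hψ.mono (subset_univ _))
    have h4 := integral_add i1 i2
    simp only [Pi.mul_apply] at h4
    rw [h4] at h3
    exact eq_neg_of_add_eq_zero_left h3
  have h3 := M.sum_trace_mul_normal_eq_zero hd hΩ (u := fun x => u x + -v x)
    (fun K hK => M.oscDecay_of_H1 hΩ hK hdu hdG hwd)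
    (fun K hK i j => M.hasDivOn_of_H1 hΩ hK hdu hdG hwd i j) isOpen_univ hzd hSf
  have hneg : OscDecay (hull K) fun x => -v x := (hov K h1).clm (-ContinuousLinearMap.id ℝ (Pt d))
  filter_upwards [h3, M.traceFrom_add hd h1 h2 (hou K h1) hneg,
    M.traceFrom_clm hd h1 h2 (hov K h1) (-ContinuousLinearMap.id ℝ (Pt d)),
    M.trace_bdry hd hΩ hS hK (hov K h1) hvi] with x hx1 hx2 hx3 hx4 K' hK'
  rw [hKS, Finset.mem_singleton] at hK'
  subst hK'
  rw [hx4.2]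
  refine M.eq_of_forall_mul_normal hd hSf hK fun i j => ?_
  have h4 := hx1 (mem_univ x) i j
  rw [hKS, Finset.sum_singleton, hx2] at h4
  have h5 : traceFrom (hull K') (fun x => -v x) x = -traceFrom (hull K') v x := hx3
  rw [h5, PiLp.add_apply, PiLp.neg_apply] at h4
  linarith

/-- The divergence of a smooth tensor field. -/
noncomputable def classicalDiv (f : Pt d → Ten d) (x : Pt d) : Pt d :=
  WithLp.toLp 2 fun i => ∑ j, partialD j (fun y => f y (i, j)) x

lemma continuous_partialD {φ : Pt d → ℝ} (hφ : ContDiff ℝ ((⊤ : ℕ∞) : WithTop ℕ∞) φ) (j : Fin d) :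
    Continuous (partialD j φ) := (hφ.continuous_fderiv (by simp)).clm_apply continuous_const

lemma continuous_classicalDiv {f : Pt d → Ten d}
    (hf : ∀ ij, ContDiff ℝ ((⊤ : ℕ∞) : WithTop ℕ∞) fun x => f x ij) :
    Continuous (classicalDiv f) := by
  refine (PiLp.continuous_toLp 2 _).comp (continuous_pi fun i => ?_)
  exact continuous_finsetSum _ fun j _ => continuous_partialD (hf (i, j)) j

/-- Integration by parts against test functions. -/
lemma integral_mul_partialD {φ ψ : Pt d → ℝ} (hφ : ContDiff ℝ ((⊤ : ℕ∞) : WithTop ℕ∞) φ)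
    {U : Set (Pt d)} (hψ : IsTest U ψ) (j : Fin d) :
    ∫ x, φ x * partialD j ψ x = -∫ x, partialD j φ x * ψ x := by
  have hs : HasCompactSupport ψ := hψ.2.1
  refine integral_mul_fderiv_eq_neg_fderiv_mul_of_integrable ?_ ?_ ?_
    (fun x _ => hφ.differentiable (by simp) x) (fun x _ => hψ.1.differentiable (by simp) x)
  · exact ((continuous_partialD hφ j).mul hψ.1.continuous).integrable_of_hasCompactSupport
      hs.mul_left
  · exact (hφ.continuous.mul (hψ.cont_partialD j)).integrable_of_hasCompactSupport
      (hψ.supp_partialD j).mul_left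
  · exact (hφ.continuous.mul hψ.1.continuous).integrable_of_hasCompactSupport hs.mul_left

lemma isWeakDiv_classicalDiv {U : Set (Pt d)} {τ f : Pt d → Ten d}
    (hf : ∀ ij, ContDiff ℝ ((⊤ : ℕ∞) : WithTop ℕ∞) fun x => f x ij)
    (h : τ =ᵐ[volume.restrict U] f) : IsWeakDiv U τ (classicalDiv f) := by
  intro i φ hφ
  have e1 : ∫ x in U, ∑ j, τ x (i, j) * partialD j φ x =
      ∫ x in U, ∑ j, f x (i, j) * partialD j φ x := by
    refine integral_congr_ae ?_
    filter_upwards [h] with x hx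
    rw [hx]
  rw [e1, hφ.setIntegral_mul fun x => classicalDiv f x i,
    hφ.setIntegral_sum_mul_partialD fun x => WithLp.toLp 2 fun j => f x (i, j)]
  simp only [classicalDiv, Finset.sum_mul]
  rw [integral_finsetSum, integral_finsetSum, ← Finset.sum_neg_distrib]
  · exact Finset.sum_congr rfl fun j _ => integral_mul_partialD (hf (i, j)) hφ j
  · intro j _
    exact ((continuous_partialD (hf (i, j)) j).mul hφ.1.continuous).integrable_of_hasCompactSupport
      (HasCompactSupport.mul_left hφ.2.1)
  · intro j _
    exact ((hf (i, j)).continuous.mul (hφ.cont_partialD j)).integrable_of_hasCompactSupport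
      (hφ.supp_partialD j).mul_left

end Mesh

/-! ### Green's formula on the mesh -/

lemma integrable_inner_of_memLp {α V : Type*} [MeasurableSpace α] [NormedAddCommGroup V]
    [InnerProductSpace ℝ V] {μ : Measure α} {f g : α → V} (hf : MemLp f 2 μ) (hg : MemLp g 2 μ) :
    Integrable (fun x => (inner ℝ (f x) (g x) : ℝ)) μ := by
  refine (L2.integrable_inner (𝕜 := ℝ) (hf.toLp f) (hg.toLp g)).congr ?_
  filter_upwards [hf.coeFn_toLp, hg.coeFn_toLp] with x h1 h2
  rw [h1, h2]

lemma inner_matVec {d : ℕ} (τ : Ten d) (u n : Pt d) :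
    inner ℝ u (matVec τ n) = ∑ i, ∑ j, u i * n j * τ (i, j) := by
  rw [PiLp.inner_apply]
  refine Finset.sum_congr rfl fun i _ => ?_
  simp only [matVec, RCLike.inner_apply, conj_trivial, Finset.sum_mul]
  exact Finset.sum_congr rfl fun j _ => by ring

namespace Mesh

variable {d : ℕ} {Ω : Set (Pt d)} (M : Mesh Ω) {K K' S S' : Finset (Pt d)}

/-- Tensor fields that agree on each element with a smooth field. -/
def IsPiecewiseSmooth (τ : Pt d → Ten d) : Prop :=
  ∀ K ∈ M.elems, ∃ f : Pt d → Ten d, (∀ ij, ContDiff ℝ ((⊤ : ℕ∞) : WithTop ℕ∞) fun x => f x ij) ∧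
    τ =ᵐ[volume.restrict (hull K)] f

lemma continuous_of_components {f : Pt d → Ten d}
    (hf : ∀ ij, ContDiff ℝ ((⊤ : ℕ∞) : WithTop ℕ∞) fun x => f x ij) : Continuous f :=
  (PiLp.continuous_toLp 2 _).comp (continuous_pi fun ij => (hf ij).continuous)

/-- Green's formula on an element for a smooth tensor field. -/
lemma green_elem_tensor (hd : 2 ≤ d) (hK : K ∈ M.elems) {u : Pt d → Pt d}
    {G : Pt d → Ten d} (hu : OscDecay (hull K) u)
    (hdiv : ∀ i j, HasDivOn K (fun x => u x i • EuclideanSpace.single j (1 : ℝ))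
      fun x => G x (i, j)) {f : Pt d → Ten d}
    (hf : ∀ ij, ContDiff ℝ ((⊤ : ℕ∞) : WithTop ℕ∞) fun x => f x ij) :
    ∫ x in hull K, (inner ℝ (G x) (f x) + inner ℝ (u x) (classicalDiv f x)) =
      ∑ S ∈ K.powersetCard d, ∫ x, inner ℝ (traceFrom (hull K) u x) (matVec (f x) (normal K S))
        ∂surf (hull S) := by
  have e1 : ∀ x, inner ℝ (G x) (f x) + inner ℝ (u x) (classicalDiv f x) =
      ∑ i, ∑ j, (∑ l, (u x i • EuclideanSpace.single j (1 : ℝ) : Pt d) l *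
        partialD l (fun y => f y (i, j)) x + G x (i, j) * f x (i, j)) := by
    intro x
    simp only [sum_smul_single_mul, Finset.sum_add_distrib]
    rw [add_comm]
    congr 1
    · rw [PiLp.inner_apply]
      refine Finset.sum_congr rfl fun i _ => ?_
      simp only [classicalDiv, RCLike.inner_apply, conj_trivial, Finset.sum_mul]
      exact Finset.sum_congr rfl fun j _ => mul_comm _ _
    · rw [PiLp.inner_apply, Fintype.sum_prod_type]
      refine Finset.sum_congr rfl fun i _ => Finset.sum_congr rfl fun j _ => ?_
      simp [mul_comm]
  simp only [e1]
  rw [integral_finsetSum _ fun i _ => integrable_finsetSum _ fun j _ =>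
    (hdiv i j).integrableOn (hf (i, j))]
  rw [Finset.sum_congr rfl fun i _ => integral_finsetSum _ fun j _ =>
    (hdiv i j).integrableOn (hf (i, j))]
  rw [Finset.sum_congr rfl fun i _ => Finset.sum_congr rfl fun j _ =>
    M.green_elem hd hK (hdiv i j) (hf (i, j))]
  rw [Finset.sum_congr rfl fun i _ => Finset.sum_comm, Finset.sum_comm]
  refine Finset.sum_congr rfl fun S hS => ?_
  have hI (i j : Fin d) : Integrable (fun x => inner ℝ (traceFrom (hull K)
      (fun x => u x i • EuclideanSpace.single j (1 : ℝ)) x) (normal K S) * f x (i, j))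
      (surf (hull S)) := by
    have h1 := M.integrable_trace_normal hd hK hS (hdiv i j).osc (normal K S)
    obtain ⟨C, hC⟩ := (isCompact_hull S).exists_bound_of_continuousOn
      (hf (i, j)).continuous.continuousOn
    exact h1.mul_bdd (hf (i, j)).continuous.aestronglyMeasurable
      ((ae_restrict_mem (measurableSet_hull S)).mono fun x hx => hC x hx)
  rw [Finset.sum_congr rfl fun i _ => (integral_finsetSum _ fun j _ => hI i j).symm,
    ← integral_finsetSum _ fun i _ => integrable_finsetSum _ fun j _ => hI i j]
  refine integral_congr_ae ?_
  have h2 : ∀ᵐ x ∂surf (hull S), ∀ i j : Fin d,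
      traceFrom (hull K) (fun x => u x i • EuclideanSpace.single j (1 : ℝ)) x =
      traceFrom (hull K) u x i • (EuclideanSpace.single j (1 : ℝ) : Pt d) := by
    refine ae_all_iff.2 fun i => ae_all_iff.2 fun j => ?_
    exact M.traceFrom_clm hd hK hS hu
      ((EuclideanSpace.proj i : Pt d →L[ℝ] ℝ).smulRight (EuclideanSpace.single j (1 : ℝ) : Pt d))
  filter_upwards [h2] with x hx
  rw [inner_matVec]
  refine Finset.sum_congr rfl fun i _ => Finset.sum_congr rfl fun j _ => ?_
  rw [hx i j, real_inner_smul_left, EuclideanSpace.inner_single_left]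
  simp

lemma classicalDiv_integrable {f : Pt d → Ten d}
    (hf : ∀ ij, ContDiff ℝ ((⊤ : ℕ∞) : WithTop ℕ∞) fun x => f x ij) {u : Pt d → Pt d}
    (hu : MemLp u 2 (volume.restrict (hull K))) :
    IntegrableOn (fun x => (inner ℝ (u x) (classicalDiv f x) : ℝ)) (hull K) := by
  have : IsFiniteMeasure (volume.restrict (hull K)) :=
    ⟨by simpa using (isCompact_hull K).measure_lt_top⟩
  obtain ⟨C, hC⟩ := (isCompact_hull K).exists_bound_of_continuousOn
    (continuous_classicalDiv hf).continuousOn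
  refine integrable_inner_of_memLp hu (MemLp.of_bound
    (continuous_classicalDiv hf).aestronglyMeasurable C ?_)
  exact (ae_restrict_mem (measurableSet_hull K)).mono fun x hx => hC x hx

/-- Green's formula on the mesh, for an `H¹` field and a piecewise smooth tensor field. -/
theorem green_mesh (hd : 2 ≤ d) (hΩ : IsLipschitzDomain Ω) {u : Pt d → Pt d}
    {G : Pt d → Ten d} (hu : MemLp u 2 (volume.restrict Ω)) (hG : MemLp G 2 (volume.restrict Ω))
    (hw : ∀ i j, IsWeakPartial Ω j (fun x => u x i) fun x => G x (i, j)) {τ : Pt d → Ten d}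
    (hτ : M.IsPiecewiseSmooth τ) :
    prodL2 Ω G τ + prodL2 Ω u (M.brokenDiv τ) = ∑ S ∈ M.faces, ∫ x, ∑ K ∈ M.around S,
      inner ℝ (traceFrom (hull K) u x) (matVec (traceFrom (hull K) τ x) (normal K S))
        ∂surf (hull S) := by
  choose! f hf hfτ using hτ
  have hou (K : Finset (Pt d)) (hK : K ∈ M.elems) := M.oscDecay_of_H1 hΩ hK hu hG hw
  have hdiv (K : Finset (Pt d)) (hK : K ∈ M.elems) := M.hasDivOn_of_H1 hΩ hK hu hG hw
  have hbd (K : Finset (Pt d)) (hK : K ∈ M.elems) :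
      M.brokenDiv τ =ᵐ[volume.restrict (hull K)] classicalDiv (f K) := by
    have : IsFiniteMeasure (volume.restrict (hull K)) :=
      ⟨by simpa using (isCompact_hull K).measure_lt_top⟩
    obtain ⟨C, hC⟩ := (isCompact_hull K).exists_bound_of_continuousOn
      (continuous_classicalDiv (hf K hK)).continuousOn
    refine M.brokenDiv_ae_eq hK (MemLp.of_bound
      (continuous_classicalDiv (hf K hK)).aestronglyMeasurable C
      ((ae_restrict_mem (measurableSet_hull K)).mono fun x hx => hC x hx))
      (isWeakDiv_classicalDiv (hf K hK) ?_)
    rw [Measure.restrict_congr_set (interior_hull_ae_eq K)]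
    exact hfτ K hK
  have i1 (K : Finset (Pt d)) (hK : K ∈ M.elems) :
      IntegrableOn (fun x => (inner ℝ (G x) (f K x) : ℝ)) (hull K) := by
    have : IsFiniteMeasure (volume.restrict (hull K)) :=
      ⟨by simpa using (isCompact_hull K).measure_lt_top⟩
    obtain ⟨C, hC⟩ := (isCompact_hull K).exists_bound_of_continuousOn
      (continuous_of_components (hf K hK)).continuousOn
    refine integrable_inner_of_memLp (M.memLp_hull hΩ hK hG) (MemLp.of_bound
      (continuous_of_components (hf K hK)).aestronglyMeasurable C ?_)
    exact (ae_restrict_mem (measurableSet_hull K)).mono fun x hx => hC x hx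
  have i2 (K : Finset (Pt d)) (hK : K ∈ M.elems) :=
    classicalDiv_integrable (hf K hK) (M.memLp_hull hΩ hK hu)
  have e1 (K : Finset (Pt d)) (hK : K ∈ M.elems) :
      (fun x => (inner ℝ (G x) (τ x) : ℝ)) =ᵐ[volume.restrict (hull K)]
        fun x => inner ℝ (G x) (f K x) := by
    filter_upwards [hfτ K hK] with x hx
    rw [hx]
  have e2 (K : Finset (Pt d)) (hK : K ∈ M.elems) :
      (fun x => (inner ℝ (u x) (M.brokenDiv τ x) : ℝ)) =ᵐ[volume.restrict (hull K)]
        fun x => inner ℝ (u x) (classicalDiv (f K) x) := by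
    filter_upwards [hbd K hK] with x hx
    rw [hx]
  rw [prodL2, prodL2,
    M.setIntegral_eq_sum hΩ fun K hK => (i1 K hK).congr_fun_ae (e1 K hK).symm,
    M.setIntegral_eq_sum hΩ fun K hK => (i2 K hK).congr_fun_ae (e2 K hK).symm,
    ← Finset.sum_add_distrib]
  have e3 : ∀ K ∈ M.elems, (∫ x in hull K, inner ℝ (G x) (τ x)) +
      ∫ x in hull K, inner ℝ (u x) (M.brokenDiv τ x) = ∑ S ∈ K.powersetCard d,
      ∫ x, inner ℝ (traceFrom (hull K) u x) (matVec (traceFrom (hull K) τ x) (normal K S))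
        ∂surf (hull S) := by
    intro K hK
    rw [integral_congr_ae (e1 K hK), integral_congr_ae (e2 K hK), ← integral_add (i1 K hK) (i2 K hK),
      M.green_elem_tensor hd hK (hou K hK) (hdiv K hK) (hf K hK)]
    refine Finset.sum_congr rfl fun S hS => integral_congr_ae ?_
    filter_upwards [ae_mem_hull (Finset.mem_powersetCard.1 hS).1] with x hx
    rw [M.traceFrom_of_continuous hK (continuous_of_components (hf K hK)) (hfτ K hK) hx]
  rw [Finset.sum_congr rfl e3, M.sum_elems_faces]
  refine Finset.sum_congr rfl fun S hS => ?_
  refine (integral_finsetSum _ fun K hK => ?_).symm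
  obtain ⟨h1, h2⟩ := M.mem_powersetCard_of_around hS hK
  have hG := M.traceGeom hd h1 h2
  have := hG.finite'
  have hLu := ((hou K h1).trace hG).1.integrable one_le_two
  have hc : Continuous fun x => matVec (f K x) (normal K S) := by
    unfold matVec
    refine (PiLp.continuous_toLp 2 _).comp (continuous_pi fun i => ?_)
    exact continuous_finsetSum _ fun j _ => (hf K h1 (i, j)).continuous.mul continuous_const
  obtain ⟨C, hC⟩ := (isCompact_hull S).exists_bound_of_continuousOn hc.continuousOn
  have hbound : MemLp (fun x => matVec (f K x) (normal K S)) 2 (surf (hull S)) :=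
    MemLp.of_bound hc.aestronglyMeasurable C
      ((ae_restrict_mem (measurableSet_hull S)).mono fun x hx => hC x hx)
  refine (integrable_inner_of_memLp ((hou K h1).trace hG).1 hbound).congr ?_
  filter_upwards [ae_mem_hull (Finset.mem_powersetCard.1 h2).1] with x hx
  rw [M.traceFrom_of_continuous h1 (continuous_of_components (hf K h1)) (hfτ K h1) hx]

/-- Green's formula on the mesh in terms of the means and jumps. -/
theorem green_mesh_jump (hd : 2 ≤ d) (hΩ : IsLipschitzDomain Ω) {u v : Pt d → Pt d}
    {G : Pt d → Ten d} (hu : MemLp u 2 (volume.restrict Ω)) (hG : MemLp G 2 (volume.restrict Ω))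
    (hw : ∀ i j, IsWeakPartial Ω j (fun x => u x i) fun x => G x (i, j))
    (hv : ∀ S ∈ M.bdryFaces, ∀ᵐ x ∂surf (hull S), ∀ K ∈ M.around S,
      traceFrom (hull K) u x = traceFrom Ω v x) {τ : Pt d → Ten d}
    (hτ : M.IsPiecewiseSmooth τ) :
    prodL2 Ω G τ + prodL2 Ω u (M.brokenDiv τ) = M.prodFaces (M.mean u) (M.jump τ) +
      ∑ S ∈ M.bdryFaces, ∫ x, inner ℝ (traceFrom Ω v x) (M.jump τ S x) ∂surf (hull S) := by
  rw [M.green_mesh hd hΩ hu hG hw hτ, M.sum_faces hd hΩ, prodFaces]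
  have hpi (i : Fin d) : MemLp (fun x => u x i) 2 (volume.restrict Ω) :=
    (EuclideanSpace.proj i : Pt d →L[ℝ] ℝ).comp_memLp' hu
  have hpi' (i : Fin d × Fin d) : MemLp (fun x => G x i) 2 (volume.restrict Ω) :=
    (EuclideanSpace.proj i : Ten d →L[ℝ] ℝ).comp_memLp' hG
  congr 1
  · refine Finset.sum_congr rfl fun S hS => integral_congr_ae ?_
    filter_upwards [M.trace_eq_mean hd hΩ (fun K hK => M.oscDecay_of_H1 hΩ hK hu hG hw)
      (fun K hK => M.hasDivOn_of_H1 hΩ hK hu hG hw) (fun i j ψ hψ => by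
        have i1 := (hpi i).integrable_mul
          (((hψ.cont_partialD j).memLp_of_hasCompactSupport (hψ.supp_partialD j)
            (p := 2) (μ := volume)).restrict Ω)
        have i2 := (hpi' (i, j)).integrable_mul
          ((hψ.1.continuous.memLp_of_hasCompactSupport hψ.2.1 (p := 2) (μ := volume)).restrict Ω)
        refine (integral_add i1 i2).trans ?_
        have := hw i j ψ hψ
        simp only [Pi.mul_apply]
        rw [this]
        ring) hS] with x hx
    rw [jump, inner_sum]
    exact Finset.sum_congr rfl fun K hK => by rw [hx K hK]
  · refine Finset.sum_congr rfl fun S hS => integral_congr_ae ?_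
    filter_upwards [hv S hS] with x hx
    rw [jump, inner_sum]
    exact Finset.sum_congr rfl fun K hK => by rw [hx K hK]

end Mesh

/-! ### Piecewise constant coefficients, means and jumps -/

namespace Body

variable {d J : ℕ} (B : Body d J)

lemma sum_indicator_part {c : Fin J → ℝ} {j : Fin J} {x : Pt d} (hx : x ∈ B.part j) :
    ∑ i, (B.part i).indicator (fun _ => c i) x = c j := by
  rw [Finset.sum_eq_single_of_mem j (Finset.mem_univ _), indicator_of_mem hx]
  intro i _ hi
  exact indicator_of_notMem (fun h => Set.disjoint_left.1 (B.part_disjoint i j hi) h hx) _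

lemma ρ_of_mem {j : Fin J} {x : Pt d} (hx : x ∈ B.part j) : B.ρ x = B.ρv j :=
  B.sum_indicator_part hx

lemma ω_of_mem {j : Fin J} {x : Pt d} (hx : x ∈ B.part j) : B.ω x = B.ωv j :=
  B.sum_indicator_part hx

lemma one_div_ρ (x : Pt d) : 1 / B.ρ x = ∑ j, (B.part j).indicator (fun _ => 1 / B.ρv j) x := by
  by_cases h : ∃ j, x ∈ B.part j
  · obtain ⟨j, hj⟩ := h
    rw [B.ρ_of_mem hj, B.sum_indicator_part hj]
  · push Not at h
    rw [ρ, Finset.sum_eq_zero fun j _ => indicator_of_notMem (h j) _,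
      Finset.sum_eq_zero fun j _ => indicator_of_notMem (h j) _, div_zero]

lemma memLp_sum_indicator_smul {V : Type} [NormedAddCommGroup V] [NormedSpace ℝ V]
    {μ : Measure (Pt d)} (c : Fin J → ℝ) {f : Pt d → V} (hf : MemLp f 2 μ) :
    MemLp (fun x => (∑ j, (B.part j).indicator (fun _ => c j) x) • f x) 2 μ := by
  have : ∀ x, (∑ j, (B.part j).indicator (fun _ => c j) x) • f x =
      ∑ j, (B.part j).indicator (fun x => c j • f x) x := by
    intro x
    rw [Finset.sum_smul]
    refine Finset.sum_congr rfl fun j _ => ?_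
    by_cases hx : x ∈ B.part j
    · rw [indicator_of_mem hx, indicator_of_mem hx]
    · rw [indicator_of_notMem hx, indicator_of_notMem hx, zero_smul]
  simp only [this]
  exact memLp_finsetSum _ fun j _ => (hf.const_smul (c j)).indicator (B.part_open j).measurableSet

lemma memLp_ω_smul {V : Type} [NormedAddCommGroup V] [NormedSpace ℝ V]
    {μ : Measure (Pt d)} {f : Pt d → V} (hf : MemLp f 2 μ) : MemLp (fun x => B.ω x • f x) 2 μ :=
  B.memLp_sum_indicator_smul B.ωv hf

lemma memLp_overρ {μ : Measure (Pt d)} {f : Pt d → Pt d} (hf : MemLp f 2 μ) :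
    MemLp (B.overρ f) 2 μ := by
  have h : B.overρ f = fun x => (∑ j, (B.part j).indicator (fun _ => 1 / B.ρv j) x) • f x :=
    funext fun x => by rw [overρ, B.one_div_ρ]
  rw [h]
  exact B.memLp_sum_indicator_smul (fun j => 1 / B.ρv j) hf

lemma memLp_jp (q : LL B.Ω) : MemLp (B.jp (fld q)) 2 (volume.restrict B.Ω) :=
  (Lp.memLp q.1).add (B.memLp_ω_smul (Lp.memLp q.2))

end Body

lemma prodL2_congr {d : ℕ} {V : Type} [NormedAddCommGroup V] [InnerProductSpace ℝ V]
    {Ω : Set (Pt d)} {f f' g g' : Pt d → V} (h : f =ᵐ[volume.restrict Ω] f')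
    (h' : g =ᵐ[volume.restrict Ω] g') : prodL2 Ω f g = prodL2 Ω f' g' := by
  refine integral_congr_ae ?_
  filter_upwards [h, h'] with x h1 h2
  rw [h1, h2]

section ProdL2

variable {d : ℕ} {V : Type} [NormedAddCommGroup V] [InnerProductSpace ℝ V] {Ω : Set (Pt d)}

lemma prodL2_zero_right (f : Pt d → V) : prodL2 Ω f (fun _ => 0) = 0 := by simp [prodL2]

lemma prodL2_add_left {f f' g : Pt d → V} (hf : MemLp f 2 (volume.restrict Ω))
    (hf' : MemLp f' 2 (volume.restrict Ω)) (hg : MemLp g 2 (volume.restrict Ω)) :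
    prodL2 Ω (fun x => f x + f' x) g = prodL2 Ω f g + prodL2 Ω f' g := by
  simp only [prodL2, inner_add_left]
  exact integral_add (integrable_inner_of_memLp hf hg) (integrable_inner_of_memLp hf' hg)

lemma prodL2_add_right {f g g' : Pt d → V} (hf : MemLp f 2 (volume.restrict Ω))
    (hg : MemLp g 2 (volume.restrict Ω)) (hg' : MemLp g' 2 (volume.restrict Ω)) :
    prodL2 Ω f (fun x => g x + g' x) = prodL2 Ω f g + prodL2 Ω f g' := by
  simp only [prodL2, inner_add_right]
  exact integral_add (integrable_inner_of_memLp hf hg) (integrable_inner_of_memLp hf hg')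

lemma prodL2_neg_right (f g : Pt d → V) : prodL2 Ω f (fun x => -g x) = -prodL2 Ω f g := by
  simp only [prodL2, inner_neg_right, integral_neg]

end ProdL2

lemma IsWeakDiv.congr {d : ℕ} {U : Set (Pt d)} {τ τ' : Pt d → Ten d} {v v' : Pt d → Pt d}
    (h : IsWeakDiv U τ v) (hτ : τ =ᵐ[volume.restrict U] τ') (hv : v =ᵐ[volume.restrict U] v') :
    IsWeakDiv U τ' v' := by
  intro i φ hφ
  have h1 := h i φ hφ
  rw [integral_congr_ae (g := fun x => ∑ j, τ' x (i, j) * partialD j φ x)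
      (by filter_upwards [hτ] with x hx; rw [hx]),
    integral_congr_ae (f := fun x => v x i * φ x) (g := fun x => v' x i * φ x)
      (by filter_upwards [hv] with x hx; rw [hx])] at h1
  exact h1

/-- The field `ψ e_i ⊗ e_j`. -/
noncomputable def unitField {d : ℕ} (i j : Fin d) (ψ : Pt d → ℝ) (x : Pt d) : Ten d :=
  ψ x • EuclideanSpace.single (i, j) 1

lemma unitField_apply {d : ℕ} (i j : Fin d) (ψ : Pt d → ℝ) (x : Pt d) (kl : Fin d × Fin d) :
    unitField i j ψ x kl = (if kl = (i, j) then 1 else 0) * ψ x := by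
  simp [unitField, mul_comm]

lemma contDiff_unitField {d : ℕ} (i j : Fin d) {ψ : Pt d → ℝ}
    (hψ : ContDiff ℝ ((⊤ : ℕ∞) : WithTop ℕ∞) ψ) (kl : Fin d × Fin d) :
    ContDiff ℝ ((⊤ : ℕ∞) : WithTop ℕ∞) fun x => unitField i j ψ x kl := by
  simp only [unitField_apply]
  exact contDiff_const.mul hψ

lemma classicalDiv_unitField {d : ℕ} (i j : Fin d) {ψ : Pt d → ℝ}
    (hψ : ContDiff ℝ ((⊤ : ℕ∞) : WithTop ℕ∞) ψ) (x : Pt d) :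
    Mesh.classicalDiv (unitField i j ψ) x = partialD j ψ x • EuclideanSpace.single i 1 := by
  have hp (k l : Fin d) : partialD l (fun y => unitField i j ψ y (k, l)) x =
      (if (k, l) = (i, j) then 1 else 0) * partialD l ψ x := by
    simp only [unitField_apply, partialD]
    rw [fderiv_const_mul (hψ.differentiable (by simp) x)]
    rfl
  ext k
  simp only [Mesh.classicalDiv, hp, Prod.mk.injEq]
  rw [Finset.sum_eq_single_of_mem j (Finset.mem_univ _)]
  · by_cases hk : k = i <;> simp [hk]
  · intro l _ hl
    simp [hl]

lemma contDiff_eval {d : ℕ} (p : MvPolynomial (Fin d) ℝ) :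
    ContDiff ℝ ((⊤ : ℕ∞) : WithTop ℕ∞) fun x : Pt d => MvPolynomial.eval (fun i => x i) p := by
  induction p using MvPolynomial.induction_on with
  | C a => simpa using contDiff_const
  | add p q hp hq => simpa using hp.add hq
  | mul_X p i hp =>
    simpa using hp.mul (EuclideanSpace.proj i : Pt d →L[ℝ] ℝ).contDiff

namespace Mesh

variable {d : ℕ} {Ω : Set (Pt d)} (M : Mesh Ω) {K K' S S' : Finset (Pt d)}

lemma integrableOn_of_elems (hΩ : IsLipschitzDomain Ω) {f : Pt d → ℝ}
    (hf : ∀ K ∈ M.elems, IntegrableOn f (hull K)) : IntegrableOn f Ω := by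
  refine IntegrableOn.congr_set_ae ?_ (M.ae_eq_closure hΩ)
  rw [← M.cover]
  exact (integrableOn_finset_iUnion).2 hf

lemma IsPiecewiseSmooth.brokenDiv {τ : Pt d → Ten d} (hτ : M.IsPiecewiseSmooth τ) :
    ∀ K ∈ M.elems, MemLp (M.brokenDiv τ) 2 (volume.restrict (hull K)) := by
  intro K hK
  obtain ⟨f, hf, hfτ⟩ := hτ K hK
  have : IsFiniteMeasure (volume.restrict (hull K)) :=
    ⟨by simpa using (isCompact_hull K).measure_lt_top⟩
  obtain ⟨C, hC⟩ := (isCompact_hull K).exists_bound_of_continuousOn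
    (continuous_classicalDiv hf).continuousOn
  have h1 : MemLp (classicalDiv f) 2 (volume.restrict (hull K)) :=
    MemLp.of_bound (continuous_classicalDiv hf).aestronglyMeasurable C
      ((ae_restrict_mem (measurableSet_hull K)).mono fun x hx => hC x hx)
  refine (memLp_congr_ae (M.brokenDiv_ae_eq hK h1 (isWeakDiv_classicalDiv hf ?_))).2 h1
  rw [Measure.restrict_congr_set (interior_hull_ae_eq K)]
  exact hfτ

lemma continuous_matVec {f : Pt d → Ten d} (hf : Continuous f) (n : Pt d) :
    Continuous fun x => matVec (f x) n := by
  unfold matVec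
  refine (PiLp.continuous_toLp 2 _).comp (continuous_pi fun i => continuous_finsetSum _ fun j _ => ?_)
  exact ((EuclideanSpace.proj (i, j) : Ten d →L[ℝ] ℝ).continuous.comp hf).mul continuous_const

lemma IsPiecewiseSmooth.memLp_jump {τ : Pt d → Ten d} (hτ : M.IsPiecewiseSmooth τ) (hd : 2 ≤ d)
    (hS : S ∈ M.faces) : MemLp (M.jump τ S) 2 (surf (hull S)) := by
  have := M.isFiniteMeasure_surf hd hS
  unfold jump
  refine memLp_finsetSum _ fun K hK => ?_
  obtain ⟨h1, h2⟩ := M.mem_powersetCard_of_around hS hK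
  obtain ⟨f, hf, hfτ⟩ := hτ K h1
  have hc := continuous_of_components hf
  have hc' := continuous_matVec hc (normal K S)
  obtain ⟨C, hC⟩ := (isCompact_hull S).exists_bound_of_continuousOn hc'.continuousOn
  have h3 : MemLp (fun x => matVec (f x) (normal K S)) 2 (surf (hull S)) :=
    MemLp.of_bound hc'.aestronglyMeasurable C
      ((ae_restrict_mem (measurableSet_hull S)).mono fun x hx => hC x hx)
  refine (memLp_congr_ae ?_).2 h3
  filter_upwards [ae_mem_hull (Finset.mem_powersetCard.1 h2).1] with x hx
  rw [M.traceFrom_of_continuous h1 hc hfτ hx]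

lemma memLp_mean (hd : 2 ≤ d) (hS : S ∈ M.faces) {u : Pt d → Pt d}
    (hu : ∀ K ∈ M.elems, OscDecay (hull K) u) : MemLp (M.mean u S) 2 (surf (hull S)) := by
  have h : MemLp (fun x => ∑ K ∈ M.around S, traceFrom (hull K) u x) 2 (surf (hull S)) :=
    memLp_finsetSum _ fun K hK => by
      obtain ⟨h1, h2⟩ := M.mem_powersetCard_of_around hS hK
      exact ((hu K h1).trace (M.traceGeom hd h1 h2)).1
  exact h.const_smul (1 / 2 : ℝ)

lemma mean_add (hd : 2 ≤ d) (hS : S ∈ M.faces) {u v : Pt d → Pt d}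
    (hu : ∀ K ∈ M.elems, OscDecay (hull K) u) (hv : ∀ K ∈ M.elems, OscDecay (hull K) v) :
    ∀ᵐ x ∂surf (hull S), M.mean (fun y => u y + v y) S x = M.mean u S x + M.mean v S x := by
  have h : ∀ᵐ x ∂surf (hull S), ∀ K ∈ M.around S, traceFrom (hull K) (fun y => u y + v y) x =
      traceFrom (hull K) u x + traceFrom (hull K) v x := by
    refine (Finset.eventually_all _).2 fun K hK => ?_
    obtain ⟨h1, h2⟩ := M.mem_powersetCard_of_around hS hK
    exact M.traceFrom_add hd h1 h2 (hu K h1) (hv K h1)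
  filter_upwards [h] with x hx
  rw [mean, mean, mean, Finset.sum_congr rfl hx, Finset.sum_add_distrib, smul_add]

lemma prodFaces_mean_add (hd : 2 ≤ d) {u v : Pt d → Pt d}
    (hu : ∀ K ∈ M.elems, OscDecay (hull K) u) (hv : ∀ K ∈ M.elems, OscDecay (hull K) v)
    {τ : Pt d → Ten d} (hτ : M.IsPiecewiseSmooth τ) :
    M.prodFaces (M.mean fun y => u y + v y) (M.jump τ) =
      M.prodFaces (M.mean u) (M.jump τ) + M.prodFaces (M.mean v) (M.jump τ) := by
  rw [prodFaces, prodFaces, prodFaces, ← Finset.sum_add_distrib]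
  refine Finset.sum_congr rfl fun S hS => ?_
  have hSf := M.intFaces_subset hS
  rw [← integral_add (integrable_inner_of_memLp (M.memLp_mean hd hSf hu) (hτ.memLp_jump M hd hSf))
    (integrable_inner_of_memLp (M.memLp_mean hd hSf hv) (hτ.memLp_jump M hd hSf))]
  refine integral_congr_ae ?_
  filter_upwards [M.mean_add hd hSf hu hv] with x hx
  rw [hx, inner_add_left]

lemma mean_congr {u v : Pt d → Pt d} (h : ∀ K ∈ M.elems, u =ᵐ[volume.restrict (hull K)] v) :
    M.mean u = M.mean v := by
  funext S x
  rw [mean, mean]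
  congr 1
  refine Finset.sum_congr rfl fun K hK => ?_
  exact traceFrom_congr (ae_eq_refl _) (h K (M.mem_around.1 hK).1) x

end Mesh

/-! ### From the equation of motion at an instant to the DG scheme -/

section Static

variable {d J : ℕ} (B : Body d J)

/-- The equation of motion at a fixed instant, where `z` is the time derivative of
`ȷ_ω p' + π₂ p` and `r'` that of the rotation. -/
def InstantMotion (z : PairF d) (r' : L2 B.Ω (Ten d)) (F : L2 B.Ω (Pt d)) (b : HHalf B.Ω)
    (P : B.X) : Prop :=
  ∀ q ∈ B.spaceS, B.A z (B.jω (fld q.pair)) + prodL2 B.Ω r' (B.jp (fld q.pair)) +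
    B.prodρ P.dv q.dv = -B.prodρ F q.dv + pairingΓ b (B.jp (fld q.pair)) q.dv

/-- The acceleration `(1/ρ) (div ȷ_ω⁺ p + F)`. -/
noncomputable def accel (F : L2 B.Ω (Pt d)) (P : B.X) (x : Pt d) : Pt d :=
  B.overρ P.dv x + B.overρ F x

/-- The tensor `C⁻¹ z₁ + r'`, which turns out to be the gradient of the acceleration. -/
noncomputable def strainRate (z : PairF d) (r' : L2 B.Ω (Ten d)) (x : Pt d) : Ten d :=
  B.C.inverse (z.1 x) + r' x

variable {B} {z : PairF d} {r' : L2 B.Ω (Ten d)} {F : L2 B.Ω (Pt d)} {b : HHalf B.Ω} {P : B.X}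

lemma memLp_accel : MemLp (accel B F P) 2 (volume.restrict B.Ω) :=
  (B.memLp_overρ (Lp.memLp P.2.2)).add (B.memLp_overρ (Lp.memLp F))

lemma memLp_strainRate (hz : MemLp z.1 2 (volume.restrict B.Ω)) :
    MemLp (strainRate B z r') 2 (volume.restrict B.Ω) :=
  (B.C.inverse.comp_memLp' hz).add (Lp.memLp r')

lemma memLp_smooth {V : Type} [NormedAddCommGroup V] {f : Pt d → V} (hf : Continuous f)
    (hs : HasCompactSupport f) {Ω : Set (Pt d)} : MemLp f 2 (volume.restrict Ω) :=
  (hf.memLp_of_hasCompactSupport hs (p := 2) (μ := volume)).restrict Ω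

/-- The equation of motion tested with the stresses `ψ e_i ⊗ e_j`, where `ψ` need not vanish on
the boundary. -/
lemma InstantMotion.unitField (h : InstantMotion B z r' F b P)
    (hz : MemLp z.1 2 (volume.restrict B.Ω)) (i j : Fin d) {ψ : Pt d → ℝ} (hψ : IsTest univ ψ) :
    ∫ x in B.Ω, (accel B F P x i * partialD j ψ x + strainRate B z r' x (i, j) * ψ x) =
      ∫ x in B.Ω, (b.lift.1.1 x i * partialD j ψ x + b.lift.1.2 x (i, j) * ψ x) := by
  have hη : MemLp (Zener.unitField i j ψ) 2 (volume.restrict B.Ω) := by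
    refine memLp_smooth (hψ.1.continuous.smul continuous_const) ?_
    exact hψ.2.1.smul_right
  set D : Pt d → Pt d := fun x => partialD j ψ x • EuclideanSpace.single i (1 : ℝ) with hD
  have hDL : MemLp D 2 (volume.restrict B.Ω) :=
    memLp_smooth ((hψ.cont_partialD j).smul continuous_const) (hψ.supp_partialD j).smul_right
  set q : B.X := (hη.toLp _, 0, hDL.toLp _) with hq
  have e0 : ⇑(0 : L2 B.Ω (Ten d)) =ᵐ[volume.restrict B.Ω] 0 := Lp.coeFn_zero _ _ _
  have e1 : B.jp (fld q.pair) =ᵐ[volume.restrict B.Ω] Zener.unitField i j ψ := by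
    filter_upwards [hη.coeFn_toLp, e0] with x h1 h2
    change hη.toLp _ x + B.ω x • (0 : L2 B.Ω (Ten d)) x = _
    rw [h1, h2, Pi.zero_apply, smul_zero, add_zero]
  have e2 : q.dv =ᵐ[volume.restrict B.Ω] D := hDL.coeFn_toLp
  have hcd : Mesh.classicalDiv (Zener.unitField i j ψ) = D :=
    funext fun x => classicalDiv_unitField i j hψ.1 x
  have hqS : q ∈ B.spaceS := by
    refine ⟨?_, ?_⟩
    · filter_upwards [e0] with x hx _
      exact hx
    · have h1 := Mesh.isWeakDiv_classicalDiv (fun kl => contDiff_unitField i j hψ.1 kl) e1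
      rw [hcd] at h1
      exact h1.congr (ae_eq_refl _) e2.symm
  have key := h q hqS
  have a1 : B.A z (B.jω (fld q.pair)) =
      prodL2 B.Ω (fun x => B.C.inverse (z.1 x)) (Zener.unitField i j ψ) := by
    have h1 : prodL2 B.Ω (fun x => (B.D - B.C).inverse (z.2 x)) (B.jω (fld q.pair)).2 = 0 := by
      rw [prodL2_congr (ae_eq_refl _) (g' := fun _ => 0), prodL2_zero_right]
      filter_upwards [e0] with x hx
      change B.ω x • (0 : L2 B.Ω (Ten d)) x = 0
      rw [hx, Pi.zero_apply, smul_zero]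
    rw [Body.A, h1, add_zero]
    exact prodL2_congr (ae_eq_refl _) hη.coeFn_toLp
  have i1 : MemLp (fun x => B.C.inverse (z.1 x)) 2 (volume.restrict B.Ω) :=
    B.C.inverse.comp_memLp' hz
  rw [a1, prodL2_congr (ae_eq_refl _) e1, Body.prodρ, Body.prodρ, pairingΓ,
    prodL2_congr (ae_eq_refl _) e2, prodL2_congr (ae_eq_refl _) e2, prodL2_congr (ae_eq_refl _) e1,
    prodL2_congr (ae_eq_refl _) e2] at key
  have k1 := prodL2_add_left i1 (Lp.memLp r') hη
  have k2 := prodL2_add_left (B.memLp_overρ (Lp.memLp P.2.2)) (B.memLp_overρ (Lp.memLp F)) hDL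
  have k3 : prodL2 B.Ω (strainRate B z r') (Zener.unitField i j ψ) + prodL2 B.Ω (accel B F P) D =
      prodL2 B.Ω b.lift.1.2 (Zener.unitField i j ψ) + prodL2 B.Ω b.lift.1.1 D := by
    have k1' : prodL2 B.Ω (strainRate B z r') (Zener.unitField i j ψ) = _ := k1
    have k2' : prodL2 B.Ω (accel B F P) D = _ := k2
    rw [k1', k2']
    unfold Body.X.dv at key
    linarith
  have hcomb {G : Pt d → Ten d} {w : Pt d → Pt d} (hG : MemLp G 2 (volume.restrict B.Ω))
      (hw : MemLp w 2 (volume.restrict B.Ω)) :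
      prodL2 B.Ω G (Zener.unitField i j ψ) + prodL2 B.Ω w D =
      ∫ x in B.Ω, (w x i * partialD j ψ x + G x (i, j) * ψ x) := by
    rw [prodL2, prodL2, add_comm, ← integral_add (integrable_inner_of_memLp hw hDL)
      (integrable_inner_of_memLp hG hη)]
    refine integral_congr_ae (ae_of_all _ fun x => ?_)
    simp only [hD, Zener.unitField, real_inner_smul_right, EuclideanSpace.inner_single_right]
    simp [mul_comm]
  rw [hcomb (memLp_strainRate hz) memLp_accel, hcomb (Lp.memLp _) (Lp.memLp _)] at k3
  exact k3

lemma integrable_mul_test {ι : Type} [Fintype ι] {Ω : Set (Pt d)} {f : Pt d → EuclideanSpace ℝ ι}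
    (hf : MemLp f 2 (volume.restrict Ω)) (i : ι) {ψ : Pt d → ℝ} (hψ : Continuous ψ)
    (hs : HasCompactSupport ψ) : IntegrableOn (fun x => f x i * ψ x) Ω :=
  ((EuclideanSpace.proj i : EuclideanSpace ℝ ι →L[ℝ] ℝ).comp_memLp' hf).integrable_mul
    (memLp_smooth hψ hs)

/-- The acceleration is in `H¹`. -/
lemma InstantMotion.isWeakPartial (h : InstantMotion B z r' F b P)
    (hz : MemLp z.1 2 (volume.restrict B.Ω)) (i j : Fin d) :
    IsWeakPartial B.Ω j (fun x => accel B F P x i) fun x => strainRate B z r' x (i, j) := by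
  intro ψ hψ
  have h1 := h.unitField hz i j (hψ.mono (subset_univ _))
  rw [integral_add (integrable_mul_test memLp_accel i (hψ.cont_partialD j) (hψ.supp_partialD j))
    (integrable_mul_test (memLp_strainRate hz) (i, j) hψ.1.continuous hψ.2.1),
    integral_add (integrable_mul_test (Lp.memLp _) i (hψ.cont_partialD j) (hψ.supp_partialD j))
    (integrable_mul_test (Lp.memLp _) (i, j) hψ.1.continuous hψ.2.1),
    b.lift.2 i j ψ hψ, neg_add_cancel] at h1
  exact eq_neg_of_add_eq_zero_left h1

/-- The equation for the internal variable, obtained with the stresses `(-ω τ, τ)` that `ȷ_ω⁺`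
maps to zero, eliminates the second component of the test stresses. -/
lemma InstantMotion.constitutive (h : InstantMotion B z r' F b P)
    (hz : MemLp z.1 2 (volume.restrict B.Ω)) (q : LL B.Ω)
    (hq : ∀ᵐ x ∂volume.restrict B.Ω, x ∈ B.elastic → q.2 x = 0) :
    B.A z (B.jω (fld q)) + prodL2 B.Ω r' (B.jp (fld q)) =
      prodL2 B.Ω (strainRate B z r') (B.jp (fld q)) := by
  have hωτ : MemLp (fun x => B.ω x • q.2 x) 2 (volume.restrict B.Ω) := B.memLp_ω_smul (Lp.memLp q.2)
  set p : B.X := (-hωτ.toLp _, q.2, 0) with hp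
  have e1 : ⇑(-hωτ.toLp _ : L2 B.Ω (Ten d)) =ᵐ[volume.restrict B.Ω] fun x => -(B.ω x • q.2 x) := by
    filter_upwards [Lp.coeFn_neg (hωτ.toLp _), hωτ.coeFn_toLp] with x h1 h2
    rw [h1, Pi.neg_apply, h2]
  have e2 : B.jp (fld p.pair) =ᵐ[volume.restrict B.Ω] fun _ => 0 := by
    filter_upwards [e1] with x hx
    change (-hωτ.toLp _ : L2 B.Ω (Ten d)) x + B.ω x • q.2 x = 0
    rw [hx, neg_add_cancel]
  have e3 : p.dv =ᵐ[volume.restrict B.Ω] fun _ => 0 := Lp.coeFn_zero _ _ _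
  have hpS : p ∈ B.spaceS := by
    refine ⟨hq, ?_⟩
    refine IsWeakDiv.congr (τ := fun _ => 0) (v := fun _ => 0) (fun i φ _ => ?_) e2.symm e3.symm
    simp
  have key := h p hpS
  have z1 : prodL2 B.Ω r' (B.jp (fld p.pair)) = 0 := by
    rw [prodL2_congr (ae_eq_refl _) e2, prodL2_zero_right]
  have z2 (f : Pt d → Pt d) : prodL2 B.Ω f p.dv = 0 := by
    rw [prodL2_congr (ae_eq_refl _) e3, prodL2_zero_right]
  have z3 (f : Pt d → Ten d) : prodL2 B.Ω f (B.jp (fld p.pair)) = 0 := by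
    rw [prodL2_congr (ae_eq_refl _) e2, prodL2_zero_right]
  rw [z3, pairingΓ, Body.prodρ, Body.prodρ, z2, z2, z2, z3, Body.A] at key
  have e4 : prodL2 B.Ω (fun x => B.C.inverse (z.1 x)) (B.jω (fld p.pair)).1 =
      -prodL2 B.Ω (fun x => B.C.inverse (z.1 x)) fun x => B.ω x • q.2 x := by
    rw [← prodL2_neg_right]
    exact prodL2_congr (ae_eq_refl _) e1
  have e5 : (B.jω (fld p.pair)).2 = fun x => B.ω x • q.2 x := rfl
  rw [e4, e5] at key
  have i1 : MemLp (fun x => B.C.inverse (z.1 x)) 2 (volume.restrict B.Ω) :=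
    B.C.inverse.comp_memLp' hz
  have k1 : prodL2 B.Ω (strainRate B z r') (B.jp (fld q)) = _ :=
    prodL2_add_left i1 (Lp.memLp r') (B.memLp_jp q)
  have k2 : prodL2 B.Ω (fun x => B.C.inverse (z.1 x)) (B.jp (fld q)) =
      prodL2 B.Ω (fun x => B.C.inverse (z.1 x)) q.1 +
        prodL2 B.Ω (fun x => B.C.inverse (z.1 x)) fun x => B.ω x • q.2 x :=
    prodL2_add_right i1 (Lp.memLp q.1) hωτ
  have e6 : B.A z (B.jω (fld q)) = prodL2 B.Ω (fun x => B.C.inverse (z.1 x)) q.1 +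
      prodL2 B.Ω (fun x => (B.D - B.C).inverse (z.2 x)) fun x => B.ω x • q.2 x := rfl
  rw [k1, k2, e6]
  linarith

variable (M : Mesh B.Ω) (hM : M.Compatible B.part)

lemma exists_part_elem (hM : M.Compatible B.part) {K : Finset (Pt d)} (hK : K ∈ M.elems) :
    ∃ j, interior (hull K) ⊆ B.part j := M.exists_part hM B.part_cover hK

/-- Piecewise polynomial pairs give rise to piecewise smooth stresses. -/
lemma isPiecewiseSmooth_jp (hM : M.Compatible B.part) {k : ℕ} {q : LL B.Ω}
    (hq : q ∈ spaceDG B M k) : M.IsPiecewiseSmooth (B.jp (fld q)) := by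
  intro K hK
  obtain ⟨j, hj⟩ := exists_part_elem M hM hK
  choose p hp1 hp2 using hq.1 K hK
  choose p' hp1' hp2' using hq.2.1 K hK
  refine ⟨fun x => WithLp.toLp 2 fun ij => MvPolynomial.eval (fun i => x i) (p ij) +
    B.ωv j * MvPolynomial.eval (fun i => x i) (p' ij), fun ij => ?_, ?_⟩
  · exact (contDiff_eval _).add (contDiff_const.mul (contDiff_eval _))
  · filter_upwards [ae_all_iff.2 hp2, ae_all_iff.2 hp2', Mesh.ae_mem_interior_hull K]
      with x h1 h2 h3
    ext ij
    change q.1 x ij + B.ω x * q.2 x ij = _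
    rw [B.ω_of_mem (hj h3), h1 ij, h2 ij]

/-- The coefficient `1/ρ` is constant on each element, so that the regularity of `f` in the parts
suffices. -/
lemma oscDecay_overρ (hM : M.Compatible B.part) {s' : ℝ} (hs' : 1 / 2 < s') {f : Pt d → Pt d}
    (hf : ∀ j, MemHsVec (B.part j) s' f) {K : Finset (Pt d)} (hK : K ∈ M.elems) :
    OscDecay (hull K) (B.overρ f) := by
  obtain ⟨j, hj⟩ := exists_part_elem M hM hK
  have h1 : OscDecay (interior (hull K)) f := OscDecay.of_components fun i =>
    (hf j i).oscDecay isOpen_interior (Mesh.convex_interior_hull K) (Mesh.isBounded_interior_hull K)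
      hj hs'
  have h2 : OscDecay (hull K) f := h1.congr_set (Mesh.interior_hull_ae_eq K)
  refine (h2.clm ((1 / B.ρv j) • ContinuousLinearMap.id ℝ (Pt d))).congr ?_
  filter_upwards [Mesh.ae_mem_interior_hull K] with x hx
  rw [Body.overρ, B.ρ_of_mem (hj hx)]
  rfl

/-- The DG equations at an instant follow from the equation of motion at that instant. -/
theorem InstantMotion.satisfiesDG (hd : 2 ≤ d) (hM : M.Compatible B.part) (k : ℕ) (a : ℝ)
    {p p' p'' : LL B.Ω} (hp : p = P.pair)
    (h : InstantMotion B (B.jω (fld p'') + pi2 (fld p')) r' F b P) (hP : P ∈ B.spaceS)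
    (hsymm : ∀ s ∈ B.spaceQ, prodL2 B.Ω s (B.jp (fld P.pair)) = 0)
    {s s' : ℝ} (hs : 1 / 2 < s) (hs' : 1 / 2 < s')
    (hpr : M.MemBrokenHs s (B.jp (fld p))) (hFr : ∀ j, MemHsVec (B.part j) s' F) :
    HasFaceTraces B M F b p ∧ SatisfiesDG B M k a F b p p' p'' r' := by
  subst hp
  set z : PairF d := B.jω (fld p'') + pi2 (fld p') with hz'
  have hΩ := B.isLipschitz
  have hz : MemLp z.1 2 (volume.restrict B.Ω) := by
    have : z.1 = fun x => p''.1 x + 0 := rfl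
    rw [this]
    simpa using Lp.memLp p''.1
  set σ := B.jp (fld P.pair) with hσ
  have hσo (K : Finset (Pt d)) (hK : K ∈ M.elems) : OscDecay (hull K) σ := by
    have h1 : OscDecay (interior (hull K)) σ := OscDecay.of_components fun i =>
      (hpr K hK i).oscDecay isOpen_interior (Mesh.convex_interior_hull K)
        (Mesh.isBounded_interior_hull K) subset_rfl hs
    exact h1.congr_set (Mesh.interior_hull_ae_eq K)
  have hdv : MemLp P.dv 2 (volume.restrict B.Ω) := Lp.memLp P.2.2
  have hw := fun i j => h.isWeakPartial hz i j
  have hG : MemLp (strainRate B z r') 2 (volume.restrict B.Ω) := memLp_strainRate hz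
  have hwo (K : Finset (Pt d)) (hK : K ∈ M.elems) : OscDecay (hull K) (accel B F P) :=
    M.oscDecay_of_H1 hΩ hK memLp_accel hG hw
  have hFo (K : Finset (Pt d)) (hK : K ∈ M.elems) : OscDecay (hull K) (B.overρ F) :=
    oscDecay_overρ M hM hs' hFr hK
  -- the broken divergence
  have hbd (K : Finset (Pt d)) (hK : K ∈ M.elems) :
      M.brokenDiv σ =ᵐ[volume.restrict (hull K)] P.dv :=
    M.brokenDiv_ae_eq hK (M.memLp_hull hΩ hK hdv) (M.isWeakDiv_elem hΩ hK hP.2)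
  have hbρ (K : Finset (Pt d)) (hK : K ∈ M.elems) :
      B.overρ (M.brokenDiv σ) =ᵐ[volume.restrict (hull K)] B.overρ P.dv := by
    filter_upwards [hbd K hK] with x hx
    rw [Body.overρ, Body.overρ, hx]
  have hdo (K : Finset (Pt d)) (hK : K ∈ M.elems) :
      OscDecay (hull K) (B.overρ (M.brokenDiv σ)) := by
    refine ((hwo K hK).add ((hFo K hK).clm (-ContinuousLinearMap.id ℝ (Pt d)))).congr ?_
    filter_upwards [hbρ K hK] with x hx
    rw [hx]
    simp [accel]
  -- the boundary datum
  have hlo (K : Finset (Pt d)) (hK : K ∈ M.elems) : OscDecay (hull K) b.lift.1.1 :=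
    M.oscDecay_of_H1 hΩ hK (Lp.memLp _) (Lp.memLp _) b.lift.2
  have : IsFiniteMeasure (volume.restrict B.Ω) :=
    ⟨by simpa using hΩ.isBounded.measure_lt_top⟩
  have hli : IntegrableOn b.lift.1.1 B.Ω := (Lp.memLp b.lift.1.1).integrable one_le_two
  refine ⟨⟨fun K hK S hS => ⟨M.hasTraceL2_elem hd hK hS (hσo K hK),
    M.hasTraceL2_elem hd hK hS (hdo K hK), M.hasTraceL2_elem hd hK hS (hFo K hK)⟩,
    fun S hS => M.hasTraceL2_bdry hd hΩ hS hlo hli⟩, fun q hq => ?_, fun s hs => hsymm s hs.2⟩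
  have hτ := isPiecewiseSmooth_jp M hM hq
  have hbτ := hτ.brokenDiv M
  set τ := B.jp (fld q) with hτ'
  -- the jumps of the stress vanish
  have hjump (S : Finset (Pt d)) (hS : S ∈ M.intFaces) : ∀ᵐ x ∂surf (hull S), M.jump σ S x = 0 :=
    M.jump_eq_zero hd hΩ (B.memLp_jp P.pair) hdv hP.2 hσo hS
  have j1 : M.prodFaces (fun S x => (a * (Metric.diam (hull S))⁻¹) • M.jump σ S x) (M.jump τ) = 0 := by
    refine Finset.sum_eq_zero fun S hS => integral_eq_zero_of_ae ?_
    filter_upwards [hjump S hS] with x hx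
    rw [hx, smul_zero, inner_zero_left, Pi.zero_apply]
  have j2 : M.prodFaces (M.mean (B.overρ (M.brokenDiv τ))) (M.jump σ) = 0 := by
    refine Finset.sum_eq_zero fun S hS => integral_eq_zero_of_ae ?_
    filter_upwards [hjump S hS] with x hx
    rw [hx, inner_zero_right, Pi.zero_apply]
  have hgreen := M.green_mesh_jump hd hΩ (v := b.lift.1.1) memLp_accel hG hw
    (fun S hS => M.trace_eq_bdry hd hΩ memLp_accel hG hw (Lp.memLp _) (Lp.memLp _) b.lift.2
      (fun i j ψ hψ => h.unitField hz i j hψ) hli hS) hτ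
  have hcons := h.constitutive hz q hq.2.2
  have hmean : M.prodFaces (M.mean (accel B F P)) (M.jump τ) =
      M.prodFaces (M.mean (B.overρ (M.brokenDiv σ))) (M.jump τ) +
      M.prodFaces (M.mean (B.overρ F)) (M.jump τ) := by
    rw [← M.prodFaces_mean_add hd hdo hFo hτ]
    congr 1
    refine M.mean_congr fun K hK => ?_
    filter_upwards [hbρ K hK] with x hx
    rw [accel, hx]
  have hint {f : Pt d → Pt d} (hf : MemLp f 2 (volume.restrict B.Ω)) :
      IntegrableOn (fun x => (inner ℝ (f x) (M.brokenDiv τ x) : ℝ)) B.Ω :=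
    M.integrableOn_of_elems hΩ fun K hK =>
      integrable_inner_of_memLp (M.memLp_hull hΩ hK hf) (hbτ K hK)
  have hacc : prodL2 B.Ω (accel B F P) (M.brokenDiv τ) =
      B.prodρ (M.brokenDiv σ) (M.brokenDiv τ) + B.prodρ F (M.brokenDiv τ) := by
    have e1 : B.prodρ (M.brokenDiv σ) (M.brokenDiv τ) =
        prodL2 B.Ω (B.overρ P.dv) (M.brokenDiv τ) := by
      refine prodL2_congr ?_ (ae_eq_refl _)
      have h1 : ∀ᵐ x, ∀ K ∈ M.elems, x ∈ hull K →
          B.overρ (M.brokenDiv σ) x = B.overρ P.dv x :=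
        (Finset.eventually_all _).2 fun K hK =>
          (ae_restrict_iff' (Mesh.measurableSet_hull K)).1 (hbρ K hK)
      filter_upwards [M.ae_mem_interior hΩ, ae_restrict_of_ae h1] with x ⟨K, hK, hx⟩ hx'
      exact hx' K hK (interior_subset hx)
    rw [e1, Body.prodρ, prodL2, prodL2, prodL2, ← integral_add (hint (B.memLp_overρ hdv))
      (hint (B.memLp_overρ (Lp.memLp F)))]
    simp only [accel, inner_add_left]
  rw [j1, j2]
  linarith

end Static

/-! ### Continuity of the variational equation in data and test stress -/

section Pairing

variable {d : ℕ} {Ω : Set (Pt d)}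

/-- The weak gradient of a test field is its classical gradient. -/
lemma grad_ae_eq_of_test (hΩ : IsOpen Ω) (u : H1 Ω) {φ : Fin d → Pt d → ℝ}
    (hφ : ∀ i, IsTest Ω (φ i)) (hu : ∀ᵐ x ∂volume.restrict Ω, ∀ i, u.1.1 x i = φ i x) :
    ∀ᵐ x ∂volume.restrict Ω, ∀ i j, u.1.2 x (i, j) = partialD j (φ i) x := by
  refine ae_all_iff.2 fun i => ae_all_iff.2 fun j => ?_
  refine ae_eq_of_setIntegral_test_eq hΩ
    (((EuclideanSpace.proj (i, j) : Ten d →L[ℝ] ℝ).comp_memLp' (Lp.memLp u.1.2)).locallyIntegrable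
      one_le_two)
    ((memLp_smooth ((hφ i).cont_partialD j) ((hφ i).supp_partialD j)).locallyIntegrable one_le_two)
    fun ψ hψ => ?_
  have h1 := u.2 i j ψ hψ
  have h2 := Mesh.integral_mul_partialD (hφ i).1 hψ j
  rw [integral_congr_ae (g := fun x => φ i x * partialD j ψ x)
    (by filter_upwards [hu] with x hx; rw [hx])] at h1
  have h3 : ∫ x in Ω, φ i x * partialD j ψ x = ∫ x, φ i x * partialD j ψ x :=
    setIntegral_eq_integral_of_forall_compl_eq_zero fun x hx => by
      rw [hψ.partialD_eq_zero j hx, mul_zero]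
  rw [h3, h2, ← hψ.setIntegral_mul fun x => partialD j (φ i) x] at h1
  exact (neg_inj.1 h1).symm

/-- The duality product with a normal trace vanishes on test fields. -/
lemma prodL2_grad_add_prodL2_div_of_test (hΩ : IsOpen Ω) {σ : Pt d → Ten d} {δ : Pt d → Pt d}
    (hσ : MemLp σ 2 (volume.restrict Ω)) (hδ : MemLp δ 2 (volume.restrict Ω))
    (h : IsWeakDiv Ω σ δ) (u : H1 Ω) {φ : Fin d → Pt d → ℝ} (hφ : ∀ i, IsTest Ω (φ i))
    (hu : ∀ᵐ x ∂volume.restrict Ω, ∀ i, u.1.1 x i = φ i x) :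
    prodL2 Ω u.1.2 σ + prodL2 Ω u.1.1 δ = 0 := by
  have e1 : prodL2 Ω u.1.2 σ = ∫ x in Ω, ∑ i, ∑ j, σ x (i, j) * partialD j (φ i) x := by
    refine integral_congr_ae ?_
    filter_upwards [grad_ae_eq_of_test hΩ u hφ hu] with x hx
    rw [PiLp.inner_apply, Fintype.sum_prod_type]
    simp only [hx, RCLike.inner_apply, conj_trivial]
  have e2 : prodL2 Ω u.1.1 δ = ∫ x in Ω, ∑ i, δ x i * φ i x := by
    refine integral_congr_ae ?_
    filter_upwards [hu] with x hx
    rw [PiLp.inner_apply]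
    simp only [hx, RCLike.inner_apply, conj_trivial]
  rw [e1, e2, integral_finsetSum, integral_finsetSum, ← Finset.sum_add_distrib]
  · exact Finset.sum_eq_zero fun i _ => by rw [h i (φ i) (hφ i), neg_add_cancel]
  · exact fun i _ => integrable_mul_test hδ i (hφ i).1.continuous (hφ i).2.1
  · exact fun i _ => integrable_finsetSum _ fun j _ =>
      integrable_mul_test hσ (i, j) ((hφ i).cont_partialD j) ((hφ i).supp_partialD j)

/-- The functional `u ↦ (∇u, σ) + (u, δ)` on `H¹(Ω)`. -/
noncomputable def greenFunctional (σ : L2 Ω (Ten d)) (δ : L2 Ω (Pt d)) : H1 Ω →L[ℝ] ℝ :=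
  ((innerSL ℝ σ).comp (ContinuousLinearMap.snd ℝ _ _) +
    (innerSL ℝ δ).comp (ContinuousLinearMap.fst ℝ _ _)).comp (H1 Ω).subtypeL

lemma greenFunctional_apply (σ : L2 Ω (Ten d)) (δ : L2 Ω (Pt d)) (u : H1 Ω) :
    greenFunctional σ δ u = prodL2 Ω u.1.2 σ + prodL2 Ω u.1.1 δ := by
  change inner ℝ σ u.1.2 + inner ℝ δ u.1.1 = _
  rw [real_inner_comm, real_inner_comm (u.1.1)]
  rfl

lemma H10_le_ker_greenFunctional (hΩ : IsOpen Ω) {σ : L2 Ω (Ten d)} {δ : L2 Ω (Pt d)}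
    (h : IsWeakDiv Ω σ δ) : H10 Ω ≤ (greenFunctional σ δ).ker := by
  refine Submodule.topologicalClosure_minimal _ (Submodule.span_le.2 ?_)
    (ContinuousLinearMap.isClosed_ker _)
  rintro u ⟨φ, hφ, hu⟩
  change greenFunctional σ δ u = 0
  rw [greenFunctional_apply]
  exact prodL2_grad_add_prodL2_div_of_test hΩ (Lp.memLp σ) (Lp.memLp δ) h u hφ hu

/-- For fixed `σ ∈ H(div, Ω)`, the pairing `b ↦ ⟨b, σ n⟩_Γ` is a continuous functional on the
trace space. -/
lemma exists_clm_pairingΓ (hΩ : IsOpen Ω) {σ : L2 Ω (Ten d)} {δ : L2 Ω (Pt d)}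
    (h : IsWeakDiv Ω σ δ) : ∃ L : HHalf Ω →L[ℝ] ℝ, ∀ b, L b = pairingΓ b σ δ := by
  refine ⟨(H10 Ω).liftQL (greenFunctional σ δ) (H10_le_ker_greenFunctional hΩ h), fun b => ?_⟩
  have hb : Submodule.Quotient.mk b.lift = b := Quotient.out_eq' b
  conv_lhs => rw [← hb]
  exact greenFunctional_apply σ δ b.lift

end Pairing

section Operators

variable {d J : ℕ} (B : Body d J) {V : Type} [NormedAddCommGroup V] [NormedSpace ℝ V]

/-- Multiplication in `L²(Ω; V)` by the function with the value `c j` on `Ω_j`. -/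
noncomputable def stepMul (c : Fin J → ℝ) : L2 B.Ω V →L[ℝ] L2 B.Ω V :=
  LinearMap.mkContinuous
    { toFun := fun f => (B.memLp_sum_indicator_smul c (Lp.memLp f)).toLp _
      map_add' := fun f g => by
        rw [← MemLp.toLp_add, MemLp.toLp_eq_toLp_iff]
        filter_upwards [Lp.coeFn_add f g] with x hx
        rw [hx, Pi.add_apply, smul_add, Pi.add_apply]
      map_smul' := fun a f => by
        rw [RingHom.id_apply, ← MemLp.toLp_const_smul, MemLp.toLp_eq_toLp_iff]
        filter_upwards [Lp.coeFn_smul a f] with x hx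
        rw [hx, Pi.smul_apply, Pi.smul_apply, smul_comm] }
    (∑ j, |c j|) fun f => by
      refine Lp.norm_le_mul_norm_of_ae_le_mul ?_
      filter_upwards [(B.memLp_sum_indicator_smul c (Lp.memLp f)).coeFn_toLp] with x hx
      change ‖(B.memLp_sum_indicator_smul c (Lp.memLp f)).toLp _ x‖ ≤ _
      rw [hx, norm_smul]
      refine mul_le_mul_of_nonneg_right ?_ (norm_nonneg _)
      refine (norm_sum_le _ _).trans (Finset.sum_le_sum fun j _ => ?_)
      exact norm_indicator_le_norm_self _ _

lemma coeFn_stepMul (c : Fin J → ℝ) (f : L2 B.Ω V) :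
    stepMul B c f =ᵐ[volume.restrict B.Ω]
      fun x => (∑ j, (B.part j).indicator (fun _ => c j) x) • f x :=
  (B.memLp_sum_indicator_smul c (Lp.memLp f)).coeFn_toLp

lemma coeFn_stepMul_ω (f : L2 B.Ω V) :
    stepMul B B.ωv f =ᵐ[volume.restrict B.Ω] fun x => B.ω x • f x := coeFn_stepMul B B.ωv f

lemma coeFn_stepMul_ρ (f : L2 B.Ω (Pt d)) :
    stepMul B (fun j => 1 / B.ρv j) f =ᵐ[volume.restrict B.Ω] B.overρ f := by
  filter_upwards [coeFn_stepMul B (fun j => 1 / B.ρv j) f] with x hx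
  rw [hx, Body.overρ, B.one_div_ρ]

/-- `ȷ_ω⁺ q` as an element of `L²`. -/
noncomputable def jpL : B.X →L[ℝ] L2 B.Ω (Ten d) :=
  ContinuousLinearMap.fst ℝ _ _ + (stepMul B B.ωv).comp
    ((ContinuousLinearMap.fst ℝ _ _).comp (ContinuousLinearMap.snd ℝ _ _))

lemma coeFn_jpL (q : B.X) : jpL B q =ᵐ[volume.restrict B.Ω] B.jp (fld q.pair) := by
  filter_upwards [Lp.coeFn_add q.1 (stepMul B B.ωv q.2.1), coeFn_stepMul_ω B q.2.1] with x h1 h2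
  change (q.1 + stepMul B B.ωv q.2.1 : L2 B.Ω (Ten d)) x = q.1 x + B.ω x • q.2.1 x
  rw [h1, Pi.add_apply, h2]

/-- The functional `(u, v, r) ↦ A(ȷ_ω u + π₂ v, ȷ_ω q) + (r, ȷ_ω⁺ q)`. -/
noncomputable def inertia (q : B.X) : LL B.Ω × LL B.Ω × L2 B.Ω (Ten d) →L[ℝ] ℝ :=
  (innerSL ℝ q.1).comp ((B.C.inverse.compLpL 2 _).comp
      ((ContinuousLinearMap.fst ℝ _ _).comp (ContinuousLinearMap.fst ℝ _ _))) +
    (innerSL ℝ (stepMul B B.ωv q.2.1)).comp (((B.D - B.C).inverse.compLpL 2 _).comp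
      ((stepMul B B.ωv).comp ((ContinuousLinearMap.snd ℝ _ _).comp (ContinuousLinearMap.fst ℝ _ _)) +
        (ContinuousLinearMap.snd ℝ _ _).comp
          ((ContinuousLinearMap.fst ℝ _ _).comp (ContinuousLinearMap.snd ℝ _ _)))) +
    (innerSL ℝ (jpL B q)).comp
      ((ContinuousLinearMap.snd ℝ _ _).comp (ContinuousLinearMap.snd ℝ _ _))

lemma inertia_eq_inner (q : B.X) (u v : LL B.Ω) (r : L2 B.Ω (Ten d)) :
    inertia B q (u, v, r) = inner ℝ q.1 (B.C.inverse.compLpL 2 _ u.1) +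
      inner ℝ (stepMul B B.ωv q.2.1)
        ((B.D - B.C).inverse.compLpL 2 _ (stepMul B B.ωv u.2 + v.2)) + inner ℝ (jpL B q) r := rfl

lemma inertia_apply (q : B.X) (u v : LL B.Ω) (r : L2 B.Ω (Ten d)) :
    inertia B q (u, v, r) = B.A (B.jω (fld u) + pi2 (fld v)) (B.jω (fld q.pair)) +
      prodL2 B.Ω r (B.jp (fld q.pair)) := by
  rw [inertia_eq_inner, real_inner_comm, real_inner_comm _ (stepMul B B.ωv q.2.1),
    real_inner_comm _ (jpL B q)]
  refine congrArg₂ _ (congrArg₂ _ (prodL2_congr ?_ ae_eq_rfl) (prodL2_congr ?_ ?_))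
    (prodL2_congr ae_eq_rfl (coeFn_jpL B q))
  · filter_upwards [B.C.inverse.coeFn_compLpL u.1] with x hx
    rw [hx]
    change _ = B.C.inverse (u.1 x + 0)
    rw [add_zero]
  · filter_upwards [(B.D - B.C).inverse.coeFn_compLpL (stepMul B B.ωv u.2 + v.2),
      Lp.coeFn_add (stepMul B B.ωv u.2) v.2, coeFn_stepMul_ω B u.2] with x h1 h2 h3
    rw [h1, h2, Pi.add_apply, h3]
    rfl
  · exact coeFn_stepMul_ω B q.2.1

lemma continuous_inertia (u v : LL B.Ω) (r : L2 B.Ω (Ten d)) :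
    Continuous fun q : B.X => inertia B q (u, v, r) := by
  simp only [inertia_eq_inner]
  fun_prop

/-- The functional `f ↦ (f, div ȷ_ω⁺ q)_ρ`. -/
noncomputable def weighted (q : B.X) : L2 B.Ω (Pt d) →L[ℝ] ℝ :=
  (innerSL ℝ q.2.2).comp (stepMul B fun j => 1 / B.ρv j)

lemma weighted_apply (q : B.X) (f : L2 B.Ω (Pt d)) : weighted B q f = B.prodρ f q.dv := by
  change inner ℝ q.2.2 (stepMul B (fun j => 1 / B.ρv j) f) = _
  rw [real_inner_comm]
  exact prodL2_congr (coeFn_stepMul_ρ B f) ae_eq_rfl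

lemma continuous_weighted (f : L2 B.Ω (Pt d)) : Continuous fun q : B.X => weighted B q f := by
  change Continuous fun q : B.X => inner ℝ q.2.2 (stepMul B (fun j => 1 / B.ρv j) f)
  fun_prop

lemma continuous_pairingΓ (b : HHalf B.Ω) :
    Continuous fun q : B.X => pairingΓ b (B.jp (fld q.pair)) q.dv := by
  have h (q : B.X) : pairingΓ b (B.jp (fld q.pair)) q.dv =
      inner ℝ b.lift.1.2 (jpL B q) + inner ℝ b.lift.1.1 q.2.2 :=
    congrArg₂ (· + ·) (prodL2_congr ae_eq_rfl (coeFn_jpL B q).symm) rfl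
  simp only [h]
  fun_prop

variable {B}

lemma Body.X.exists_clm_pairingΓ {q : B.X} (hq : q ∈ B.spaceS) :
    ∃ L : HHalf B.Ω →L[ℝ] ℝ, ∀ b, L b = pairingΓ b (B.jp (fld q.pair)) q.dv := by
  obtain ⟨L, hL⟩ := Zener.exists_clm_pairingΓ B.isLipschitz.isOpen (σ := jpL B q) (δ := q.2.2)
    (hq.2.congr (coeFn_jpL B q).symm ae_eq_rfl)
  refine ⟨L, fun b => (hL b).trans ?_⟩
  exact congrArg₂ (· + ·) (prodL2_congr ae_eq_rfl (coeFn_jpL B q)) rfl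

instance secondCountableTopology_L2 {Ω : Set (Pt d)} [SecondCountableTopology V] :
    SecondCountableTopology (L2 Ω V) := by
  have : Fact ((2 : ℝ≥0∞) ≠ ⊤) := ⟨by simp⟩
  infer_instance

/-- The equation of motion holds for all test stresses as soon as it holds for those of a dense
subset. -/
lemma exists_countable_instantMotion : ∃ N : Set B.X, N.Countable ∧ N ⊆ B.spaceS ∧
    ∀ (u v : LL B.Ω) (r' : L2 B.Ω (Ten d)) (F : L2 B.Ω (Pt d)) (b : HHalf B.Ω) (P : B.X),
      (∀ q ∈ N, inertia B q (u, v, r') + weighted B q P.2.2 =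
        -weighted B q F + pairingΓ b (B.jp (fld q.pair)) q.dv) →
      InstantMotion B (B.jω (fld u) + pi2 (fld v)) r' F b P := by
  obtain ⟨N, hN, hNc, hNd⟩ := TopologicalSpace.IsSeparable.exists_countable_dense_subset
    (TopologicalSpace.IsSeparable.of_separableSpace B.spaceS)
  refine ⟨N, hNc, hN, fun u v r' F b P h q hq => ?_⟩
  have hcl : IsClosed {q : B.X | inertia B q (u, v, r') + weighted B q P.2.2 =
      -weighted B q F + pairingΓ b (B.jp (fld q.pair)) q.dv} :=
    isClosed_eq ((continuous_inertia B u v r').add (continuous_weighted B P.2.2))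
      ((continuous_weighted B F).neg.add (continuous_pairingΓ B b))
  have := closure_minimal h hcl (hNd hq)
  simp only [inertia_apply, weighted_apply] at this
  exact this

end Operators

/-! ### From distributions in time to instants -/

section Time

/-- A distributional equation `ȧ + m = g` on `(0, T)` with a continuously differentiable `a` holds
almost everywhere. -/
lemma ae_add_eq_of_distributional {T : ℝ} (hT : 0 < T) {a a' m g : ℝ → ℝ}
    (ha : ∀ t ∈ Icc 0 T, HasDerivWithinAt a (a' t) (Icc 0 T) t) (ha' : ContinuousOn a' (Icc 0 T))
    (hm : ContinuousOn m (Icc 0 T)) (hg : IntegrableOn g (Ioo 0 T))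
    (h : ∀ φ, IsTest (Ioo 0 T) φ → -(∫ t in (0 : ℝ)..T, deriv φ t * a t) +
      ∫ t in (0 : ℝ)..T, φ t * m t = ∫ t in (0 : ℝ)..T, φ t * g t) :
    (fun t => a' t + m t) =ᵐ[volume.restrict (Ioo 0 T)] g := by
  have hint : IntegrableOn (fun t => a' t + m t) (Ioo 0 T) :=
    ((ha'.add hm).integrableOn_Icc).mono_set Ioo_subset_Icc_self
  refine ae_eq_of_setIntegral_test_eq isOpen_Ioo hint.locallyIntegrable hg.locallyIntegrable
    fun φ hφ => ?_
  have hz : ∀ t, t ∉ Ioo 0 T → φ t = 0 := fun t ht =>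
    image_eq_zero_of_notMem_tsupport fun h' => ht (hφ.2.2 h')
  have hac : ContinuousOn a (Icc 0 T) := fun t ht => (ha t ht).continuousWithinAt
  have hφc := hφ.1.continuous
  have hφ'c : Continuous (deriv φ) := hφ.1.continuous_deriv (by simp)
  have parts : ∫ t in (0 : ℝ)..T, (deriv φ t * a t + φ t * a' t) = 0 := by
    rw [intervalIntegral.integral_deriv_mul_eq_sub_of_hasDerivAt (u := φ) (v := a)
      hφc.continuousOn (by rwa [uIcc_of_le hT.le])
      (fun t _ => (hφ.1.differentiable (by simp) t).hasDerivAt)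
      (fun t ht => ?_) (hφ'c.intervalIntegrable _ _)
      (ContinuousOn.intervalIntegrable (by rwa [uIcc_of_le hT.le])),
      hz 0 (by simp), hz T (by simp), zero_mul, zero_mul, sub_zero]
    rw [min_eq_left hT.le, max_eq_right hT.le] at ht
    exact (ha t (Ioo_subset_Icc_self ht)).hasDerivAt (Icc_mem_nhds ht.1 ht.2)
  have ii {u v : ℝ → ℝ} (hu : Continuous u) (hv : ContinuousOn v (Icc 0 T)) :
      IntervalIntegrable (fun t => u t * v t) volume 0 T :=
    ContinuousOn.intervalIntegrable (by
      rw [uIcc_of_le hT.le]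
      exact hu.continuousOn.mul hv)
  rw [intervalIntegral.integral_add (ii hφ'c hac) (ii hφc ha')] at parts
  have e := h φ hφ
  rw [neg_eq_of_add_eq_zero_right parts,
    ← intervalIntegral.integral_add (ii hφc ha') (ii hφc hm)] at e
  rw [intervalIntegral.integral_of_le hT.le, intervalIntegral.integral_of_le hT.le,
    integral_Ioc_eq_integral_Ioo, integral_Ioc_eq_integral_Ioo] at e
  simp only [← mul_add] at e
  simpa only [mul_comm] using e

variable {V : Type} [NormedAddCommGroup V] [NormedSpace ℝ V] {T : ℝ} {f f' : ℝ → V}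

lemma HasTimeDeriv.intervalIntegrable (h : HasTimeDeriv T f f') (hT : 0 < T) :
    IntervalIntegrable f' volume 0 T := by
  rw [intervalIntegrable_iff_integrableOn_Ioo_of_le hT.le]
  exact h.1.integrable one_le_two

lemma HasTimeDeriv.integrableOn_clm (h : HasTimeDeriv T f f') (L : V →L[ℝ] ℝ) :
    IntegrableOn (fun t => L (f' t)) (Ioo 0 T) :=
  L.integrable_comp (h.1.integrable one_le_two)

lemma HasTimeDeriv.continuousOn (h : HasTimeDeriv T f f') (hT : 0 < T) :
    ContinuousOn f (Icc 0 T) := by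
  have h1 : ContinuousOn (fun t => f 0 + ∫ s in (0 : ℝ)..t, f' s) (Icc 0 T) := by
    rw [← uIcc_of_le hT.le]
    refine continuousOn_const.add (intervalIntegral.continuousOn_primitive_interval ?_)
    rw [uIcc_of_le hT.le, integrableOn_Icc_iff_integrableOn_Ioo]
    exact h.1.integrable one_le_two
  exact h1.congr h.2

lemma HasTimeDeriv.ae_hasDerivAt [CompleteSpace V] (h : HasTimeDeriv T f f') (hT : 0 < T) :
    ∀ᵐ t ∂volume.restrict (Ioo 0 T), HasDerivAt f (f' t) t := by
  filter_upwards [ae_restrict_of_ae (h.intervalIntegrable hT).ae_hasDerivAt_integral,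
    ae_restrict_mem measurableSet_Ioo] with t h1 h2
  have h3 := h1 (by rw [uIcc_of_le hT.le]; exact Ioo_subset_Icc_self h2) 0 left_mem_uIcc
  refine (h3.const_add (f 0)).congr_of_eventuallyEq ?_
  filter_upwards [Icc_mem_nhds h2.1 h2.2] with x hx
  exact h.2 x hx

end Time

section Motion

variable {d J : ℕ} {B : Body d J} {T : ℝ} {F : ℝ → L2 B.Ω (Pt d)} {dg ddg : ℝ → HHalf B.Ω}
  {P P' : ℝ → B.X} {r r' : ℝ → L2 B.Ω (Ten d)} {p p' p'' : ℝ → LL B.Ω}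

/-- For a fixed test stress, the equation of motion holds at almost every time. -/
lemma IsSolution.ae_motion (hsol : IsSolution B T F ddg P P' r) (hT : 0 < T)
    (hF : MemLp F 2 (volume.restrict (Ioo 0 T))) (hg : HasTimeDeriv T dg ddg)
    (hp : ∀ t, p t = (P t).pair)
    (hp1 : ∀ t ∈ Icc 0 T, HasDerivWithinAt p (p' t) (Icc 0 T) t)
    (hp2 : ∀ t ∈ Icc 0 T, HasDerivWithinAt p' (p'' t) (Icc 0 T) t)
    (hr : ∀ t ∈ Icc 0 T, HasDerivWithinAt r (r' t) (Icc 0 T) t)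
    (hp2c : ContinuousOn p'' (Icc 0 T)) (hrc : ContinuousOn r' (Icc 0 T))
    {q : B.X} (hq : q ∈ B.spaceS) :
    ∀ᵐ t ∂volume.restrict (Ioo 0 T),
      inertia B q (p'' t, p' t, r' t) + weighted B q (P t).2.2 =
        -weighted B q (F t) + pairingΓ (ddg t) (B.jp (fld q.pair)) q.dv := by
  obtain ⟨L, hL⟩ := Body.X.exists_clm_pairingΓ hq
  have hp1c : ContinuousOn p' (Icc 0 T) := fun t ht => (hp2 t ht).continuousWithinAt
  have hPc := hsol.timeDeriv.continuousOn hT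
  have hP' : ∀ᵐ t ∂volume.restrict (Ioo 0 T), (P' t).pair = p' t := by
    filter_upwards [hsol.timeDeriv.ae_hasDerivAt hT, ae_restrict_mem measurableSet_Ioo]
      with t h1 h2
    have h3 : HasDerivAt p (P' t).pair t := by
      have h4 : p = fun t => (P t).pair := funext hp
      rw [h4]
      exact (h1.fst).prodMk h1.snd.fst
    exact h3.unique ((hp1 t (Ioo_subset_Icc_self h2)).hasDerivAt (Icc_mem_nhds h2.1 h2.2))
  have hint : IntegrableOn (fun t => -weighted B q (F t) + L (ddg t)) (Ioo 0 T) :=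
    (((weighted B q).integrable_comp (hF.integrable one_le_two)).neg).add
      (hg.integrableOn_clm L)
  have := ae_add_eq_of_distributional hT (a := fun t => inertia B q (p' t, p t, r t))
    (a' := fun t => inertia B q (p'' t, p' t, r' t)) (m := fun t => weighted B q (P t).2.2)
    (g := fun t => -weighted B q (F t) + L (ddg t))
    (fun t ht => (inertia B q).hasFDerivAt.comp_hasDerivWithinAt t
      ((hp2 t ht).prodMk ((hp1 t ht).prodMk (hr t ht))))
    ((inertia B q).continuous.comp_continuousOn (hp2c.prodMk (hp1c.prodMk hrc)))
    ((weighted B q).continuous.comp_continuousOn hPc.snd.snd) hint fun φ hφ => ?_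
  · filter_upwards [this] with t ht
    rw [ht, hL]
  · have e := hsol.motion q hq φ hφ
    have e1 : ∫ t in (0 : ℝ)..T, deriv φ t * inertia B q (p' t, p t, r t) =
        ∫ t in (0 : ℝ)..T, deriv φ t *
          (B.A (B.jω (fld (P' t).pair) + pi2 (fld (P t).pair)) (B.jω (fld q.pair)) +
            prodL2 B.Ω (r t) (B.jp (fld q.pair))) := by
      rw [intervalIntegral.integral_of_le hT.le, intervalIntegral.integral_of_le hT.le,
        integral_Ioc_eq_integral_Ioo, integral_Ioc_eq_integral_Ioo]
      refine integral_congr_ae ?_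
      filter_upwards [hP'] with t ht
      rw [inertia_apply, ht, hp]
    simp only [weighted_apply, hL]
    rw [e1]
    exact e

/-- The equation of motion holds at almost every time, simultaneously for all test stresses. -/
lemma IsSolution.ae_instantMotion (hsol : IsSolution B T F ddg P P' r) (hT : 0 < T)
    (hF : MemLp F 2 (volume.restrict (Ioo 0 T))) (hg : HasTimeDeriv T dg ddg)
    (hp : ∀ t, p t = (P t).pair)
    (hp1 : ∀ t ∈ Icc 0 T, HasDerivWithinAt p (p' t) (Icc 0 T) t)
    (hp2 : ∀ t ∈ Icc 0 T, HasDerivWithinAt p' (p'' t) (Icc 0 T) t)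
    (hr : ∀ t ∈ Icc 0 T, HasDerivWithinAt r (r' t) (Icc 0 T) t)
    (hp2c : ContinuousOn p'' (Icc 0 T)) (hrc : ContinuousOn r' (Icc 0 T)) :
    ∀ᵐ t ∂volume.restrict (Ioo 0 T),
      InstantMotion B (B.jω (fld (p'' t)) + pi2 (fld (p' t))) (r' t) (F t) (ddg t) (P t) := by
  obtain ⟨N, hNc, hN, h⟩ := exists_countable_instantMotion (B := B)
  filter_upwards [(ae_ball_iff hNc).2 fun q hq =>
    hsol.ae_motion hT hF hg hp hp1 hp2 hr hp2c hrc (hN hq)] with t ht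
  exact h _ _ _ _ _ _ ht

/-- With data that are continuous in time, the equation of motion holds at every time. -/
lemma IsSolution.instantMotion (hsol : IsSolution B T F ddg P P' r) (hT : 0 < T)
    (hF : MemLp F 2 (volume.restrict (Ioo 0 T))) (hg : HasTimeDeriv T dg ddg)
    (hp : ∀ t, p t = (P t).pair)
    (hp1 : ∀ t ∈ Icc 0 T, HasDerivWithinAt p (p' t) (Icc 0 T) t)
    (hp2 : ∀ t ∈ Icc 0 T, HasDerivWithinAt p' (p'' t) (Icc 0 T) t)
    (hr : ∀ t ∈ Icc 0 T, HasDerivWithinAt r (r' t) (Icc 0 T) t)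
    (hp2c : ContinuousOn p'' (Icc 0 T)) (hrc : ContinuousOn r' (Icc 0 T))
    (hFc : ContinuousOn F (Icc 0 T)) (hgc : ContinuousOn ddg (Icc 0 T)) {t : ℝ}
    (ht : t ∈ Icc 0 T) :
    InstantMotion B (B.jω (fld (p'' t)) + pi2 (fld (p' t))) (r' t) (F t) (ddg t) (P t) := by
  intro q hq
  obtain ⟨L, hL⟩ := Body.X.exists_clm_pairingΓ hq
  have hp1c : ContinuousOn p' (Icc 0 T) := fun t ht => (hp2 t ht).continuousWithinAt
  have h := Measure.eqOn_Icc_of_ae_eq volume hT.ne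
    (f := fun t => inertia B q (p'' t, p' t, r' t) + weighted B q (P t).2.2)
    (g := fun t => -weighted B q (F t) + L (ddg t)) ?_
    (((inertia B q).continuous.comp_continuousOn (hp2c.prodMk (hp1c.prodMk hrc))).add
      ((weighted B q).continuous.comp_continuousOn (hsol.timeDeriv.continuousOn hT).snd.snd))
    (((weighted B q).continuous.comp_continuousOn hFc).neg.add
      (L.continuous.comp_continuousOn hgc)) ht
  · simp only [inertia_apply, weighted_apply, hL] at h
    exact h
  · rw [← Measure.restrict_congr_set Ioo_ae_eq_Icc]
    filter_upwards [hsol.ae_motion hT hF hg hp hp1 hp2 hr hp2c hrc hq] with t ht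
    rw [ht, hL]

end Motion

end Zener

theorem proposition7p1 {d J : ℕ} (hd : d = 2 ∨ d = 3) (B : Zener.Body d J)
    (M : Zener.Mesh B.Ω) (hM : M.Compatible B.part) (k : ℕ) (hk : 1 ≤ k) (a : ℝ)
    (T : ℝ) (hT : 0 < T)
    -- the data: `F ∈ L²(L²(Ω))`, `g ∈ H²(H^{1/2}(Γ))`
    (F : ℝ → Zener.L2 B.Ω (Zener.Pt d)) (hF : MemLp F 2 (volume.restrict (Ioo 0 T)))
    (g dg ddg : ℝ → Zener.HHalf B.Ω)
    (hg : Zener.HasTimeDeriv T g dg) (hdg : Zener.HasTimeDeriv T dg ddg)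
    -- the solution `(p, r)` of the continuous problem
    (P P' : ℝ → B.X) (r : ℝ → Zener.L2 B.Ω (Zener.Ten d))
    (hsol : Zener.IsSolution B T F ddg P P' r)
    -- `p ∈ C²(𝔏²(Ω))` and `r ∈ C¹(ℚ)`
    (p : ℝ → Zener.LL B.Ω) (hp : ∀ t, p t = (P t).pair)
    (hp2 : ContDiffOn ℝ 2 p (Icc 0 T)) (hr1 : ContDiffOn ℝ 1 r (Icc 0 T))
    (s s' : ℝ) (hs : 1 / 2 < s) (hs' : 1 / 2 < s') :
    -- at almost every time
    (∀ᵐ t ∂volume.restrict (Ioo 0 T),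
      M.MemBrokenHs s (B.jp (Zener.fld (p t))) → (∀ j, Zener.MemHsVec (B.part j) s' (F t)) →
        Zener.HasFaceTraces B M (F t) (ddg t) (p t) ∧
        Zener.SatisfiesDG B M k a (F t) (ddg t) (p t)
          (derivWithin p (Icc 0 T) t) (derivWithin (derivWithin p (Icc 0 T)) (Icc 0 T) t)
          (derivWithin r (Icc 0 T) t)) ∧
    -- at every time, if the data are continuous in time
    (ContinuousOn F (Icc 0 T) → ContinuousOn ddg (Icc 0 T) → ∀ t ∈ Icc 0 T,
      M.MemBrokenHs s (B.jp (Zener.fld (p t))) → (∀ j, Zener.MemHsVec (B.part j) s' (F t)) →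
        Zener.HasFaceTraces B M (F t) (ddg t) (p t) ∧
        Zener.SatisfiesDG B M k a (F t) (ddg t) (p t)
          (derivWithin p (Icc 0 T) t) (derivWithin (derivWithin p (Icc 0 T)) (Icc 0 T) t)
          (derivWithin r (Icc 0 T) t)) := by
  have hd2 : 2 ≤ d := by omega
  have hu := uniqueDiffOn_Icc hT
  have hp' : ContDiffOn ℝ 1 (derivWithin p (Icc 0 T)) (Icc 0 T) :=
    hp2.derivWithin hu (by norm_num)
  have h1 : ∀ t ∈ Icc 0 T, HasDerivWithinAt p (derivWithin p (Icc 0 T) t) (Icc 0 T) t :=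
    fun t ht => (hp2.differentiableOn (by norm_num) t ht).hasDerivWithinAt
  have h2 : ∀ t ∈ Icc 0 T, HasDerivWithinAt (derivWithin p (Icc 0 T))
      (derivWithin (derivWithin p (Icc 0 T)) (Icc 0 T) t) (Icc 0 T) t :=
    fun t ht => (hp'.differentiableOn (by norm_num) t ht).hasDerivWithinAt
  have h3 : ∀ t ∈ Icc 0 T, HasDerivWithinAt r (derivWithin r (Icc 0 T) t) (Icc 0 T) t :=
    fun t ht => (hr1.differentiableOn (by norm_num) t ht).hasDerivWithinAt
  have h4 := hp'.continuousOn_derivWithin hu le_rfl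
  have h5 := hr1.continuousOn_derivWithin hu le_rfl
  refine ⟨?_, fun hFc hgc t ht hpr hFr => ?_⟩
  · filter_upwards [hsol.ae_instantMotion hT hF hdg hp h1 h2 h3 h4 h5,
      ae_restrict_mem measurableSet_Ioo] with t hm ht hpr hFr
    have ht' := Ioo_subset_Icc_self ht
    exact hm.satisfiesDG M hd2 hM k a (hp t) (hsol.mem t ht').1 (hsol.symm t ht') hs hs' hpr hFr
  · exact (hsol.instantMotion hT hF hdg hp h1 h2 h3 h4 h5 hFc hgc ht).satisfiesDG M hd2 hM k a
      (hp t) (hsol.mem t ht).1 (hsol.symm t ht) hs hs' hpr hFr
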